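/- Let $\mathbb C[z]\langle u,v\rangle$ be the free associative algebra in $u,v$ over $\mathbb C[z]$ (the parameter $z$ commutes with everything), let $\kappa_1,\kappa_2,\kappa_3,\kappa_4\in\mathbb C$, and let $$H=u^3v^2-u^2v^2-\kappa_1u^2v+\kappa_2uv-\kappa_3u+z\bigl(-u^2v^2+uv^2+\kappa_4uv+(\kappa_1-\kappa_2-\kappa_4)v\bigr)$$ be the scalar (commutative) Hamiltonian of Painlevé-6 type. For $a_1,a_2,a_3,c_1,c_2,e_1,f_1,f_2,h_1\in\mathbb C$ consider the non-abelian autonomous system $u'=P_1+zQ_1$, $v'=P_2+zQ_2$ with $$\begin{aligned} P_1&=a_1u^3v+a_2u^2vu+a_3uvu^2+(2-a_1-a_2-a_3)vu^3+c_1u^2v-(2+c_1+c_2)uvu+c_2vu^2-\kappa_1u^2+\kappa_2u,\\ Q_1&=f_1u^2v-(2+f_1+f_2)uvu+f_2vu^2+h_1uv+(2-h_1)vu+\kappa_4u+(\kappa_1-\kappa_2-\kappa_4),\\ P_2&=-a_1u^2v^2-(a_1+a_2)uvuv+(1-a_2-a_3)vu^2v+(a_1+a_2-2)vuvu+(a_1+a_2+a_3-2)v^2u^2\\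 &\quad-c_1uv^2+(2+c_1+c_2)vuv-c_2v^2u+e_1uv+(2\kappa_1-e_1)vu-\kappa_2v+\kappa_3,\\ Q_2&=-f_1uv^2+(2+f_1+f_2)vuv-f_2v^2u-v^2-\kappa_4v . \end{aligned}$$ Its commutative reduction is $u'=\partial H/\partial v$, $v'=-\partial H/\partial u$. The transposition $\tau$ (which fixes $u$, $v$, $z$ and reverses the order of all products) maps this class of systems to itself; on the coefficients it acts by $$(a_1,a_2,a_3,c_1,c_2,e_1,f_1,f_2,h_1)\mapsto(2-a_1-a_2-a_3,\,a_3,\,a_2,\,c_2,\,c_1,\,2\kappa_1-e_1,\,f_2,\,f_1,\,2-h_1).$$ Assume that $(a_1,a_2,a_3)$ is, up to $\tau$, of the form $(a,2-a,0)$ with $a\in\{-1,0,1,2\}$ or $(0,a,2-a)$ with $a\in\{-1,0,1,2,3\}$. We say that the system admits a non-abelianization of the symmetry of degree $9$ if there are $G_1,G_2\in\mathbb C[z]\langle u,v\rangle$ of degree at most $9$ in $u,v$, whose commutative images are $H\,\partial H/\partial v$ and $-H\,\partial H/\partial u$ respectively, such that the flow $u_s=G_1$, $v_s=G_2$ (with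 a second time $s$) commutes with the system (that is, $D_F(G_1)=D_G(F_1)$ and $D_F(G_2)=D_G(F_2)$, where $F_i=P_i+zQ_i$ and $D_F$, $D_G$ are the $\mathbb C[z]$-linear derivations with $D_F(u)=F_1$, $D_F(v)=F_2$, $D_G(u)=G_1$, $D_G(v)=G_2$). Then the system admits a non-abelianization of the symmetry of degree $9$ if and only if, up to the transposition $\tau$, its coefficients $(a_1,a_2,a_3;\,c_1,c_2;\,f_1,f_2;\,h_1;\,e_1)$ are in one of the following three lists, where $\hat\kappa$ denotes any complex number with $\kappa_3=\tfrac14(\hat\kappa^2-\kappa_1^2)$. (i) The Hamiltonian systems: $(0,1,1;\,\beta,\beta;\,\gamma,\gamma;\,1;\,\kappa_1)$ with $\beta,\gamma\in\mathbb C$. (ii) The systems with a generalized Okamoto integral: $(0,2,0;\,c_1,0;\,f_1,0;\,h_1;\,\tfrac12(3\kappa_1-\hat\kappa))$ with $(c_1,f_1,h_1)\in\{(0,-1,1),(-1,0,1),(-1,-1,2)\}$; $(1,1,0;\,c_1,0;\,f_1,0;\,h_1;\,2\kappa_1)$ with $(c_1,f_1,h_1)\in\{(-1,-2,2),(-2,-1,2),(-1,-1,1)\}$;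 $(0,1,1;\,c_1,c_2;\,f_1,f_2;\,h_1;\,\kappa_1)$ with $(c_1,c_2;\,f_1,f_2;\,h_1)\in\{(-1,0;\,0,0;\,2),(0,0;\,-1,0;\,2),(-1,0;\,0,-1;\,1)\}$. (iii) The eight further systems: $(-1,3,0;\,0,0;\,0,0;\,1;\,\kappa_1-\hat\kappa)$; $(1,1,0;\,-2,0;\,-2,0;\,3;\,2\kappa_1)$; $(1,1,0;\,-2,0;\,0,0;\,1;\,2\kappa_1)$; $(1,1,0;\,0,0;\,-2,0;\,1;\,2\kappa_1)$; $(2,0,0;\,-2,0;\,-2,0;\,2;\,\tfrac12(5\kappa_1-\hat\kappa))$; $(0,2,0;\,-2,0;\,0,0;\,2;\,\tfrac12(3\kappa_1-\hat\kappa))$; $(0,2,0;\,0,0;\,-2,0;\,2;\,\tfrac12(3\kappa_1-\hat\kappa))$; $(0,2,0;\,0,0;\,0,0;\,0;\,\tfrac12(3\kappa_1-\hat\kappa))$. -/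

import Mathlib

open scoped Polynomial

noncomputable section

namespace PainleveSix

/-- Non-commutative polynomials in the two variables `u`, `v`; the scalars are complex polynomials
in the parameter `z`, so `z` is central and treated as an indeterminate. -/
abbrev NC : Type := FreeAlgebra ℂ[X] (Fin 2)

/-- A polynomial system `u' = F 0`, `v' = F 1`. -/
abbrev NCSystem : Type := Fin 2 → NC

def u : NC := FreeAlgebra.ι ℂ[X] 0

def v : NC := FreeAlgebra.ι ℂ[X] 1

/-- The parameter `z`, as a central element. -/
def z : NC := algebraMap ℂ[X] NC Polynomial.X

/-- A complex constant, as a central element. -/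
def cst (c : ℂ) : NC := algebraMap ℂ NC c

/-- The derivation along the system `F`: `flow F p` is the `t`-derivative of `p(u, v)` when
`u' = F 0`, `v' = F 1` (the `ε`-part of `p(u + ε F 0, v + ε F 1)`, `ε ^ 2 = 0`). -/
def flow (F : NCSystem) (p : NC) : NC :=
  TrivSqZeroExt.snd (FreeAlgebra.lift ℂ[X]
    (fun i : Fin 2 => (TrivSqZeroExt.inl (FreeAlgebra.ι ℂ[X] i) + TrivSqZeroExt.inr (F i) :
      TrivSqZeroExt NC NC)) p)

theorem flow_var (F : NCSystem) (i : Fin 2) : flow F (FreeAlgebra.ι ℂ[X] i) = F i := by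
  simp [flow]

/-- `flow F` satisfies the Leibniz rule. -/
theorem flow_mul (F : NCSystem) (p q : NC) : flow F (p * q) = flow F p * q + p * flow F q := by
  have h : ∀ p : NC, TrivSqZeroExt.fst (FreeAlgebra.lift ℂ[X]
      (fun i : Fin 2 => (TrivSqZeroExt.inl (FreeAlgebra.ι ℂ[X] i) + TrivSqZeroExt.inr (F i) :
        TrivSqZeroExt NC NC)) p) = p := by
    intro p
    induction p using FreeAlgebra.induction with
    | grade0 r => simp [TrivSqZeroExt.algebraMap_eq_inl']
    | grade1 i => simp
    | mul a b ha hb => rw [map_mul, TrivSqZeroExt.fst_mul, ha, hb]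
    | add a b ha hb => rw [map_add, TrivSqZeroExt.fst_add, ha, hb]
  unfold flow
  rw [map_mul, TrivSqZeroExt.snd_mul, h, h, smul_eq_mul, MulOpposite.smul_eq_mul_unop,
    MulOpposite.unop_op, add_comm]

/-- The commutative reduction (matrices of size one). -/
def comm : NC →ₐ[ℂ[X]] MvPolynomial (Fin 2) ℂ[X] :=
  FreeAlgebra.lift ℂ[X] MvPolynomial.X

/-- Total degree in `u`, `v` at most `n`. -/
def DegreeLE (n : ℕ) (p : NC) : Prop :=
  ∀ w ∈ (FreeAlgebra.equivMonoidAlgebraFreeMonoid p :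
    MonoidAlgebra ℂ[X] (FreeMonoid (Fin 2))).coeff.support, w.length ≤ n

/-- The matrix transposition `u ↦ uᵀ`, `v ↦ vᵀ` acting on systems: `star` on the free algebra
fixes the variables and the scalars and reverses the order of every product. -/
def transpose (F : NCSystem) : NCSystem := fun i => star (F i)

/-- The parameters `κ₁, κ₂, κ₃, κ₄`. -/
structure Kappa where
  k1 : ℂ
  k2 : ℂ
  k3 : ℂ
  k4 : ℂ

section Scalar

/-- The scalar Hamiltonian `H = H₁ + z H₂`. -/
def scalarH (κ : Kappa) : MvPolynomial (Fin 2) ℂ[X] :=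
  let U : MvPolynomial (Fin 2) ℂ[X] := MvPolynomial.X 0
  let V : MvPolynomial (Fin 2) ℂ[X] := MvPolynomial.X 1
  let Z : MvPolynomial (Fin 2) ℂ[X] := MvPolynomial.C Polynomial.X
  (U ^ 3 * V ^ 2 - U ^ 2 * V ^ 2 - κ.k1 • (U ^ 2 * V) + κ.k2 • (U * V) - κ.k3 • U)
    + Z * (- (U ^ 2 * V ^ 2) + U * V ^ 2 + κ.k4 • (U * V) + (κ.k1 - κ.k2 - κ.k4) • V)

/-- The right-hand side of the scalar autonomous system of Painlevé-6 type. -/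
def scalarRhs (κ : Kappa) : Fin 2 → MvPolynomial (Fin 2) ℂ[X] :=
  let U : MvPolynomial (Fin 2) ℂ[X] := MvPolynomial.X 0
  let V : MvPolynomial (Fin 2) ℂ[X] := MvPolynomial.X 1
  let Z : MvPolynomial (Fin 2) ℂ[X] := MvPolynomial.C Polynomial.X
  ![2 * U ^ 3 * V - 2 * U ^ 2 * V - κ.k1 • U ^ 2 + κ.k2 • U
      + Z * (- 2 * U ^ 2 * V + 2 * U * V + κ.k4 • U + (κ.k1 - κ.k2 - κ.k4) • 1),
    - 3 * U ^ 2 * V ^ 2 + 2 * U * V ^ 2 + (2 * κ.k1) • (U * V) - κ.k2 • V + κ.k3 • 1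
      + Z * (2 * U * V ^ 2 - V ^ 2 - κ.k4 • V)]

end Scalar

/-- `F` admits a non-abelianization of the symmetry of degree 9: there is a non-commutative
polynomial system `u_τ = G 0`, `v_τ = G 1` of degree 9 which reduces to the scalar symmetry
`u_τ = u' H`, `v_τ = v' H` in the commutative case and is compatible with `F`, that is
`u_{tτ} = u_{τt}` and `v_{tτ} = v_{τt}`. -/
def AdmitsSymmetryNine (κ : Kappa) (F : NCSystem) : Prop :=
  ∃ G : NCSystem,
    (∀ i, DegreeLE 9 (G i)) ∧
    (∀ i, comm (G i) = scalarRhs κ i * scalarH κ) ∧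
    (∀ i, flow F (G i) = flow G (F i))

/-- The nine coefficients of the systems admitting a non-abelianization of the integrals. -/
structure Coeffs where
  a1 : ℂ
  a2 : ℂ
  a3 : ℂ
  c1 : ℂ
  c2 : ℂ
  e1 : ℂ
  f1 : ℂ
  f2 : ℂ
  h1 : ℂ

/-- The autonomous systems `u' = P₁ + z Q₁`, `v' = P₂ + z Q₂` under consideration. -/
def system (κ : Kappa) (s : Coeffs) : NCSystem :=
  ![s.a1 • (u * u * u * v) + s.a2 • (u * u * v * u) + s.a3 • (u * v * u * u)
      + (2 - s.a1 - s.a2 - s.a3) • (v * u * u * u)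
      + s.c1 • (u * u * v) + (- 2 - s.c1 - s.c2) • (u * v * u) + s.c2 • (v * u * u)
      - κ.k1 • (u * u) + κ.k2 • u
      + z * (s.f1 • (u * u * v) + (- 2 - s.f1 - s.f2) • (u * v * u) + s.f2 • (v * u * u)
        + s.h1 • (u * v) + (2 - s.h1) • (v * u) + κ.k4 • u + cst (κ.k1 - κ.k2 - κ.k4)),
    - s.a1 • (u * u * v * v) + (- s.a1 - s.a2) • (u * v * u * v)
      + (1 - s.a2 - s.a3) • (v * u * u * v) + (- 2 + s.a1 + s.a2) • (v * u * v * u)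
      + (- 2 + s.a1 + s.a2 + s.a3) • (v * v * u * u)
      - s.c1 • (u * v * v) + (2 + s.c1 + s.c2) • (v * u * v) - s.c2 • (v * v * u)
      + s.e1 • (u * v) + (2 * κ.k1 - s.e1) • (v * u) - κ.k2 • v + cst κ.k3
      + z * (- s.f1 • (u * v * v) + (2 + s.f1 + s.f2) • (v * u * v) - s.f2 • (v * v * u)
        - v * v - κ.k4 • v)]

/-- The two series of leading homogeneous parts. -/
def IsLeadingCase (a1 a2 a3 : ℂ) : Prop :=
  (∃ a : ℂ, (a = -1 ∨ a = 0 ∨ a = 1 ∨ a = 2) ∧ a1 = a ∧ a2 = 2 - a ∧ a3 = 0) ∨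
  (∃ a : ℂ, (a = -1 ∨ a = 0 ∨ a = 1 ∨ a = 2 ∨ a = 3) ∧ a1 = 0 ∧ a2 = a ∧ a3 = 2 - a)

/-- The leading part is in one of the two series, up to transposition, which sends
`(a₁, a₂, a₃)` to `(2 - a₁ - a₂ - a₃, a₃, a₂)`. -/
def HasLeadingCase (s : Coeffs) : Prop :=
  IsLeadingCase s.a1 s.a2 s.a3 ∨ IsLeadingCase (2 - s.a1 - s.a2 - s.a3) s.a3 s.a2

/-- The Hamiltonian systems. The numbers `β`, `γ` stand for the term
`- (β + γ z) / 2 * trace [u, v] ^ 2` of the Hamiltonian, which is a first integral of every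
Hamiltonian system. -/
def hamiltonian (κ : Kappa) (β γ : ℂ) : NCSystem :=
  ![u * u * v * u + u * v * u * u - 2 * (u * v * u)
      + β • (u * u * v - 2 * (u * v * u) + v * u * u)
      - κ.k1 • (u * u) + κ.k2 • u
      + z * (- 2 * (u * v * u) + γ • (u * u * v - 2 * (u * v * u) + v * u * u)
        + u * v + v * u + κ.k4 • u + cst (κ.k1 - κ.k2 - κ.k4)),
    - (u * v * u * v) - v * u * u * v - v * u * v * u + 2 * (v * u * v)
      - β • (u * v * v - 2 * (v * u * v) + v * v * u)
      + κ.k1 • (u * v) + κ.k1 • (v * u) - κ.k2 • v + cst κ.k3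
      + z * (2 * (v * u * v) - γ • (u * v * v - 2 * (v * u * v) + v * v * u)
        - v * v - κ.k4 • v)]

/-! The systems with a generalized Okamoto integral (a non-commutative polynomial that is constant
along the system and reduces to `H`), one from each pair of mutually transposed systems. In those
that contain `kh`, this number is related to `κ` by `κ₃ = (kh ^ 2 - κ₁ ^ 2) / 4`. -/

def okamoto1 (κ : Kappa) (kh : ℂ) : NCSystem :=
  ![2 * (u * u * v * u) - 2 * (u * v * u) - κ.k1 • (u * u) + κ.k2 • u
      + z * (- (u * u * v) - u * v * u + u * v + v * u + κ.k4 • u + cst (κ.k1 - κ.k2 - κ.k4)),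
    - 2 * (u * v * u * v) - v * u * u * v + 2 * (v * u * v)
      + ((3 * κ.k1 - kh) / 2) • (u * v) + ((κ.k1 + kh) / 2) • (v * u) - κ.k2 • v + cst κ.k3
      + z * (u * v * v + v * u * v - v * v - κ.k4 • v)]

def okamoto2 (κ : Kappa) (kh : ℂ) : NCSystem :=
  ![2 * (u * u * v * u) - u * u * v - u * v * u - κ.k1 • (u * u) + κ.k2 • u
      + z * (- 2 * (u * v * u) + u * v + v * u + κ.k4 • u + cst (κ.k1 - κ.k2 - κ.k4)),
    - 2 * (u * v * u * v) - v * u * u * v + u * v * v + v * u * v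
      + ((3 * κ.k1 - kh) / 2) • (u * v) + ((κ.k1 + kh) / 2) • (v * u) - κ.k2 • v + cst κ.k3
      + z * (2 * (v * u * v) - v * v - κ.k4 • v)]

def okamoto3 (κ : Kappa) (kh : ℂ) : NCSystem :=
  ![2 * (u * u * v * u) - u * u * v - u * v * u - κ.k1 • (u * u) + κ.k2 • u
      + z * (- (u * u * v) - u * v * u + 2 * (u * v) + κ.k4 • u + cst (κ.k1 - κ.k2 - κ.k4)),
    - 2 * (u * v * u * v) - v * u * u * v + u * v * v + v * u * v
      + ((3 * κ.k1 - kh) / 2) • (u * v) + ((κ.k1 + kh) / 2) • (v * u) - κ.k2 • v + cst κ.k3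
      + z * (u * v * v + v * u * v - v * v - κ.k4 • v)]

def okamoto4 (κ : Kappa) : NCSystem :=
  ![u * u * u * v + u * u * v * u - u * u * v - u * v * u - κ.k1 • (u * u) + κ.k2 • u
      + z * (- 2 * (u * u * v) + 2 * (u * v) + κ.k4 • u + cst (κ.k1 - κ.k2 - κ.k4)),
    - (u * u * v * v) - 2 * (u * v * u * v) + u * v * v + v * u * v
      + (2 * κ.k1) • (u * v) - κ.k2 • v + cst κ.k3
      + z * (2 * (u * v * v) - v * v - κ.k4 • v)]

def okamoto5 (κ : Kappa) : NCSystem :=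
  ![u * u * u * v + u * u * v * u - 2 * (u * u * v) - κ.k1 • (u * u) + κ.k2 • u
      + z * (- (u * u * v) - u * v * u + 2 * (u * v) + κ.k4 • u + cst (κ.k1 - κ.k2 - κ.k4)),
    - (u * u * v * v) - 2 * (u * v * u * v) + 2 * (u * v * v)
      + (2 * κ.k1) • (u * v) - κ.k2 • v + cst κ.k3
      + z * (u * v * v + v * u * v - v * v - κ.k4 • v)]

def okamoto6 (κ : Kappa) : NCSystem :=
  ![u * u * u * v + u * u * v * u - u * u * v - u * v * u - κ.k1 • (u * u) + κ.k2 • u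
      + z * (- (u * u * v) - u * v * u + u * v + v * u + κ.k4 • u + cst (κ.k1 - κ.k2 - κ.k4)),
    - (u * u * v * v) - 2 * (u * v * u * v) + u * v * v + v * u * v
      + (2 * κ.k1) • (u * v) - κ.k2 • v + cst κ.k3
      + z * (u * v * v + v * u * v - v * v - κ.k4 • v)]

def okamoto7 (κ : Kappa) : NCSystem :=
  ![u * u * v * u + u * v * u * u - u * u * v - u * v * u - κ.k1 • (u * u) + κ.k2 • u
      + z * (- 2 * (u * v * u) + 2 * (u * v) + κ.k4 • u + cst (κ.k1 - κ.k2 - κ.k4)),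
    - (u * v * u * v) - v * u * u * v - v * u * v * u + u * v * v + v * u * v
      + κ.k1 • (u * v) + κ.k1 • (v * u) - κ.k2 • v + cst κ.k3
      + z * (2 * (v * u * v) - v * v - κ.k4 • v)]

def okamoto8 (κ : Kappa) : NCSystem :=
  ![u * u * v * u + u * v * u * u - 2 * (u * v * u) - κ.k1 • (u * u) + κ.k2 • u
      + z * (- (u * u * v) - u * v * u + 2 * (u * v) + κ.k4 • u + cst (κ.k1 - κ.k2 - κ.k4)),
    - (u * v * u * v) - v * u * u * v - v * u * v * u + 2 * (v * u * v)
      + κ.k1 • (u * v) + κ.k1 • (v * u) - κ.k2 • v + cst κ.k3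
      + z * (u * v * v + v * u * v - v * v - κ.k4 • v)]

def okamoto9 (κ : Kappa) : NCSystem :=
  ![u * u * v * u + u * v * u * u - u * u * v - u * v * u - κ.k1 • (u * u) + κ.k2 • u
      + z * (- (u * v * u) - v * u * u + u * v + v * u + κ.k4 • u + cst (κ.k1 - κ.k2 - κ.k4)),
    - (u * v * u * v) - v * u * u * v - v * u * v * u + u * v * v + v * u * v
      + κ.k1 • (u * v) + κ.k1 • (v * u) - κ.k2 • v + cst κ.k3
      + z * (v * u * v + v * v * u - v * v - κ.k4 • v)]

/-! The eight further systems, one from each pair of mutually transposed ones; `kh` is `κ̂₃`,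
related to `κ` by `κ₃ = (kh ^ 2 - κ₁ ^ 2) / 4`. -/

def new1 (κ : Kappa) (kh : ℂ) : NCSystem :=
  ![- (u * u * u * v) + 3 * (u * u * v * u) - 2 * (u * v * u) - κ.k1 • (u * u) + κ.k2 • u
      + z * (- 2 * (u * v * u) + u * v + v * u + κ.k4 • u + cst (κ.k1 - κ.k2 - κ.k4)),
    u * u * v * v - 2 * (u * v * u * v) - 2 * (v * u * u * v) + 2 * (v * u * v)
      + (κ.k1 - kh) • (u * v) + (κ.k1 + kh) • (v * u) - κ.k2 • v
      + cst ((kh ^ 2 - κ.k1 ^ 2) / 4)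
      + z * (2 * (v * u * v) - v * v - κ.k4 • v)]

def new2 (κ : Kappa) : NCSystem :=
  ![u * u * u * v + u * u * v * u - 2 * (u * u * v) - κ.k1 • (u * u) + κ.k2 • u
      + z * (- 2 * (u * u * v) + 3 * (u * v) - v * u + κ.k4 • u + cst (κ.k1 - κ.k2 - κ.k4)),
    - (u * u * v * v) - 2 * (u * v * u * v) + 2 * (u * v * v)
      + (2 * κ.k1) • (u * v) - κ.k2 • v + cst κ.k3
      + z * (2 * (u * v * v) - v * v - κ.k4 • v)]

def new3 (κ : Kappa) : NCSystem :=
  ![u * u * u * v + u * u * v * u - 2 * (u * u * v) - κ.k1 • (u * u) + κ.k2 • u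
      + z * (- 2 * (u * v * u) + u * v + v * u + κ.k4 • u + cst (κ.k1 - κ.k2 - κ.k4)),
    - (u * u * v * v) - 2 * (u * v * u * v) + 2 * (u * v * v)
      + (2 * κ.k1) • (u * v) - κ.k2 • v + cst κ.k3
      + z * (2 * (v * u * v) - v * v - κ.k4 • v)]

def new4 (κ : Kappa) : NCSystem :=
  ![u * u * u * v + u * u * v * u - 2 * (u * v * u) - κ.k1 • (u * u) + κ.k2 • u
      + z * (- 2 * (u * u * v) + u * v + v * u + κ.k4 • u + cst (κ.k1 - κ.k2 - κ.k4)),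
    - (u * u * v * v) - 2 * (u * v * u * v) + 2 * (v * u * v)
      + (2 * κ.k1) • (u * v) - κ.k2 • v + cst κ.k3
      + z * (2 * (u * v * v) - v * v - κ.k4 • v)]

def new5 (κ : Kappa) (kh : ℂ) : NCSystem :=
  ![2 * (u * u * u * v) - 2 * (u * u * v) - κ.k1 • (u * u) + κ.k2 • u
      + z * (- 2 * (u * u * v) + 2 * (u * v) + κ.k4 • u + cst (κ.k1 - κ.k2 - κ.k4)),
    - 2 * (u * u * v * v) - 2 * (u * v * u * v) + v * u * u * v + 2 * (u * v * v)
      + ((5 * κ.k1 - kh) / 2) • (u * v) + ((- κ.k1 + kh) / 2) • (v * u) - κ.k2 • v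
      + cst ((kh ^ 2 - κ.k1 ^ 2) / 4)
      + z * (2 * (u * v * v) - v * v - κ.k4 • v)]

def new6 (κ : Kappa) (kh : ℂ) : NCSystem :=
  ![2 * (u * u * v * u) - 2 * (u * u * v) - κ.k1 • (u * u) + κ.k2 • u
      + z * (- 2 * (u * v * u) + 2 * (u * v) + κ.k4 • u + cst (κ.k1 - κ.k2 - κ.k4)),
    - 2 * (u * v * u * v) - v * u * u * v + 2 * (u * v * v)
      + ((3 * κ.k1 - kh) / 2) • (u * v) + ((κ.k1 + kh) / 2) • (v * u) - κ.k2 • v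
      + cst ((kh ^ 2 - κ.k1 ^ 2) / 4)
      + z * (2 * (v * u * v) - v * v - κ.k4 • v)]

def new7 (κ : Kappa) (kh : ℂ) : NCSystem :=
  ![2 * (u * u * v * u) - 2 * (u * v * u) - κ.k1 • (u * u) + κ.k2 • u
      + z * (- 2 * (u * u * v) + 2 * (u * v) + κ.k4 • u + cst (κ.k1 - κ.k2 - κ.k4)),
    - 2 * (u * v * u * v) - v * u * u * v + 2 * (v * u * v)
      + ((3 * κ.k1 - kh) / 2) • (u * v) + ((κ.k1 + kh) / 2) • (v * u) - κ.k2 • v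
      + cst ((kh ^ 2 - κ.k1 ^ 2) / 4)
      + z * (2 * (u * v * v) - v * v - κ.k4 • v)]

def new8 (κ : Kappa) (kh : ℂ) : NCSystem :=
  ![2 * (u * u * v * u) - 2 * (u * v * u) - κ.k1 • (u * u) + κ.k2 • u
      + z * (- 2 * (u * v * u) + 2 * (v * u) + κ.k4 • u + cst (κ.k1 - κ.k2 - κ.k4)),
    - 2 * (u * v * u * v) - v * u * u * v + 2 * (v * u * v)
      + ((3 * κ.k1 - kh) / 2) • (u * v) + ((κ.k1 + kh) / 2) • (v * u) - κ.k2 • v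
      + cst ((kh ^ 2 - κ.k1 ^ 2) / 4)
      + z * (2 * (v * u * v) - v * v - κ.k4 • v)]

/-- List i): the Hamiltonian systems. -/
def InHamiltonianList (κ : Kappa) (F : NCSystem) : Prop :=
  ∃ β γ : ℂ, F = hamiltonian κ β γ

/-- List ii): the systems with a generalized Okamoto integral. -/
def InOkamotoList (κ : Kappa) (F : NCSystem) : Prop :=
  (∃ kh : ℂ, κ.k3 = (kh ^ 2 - κ.k1 ^ 2) / 4 ∧
    (F = okamoto1 κ kh ∨ F = okamoto2 κ kh ∨ F = okamoto3 κ kh)) ∨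
  F = okamoto4 κ ∨ F = okamoto5 κ ∨ F = okamoto6 κ ∨
  F = okamoto7 κ ∨ F = okamoto8 κ ∨ F = okamoto9 κ

/-- List iii): the eight further systems. -/
def InNewList (κ : Kappa) (F : NCSystem) : Prop :=
  (∃ kh : ℂ, κ.k3 = (kh ^ 2 - κ.k1 ^ 2) / 4 ∧
    (F = new1 κ kh ∨ F = new5 κ kh ∨ F = new6 κ kh ∨ F = new7 κ kh ∨ F = new8 κ kh)) ∨
  F = new2 κ ∨ F = new3 κ ∨ F = new4 κ

/-- Membership in one of the three lists. -/
def InLists (κ : Kappa) (F : NCSystem) : Prop :=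
  InHamiltonianList κ F ∨ InOkamotoList κ F ∨ InNewList κ F

end PainleveSix

end

noncomputable section

namespace PainleveSix

/-! ### Computable commutative polynomials -/

/-- A polynomial with integer coefficients: a list of pairs of a monomial (a list of variable
indices) and its coefficient. -/
abbrev Poly : Type := List (List ℕ × ℤ)

namespace Poly

/-! The functions used inside the certificates are written with recursors, which the kernel
evaluates faster than compiled pattern matching. -/

section Ops

def insVar (i : ℕ) (m : List ℕ) : List ℕ :=
  List.rec [i] (fun j m ih => Bool.rec (j :: ih) (i :: j :: m) (Nat.ble i j)) m

def mulMono (m n : List ℕ) : List ℕ := List.rec n (fun i _ ih => insVar i ih) m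

def eqMono (m : List ℕ) : List ℕ → Bool :=
  List.rec (motive := fun _ => List ℕ → Bool)
    (fun n => List.rec (motive := fun _ => Bool) true (fun _ _ _ => false) n)
    (fun i _ ih n => List.rec (motive := fun _ => Bool) false
      (fun j n _ => Bool.rec false (ih n) (Nat.beq i j)) n) m

def leMono (m : List ℕ) : List ℕ → Bool :=
  List.rec (motive := fun _ => List ℕ → Bool) (fun _ => true)
    (fun i _ ih n => List.rec (motive := fun _ => Bool) false
      (fun j n _ => Bool.rec (Nat.ble i j) (ih n) (Nat.beq i j)) n) m

def isZeroInt (c : ℤ) : Bool := Int.rec (fun n => Nat.beq n 0) (fun _ => false) c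

def consTerm (m : List ℕ) (c : ℤ) (p : Poly) : Poly :=
  Bool.rec ((m, c) :: p) p (isZeroInt c)

def addTerm (m : List ℕ) (c : ℤ) (p : Poly) : Poly :=
  List.rec [(m, c)] (fun t p ih => Bool.rec
    (Bool.rec (t :: ih) ((m, c) :: t :: p) (leMono m t.1))
    (consTerm m (c + t.2) p) (eqMono m t.1)) p

def add (p q : Poly) : Poly := List.rec q (fun t _ ih => addTerm t.1 t.2 ih) p

def mulTerm (m : List ℕ) (c : ℤ) (p q : Poly) : Poly :=
  List.rec q (fun t _ ih => addTerm (mulMono m t.1) (c * t.2) ih) p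

/-- `addMul p q r = p * q + r`. -/
def addMul (p q r : Poly) : Poly :=
  List.rec r (fun t _ ih => mulTerm t.1 t.2 q ih) p

def smul (c : ℤ) (p : Poly) : Poly :=
  List.rec [] (fun t _ ih => (t.1, c * t.2) :: ih) p

theorem add_cons (t : List ℕ × ℤ) (p q : Poly) : add (t :: p) q = addTerm t.1 t.2 (add p q) := rfl

theorem mulTerm_cons (m : List ℕ) (c : ℤ) (t : List ℕ × ℤ) (p q : Poly) :
    mulTerm m c (t :: p) q = addTerm (mulMono m t.1) (c * t.2) (mulTerm m c p q) := rfl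

theorem addMul_cons (t : List ℕ × ℤ) (p q r : Poly) :
    addMul (t :: p) q r = mulTerm t.1 t.2 q (addMul p q r) := rfl

theorem smul_cons (c : ℤ) (t : List ℕ × ℤ) (p : Poly) :
    smul c (t :: p) = (t.1, c * t.2) :: smul c p := rfl

theorem eq_of_eqMono {m n : List ℕ} (h : eqMono m n = true) : m = n := by
  induction m generalizing n with
  | nil =>
    cases n with
    | nil => rfl
    | cons j n => exact absurd h Bool.false_ne_true
  | cons i m ih =>
    cases n with
    | nil => exact absurd h Bool.false_ne_true
    | cons j n =>
      have hu : eqMono (i :: m) (j :: n) = Bool.rec false (eqMono m n) (Nat.beq i j) := rfl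
      rw [hu] at h
      cases hb : Nat.beq i j
      · rw [hb] at h; exact absurd h Bool.false_ne_true
      · rw [hb] at h; rw [Nat.eq_of_beq_eq_true hb, ih h]

theorem isZeroInt_eq {c : ℤ} (h : isZeroInt c = true) : c = 0 := by
  cases c with
  | ofNat n => rw [Nat.eq_of_beq_eq_true (n := n) (m := 0) h]; rfl
  | negSucc n => exact absurd h Bool.false_ne_true

end Ops

section Eval

variable {R : Type*} [CommRing R] (env : ℕ → R)

def evalMono : List ℕ → R
  | [] => 1
  | i :: m => env i * evalMono m

def eval : Poly → R
  | [] => 0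
  | (m, c) :: p => c * evalMono env m + eval p

@[simp] theorem eval_nil : eval env [] = 0 := rfl

theorem eval_cons (t : List ℕ × ℤ) (p : Poly) :
    eval env (t :: p) = t.2 * evalMono env t.1 + eval env p := rfl

theorem evalMono_insVar (i : ℕ) (m : List ℕ) :
    evalMono env (insVar i m) = env i * evalMono env m := by
  induction m with
  | nil => rfl
  | cons j m ih =>
    have hu : insVar i (j :: m) = Bool.rec (j :: insVar i m) (i :: j :: m) (Nat.ble i j) := rfl
    rw [hu]
    cases Nat.ble i j
    · simp only [evalMono, ih]; ring
    · simp only [evalMono]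

theorem evalMono_mulMono (m n : List ℕ) :
    evalMono env (mulMono m n) = evalMono env m * evalMono env n := by
  induction m with
  | nil => rw [evalMono, one_mul]; rfl
  | cons i m ih =>
    have hu : mulMono (i :: m) n = insVar i (mulMono m n) := rfl
    rw [hu, evalMono_insVar, ih, evalMono, mul_assoc]

theorem eval_consTerm (m : List ℕ) (c : ℤ) (p : Poly) :
    eval env (consTerm m c p) = c * evalMono env m + eval env p := by
  unfold consTerm
  cases h : isZeroInt c
  · rfl
  · simp [isZeroInt_eq h]

theorem eval_addTerm (m : List ℕ) (c : ℤ) (p : Poly) :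
    eval env (addTerm m c p) = c * evalMono env m + eval env p := by
  induction p with
  | nil => rfl
  | cons t p ih =>
    have hu : addTerm m c (t :: p) = Bool.rec
      (Bool.rec (t :: addTerm m c p) ((m, c) :: t :: p) (leMono m t.1))
      (consTerm m (c + t.2) p) (eqMono m t.1) := rfl
    rw [hu]
    cases h : eqMono m t.1
    · cases leMono m t.1
      · simp only [eval_cons, ih]; ring
      · simp only [eval_cons]
    · simp only [eval_consTerm, eval_cons, eq_of_eqMono h]; push_cast; ring

theorem eval_add (p q : Poly) : eval env (add p q) = eval env p + eval env q := by
  induction p with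
  | nil => rw [eval_nil, zero_add]; rfl
  | cons t p ih => rw [add_cons, eval_addTerm, ih, eval_cons, add_assoc]

theorem eval_mulTerm (m : List ℕ) (c : ℤ) (p q : Poly) :
    eval env (mulTerm m c p q) = c * evalMono env m * eval env p + eval env q := by
  induction p with
  | nil => rw [eval_nil, mul_zero, zero_add]; rfl
  | cons t p ih =>
    rw [mulTerm_cons, eval_addTerm, evalMono_mulMono, ih, eval_cons]; push_cast; ring

theorem eval_addMul (p q r : Poly) :
    eval env (addMul p q r) = eval env p * eval env q + eval env r := by
  induction p with
  | nil => rw [eval_nil, zero_mul, zero_add]; rfl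
  | cons t p ih => rw [addMul_cons, eval_mulTerm, ih, eval_cons]; ring

theorem eval_smul (c : ℤ) (p : Poly) : eval env (smul c p) = c * eval env p := by
  induction p with
  | nil => rw [eval_nil, mul_zero]; rfl
  | cons t p ih => rw [smul_cons, eval_cons, ih, eval_cons]; push_cast; ring

end Eval

end Poly

/-! ### Words and coefficients -/

/-- Words in two letters; `false` stands for `u` and `true` for `v`. -/
abbrev Word : Type := List Bool

namespace Word

/-- The word `b` with `o = m ++ b`. -/
def strip (m : Word) : Word → Option Word :=
  List.rec (motive := fun _ => Word → Option Word) some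
    (fun c _ ih o => List.rec (motive := fun _ => Option Word) none
      (fun x o _ => Bool.rec (Bool.rec (ih o) none x) (Bool.rec none (ih o) x) c) o) m

def beq (m : Word) : Word → Bool :=
  List.rec (motive := fun _ => Word → Bool)
    (fun o => List.rec (motive := fun _ => Bool) true (fun _ _ _ => false) o)
    (fun c _ ih o => List.rec (motive := fun _ => Bool) false
      (fun x o _ => Bool.rec (Bool.rec (ih o) false x) (Bool.rec false (ih o) x) c) o) m

def size (m : Word) : ℕ :=
  List.rec (motive := fun _ => ℕ) 0 (fun _ _ n => Nat.succ n) m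

def dropN (k : ℕ) : Word → Word :=
  Nat.rec (motive := fun _ => Word → Word) (fun o => o)
    (fun _ ih o => List.rec (motive := fun _ => Word) [] (fun _ o _ => ih o) o) k

def takeN (k : ℕ) : Word → Word :=
  Nat.rec (motive := fun _ => Word → Word) (fun _ => [])
    (fun _ ih o => List.rec (motive := fun _ => Word) [] (fun c o _ => c :: ih o) o) k

def revAppend (a : Word) : Word → Word :=
  List.rec (motive := fun _ => Word → Word) (fun b => b) (fun c _ ih b => ih (c :: b)) a

/-- The words obtained from `o` by replacing one occurrence of the factor `m` by the letter `c`,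
preceded by the reverse of `a`. -/
def subs (c : Bool) (m o : Word) : Word → List Word :=
  List.rec (motive := fun _ => Word → List Word)
    (fun a => Option.rec [] (fun b => [revAppend a (c :: b)]) (strip m []))
    (fun x o ih a => Option.rec (ih (x :: a)) (fun b => revAppend a (c :: b) :: ih (x :: a))
      (strip m (x :: o))) o

/-- The pairs of a letter `c` and a word `w` of length `n` such that `o` results from `f` by
replacing one occurrence of the letter `c` by `w`. -/
def holes (n : ℕ) (f : Word) : Word → List (Bool × Word) :=
  List.rec (motive := fun _ => Word → List (Bool × Word)) (fun _ => [])
    (fun c f ih o =>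
      Bool.rec (List.rec (motive := fun _ => List (Bool × Word)) []
          (fun x o _ => Bool.rec (Bool.rec (ih o) [] x) (Bool.rec [] (ih o) x) c) o)
        ((c, takeN n o) :: List.rec (motive := fun _ => List (Bool × Word)) []
          (fun x o _ => Bool.rec (Bool.rec (ih o) [] x) (Bool.rec [] (ih o) x) c) o)
        (beq f (dropN n o))) f

theorem strip_nil (o : Word) : strip [] o = some o := rfl

theorem strip_cons_nil (c : Bool) (m : Word) : strip (c :: m) [] = none := rfl

theorem strip_cons_cons (c x : Bool) (m o : Word) :
    strip (c :: m) (x :: o) = if c = x then strip m o else none := by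
  cases c <;> cases x <;> rfl

theorem strip_eq_some {m o b : Word} : strip m o = some b ↔ o = m ++ b := by
  induction m generalizing o with
  | nil => simp [strip_nil]
  | cons c m ih =>
    cases o with
    | nil => simp [strip_cons_nil]
    | cons x o => rw [strip_cons_cons]; by_cases h : c = x <;> simp [h, ih, eq_comm]

theorem beq_iff {m o : Word} : beq m o = true ↔ m = o := by
  induction m generalizing o with
  | nil =>
    cases o with
    | nil => exact iff_of_true rfl rfl
    | cons x o => exact iff_of_false Bool.false_ne_true (by simp)
  | cons c m ih =>
    cases o with
    | nil => exact iff_of_false Bool.false_ne_true (by simp)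
    | cons x o =>
      have h : beq (c :: m) (x :: o) = if c = x then beq m o else false := by
        cases c <;> cases x <;> rfl
      rw [h]; by_cases h : c = x <;> simp [h, ih]

theorem size_eq (m : Word) : size m = m.length := by
  induction m with
  | nil => rfl
  | cons c m ih => rw [List.length_cons, ← ih]; rfl

theorem dropN_eq (k : ℕ) (o : Word) : dropN k o = o.drop k := by
  induction k generalizing o with
  | zero => rfl
  | succ k ih =>
    cases o with
    | nil => rfl
    | cons x o => rw [List.drop_succ_cons, ← ih]; rfl

theorem takeN_eq (k : ℕ) (o : Word) : takeN k o = o.take k := by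
  induction k generalizing o with
  | zero => rfl
  | succ k ih =>
    cases o with
    | nil => rfl
    | cons x o => rw [List.take_succ_cons, ← ih]; rfl

theorem revAppend_eq (a b : Word) : revAppend a b = a.reverse ++ b := by
  induction a generalizing b with
  | nil => rfl
  | cons c a ih => rw [List.reverse_cons, List.append_assoc, List.singleton_append, ← ih]; rfl

theorem subs_cons_acc (c x : Bool) (m o a : Word) :
    subs c m o (a ++ [x]) = (subs c m o a).map (x :: ·) := by
  induction o generalizing a with
  | nil =>
    unfold subs
    dsimp only
    cases strip m [] <;> simp [revAppend_eq]
  | cons y o ih =>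
    have hu : ∀ a, subs c m (y :: o) a = Option.rec (subs c m o (y :: a))
        (fun b => revAppend a (c :: b) :: subs c m o (y :: a)) (strip m (y :: o)) := fun _ => rfl
    rw [hu, hu]
    have := ih (y :: a)
    rw [List.cons_append] at this
    cases strip m (y :: o) <;> simp [revAppend_eq, this]

theorem subs_nil (c : Bool) (m : Word) :
    subs c m [] [] = match strip m [] with
      | none => []
      | some b => [c :: b] := by
  unfold subs
  dsimp only
  cases strip m [] <;> rfl

theorem subs_cons (c x : Bool) (m o : Word) :
    subs c m (x :: o) [] = match strip m (x :: o) with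
      | none => (subs c m o []).map (x :: ·)
      | some b => (c :: b) :: (subs c m o []).map (x :: ·) := by
  have hu : subs c m (x :: o) [] = Option.rec (subs c m o [x])
      (fun b => revAppend [] (c :: b) :: subs c m o [x]) (strip m (x :: o)) := rfl
  have h : subs c m o [x] = (subs c m o []).map (x :: ·) := subs_cons_acc c x m o []
  rw [hu, h]
  cases strip m (x :: o) <;> rfl

/-- The word `a` with `o = a ++ m`. -/
def stripEnd (m o : Word) : Option Word :=
  if m = o.drop (o.length - m.length) then some (o.take (o.length - m.length)) else none

theorem stripEnd_eq_some {m o a : Word} : stripEnd m o = some a ↔ o = a ++ m := by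
  unfold stripEnd
  constructor
  · intro h
    split at h
    · rename_i h1
      rw [Option.some.injEq] at h
      conv_lhs => rw [← List.take_append_drop (o.length - m.length) o]
      rw [h, ← h1]
    · exact absurd h (by simp)
  · rintro rfl
    simp

theorem holes_cons (n : ℕ) (c : Bool) (f o : Word) (h1 : o.length - f.length = n) :
    holes n (c :: f) o = (match stripEnd f o with
      | none => []
      | some w => [(c, w)]) ++
      match o with
      | [] => []
      | y :: o => if c = y then holes n f o else [] := by
  unfold stripEnd
  rw [h1, ← dropN_eq, ← takeN_eq]
  have hu : holes n (c :: f) o =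
      Bool.rec (List.rec (motive := fun _ => List (Bool × Word)) []
          (fun x o _ => Bool.rec (Bool.rec (holes n f o) [] x) (Bool.rec [] (holes n f o) x) c) o)
        ((c, takeN n o) :: List.rec (motive := fun _ => List (Bool × Word)) []
          (fun x o _ => Bool.rec (Bool.rec (holes n f o) [] x) (Bool.rec [] (holes n f o) x) c) o)
        (beq f (dropN n o)) := rfl
  rw [hu]
  by_cases hb : f = dropN n o
  · rw [beq_iff.2 hb, if_pos hb]
    cases o with
    | nil => rfl
    | cons x o => cases c <;> cases x <;> rfl
  · have : beq f (dropN n o) = false := by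
      rw [← Bool.not_eq_true, beq_iff]; exact hb
    rw [this, if_neg hb]
    cases o with
    | nil => rfl
    | cons x o => cases c <;> cases x <;> rfl

theorem length_of_mem_subs {c : Bool} {m o w : Word} (h : w ∈ subs c m o []) :
    w.length + m.length = o.length + 1 := by
  have hb : ∀ {o b : Word}, strip m o = some b → b.length + m.length = o.length := by
    intro o b h
    rw [strip_eq_some.1 h, List.length_append, add_comm]
  induction o generalizing w with
  | nil =>
    rw [subs_nil] at h
    split at h
    · simp at h
    · rename_i b hs
      rw [List.mem_singleton.1 h, List.length_cons, ← hb hs]; ring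
  | cons x o ih =>
    have key : ∀ w ∈ (subs c m o []).map (x :: ·), w.length + m.length = (x :: o).length + 1 := by
      intro w hw
      obtain ⟨w', hw', rfl⟩ := List.mem_map.1 hw
      have := ih hw'
      simp only [List.length_cons]; omega
    rw [subs_cons] at h
    split at h
    · exact key w h
    · rename_i b hs
      rcases List.mem_cons.1 h with rfl | h
      · rw [List.length_cons, ← hb hs]; ring
      · exact key w h

theorem length_of_mem_holes {f o : Word} {t : Bool × Word}
    (h : t ∈ holes (o.length + 1 - f.length) f o) : t.2.length = o.length + 1 - f.length := by
  induction f generalizing o with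
  | nil => exact absurd h List.not_mem_nil
  | cons c f ih =>
    have hn : o.length - f.length = o.length + 1 - (c :: f).length := by
      rw [List.length_cons]; omega
    rw [holes_cons _ _ _ _ hn, List.mem_append] at h
    rcases h with h | h
    · split at h
      · simp at h
      · rename_i w hw
        rw [stripEnd_eq_some] at hw
        rw [List.mem_singleton.1 h, ← hn, hw]
        simp
    · cases o with
      | nil => simp at h
      | cons y o =>
        have hn' : o.length + 1 - f.length = (y :: o).length + 1 - (c :: f).length := by
          simp only [List.length_cons]; omega
        replace h : t ∈ if c = y then holes ((y :: o).length + 1 - (c :: f).length) f o else [] := h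
        rw [← hn'] at h ⊢
        split at h
        · exact ih h
        · simp at h

end Word

def fin (c : Bool) : Fin 2 := bif c then 1 else 0

theorem fin_injective : Function.Injective fin := by
  intro a b; cases a <;> cases b <;> simp [fin]

def letter (c : Bool) : NC := FreeAlgebra.ι ℂ[X] (fin c)

def word : Word → NC
  | [] => 1
  | c :: w => letter c * word w

@[simp] theorem word_nil : word [] = 1 := rfl

theorem word_cons (c : Bool) (w : Word) : word (c :: w) = letter c * word w := rfl

theorem word_append (a b : Word) : word (a ++ b) = word a * word b := by
  induction a with
  | nil => simp
  | cons c a ih => simp [word_cons, ih, mul_assoc]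

/-- The coefficient of a word. -/
def co (w : Word) : NC →ₗ[ℂ[X]] ℂ[X] where
  toFun p := (FreeAlgebra.equivMonoidAlgebraFreeMonoid p :
    MonoidAlgebra ℂ[X] (FreeMonoid (Fin 2))).coeff (FreeMonoid.ofList (w.map fin))
  map_add' p q := by simp
  map_smul' r p := by simp

theorem equiv_word (w : Word) : FreeAlgebra.equivMonoidAlgebraFreeMonoid (word w) =
    MonoidAlgebra.single (FreeMonoid.ofList (w.map fin)) (1 : ℂ[X]) := by
  induction w with
  | nil => simp [MonoidAlgebra.one_def]
  | cons c w ih =>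
    rw [word_cons, map_mul, ih, letter, FreeAlgebra.equivMonoidAlgebraFreeMonoid]
    simp [MonoidAlgebra.single_mul_single]

theorem co_word (w w' : Word) : co w (word w') = if w = w' then 1 else 0 := by
  classical
  have h : co w (word w') = (FreeAlgebra.equivMonoidAlgebraFreeMonoid (word w') :
    MonoidAlgebra ℂ[X] (FreeMonoid (Fin 2))).coeff (FreeMonoid.ofList (w.map fin)) := rfl
  rw [h, equiv_word, MonoidAlgebra.coeff_single, Finsupp.single_apply]
  congr 1
  rw [eq_iff_iff, FreeMonoid.ofList.injective.eq_iff,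
    (List.map_injective_iff.2 fin_injective).eq_iff, eq_comm]

theorem exists_word_eq (m : FreeMonoid (Fin 2)) :
    ∃ w : Word, m = FreeMonoid.ofList (w.map fin) := by
  refine ⟨(FreeMonoid.toList m).map (fun i => decide (i = 1)), ?_⟩
  rw [List.map_map]
  conv_lhs => rw [← FreeMonoid.ofList_toList m]
  congr 1
  conv_lhs => rw [← List.map_id (FreeMonoid.toList m)]
  apply List.map_congr_left
  intro i _
  fin_cases i <;> simp [fin]

theorem nc_induction {motive : NC → Prop} (p : NC) (zero : motive 0)
    (add : ∀ p q, motive p → motive q → motive (p + q))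
    (word : ∀ (r : ℂ[X]) w, motive (r • word w)) : motive p := by
  have key : ∀ x : MonoidAlgebra ℂ[X] (FreeMonoid (Fin 2)),
      motive (FreeAlgebra.equivMonoidAlgebraFreeMonoid.symm x) := by
    intro x
    induction x using MonoidAlgebra.induction_linear with
    | zero => simpa using zero
    | add x y hx hy => rw [map_add]; exact add _ _ hx hy
    | single m r =>
      obtain ⟨w, hw⟩ := exists_word_eq m
      have : MonoidAlgebra.single m r =
          r • FreeAlgebra.equivMonoidAlgebraFreeMonoid (PainleveSix.word w) := by
        rw [equiv_word, hw]; simp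
      rw [this, ← map_smul, AlgEquiv.symm_apply_apply]
      exact word r w
  simpa using key (FreeAlgebra.equivMonoidAlgebraFreeMonoid p)

theorem co_word_mul (o m : Word) (p : NC) :
    co o (word m * p) = match Word.strip m o with | none => 0 | some b => co b p := by
  induction p using nc_induction with
  | zero => cases Word.strip m o <;> simp
  | add p q hp hq =>
    rw [mul_add, map_add, hp, hq]
    cases Word.strip m o <;> simp
  | word r w =>
    rw [mul_smul_comm, map_smul, ← word_append, co_word]
    cases h : Word.strip m o with
    | none =>
      have : o ≠ m ++ w := fun h' => by rw [Word.strip_eq_some.2 h'] at h; exact absurd h (by simp)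
      simp [this]
    | some b =>
      rw [Word.strip_eq_some] at h
      subst h
      simp [co_word]

theorem co_mul_word (o m : Word) (p : NC) :
    co o (p * word m) = match Word.stripEnd m o with | none => 0 | some b => co b p := by
  induction p using nc_induction with
  | zero => cases Word.stripEnd m o <;> simp
  | add p q hp hq =>
    rw [add_mul, map_add, hp, hq]
    cases Word.stripEnd m o <;> simp
  | word r w =>
    rw [smul_mul_assoc, map_smul, ← word_append, co_word]
    cases h : Word.stripEnd m o with
    | none =>
      have : o ≠ w ++ m := fun h' => by
        rw [Word.stripEnd_eq_some.2 h'] at h; exact absurd h (by simp)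
      simp [this]
    | some b =>
      rw [Word.stripEnd_eq_some] at h
      subst h
      simp [co_word]

theorem co_nil_letter_mul (c : Bool) (p : NC) : co [] (letter c * p) = 0 := by
  have := co_word_mul [] [c] p
  rw [word_cons, word_nil, mul_one] at this
  rw [this]; cases c <;> rfl

theorem co_cons_letter_mul (x c : Bool) (w : Word) (p : NC) :
    co (x :: w) (letter c * p) = if c = x then co w p else 0 := by
  have := co_word_mul (x :: w) [c] p
  rw [word_cons, word_nil, mul_one] at this
  rw [this]; cases c <;> cases x <;> rfl

/-! ### The derivation along a system -/

/-- `flow F` as a linear map. -/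
def flowL (F : NCSystem) : NC →ₗ[ℂ[X]] NC where
  toFun := flow F
  map_add' p q := by simp [flow]
  map_smul' r p := by simp [flow]

theorem flow_add (F : NCSystem) (p q : NC) : flow F (p + q) = flow F p + flow F q :=
  (flowL F).map_add p q

theorem flow_zero (F : NCSystem) : flow F 0 = 0 := (flowL F).map_zero

theorem flow_smul (F : NCSystem) (r : ℂ[X]) (p : NC) : flow F (r • p) = r • flow F p :=
  (flowL F).map_smul r p

theorem flow_algebraMap (F : NCSystem) (r : ℂ[X]) : flow F (algebraMap ℂ[X] NC r) = 0 := by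
  simp [flow, TrivSqZeroExt.algebraMap_eq_inl']

theorem flow_one (F : NCSystem) : flow F 1 = 0 := by
  simpa using flow_algebraMap F 1

theorem flow_letter_mul (F : NCSystem) (c : Bool) (p : NC) :
    flow F (letter c * p) = F (fin c) * p + letter c * flow F p := by
  rw [flow_mul, letter, flow_var]

/-- Polynomial vector fields: a list of a component, a word and its coefficient. -/
abbrev VField : Type := List (Bool × Word × Poly)

def VField.eval (env : ℕ → ℂ[X]) : VField → Bool → NC
  | [], _ => 0
  | (c, m, q) :: L, i =>
    (if c = i then q.eval env • word m else 0) + VField.eval env L i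

/-- Formal linear combinations of the coefficients of a vector field. -/
abbrev LForm : Type := List (Poly × Bool × Word)

def LForm.eval {R : Type*} [CommRing R] (env : ℕ → R) (g : Bool → Word → R) : LForm → R
  | [] => 0
  | (q, c, w) :: l => q.eval env * g c w + LForm.eval env g l

theorem LForm.eval_append {R : Type*} [CommRing R] (env : ℕ → R) (g : Bool → Word → R)
    (l l' : LForm) : LForm.eval env g (l ++ l') = LForm.eval env g l + LForm.eval env g l' := by
  induction l with
  | nil => simp [LForm.eval]
  | cons t l ih => obtain ⟨q, c, w⟩ := t; simp [LForm.eval, ih, add_assoc]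

/-- The coefficient of the word `o` of length `n` in the component `i` of the commutator of the
vector field `L` with a general one, whose coefficients at words of length at least ten vanish. -/
def VField.pull (i : Bool) (o : Word) (n : ℕ) (L : VField) : LForm :=
  List.rec (motive := fun _ => LForm) []
    (fun t _ ih => Bool.rec
      (Bool.rec (List.rec (motive := fun _ => LForm) ih (fun w _ l => (t.2.2, i, w) :: l)
          (Word.subs t.1 t.2.1 o []))
        (List.rec (motive := fun _ => LForm)
          (List.rec (motive := fun _ => LForm) ih
            (fun x _ l => (Poly.smul (-1) t.2.2, x.1, x.2) :: l)
            (Word.holes (Nat.sub (Nat.succ n) (Word.size t.2.1)) t.2.1 o))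
          (fun w _ l => (t.2.2, i, w) :: l) (Word.subs t.1 t.2.1 o []))
        (not (xor t.1 i)))
      ih (Nat.ble (Nat.add (Word.size t.2.1) 9) n)) L

theorem sum_subs_one (c : Bool) (m o : Word) :
    ((Word.subs c m o []).map (fun w => co w 1)).sum = 0 := by
  have h : ∀ x (w : Word), co (x :: w) 1 = 0 := by
    intro x w
    rw [← word_nil, co_word]; simp
  cases o with
  | nil => rw [Word.subs_nil]; split <;> simp [h]
  | cons x o =>
    rw [Word.subs_cons]
    split <;> simp [h, Function.comp_def]

theorem sum_subs_letter_mul (c x : Bool) (m o : Word) (p : NC) :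
    ((Word.subs c m o []).map (fun w => co w (letter x * p))).sum =
      (if c = x then co o (word m * p) else 0) +
        (match o with
          | [] => 0
          | y :: o => if x = y then ((Word.subs c m o []).map (fun w => co w p)).sum else 0) := by
  rw [co_word_mul]
  cases o with
  | nil =>
    rw [Word.subs_nil]
    cases Word.strip m [] with
    | none => simp
    | some b => simp [co_cons_letter_mul, eq_comm]
  | cons y o =>
    rw [Word.subs_cons]
    have h : ((fun w => co w (letter x * p)) ∘ fun w => y :: w) =
        fun w => if x = y then co w p else 0 := by
      funext w; simp [co_cons_letter_mul]
    have h2 : ((Word.subs c m o []).map (fun w => if x = y then co w p else 0)).sum =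
        if x = y then ((Word.subs c m o []).map (fun w => co w p)).sum else 0 := by
      split <;> simp
    cases Word.strip m (y :: o) with
    | none => simp [List.map_map, h, h2]
    | some b => simp [List.map_map, h, h2, co_cons_letter_mul, eq_comm]

/-- The substitution part of `VField.pull`, evaluated. -/
def subsSum (env : ℕ → ℂ[X]) (p : NC) (o : Word) : VField → ℂ[X]
  | [] => 0
  | (c, m, q) :: L =>
    q.eval env * ((Word.subs c m o []).map (fun w => co w p)).sum + subsSum env p o L

theorem subsSum_one (env : ℕ → ℂ[X]) (o : Word) (L : VField) : subsSum env 1 o L = 0 := by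
  induction L with
  | nil => rfl
  | cons t L ih => obtain ⟨c, m, q⟩ := t; simp [subsSum, ih, sum_subs_one]

theorem subsSum_zero (env : ℕ → ℂ[X]) (o : Word) (L : VField) : subsSum env 0 o L = 0 := by
  induction L with
  | nil => rfl
  | cons t L ih => obtain ⟨c, m, q⟩ := t; simp [subsSum, ih]

theorem subsSum_add (env : ℕ → ℂ[X]) (p p' : NC) (o : Word) (L : VField) :
    subsSum env (p + p') o L = subsSum env p o L + subsSum env p' o L := by
  induction L with
  | nil => simp [subsSum]
  | cons t L ih => obtain ⟨c, m, q⟩ := t; simp [subsSum, ih, List.sum_map_add]; ring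

theorem subsSum_smul (env : ℕ → ℂ[X]) (r : ℂ[X]) (p : NC) (o : Word) (L : VField) :
    subsSum env (r • p) o L = r * subsSum env p o L := by
  induction L with
  | nil => simp [subsSum]
  | cons t L ih =>
    obtain ⟨c, m, q⟩ := t
    simp [subsSum, ih, List.sum_map_mul_left]; ring

theorem subsSum_letter_mul (env : ℕ → ℂ[X]) (x : Bool) (p : NC) (o : Word) (L : VField) :
    subsSum env (letter x * p) o L = co o (VField.eval env L x * p) +
      (match o with
        | [] => 0
        | y :: o => if x = y then subsSum env p o L else 0) := by
  induction L with
  | nil => cases o <;> simp [subsSum, VField.eval]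
  | cons t L ih =>
    obtain ⟨c, m, q⟩ := t
    rw [subsSum, ih, sum_subs_letter_mul, VField.eval, add_mul, map_add]
    have : co o ((if c = x then q.eval env • word m else 0) * p) =
        q.eval env * (if c = x then co o (word m * p) else 0) := by
      split <;> simp
    rw [this]
    cases o with
    | nil => ring
    | cons y o => by_cases hxy : x = y <;> simp only [hxy, subsSum, if_true, if_false] <;> ring

theorem co_flow (env : ℕ → ℂ[X]) (L : VField) (F : NCSystem)
    (hF : ∀ i, F (fin i) = VField.eval env L i) (p : NC) (o : Word) :
    co o (flow F p) = subsSum env p o L := by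
  have key : ∀ x o, co o (flow F (word x)) = subsSum env (word x) o L := by
    intro x
    induction x with
    | nil => intro o; rw [word_nil, flow_one, subsSum_one, map_zero]
    | cons c x ih =>
      intro o
      rw [word_cons, flow_letter_mul, map_add, subsSum_letter_mul, hF]
      congr 1
      cases o with
      | nil => simp [co_nil_letter_mul]
      | cons y o => simp [co_cons_letter_mul, ih]
  induction p using nc_induction with
  | zero => rw [flow_zero, map_zero, subsSum_zero]
  | add p q hp hq => rw [flow_add, map_add, hp, hq, subsSum_add]
  | word r w => rw [flow_smul, map_smul, key, subsSum_smul, smul_eq_mul]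

theorem co_flow_word (G : NCSystem) (f o : Word) : co o (flow G (word f)) =
    ((Word.holes (o.length + 1 - f.length) f o).map (fun t => co t.2 (G (fin t.1)))).sum := by
  induction f generalizing o with
  | nil =>
    rw [word_nil, flow_one, map_zero]
    rfl
  | cons c f ih =>
    have hn : o.length - f.length = o.length + 1 - (c :: f).length := by
      rw [List.length_cons]; omega
    rw [word_cons, flow_letter_mul, map_add, co_mul_word, Word.holes_cons _ _ _ _ hn,
      List.map_append, List.sum_append]
    congr 1
    · cases Word.stripEnd f o <;> simp
    · cases o with
      | nil => rw [co_nil_letter_mul]; simp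
      | cons y o =>
        rw [co_cons_letter_mul, ih]
        by_cases h : c = y <;> simp [h]

theorem VField.pull_cons (i : Bool) (o : Word) (n : ℕ) (t : Bool × Word × Poly) (L : VField) :
    VField.pull i o n (t :: L) = (if t.2.1.length + 9 ≤ n then [] else
      (Word.subs t.1 t.2.1 o []).map (fun w => (t.2.2, i, w)) ++
        if t.1 = i then (Word.holes (n + 1 - t.2.1.length) t.2.1 o).map
          (fun x => (Poly.smul (-1) t.2.2, x.1, x.2)) else []) ++ VField.pull i o n L := by
  have h1 : ∀ (l : List Word) (a : LForm), List.rec (motive := fun _ => LForm) a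
      (fun w _ l => (t.2.2, i, w) :: l) l = l.map (fun w => (t.2.2, i, w)) ++ a := by
    intro l a
    induction l with
    | nil => rfl
    | cons w l ih => rw [List.map_cons, List.cons_append, ← ih]
  have h2 : ∀ (l : List (Bool × Word)) (a : LForm), List.rec (motive := fun _ => LForm) a
      (fun x _ l => (Poly.smul (-1) t.2.2, x.1, x.2) :: l) l =
        l.map (fun x => (Poly.smul (-1) t.2.2, x.1, x.2)) ++ a := by
    intro l a
    induction l with
    | nil => rfl
    | cons w l ih => rw [List.map_cons, List.cons_append, ← ih]
  unfold VField.pull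
  dsimp only
  rw [h1, h2, h1, Word.size_eq]
  by_cases hn : t.2.1.length + 9 ≤ n
  · have : Nat.ble (Nat.add t.2.1.length 9) n = true := Nat.ble_eq_true_of_le hn
    rw [this, if_pos hn]
    rfl
  · have : Nat.ble (Nat.add t.2.1.length 9) n = false := by
      rw [← Bool.not_eq_true, Nat.ble_eq]; exact hn
    rw [this, if_neg hn]
    by_cases hc : t.1 = i
    · rw [if_pos hc, hc, Bool.xor_self, List.append_assoc]
      rfl
    · have : (!(t.1 ^^ i)) = false := by revert hc; cases t.1 <;> cases i <;> simp
      rw [if_neg hc, this, List.append_nil]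

theorem eval_pull (env : ℕ → ℂ[X]) (L : VField) (G : NCSystem)
    (hG : ∀ c w, 10 ≤ w.length → co w (G (fin c)) = 0) (i : Bool) (o : Word) :
    LForm.eval env (fun c w => co w (G (fin c))) (L.pull i o o.length) =
      subsSum env (G (fin i)) o L - co o (flow G (L.eval env i)) := by
  induction L with
  | nil =>
    simp only [subsSum, VField.eval, flow_zero, map_zero, sub_zero]
    rfl
  | cons t L ih =>
    rw [VField.pull_cons, LForm.eval_append, ih]
    obtain ⟨c, m, q⟩ := t
    rw [subsSum, VField.eval, flow_add, map_add]
    have h1 : ∀ l : List Word, LForm.eval env (fun c w => co w (G (fin c)))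
        (l.map fun w => (q, i, w)) = q.eval env * (l.map fun w => co w (G (fin i))).sum := by
      intro l
      induction l with
      | nil => simp [LForm.eval]
      | cons a l ih => simp [LForm.eval, ih, mul_add]
    have h2 : ∀ l : List (Bool × Word), LForm.eval env (fun c w => co w (G (fin c)))
        (l.map fun t => (Poly.smul (-1) q, t.1, t.2)) =
          - (q.eval env * (l.map fun t => co t.2 (G (fin t.1))).sum) := by
      intro l
      induction l with
      | nil => simp [LForm.eval]
      | cons a l ih =>
        simp only [List.map_cons, LForm.eval, ih, Poly.eval_smul, List.sum_cons]
        push_cast; ring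
    have h3 : co o (flow G (if c = i then q.eval env • word m else 0)) = if c = i then
        q.eval env * ((Word.holes (o.length + 1 - m.length) m o).map
          (fun t => co t.2 (G (fin t.1)))).sum else 0 := by
      split
      · rw [flow_smul, map_smul, co_flow_word, smul_eq_mul]
      · rw [flow_zero, map_zero]
    rw [h3]
    by_cases hn : m.length + 9 ≤ o.length
    · have s1 : ((Word.subs c m o []).map (fun w => co w (G (fin i)))).sum = 0 := by
        apply List.sum_eq_zero
        intro x hx
        obtain ⟨w, hw, rfl⟩ := List.mem_map.1 hx
        have := Word.length_of_mem_subs hw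
        exact hG _ _ (by omega)
      have s2 : ((Word.holes (o.length + 1 - m.length) m o).map
          (fun t => co t.2 (G (fin t.1)))).sum = 0 := by
        apply List.sum_eq_zero
        intro x hx
        obtain ⟨w, hw, rfl⟩ := List.mem_map.1 hx
        have := Word.length_of_mem_holes hw
        exact hG _ _ (by omega)
      rw [if_pos hn, s1, s2]
      simp only [LForm.eval, mul_zero, ite_self]
      ring
    · rw [if_neg hn, LForm.eval_append, h1]
      split
      · rw [h2]; ring
      · simp only [LForm.eval]; ring

theorem eval_pull_eq_zero {env : ℕ → ℂ[X]} {L : VField} {F G : NCSystem}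
    (hF : ∀ i, F (fin i) = VField.eval env L i) (h : ∀ i, flow F (G i) = flow G (F i))
    (hG : ∀ c w, 10 ≤ w.length → co w (G (fin c)) = 0) (i : Bool) (o : Word) :
    LForm.eval env (fun c w => co w (G (fin c))) (L.pull i o o.length) = 0 := by
  rw [eval_pull env L G hG, ← co_flow env L F hF, h, hF, sub_self]

/-! ### Elimination certificates -/

/-! Normal forms: `force x k = k x`, but the kernel evaluates `x` before it passes it on. -/

def forceNat {α : Sort*} (n : ℕ) (k : ℕ → α) : α :=
  Nat.rec (motive := fun _ => α) (k 0) (fun n _ => k (Nat.succ n)) n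

def forceInt {α : Sort*} (c : ℤ) (k : ℤ → α) : α :=
  Int.rec (motive := fun _ => α) (fun n => forceNat n fun n => k (Int.ofNat n))
    (fun n => forceNat n fun n => k (Int.negSucc n)) c

def forceMono {α : Sort*} (m : List ℕ) : (List ℕ → α) → α :=
  List.rec (motive := fun _ => (List ℕ → α) → α) (fun k => k [])
    (fun i _ ih k => forceNat i fun i => ih fun m => k (i :: m)) m

def forceWord {α : Sort*} (w : Word) : (Word → α) → α :=
  List.rec (motive := fun _ => (Word → α) → α) (fun k => k [])
    (fun c _ ih k => Bool.rec (ih fun w => k (false :: w)) (ih fun w => k (true :: w)) c) w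

def forcePoly {α : Sort*} (p : Poly) : (Poly → α) → α :=
  List.rec (motive := fun _ => (Poly → α) → α) (fun k => k [])
    (fun t _ ih k => forceMono t.1 fun m => forceInt t.2 fun c => ih fun p => k ((m, c) :: p)) p

def forceTerms {α : Sort*} (l : List (Word × Poly)) :
    (List (Word × Poly) → α) → α :=
  List.rec (motive := fun _ => (List (Word × Poly) → α) → α) (fun k => k [])
    (fun t _ ih k => forceWord t.1 fun w => forcePoly t.2 fun p => ih fun l => k ((w, p) :: l)) l

def forceField {α : Sort*} (L : VField) : (VField → α) → α :=
  List.rec (motive := fun _ => (VField → α) → α) (fun k => k [])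
    (fun t _ ih k => Bool.rec
      (forceWord t.2.1 fun w => forcePoly t.2.2 fun p => ih fun l => k ((false, w, p) :: l))
      (forceWord t.2.1 fun w => forcePoly t.2.2 fun p => ih fun l => k ((true, w, p) :: l)) t.1) L

theorem forceNat_eq {α : Sort*} (n : ℕ) (k : ℕ → α) : forceNat n k = k n := by
  cases n <;> rfl

theorem forceInt_eq {α : Sort*} (c : ℤ) (k : ℤ → α) : forceInt c k = k c := by
  cases c with
  | ofNat n => exact forceNat_eq n fun n => k (Int.ofNat n)
  | negSucc n => exact forceNat_eq n fun n => k (Int.negSucc n)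

theorem forceMono_eq {α : Sort*} (m : List ℕ) (k : List ℕ → α) : forceMono m k = k m := by
  induction m generalizing k with
  | nil => rfl
  | cons i m ih => exact (forceNat_eq i fun i => forceMono m fun m => k (i :: m)).trans (ih _)

theorem forceWord_eq {α : Sort*} (w : Word) (k : Word → α) : forceWord w k = k w := by
  induction w generalizing k with
  | nil => rfl
  | cons c w ih => cases c <;> exact ih _

theorem forcePoly_eq {α : Sort*} (p : Poly) (k : Poly → α) : forcePoly p k = k p := by
  induction p generalizing k with
  | nil => rfl
  | cons t p ih => exact (forceMono_eq _ _).trans ((forceInt_eq _ _).trans (ih _))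

theorem forceTerms_eq {α : Sort*} (l : List (Word × Poly)) (k : List (Word × Poly) → α) :
    forceTerms l k = k l := by
  induction l generalizing k with
  | nil => rfl
  | cons t l ih => exact (forceWord_eq _ _).trans ((forcePoly_eq _ _).trans (ih _))

theorem forceField_eq {α : Sort*} (L : VField) (k : VField → α) : forceField L k = k L := by
  induction L generalizing k with
  | nil => rfl
  | cons t L ih =>
    obtain ⟨c, w, p⟩ := t
    cases c <;> exact (forceWord_eq _ _).trans ((forcePoly_eq _ _).trans (ih _))

/-- Finite partial maps from words to polynomials. -/
inductive Trie : Type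
  | leaf : Trie
  | node (v : Option Poly) (l r : Trie) : Trie

namespace Trie

def lookup (t : Trie) : Word → Option Poly :=
  Trie.rec (motive := fun _ => Word → Option Poly) (fun _ => none)
    (fun v _ _ ihl ihr w => List.rec (motive := fun _ => Option Poly) v
      (fun c w _ => Bool.rec (ihl w) (ihr w) c) w) t

/-- Insertion, followed by a continuation. -/
def insertK {α : Type} (p : Poly) (w : Word) : Trie → (Trie → α) → α :=
  List.rec (motive := fun _ => Trie → (Trie → α) → α)
    (fun t k => Trie.rec (motive := fun _ => α) (k (node (some p) leaf leaf))
      (fun _ l r _ _ => k (node (some p) l r)) t)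
    (fun c _ ih t k => Trie.rec (motive := fun _ => α)
      (Bool.rec (ih leaf fun l => k (node none l leaf)) (ih leaf fun r => k (node none leaf r)) c)
      (fun v l r _ _ => Bool.rec (ih l fun l => k (node v l r)) (ih r fun r => k (node v l r)) c)
      t) w

def insert (p : Poly) (w : Word) (t : Trie) : Trie := insertK p w t id

theorem insertK_eq {α : Type} (p : Poly) (w : Word) (t : Trie) (k : Trie → α) :
    insertK p w t k = k (insert p w t) := by
  have key : ∀ (w : Word) (α : Type) (t : Trie) (k : Trie → α),
      insertK p w t k = k (insertK p w t id) := by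
    intro w
    induction w with
    | nil => intro α t k; cases t <;> rfl
    | cons c w ih =>
      intro α t k
      cases t with
      | leaf =>
        cases c
        · exact (ih _ leaf fun l => k (node none l leaf)).trans
            (congrArg k (ih _ leaf fun l => node none l leaf).symm)
        · exact (ih _ leaf fun r => k (node none leaf r)).trans
            (congrArg k (ih _ leaf fun r => node none leaf r).symm)
      | node v l r =>
        cases c
        · exact (ih _ l fun l => k (node v l r)).trans
            (congrArg k (ih _ l fun l => node v l r).symm)
        · exact (ih _ r fun r => k (node v l r)).trans
            (congrArg k (ih _ r fun r => node v l r).symm)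
  exact key w α t k

theorem insert_cons_leaf (p : Poly) (c : Bool) (w : Word) : insert p (c :: w) leaf =
    bif c then node none leaf (insert p w leaf) else node none (insert p w leaf) leaf := by
  cases c
  · exact insertK_eq p w leaf fun l => node none l leaf
  · exact insertK_eq p w leaf fun r => node none leaf r

theorem insert_cons_node (p : Poly) (c : Bool) (w : Word) (v : Option Poly) (l r : Trie) :
    insert p (c :: w) (node v l r) =
      bif c then node v l (insert p w r) else node v (insert p w l) r := by
  cases c
  · exact insertK_eq p w l fun l => node v l r
  · exact insertK_eq p w r fun r => node v l r

theorem lookup_leaf (w : Word) : lookup leaf w = none := by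
  rfl

theorem lookup_insert (p : Poly) (w w' : Word) (t : Trie) :
    lookup (insert p w t) w' = if w' = w then some p else lookup t w' := by
  induction w generalizing w' t with
  | nil => cases t <;> rcases w' with _ | ⟨_ | _, w'⟩ <;> rfl
  | cons c w ih =>
    cases t with
    | leaf =>
      rw [insert_cons_leaf]
      cases c <;> rcases w' with _ | ⟨_ | _, w'⟩ <;> first
        | rfl
        | exact (ih w' leaf).trans (by simp [lookup_leaf])
    | node v l r =>
      rw [insert_cons_node]
      cases c <;> rcases w' with _ | ⟨_ | _, w'⟩ <;> first
        | rfl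
        | exact (ih w' l).trans (by simp; rfl)
        | exact (ih w' r).trans (by simp; rfl)

end Trie

namespace Word

/-- All words of length `n` with `i` letters `u`. -/
def all : ℕ → ℕ → List Word
  | 0, 0 => [[]]
  | 0, _ + 1 => []
  | n + 1, 0 => (all n 0).map (true :: ·)
  | n + 1, i + 1 => (all n i).map (false :: ·) ++ (all n (i + 1)).map (true :: ·)

def numU : Word → ℕ
  | [] => 0
  | false :: w => numU w + 1
  | true :: w => numU w

theorem numU_le_length : ∀ w : Word, numU w ≤ w.length
  | [] => le_rfl
  | false :: w => Nat.succ_le_succ (numU_le_length w)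
  | true :: w => (numU_le_length w).trans (Nat.le_succ _)

theorem mem_all {n i : ℕ} {w : Word} : w ∈ all n i ↔ w.length = n ∧ numU w = i := by
  induction n generalizing i w with
  | zero => cases i <;> cases w <;> simp [all, numU]
  | succ n ih =>
    cases i <;> rcases w with _ | ⟨_ | _, w⟩ <;> simp [all, numU, ih]

theorem nodup_all (n i : ℕ) : (all n i).Nodup := by
  induction n generalizing i with
  | zero => cases i <;> simp [all]
  | succ n ih =>
    cases i with
    | zero => exact (ih 0).map (List.cons_injective)
    | succ i =>
      refine List.Nodup.append ((ih i).map List.cons_injective)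
        ((ih (i + 1)).map List.cons_injective) ?_
      intro w h1 h2
      rw [List.mem_map] at h1 h2
      obtain ⟨a, -, rfl⟩ := h1
      obtain ⟨b, -, hb⟩ := h2
      simp at hb

/-- The word coded by the binary digits of `n` after the leading one. -/
def decode (k : ℕ) : ℕ → Word → Word :=
  Nat.rec (motive := fun _ => ℕ → Word → Word) (fun _ a => a)
    (fun _ ih n a => Bool.rec
      (Bool.rec (ih (Nat.div n 2) (false :: a)) (ih (Nat.div n 2) (true :: a))
        (Nat.beq (Nat.mod n 2) 1)) a (Nat.ble n 1)) k

end Word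

/-- A system of linear equations for the coefficients of a vector field: it commutes with `field`,
its coefficients at the words of length `n` with `i` letters `u` in the component `c` vanish
for the triples `(c, n, i)` in `zeros`, as do all those at words of length at least ten, and the sum
of its coefficients over these words is `p` for the quadruples `(c, n, i, p)` in `sums`. -/
structure LinSys where
  field : VField
  zeros : List (Bool × ℕ × ℕ)
  sums : List (Bool × ℕ × ℕ × Poly)

/-- The equations of a `LinSys`. -/
inductive Row : Type
  | out (n : ℕ) : Row
  | sum (k : ℕ) : Row

/-- Linear forms in unknowns indexed by words, with a constant term. -/
structure AffForm where
  const : Poly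
  terms : List (Word × Poly)

namespace AffForm

def addUnknown (k : Word) (p : Poly) : List (Word × Poly) → List (Word × Poly)
  | [] => [(k, p)]
  | (k', q) :: l => bif Word.beq k k' then
      (match Poly.add p q with
        | [] => l
        | t :: r => (k, t :: r) :: l)
    else (k', q) :: addUnknown k p l

def addTerm (k : Word) (p : Poly) (l : List (Word × Poly)) : List (Word × Poly) :=
  List.rec (motive := fun _ => List (Word × Poly)) l (fun _ _ _ => addUnknown k p l) p

end AffForm

namespace LinSys

def inZeros (c : Bool) (n i : ℕ) : List (Bool × ℕ × ℕ) → Bool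
  | [] => false
  | (c', n', i') :: l => (!(xor c c') && Nat.beq n n' && Nat.beq i i') || inZeros c n i l

def isZero (S : LinSys) (c : Bool) (w : Word) : Bool :=
  Bool.rec (inZeros c (Word.size w) (Word.numU w) S.zeros) true (Nat.ble 10 (Word.size w))

def collect (S : LinSys) (t : Trie) (f : Poly → Poly) (l : LForm) :
    AffForm → AffForm :=
  List.rec (motive := fun _ => AffForm → AffForm) (fun a => a)
    (fun x _ ih a => Option.rec
      (Bool.rec
        (ih ⟨a.const, AffForm.addTerm (x.2.1 :: x.2.2) (f x.1) a.terms⟩)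
        (ih a) (S.isZero x.2.1 x.2.2))
      (fun p => List.rec (motive := fun _ => AffForm) (ih a)
        (fun _ _ _ => ih ⟨Poly.addMul (f x.1) p a.const, a.terms⟩) p)
      (t.lookup (x.2.1 :: x.2.2))) l

def addOut (S : LinSys) (t : Trie) (f : Poly → Poly) (a : AffForm) (n : ℕ) :
    AffForm :=
  List.rec (motive := fun _ => AffForm) a
    (fun i o _ => S.collect t f (S.field.pull i o (Word.size o)) a) (Word.decode 15 n [])

def addRow (S : LinSys) (t : Trie) (μ : Poly) (a : AffForm) : Row → AffForm
  | .out n => S.addOut t (fun q => Poly.addMul μ q []) a n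
  | .sum k => match S.sums[k]? with
    | none => a
    | some (c, n, i, p) => S.collect t (fun q => Poly.addMul μ q [])
        ((Word.all n i).map fun w => ([([], 1)], c, w))
        ⟨Poly.addMul (Poly.smul (-1) μ) p a.const, a.terms⟩

def addRows (S : LinSys) (t : Trie) : List (Poly × Row) → AffForm → AffForm
  | [], a => a
  | (μ, r) :: l, a => forcePoly (S.addRow t μ a r).const fun p =>
    forceTerms (S.addRow t μ a r).terms fun q => S.addRows t l ⟨p, q⟩

def divide (n : ℤ) : Poly → Poly
  | [] => []
  | (m, c) :: p => (m, c / n) :: divide n p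

/-- Solve the equation `a = 0` for its only unknown. -/
def solve (t : Trie) (a : AffForm) (k : Trie → Option Trie) : Option Trie :=
  match a.terms with
  | [(w, [([], n)])] =>
    bif Poly.isZeroInt n then none else
    List.rec (motive := fun _ => Option Trie) (forceWord w fun w => t.insertK [] w k)
      (fun _ _ _ => match Poly.add (Poly.smul n (divide (-n) a.const)) a.const with
        | [] => forcePoly (divide (-n) a.const) fun v => forceWord w fun w => t.insertK v w k
        | _ :: _ => none) a.const
  | _ => none

def runKills (S : LinSys) (k : Trie → Option Trie) (l : List ℕ) :
    Trie → Option Trie :=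
  List.rec (motive := fun _ => Trie → Option Trie) k
    (fun n _ ih t => solve t (S.addOut t (fun q => q) ⟨[], []⟩ n) ih) l

/-- The steps of an elimination: solve each of a list of equations for its only unknown, or solve
a linear combination of equations for its only unknown. -/
inductive Step : Type
  | kills (l : List ℕ) : Step
  | combo (l : List (Poly × Row)) : Step

def run (S : LinSys) : List Step → Trie → Option Trie
  | [], t => some t
  | .kills l :: s, t => runKills S (run S s) l t
  | .combo l :: s, t => solve t (S.addRows t l ⟨[], []⟩) (run S s)

def initTrie : List (ℕ × Poly) → Trie
  | [] => .leaf
  | (n, p) :: l => (initTrie l).insert p (Word.decode 15 n [])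

def relation (S : LinSys) (t : Trie) (l : List (Poly × Row)) : Option Poly :=
  match S.addRows t l ⟨[], []⟩ with
  | ⟨p, []⟩ => some p
  | _ => none

/-- The relations between the parameters that result from an elimination. -/
def relations (S : LinSys) (free : List (ℕ × Poly)) (s : List Step)
    (ls : List (List (Poly × Row))) : List (Option Poly) :=
  forceField S.field fun L => match LinSys.run ⟨L, S.zeros, S.sums⟩ s (initTrie free) with
  | none => []
  | some t => ls.map (LinSys.relation ⟨L, S.zeros, S.sums⟩ t)

def vanishes (t : Trie) : List (Bool × ℕ × ℕ) → Bool
  | [] => true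
  | (c, n, i) :: l => (Word.all n i).all (fun w =>
      match t.lookup (c :: w) with
      | some [] => true
      | _ => false) && vanishes t l

/-- Do all coefficients in the given blocks vanish as the result of an elimination? -/
def eliminates (S : LinSys) (free : List (ℕ × Poly)) (s : List Step)
    (b : List (Bool × ℕ × ℕ)) : Bool :=
  forceField S.field fun L => match LinSys.run ⟨L, S.zeros, S.sums⟩ s (initTrie free) with
  | none => false
  | some t => vanishes t b

section Sound

variable {R : Type*} [CommRing R]

/-- `g` is a solution of the system `S` for the values `env` of the parameters. -/
structure IsSol (S : LinSys) (env : ℕ → R) (g : Bool → Word → R) : Prop where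
  pull : ∀ i o, LForm.eval env g (S.field.pull i o o.length) = 0
  long : ∀ c w, 10 ≤ w.length → g c w = 0
  zeros : ∀ c n i, (c, n, i) ∈ S.zeros → ∀ w ∈ Word.all n i, g c w = 0
  sums : ∀ c n i p, (c, n, i, p) ∈ S.sums → ((Word.all n i).map (g c)).sum = p.eval env

def key (g : Bool → Word → R) : Word → R
  | [] => 0
  | c :: w => g c w

def Knows (env : ℕ → R) (g : Bool → Word → R) (t : Trie) : Prop :=
  ∀ w p, t.lookup w = some p → key g w = p.eval env

def evalTerms (env : ℕ → R) (g : Bool → Word → R) : List (Word × Poly) → R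
  | [] => 0
  | (k, p) :: l => p.eval env * key g k + evalTerms env g l

def evalAff (env : ℕ → R) (g : Bool → Word → R) (a : AffForm) : R :=
  a.const.eval env + evalTerms env g a.terms

variable {S : LinSys} {env : ℕ → R} {g : Bool → Word → R} {t : Trie}

theorem evalTerms_addUnknown (k : Word) (p : Poly) (l : List (Word × Poly)) :
    evalTerms env g (AffForm.addUnknown k p l) = p.eval env * key g k + evalTerms env g l := by
  induction l with
  | nil => rfl
  | cons t l ih =>
    obtain ⟨k', q⟩ := t
    rw [AffForm.addUnknown]
    cases h : Word.beq k k'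
    · simp only [cond_false, evalTerms, ih]; ring
    · rw [Word.beq_iff] at h
      subst h
      have ha := Poly.eval_add env p q
      simp only [cond_true]
      split
      · rename_i h0
        rw [h0, Poly.eval_nil] at ha
        simp only [evalTerms]; linear_combination key g k * ha
      · rename_i h0
        rw [h0] at ha
        simp only [evalTerms]; linear_combination key g k * ha

theorem evalTerms_addTerm (k : Word) (p : Poly) (l : List (Word × Poly)) :
    evalTerms env g (AffForm.addTerm k p l) = p.eval env * key g k + evalTerms env g l := by
  cases p with
  | nil =>
    rw [Poly.eval_nil, zero_mul, zero_add]
    rfl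
  | cons t p => exact evalTerms_addUnknown k (t :: p) l

theorem mem_of_inZeros {c : Bool} {n i : ℕ} {l : List (Bool × ℕ × ℕ)}
    (h : inZeros c n i l = true) : (c, n, i) ∈ l := by
  induction l with
  | nil => simp [inZeros] at h
  | cons a l ih =>
    obtain ⟨c', n', i'⟩ := a
    simp only [inZeros, Bool.or_eq_true, Bool.and_eq_true] at h
    rcases h with ⟨⟨h1, h2⟩, h3⟩ | h
    · have hc : c = c' := by cases c <;> cases c' <;> simp_all
      rw [hc, Nat.eq_of_beq_eq_true h2, Nat.eq_of_beq_eq_true h3]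
      exact List.mem_cons_self
    · exact List.mem_cons_of_mem _ (ih h)

theorem IsSol.eq_zero_of_isZero (hS : S.IsSol env g) {c : Bool} {w : Word}
    (h : S.isZero c w = true) : g c w = 0 := by
  unfold isZero at h
  rw [Word.size_eq] at h
  cases hb : Nat.ble 10 w.length
  · rw [hb] at h
    exact hS.zeros _ _ _ (mem_of_inZeros h) w (Word.mem_all.2 ⟨rfl, rfl⟩)
  · exact hS.long c w (Nat.le_of_ble_eq_true hb)

theorem IsSol.evalAff_collect (hS : S.IsSol env g) (ht : Knows env g t) {f : Poly → Poly} {r : R}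
    (hf : ∀ q, (f q).eval env = r * q.eval env) (l : LForm) (a : AffForm) :
    evalAff env g (S.collect t f l a) = r * LForm.eval env g l + evalAff env g a := by
  induction l generalizing a with
  | nil =>
    simp only [LForm.eval, mul_zero, zero_add]
    rfl
  | cons x l ih =>
    obtain ⟨q, c, w⟩ := x
    have hu : S.collect t f ((q, c, w) :: l) a = Option.rec
      (Bool.rec
        (S.collect t f l ⟨a.const, AffForm.addTerm (c :: w) (f q) a.terms⟩)
        (S.collect t f l a) (S.isZero c w))
      (fun p => List.rec (motive := fun _ => AffForm) (S.collect t f l a)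
        (fun _ _ _ => S.collect t f l ⟨Poly.addMul (f q) p a.const, a.terms⟩) p)
      (t.lookup (c :: w)) := rfl
    rw [hu]
    cases hl : t.lookup (c :: w) with
    | some p =>
      have h1 := ht _ _ hl
      rw [key] at h1
      cases p with
      | nil =>
        rw [Poly.eval_nil] at h1
        dsimp only
        rw [ih]
        simp only [LForm.eval, h1]; ring
      | cons m p =>
        dsimp only
        rw [ih]
        simp only [evalAff, LForm.eval, Poly.eval_addMul, hf, h1]; ring
    | none =>
      cases hz : S.isZero c w
      · dsimp only
        rw [ih]
        simp only [evalAff, LForm.eval, evalTerms_addTerm, hf, key]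
        ring
      · have h1 := hS.eq_zero_of_isZero hz
        dsimp only
        rw [ih]
        simp only [LForm.eval, h1]; ring

theorem IsSol.evalAff_addOut (hS : S.IsSol env g) (ht : Knows env g t) {f : Poly → Poly} {r : R}
    (hf : ∀ q, (f q).eval env = r * q.eval env) (a : AffForm) (n : ℕ) :
    evalAff env g (S.addOut t f a n) = evalAff env g a := by
  unfold addOut
  cases Word.decode 15 n [] with
  | nil => rfl
  | cons i o =>
    dsimp only
    rw [hS.evalAff_collect ht hf, Word.size_eq, hS.pull]; ring

theorem IsSol.evalAff_addRow (hS : S.IsSol env g) (ht : Knows env g t) (μ : Poly) (a : AffForm)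
    (r : Row) : evalAff env g (S.addRow t μ a r) = evalAff env g a := by
  have hf : ∀ q, (Poly.addMul μ q []).eval env = μ.eval env * q.eval env := by
    intro q
    rw [Poly.eval_addMul, Poly.eval_nil, add_zero]
  cases r with
  | out n => exact hS.evalAff_addOut ht hf a n
  | sum k =>
    rw [addRow]
    split
    · rfl
    · rename_i c n i p hk
      have hs := hS.sums c n i p (List.mem_of_getElem? hk)
      have h1 : ∀ l : List Word, LForm.eval env g (l.map fun w => ([([], 1)], c, w)) =
          (l.map (g c)).sum := by
        intro l
        induction l with
        | nil => rfl
        | cons a l ih => simp [LForm.eval, ih, Poly.eval, Poly.evalMono]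
      rw [hS.evalAff_collect ht hf, h1, hs]
      simp only [evalAff, Poly.eval_addMul, Poly.eval_smul]
      push_cast; ring

theorem IsSol.evalAff_addRows (hS : S.IsSol env g) (ht : Knows env g t) (l : List (Poly × Row))
    (a : AffForm) : evalAff env g (S.addRows t l a) = evalAff env g a := by
  induction l generalizing a with
  | nil => rfl
  | cons x l ih => rw [addRows, forcePoly_eq, forceTerms_eq, ih, hS.evalAff_addRow ht]

theorem knows_solve [NoZeroDivisors R] [CharZero R] {t' : Trie} {a : AffForm}
    (ht : Knows env g t) (ha : evalAff env g a = 0) {k : Trie → Option Trie}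
    (hk : ∀ t, Knows env g t → k t = some t' → Knows env g t') (h : solve t a k = some t') :
    Knows env g t' := by
  unfold solve at h
  split at h
  · rename_i w n hterms
    cases hn : Poly.isZeroInt n
    · rw [hn, cond_false] at h
      have hn0 : (n : R) ≠ 0 := by
        rw [Int.cast_ne_zero]
        rintro rfl
        exact absurd hn (by decide)
      have insert_knows : ∀ v : Poly, key g w = v.eval env → Knows env g (t.insert v w) := by
        intro v hv w' p hw'
        rw [Trie.lookup_insert] at hw'
        split at hw'
        · rename_i hwk
          rw [Option.some.injEq] at hw'
          rw [hwk, hv, hw']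
        · exact ht w' p hw'
      rw [evalAff, hterms] at ha
      simp only [evalTerms, Poly.eval, Poly.evalMono] at ha
      cases hc : a.const with
      | nil =>
        rw [hc] at h ha
        dsimp only at h
        rw [forceWord_eq, Trie.insertK_eq] at h
        refine hk _ (insert_knows [] ?_) h
        apply mul_left_cancel₀ hn0
        rw [Poly.eval_nil] at ha ⊢
        linear_combination ha
      | cons m p =>
        rw [hc] at h
        dsimp only at h
        rw [← hc] at h
        split at h
        · rename_i hp
          have hv := congrArg (Poly.eval env) hp
          rw [Poly.eval_add, Poly.eval_smul, Poly.eval_nil] at hv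
          rw [forcePoly_eq, forceWord_eq, Trie.insertK_eq] at h
          refine hk _ (insert_knows _ ?_) h
          apply mul_left_cancel₀ hn0
          linear_combination ha - hv
        · exact absurd h (by simp)
    · rw [hn, cond_true] at h
      exact absurd h (by simp)
  · exact absurd h (by simp)

theorem IsSol.knows_runKills [NoZeroDivisors R] [CharZero R] (hS : S.IsSol env g)
    {l : List ℕ} {t t' : Trie} {k : Trie → Option Trie}
    (hk : ∀ t, Knows env g t → k t = some t' → Knows env g t')
    (ht : Knows env g t) (h : S.runKills k l t = some t') : Knows env g t' := by
  induction l generalizing t with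
  | nil => exact hk t ht h
  | cons n l ih =>
    refine knows_solve ht ?_ (fun t ht h => ih ht h) h
    rw [hS.evalAff_addOut ht (r := 1) (fun q => (one_mul _).symm)]
    simp [evalAff, evalTerms]

theorem IsSol.knows_run [NoZeroDivisors R] [CharZero R] (hS : S.IsSol env g)
    {s : List Step} {t t' : Trie}
    (ht : Knows env g t) (h : S.run s t = some t') : Knows env g t' := by
  induction s generalizing t with
  | nil =>
    rw [run, Option.some.injEq] at h
    exact h ▸ ht
  | cons x s ih =>
    cases x with
    | kills l =>
      rw [run] at h
      exact hS.knows_runKills (fun t ht h => ih ht h) ht h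
    | combo l =>
      rw [run] at h
      refine knows_solve ht ?_ (fun t ht h => ih ht h) h
      rw [hS.evalAff_addRows ht]
      simp [evalAff, evalTerms]

theorem knows_leaf : Knows env g .leaf := by
  intro w p h
  rw [Trie.lookup_leaf] at h
  exact absurd h (by simp)

theorem knows_initTrie {free : List (ℕ × Poly)}
    (hf : ∀ x ∈ free, key g (Word.decode 15 x.1 []) = x.2.eval env) :
    Knows env g (initTrie free) := by
  induction free with
  | nil => exact knows_leaf
  | cons x l ih =>
    obtain ⟨n, q⟩ := x
    intro w p h
    rw [initTrie, Trie.lookup_insert] at h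
    split at h
    · rename_i hw
      rw [Option.some.injEq] at h
      rw [hw, ← h, hf _ List.mem_cons_self]
    · exact ih (fun x hx => hf x (List.mem_cons_of_mem _ hx)) w p h

theorem IsSol.relations_eq_zero [NoZeroDivisors R] [CharZero R] (hS : S.IsSol env g)
    {free : List (ℕ × Poly)}
    (hf : ∀ x ∈ free, key g (Word.decode 15 x.1 []) = x.2.eval env) {s : List Step}
    {ls : List (List (Poly × Row))} {p : Poly} (h : some p ∈ S.relations free s ls) :
    p.eval env = 0 := by
  unfold relations at h
  rw [forceField_eq] at h
  split at h
  · simp at h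
  · rename_i t hrun
    have ht := hS.knows_run (knows_initTrie hf) hrun
    rw [List.mem_map] at h
    obtain ⟨l, -, hl⟩ := h
    have ha := hS.evalAff_addRows ht l ⟨[], []⟩
    unfold relation at hl
    split at hl
    · rename_i q hq
      rw [hq] at ha
      rw [Option.some.injEq] at hl
      subst hl
      simpa [evalAff, evalTerms] using ha
    · exact absurd hl (by simp)

theorem IsSol.eq_zero_of_eliminates [NoZeroDivisors R] [CharZero R] (hS : S.IsSol env g)
    {free : List (ℕ × Poly)} (hf : ∀ x ∈ free, key g (Word.decode 15 x.1 []) = x.2.eval env)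
    {s : List Step} {b : List (Bool × ℕ × ℕ)} (h : S.eliminates free s b = true) :
    ∀ c n i, (c, n, i) ∈ b → ∀ w ∈ Word.all n i, g c w = 0 := by
  unfold eliminates at h
  rw [forceField_eq] at h
  split at h
  · exact absurd h (by simp)
  · rename_i t hrun
    have ht := hS.knows_run (knows_initTrie hf) hrun
    induction b with
    | nil => simp
    | cons x b ih =>
      obtain ⟨c', n', i'⟩ := x
      simp only [vanishes, Bool.and_eq_true, List.all_eq_true] at h
      intro c n i hm w hw
      rcases List.mem_cons.1 hm with hm | hm
      · obtain ⟨rfl, rfl, rfl⟩ : c = c' ∧ n = n' ∧ i = i' := by simpa using hm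
        have h1 := h.1 w hw
        split at h1
        · rename_i h2
          have := ht _ _ h2
          simpa [key] using this
        · exact absurd h1 (by simp)
      · exact ih h.2 c n i hm w hw

end Sound

end LinSys

/-! ### Systems with the variable `u` shifted to make the cubic depressed -/

/-- The parameters of a shifted system, as values or as polynomials. The scalar Hamiltonian is
`(u ^ 3 - p u - q) v ^ 2 + (- k1 u ^ 2 + th1 u + th0) v - k3 u` up to a constant. -/
structure Params (R : Type*) where
  C1 : R
  C2 : R
  x : R
  p : R
  q : R
  k1 : R
  e1 : R
  th1 : R
  th0 : R
  k3 : R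

def Params.eval {R : Type*} [CommRing R] (env : ℕ → R) (P : Params Poly) : Params R :=
  ⟨P.C1.eval env, P.C2.eval env, P.x.eval env, P.p.eval env, P.q.eval env, P.k1.eval env,
    P.e1.eval env, P.th1.eval env, P.th0.eval env, P.k3.eval env⟩

def Params.map {R S : Type*} (f : R → S) (P : Params R) : Params S :=
  ⟨f P.C1, f P.C2, f P.x, f P.p, f P.q, f P.k1, f P.e1, f P.th1, f P.th0, f P.k3⟩

def Poly.const (n : ℤ) : Poly := Poly.consTerm [] n []

theorem Poly.eval_const {R : Type*} [CommRing R] (env : ℕ → R) (n : ℤ) :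
    (Poly.const n).eval env = n := by
  simp [Poly.const, Poly.eval_consTerm, Poly.evalMono]

def VField.push (c : Bool) (m : Word) (q : Poly) (L : VField) : VField :=
  match q with
  | [] => L
  | t :: q => (c, m, t :: q) :: L

/-- The shifted system with the leading coefficients `a1`, `a2`, `a3`. -/
def mkField (a1 a2 a3 : ℤ) (P : Params Poly) : VField :=
  VField.push false [false, false, false, true] (.const a1) <|
  VField.push false [false, false, true, false] (.const a2) <|
  VField.push false [false, true, false, false] (.const a3) <|
  VField.push false [true, false, false, false] (.const (2 - a1 - a2 - a3)) <|
  VField.push true [false, false, true, true] (.const (-a1)) <|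
  VField.push true [false, true, false, true] (.const (-a1 - a2)) <|
  VField.push true [true, false, false, true] (.const (1 - a2 - a3)) <|
  VField.push true [true, false, true, false] (.const (a1 + a2 - 2)) <|
  VField.push true [true, true, false, false] (.const (a1 + a2 + a3 - 2)) <|
  VField.push false [false, false, true] P.C1 <|
  VField.push false [false, true, false] (Poly.add (.smul (-1) P.C1) (.smul (-1) P.C2)) <|
  VField.push false [true, false, false] P.C2 <|
  VField.push true [false, true, true] (.smul (-1) P.C1) <|
  VField.push true [true, false, true] (Poly.add P.C1 P.C2) <|
  VField.push true [true, true, false] (.smul (-1) P.C2) <|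
  VField.push false [false, true] (Poly.add (.smul (-1) P.x) (.smul (-1) P.p)) <|
  VField.push false [true, false] (Poly.add P.x (.smul (-1) P.p)) <|
  VField.push true [true, true] P.p <|
  VField.push false [true] (.smul (-2) P.q) <|
  VField.push false [false, false] (.smul (-1) P.k1) <|
  VField.push true [false, true] P.e1 <|
  VField.push true [true, false] (Poly.add (.smul 2 P.k1) (.smul (-1) P.e1)) <|
  VField.push false [false] P.th1 <|
  VField.push true [true] (.smul (-1) P.th1) <|
  VField.push false [] P.th0 <|
  VField.push true [] P.k3 []

/-- Sums of the coefficients of the symmetry over words of given length and number of `u`. -/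
def mkSums (P : Params Poly) : List (Bool × ℕ × ℕ × Poly) :=
  [(false, 9, 6, .const 2), (true, 9, 5, .const (-3)), (false, 8, 5, []), (true, 8, 4, []),
   (false, 7, 4, .smul (-4) P.p), (true, 7, 3, .smul 4 P.p),
   (false, 6, 3, .smul (-4) P.q), (true, 6, 2, .smul 3 P.q),
   (false, 5, 2, .smul 2 (.addMul P.p P.p [])), (true, 5, 1, .smul (-1) (.addMul P.p P.p [])),
   (false, 7, 5, .smul (-3) P.k1), (true, 7, 4, .smul 5 P.k1),
   (false, 5, 4, .addMul P.k1 P.k1 (.smul (-2) P.k3)),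
   (true, 5, 3, .smul (-2) (.addMul P.k1 P.k1 (.smul (-2) P.k3)))]

def mkSys (a1 a2 a3 N : ℤ) (P : Params Poly) (Z : List (Bool × ℕ × ℕ)) : LinSys :=
  ⟨mkField a1 a2 a3 P, Z,
    (mkSums P).map fun t => (t.1, t.2.1, t.2.2.1, Poly.smul N t.2.2.2)⟩

/-- The equations satisfied by the coefficients of a symmetry of the shifted system. -/
structure IsSymmetry {R : Type*} [CommRing R] (a1 a2 a3 : ℤ) (V : Params R)
    (g : Bool → Word → R) : Prop where
  pull : ∀ (env : ℕ → R) (P : Params Poly), P.eval env = V → ∀ i o,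
    LForm.eval env g ((mkField a1 a2 a3 P).pull i o o.length) = 0
  long : ∀ c w, 10 ≤ w.length → g c w = 0
  sums : ∀ (env : ℕ → R) (P : Params Poly), P.eval env = V → ∀ c n i p,
    (c, n, i, p) ∈ mkSums P → ((Word.all n i).map (g c)).sum = p.eval env

/-- The coefficients in the given blocks vanish. -/
def VanishOn {R : Type*} [CommRing R] (g : Bool → Word → R) (Z : List (Bool × ℕ × ℕ)) : Prop :=
  ∀ c n i, (c, n, i) ∈ Z → ∀ w ∈ Word.all n i, g c w = 0

theorem LForm.eval_mul {R : Type*} [CommRing R] (env : ℕ → R) (g : Bool → Word → R) (N : R)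
    (l : LForm) : LForm.eval env (fun c w => N * g c w) l = N * LForm.eval env g l := by
  induction l with
  | nil => simp [LForm.eval]
  | cons t l ih => simp only [LForm.eval, ih]; ring

theorem IsSymmetry.isSol {R : Type*} [CommRing R] {a1 a2 a3 : ℤ} {V : Params R}
    {g : Bool → Word → R} (h : IsSymmetry a1 a2 a3 V g) (N : ℤ) {env : ℕ → R} {P : Params Poly}
    (hP : P.eval env = V) {Z : List (Bool × ℕ × ℕ)} (hZ : VanishOn g Z) :
    (mkSys a1 a2 a3 N P Z).IsSol env (fun c w => N * g c w) where
  pull i o := by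
    rw [LForm.eval_mul]
    simp only [mkSys]
    rw [h.pull env P hP, mul_zero]
  long c w hw := by rw [h.long c w hw, mul_zero]
  zeros c n i hm w hw := by rw [hZ c n i hm w hw, mul_zero]
  sums c n i p hm := by
    simp only [mkSys, List.mem_map, Prod.mk.injEq] at hm
    obtain ⟨⟨c', n', i', p'⟩, ht, rfl, rfl, rfl, rfl⟩ := hm
    rw [List.sum_map_mul_left, h.sums env P hP _ _ _ _ ht, Poly.eval_smul]

/-- The parameters as variables. -/
def stdParams : Params Poly :=
  ⟨[([0], 1)], [([1], 1)], [([2], 1)], [([3], 1)], [([4], 1)], [([5], 1)], [([6], 1)], [([7], 1)],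
    [([8], 1)], [([9], 1)]⟩

def Params.env {R : Type*} [CommRing R] (V : Params R) (l : List R) (n : ℕ) : R :=
  ([V.C1, V.C2, V.x, V.p, V.q, V.k1, V.e1, V.th1, V.th0, V.k3] ++ l).getD n 0

theorem stdParams_eval {R : Type*} [CommRing R] (V : Params R) (l : List R) :
    stdParams.eval (V.env l) = V := by
  simp [stdParams, Params.eval, Poly.eval, Poly.evalMono, Params.env]

section

variable {R : Type*} [CommRing R] [NoZeroDivisors R] [CharZero R] {a1 a2 a3 : ℤ} {V : Params R}
  {g : Bool → Word → R}

theorem IsSymmetry.relation (h : IsSymmetry a1 a2 a3 V g) (N : ℤ) {env : ℕ → R}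
    {P : Params Poly} (hP : P.eval env = V) {Z : List (Bool × ℕ × ℕ)} (hZ : VanishOn g Z)
    {free : List (ℕ × Poly)} (hf : ∀ x ∈ free,
      LinSys.key (fun c w => N * g c w) (Word.decode 15 x.1 []) = x.2.eval env)
    {s : List LinSys.Step} {ls : List (List (Poly × Row))} {ps : List (Option Poly)}
    (hr : (mkSys a1 a2 a3 N P Z).relations free s ls = ps) {p : Poly} (hp : some p ∈ ps) :
    p.eval env = 0 :=
  (h.isSol N hP hZ).relations_eq_zero hf (hr ▸ hp)

theorem IsSymmetry.vanishOn (h : IsSymmetry a1 a2 a3 V g) {env : ℕ → R}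
    {P : Params Poly} (hP : P.eval env = V) {Z : List (Bool × ℕ × ℕ)} (hZ : VanishOn g Z)
    {free : List (ℕ × Poly)} (hf : ∀ x ∈ free,
      LinSys.key (fun c w => ((1 : ℤ) : R) * g c w) (Word.decode 15 x.1 []) = x.2.eval env)
    {s : List LinSys.Step} {b : List (Bool × ℕ × ℕ)}
    (hr : (mkSys a1 a2 a3 1 P Z).eliminates free s b = true) : VanishOn g b := by
  intro c n i hm w hw
  simpa using (h.isSol 1 hP hZ).eq_zero_of_eliminates hf hr c n i hm w hw

end

def lead130_vanishing_steps : List LinSys.Step :=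
  [.kills [9472, 8705, 15361, 14849, 13569, 8576, 13057, 12929, 14624, 14608, 14600, 14596, 14594,
    14472, 14480, 14468, 14466, 14404, 14408, 14402, 14370, 14372, 14354, 12673, 12609, 12577,
    12561, 12553, 12481, 12449, 12385, 12369, 12337, 8768, 13441, 8480, 8456, 8452, 13377, 8328,
    8225, 8258, 12355, 12421, 14369, 9600, 9730, 13827, 15873, 15105, 9536, 15617, 10528, 10512,
    10504, 10500, 10498, 9345, 14595, 9488, 13829, 8577, 13697, 14721, 8864, 9360, 9352, 9348,
    8722, 8451, 12807, 8206, 8640, 13185, 8608, 13121, 14736, 15496, 15492, 15490, 12993, 14920,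
    14916, 14914, 14660, 14628, 14616, 14488, 14504, 14536, 14532, 14530, 14612, 14484, 14500,
    14498, 14604, 14476, 14412, 14420, 14436, 14434, 14602, 14474, 14410, 14418, 14598, 14470,
    14406, 14374, 14378, 14386, 12737, 12705, 12689, 12641, 12617, 13458, 12569, 12513, 12497,
    12465, 8769, 9346, 13443, 14597, 13889, 14913, 8513, 13601, 8453, 12811, 8385, 8353, 8776,
    13457, 8454, 12813, 12677, 14433, 12613, 14417, 8484, 8241, 8233, 12453, 14626, 12873, 14610,
    14625, 14601, 8772, 8337, 8482, 12579, 12869, 14481, 13449, 8338, 12435, 12581, 8229, 8481,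
    12867, 13445, 4736, 4353, 7681, 7425, 6785, 4288, 6529, 6465, 7312, 7304, 7300, 7298, 7236,
    7240, 7234, 7202, 7204, 7186, 6337, 6305, 6289, 6281, 6241, 6225, 6193, 4384, 6721, 4240,
    4228, 6689, 4164, 4113, 4130, 6179, 6213, 7185, 4800, 4866, 6915, 7937, 7553, 4768, 7809,
    5264, 5256, 5252, 5250, 4673, 7299, 4744, 6917, 4289, 6849, 7361, 4432, 4680, 4676, 4370,
    4227, 6407, 4110, 4320, 6593, 4304, 6561, 7368, 7748, 7746, 6497, 7460, 7458, 7330, 7314,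
    7308, 7244, 7252, 7268, 7266, 7306, 7242, 7250, 7302, 7238, 7206, 7210, 7218, 6369, 6353,
    6345, 6321, 4385, 4674, 6723, 7301, 6945, 7457, 4257, 6801, 4229, 6411, 4193, 4177, 4388,
    6729, 7241, 4230, 6413, 6341, 7217, 6697, 7209, 4117, 7313, 7305, 4169, 6291, 6437, 4241,
    6435, 6725, 2368, 2177, 3841, 3713, 3393, 2144, 3265, 3233, 3656, 3652, 3650, 3618, 3620,
    3602, 3169, 3153, 3145, 3121, 2192, 3361, 2120, 3345, 2084, 3109, 2178, 3203, 3333, 2081,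
    1184, 1089, 1921, 1857, 1697, 1072, 1633, 1617, 1828, 1826, 1810, 1585, 1096, 1681, 1060,
    1042, 1573, 1090, 1603, 1669, 1041, 9696, 10114, 14211, 16257, 15297, 9680, 11600, 10050,
    14147, 16193, 15265, 11848, 11844, 11842, 10017, 15939, 9668, 10692, 10948, 11460, 11588,
    9666, 9093, 14213, 9091, 9136, 9922, 14019, 14177, 15201, 10920, 16033, 11556, 11554, 9873,
    9874, 15651, 13971, 15177, 9634, 10658, 11426, 9029, 14149, 9027, 15969, 10900, 9810, 15953,
    11409, 11401, 9797, 11402, 9798, 15499, 9612, 14105, 10634, 10890, 9094, 9753, 8973, 15411,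
    8971, 8967, 9072, 14049, 15073, 9064, 14033, 15057, 11044, 11042, 10594, 10850, 8901, 14021,
    15045, 15713, 15011, 15697, 9542, 15665, 9509, 8851, 9510, 8843, 9494, 8839, 9486, 15585,
    9426, 15569, 8803, 13511, 14733, 9516, 15537, 10531, 10515, 10517, 10521, 9357, 8775, 10522,
    9358, 14619, 13455, 14621, 14919, 9500, 13881, 9491, 8673, 13793, 14817, 8657, 13777, 14801,
    10020, 8625, 13745, 14769, 9876, 8914, 13733, 8553, 13011, 13673, 9388, 8782, 12879, 8477,
    12859, 8475, 12855, 8750, 12847, 8734, 12831, 8425, 8658, 13221, 13529, 14553, 8373, 8335,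
    8301, 8271, 8310, 8302, 8286, 8254, 8688, 13281, 8680, 13265, 14820, 16162, 15698, 14998,
    15250, 15178, 14678, 14934, 14622, 14494, 14510, 14542, 14550, 14566, 14570, 14578, 9105,
    10018, 14115, 14225, 15249, 9009, 15153, 8932, 13769, 8433, 8377, 13029, 8478, 12861, 8313],
  .combo [([([], 2)], .out 8505), ([([], -1)], .out 14649)],
  .kills [13427],
  .combo [([([], -1)], .out 9034), ([([], -1)], .out 15657), ([([], -1)], .out 8617), ([([], -3)],
    .out 8613)],
  .kills [13419],
  .combo [([([], 6)], .out 10642), ([([], -3)], .out 10898), ([([], 1)], .out 9554), ([([], 1)],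
    .out 10578), ([([], -4)], .out 9522), ([([], 3)], .out 10570), ([([], -1)], .out 9514), ([([],
    2)], .out 9394), ([([], -1)], .out 9386), ([([], 3)], .out 9381), ([([], -2)], .out 9382)],
  .combo [([([], -1)], .out 10578), ([([], 1)], .out 10834), ([([], 1)], .out 9522), ([([], -2)],
    .out 10570), ([([], -1)], .out 9394), ([([], 2)], .out 9382)],
  .combo [([([], 2)], .out 10642), ([([], -1)], .out 10898), ([([], -1)], .out 10578)],
  .kills [10898, 9801, 15507, 14117, 8905, 15049, 9554, 15017, 10578, 10834, 9546, 15001, 10570,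
    9513, 9418, 9394, 9385, 14643, 14635, 8649, 14793, 8617, 14745, 8882, 8537, 12979, 8870,
    12967, 8523, 13613, 8505, 8499, 13485, 8421, 8405, 8397],
  .combo [([([], 1)], .out 8857), ([([], -1)], .out 8793), ([([], -1)], .out 8787)],
  .kills [8793, 8787, 13463, 14637, 14515, 8906, 8525, 13621, 8853, 13611, 14933, 8789, 13483,
    14677, 8873, 13651, 15013, 8869, 13643, 14997]]

theorem lead130_vanishing : (mkSys (-1) 3 0 1 stdParams []).eliminates [] lead130_vanishing_steps
    [(false, 9, 8), (true, 9, 7), (false, 9, 7), (true, 9, 6), (false, 8, 7), (true, 8, 6),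
    (false, 8, 6), (true, 8, 5), (false, 7, 6), (true, 7, 5), (false, 6, 5), (true, 6, 4), (false,
    9, 5), (true, 9, 4)] = true := by
  decide +kernel

def lead130_relations_e1_steps : List LinSys.Step :=
  [.kills [9664, 9986, 14083, 16129, 15233, 9632, 10912, 9858, 13955, 16001, 15169, 11408, 11400,
    11396, 11394, 9793, 15491, 9608, 10632, 10888, 8965, 14085, 8963, 9056, 14017, 15041, 15681,
    10824, 10820, 10818, 10564, 9490, 13957, 8835, 9478, 15553, 9512, 9377, 14659, 15521, 10532,
    9361, 14627, 10529, 10513, 10505, 9349, 8771, 10506, 9350, 14603, 13447, 14605, 9496, 8753,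
    15457, 14897, 9492, 9298, 13865, 9289, 8741, 15433, 14475, 9484, 13849, 8641, 13761, 14785,
    8609, 13729, 14753, 9800, 9796, 9412, 8483, 8774, 12871, 13453, 8754, 12851, 8746, 12843,
    8742, 12839, 8461, 12827, 8459, 12823, 8718, 12815, 8327, 8243, 8235, 8231, 8246, 8238, 8222,
    8672, 13249, 8656, 13217, 14792, 15940, 15938, 13153, 14756, 15650, 14996, 15506, 8588, 13025,
    13009, 15140, 15138, 14690, 14946, 14630, 14620, 14492, 14508, 14540, 14548, 14564, 14562,
    14618, 14490, 14538, 14546, 14614, 14486, 14502, 14514, 14606, 14478, 14414, 14422, 14438,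
    14442, 14450, 12769, 12753, 12745, 13650, 8993, 9794, 13891, 15493, 14113, 15137, 13969,
    14885, 8996, 9508, 10530, 13897, 15505, 8994, 13893, 14533, 14435, 8904, 13713, 14729, 9380,
    8497, 8417, 8401, 8804, 8393, 13513, 8369, 8345, 8474, 12853, 8470, 12845, 8462, 12829, 12741,
    14449, 8297, 8293, 8281, 8269, 14994, 14674, 14930, 8849, 9506, 13603, 14993, 8529, 13641,
    8361, 12965],
  .combo [([([], 3)], .out 8485), ([([], 1)], .out 8778)],
  .kills [13387],
  .combo [([([], 2)], .out 8489), ([([], -1)], .out 14633)],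
  .kills [13395],
  .combo [([([], -2)], .out 8777), ([([], 1)], .out 14629)],
  .combo [([([], -6)], .out 8786), ([([], -9)], .out 14633), ([([], 2)], .out 8778), ([([], 6)],
    .sum 0)],
  .kills [14501, 8521, 8850, 14665, 8489, 13477, 8485, 13461]]

def lead130_relations_e1_rows : List (List (Poly × Row)) :=
  [[([([], 3)], .out 648), ([([], 6)], .out 584), ([([], -6)], .out 545), ([([5], -3)], .out
    2596), ([([5], -3)], .out 2372), ([([5], -6)], .out 2193), ([([6], -3)], .out 2628), ([([6],
    1)], .out 2596), ([([6], 3)], .out 2340), ([([6], 3)], .out 2321)],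
  [([([], -1)], .out 5268), ([([], -1)], .out 4682), ([([], -3)], .out 4389)],
  [([([], -1)], .out 5268)]]

theorem lead130_relations_e1 :
    (mkSys (-1) 3 0 1 stdParams [(false, 9, 8), (true, 9, 7), (false, 9, 7),
    (true, 9, 6), (false, 8, 7), (true, 8, 6), (false, 8, 6), (true, 8, 5), (false, 7, 6), (true,
    7, 5), (false, 6, 5), (true, 6, 4), (false, 9, 5), (true, 9, 4)]).relations
    [] lead130_relations_e1_steps lead130_relations_e1_rows =
      [some [([5, 6], 6), ([6, 6], -3), ([9], 12)], some [([0], 2)], some [([1], 1)]] := by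
  decide +kernel

def lead130_relation_x_steps : List LinSys.Step :=
  [.kills [9664, 9986, 14083, 16129, 15233, 9632, 10912, 9858, 13955, 16001, 15169, 11408, 11400,
    11396, 11394, 9793, 15491, 9608, 10632, 10888, 8965, 14085, 8963, 9056, 14017, 15041, 15681,
    10824, 10820, 10818, 10564, 9490, 13957, 8835, 9478, 15553, 9512, 9377, 14659, 15521, 10532,
    9361, 14627, 10529, 10513, 10505, 9349, 8771, 10506, 9350, 14603, 13447, 14605, 9496, 8753,
    15457, 14897, 9492, 9298, 13865, 9289, 8741, 15433, 14475, 9484, 13849, 8641, 13761, 14785,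
    8609, 13729, 14753, 9800, 9796, 9412, 8483, 8774, 12871, 13453, 8754, 12851, 8746, 12843,
    8742, 12839, 8461, 12827, 8459, 12823, 8718, 12815, 8327, 8243, 8235, 8231, 8246, 8238, 8222,
    8672, 13249, 8656, 13217, 14792, 15940, 15938, 13153, 14756, 15650, 14996, 15506, 8588, 13025,
    13009, 15140, 15138, 14690, 14946, 14630, 14620, 14492, 14508, 14540, 14548, 14564, 14562,
    14618, 14490, 14538, 14546, 14614, 14486, 14502, 14514, 14606, 14478, 14414, 14422, 14438,
    14442, 14450, 12769, 12753, 12745, 13650, 8993, 9794, 13891, 15493, 14113, 15137, 13969,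
    14885, 8996, 9508, 10530, 13897, 15505, 8994, 13893, 14533, 14435, 8904, 13713, 14729, 9380,
    8497, 8417, 8401, 8804, 8393, 13513, 8369, 8345, 8474, 12853, 8470, 12845, 8462, 12829, 12741,
    14449, 8297, 8293, 8281, 8269, 14994, 14674, 14930, 8849, 9506, 13603, 14993, 8529, 13641,
    8361, 12965],
  .combo [([([], 3)], .out 8485), ([([], 1)], .out 8778)],
  .kills [13387],
  .combo [([([], 2)], .out 8489), ([([], -1)], .out 14633)],
  .kills [13395],
  .combo [([([], -2)], .out 8777), ([([], 1)], .out 14629)],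
  .combo [([([], -6)], .out 8786), ([([], -9)], .out 14633), ([([], 2)], .out 8778), ([([], 6)],
    .sum 0)],
  .kills [14501, 8521, 8850, 14665, 8489, 13477, 8485, 13461]]

def lead130_relation_x_rows : List (List (Poly × Row)) :=
  [[([([], 1)], .out 2634), ([([], 3)], .out 2195)]]

theorem lead130_relation_x : (mkSys (-1) 3 0 1 ⟨[], [], [([2], 1)], [([3], 1)], [([4], 1)], [([5],
    1)], [([6], 1)], [([7], 1)], [([8], 1)], [([9], 1)]⟩ [(false, 9, 8), (true, 9, 7), (false, 9,
    7), (true, 9, 6), (false, 8, 7), (true, 8, 6), (false, 8, 6), (true, 8, 5), (false, 7, 6),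
    (true, 7, 5), (false, 6, 5), (true, 6, 4), (false, 9, 5), (true, 9, 4)]).relations
    [] lead130_relation_x_steps lead130_relation_x_rows =
      [some [([2], 3)]] := by
  decide +kernel

def lead200_vanishing_steps : List LinSys.Step :=
  [.kills [8960, 8705, 15361, 14849, 13569, 8768, 12929, 14624, 13504, 12609, 13456, 13448, 13444,
    13442, 13384, 13380, 13378, 13348, 13346, 13330, 12896, 12449, 12433, 12425, 12592, 12369,
    12568, 12556, 12313, 13441, 8480, 8336, 8328, 8324, 8322, 8209, 12323, 12357, 13329, 13321,
    14345, 12865, 14480, 14472, 12833, 9088, 15365, 15873, 9024, 9536, 15617, 10528, 10512, 10504,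
    10500, 10498, 9345, 8976, 9488, 13829, 14721, 9360, 9352, 9348, 9346, 8840, 8776, 8772, 8770,
    8496, 8528, 8592, 8584, 8580, 8578, 15008, 14920, 14916, 14914, 14660, 14628, 14626, 13536,
    13520, 13648, 13896, 13892, 13890, 13508, 13636, 13604, 13602, 13474, 13458, 13452, 13388,
    13396, 13412, 13410, 13450, 13386, 13394, 13446, 13382, 13350, 13354, 13362, 12912, 12904,
    12968, 12489, 12600, 12596, 12628, 12393, 12377, 12572, 12345, 8769, 13443, 13889, 14913,
    14467, 13601, 14625, 8451, 12807, 14529, 8353, 14497, 13457, 13449, 12677, 12613, 8484, 8482,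
    8472, 12485, 13361, 8468, 8338, 8460, 8217, 12389, 13337, 8330, 12873, 12841, 14482, 14474,
    8481, 12867, 13445, 8337, 12579, 12869, 14481, 8329, 12563, 12837, 14473, 8325, 12555, 12821,
    14469, 4480, 4353, 7681, 7425, 6785, 4384, 6465, 7312, 6752, 6305, 6728, 6724, 6722, 6692,
    6690, 6674, 6448, 6225, 6217, 6296, 6284, 6169, 6721, 4240, 4168, 4164, 4162, 4105, 6163,
    6181, 6665, 7177, 6433, 7240, 7236, 6417, 4544, 7685, 7937, 4512, 4768, 7809, 5264, 5256,
    5252, 5250, 4673, 4488, 4744, 6917, 7361, 4680, 4676, 4674, 4420, 4388, 4386, 4248, 4264,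
    4296, 4292, 4290, 7504, 7460, 7458, 7330, 7314, 6768, 6760, 6824, 6948, 6946, 6754, 6818,
    6802, 6730, 6726, 6694, 6698, 6706, 6456, 6452, 6484, 6249, 6233, 6300, 6201, 4385, 6723,
    6945, 7457, 7235, 6801, 7313, 4227, 6407, 7265, 4177, 7249, 6729, 6341, 6697, 7209, 4242,
    4236, 4166, 4109, 6425, 7238, 4241, 6435, 6725, 4169, 6291, 6437, 7241, 4165, 6283, 6421,
    7237, 2240, 2177, 3841, 3713, 3393, 2192, 3233, 3656, 3376, 3153, 3364, 3362, 3346, 3224,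
    3148, 3097, 3361, 2120, 2084, 2082, 3217, 3620, 3618, 3209, 2081, 3139, 3205, 3617, 1120,
    1089, 1921, 1857, 1697, 1096, 1617, 1828, 1688, 1682, 1612, 1561, 1681, 1060, 1042, 1609,
    1810, 1041, 1571, 1605, 1809, 9184, 16133, 16257, 9168, 11600, 16005, 16193, 11848, 11844,
    11842, 10017, 15939, 9156, 9668, 10692, 10948, 11460, 11588, 9093, 16137, 15237, 9091, 15749,
    16065, 10920, 16033, 11556, 11554, 9873, 15651, 15653, 9122, 9634, 10658, 11426, 9029, 16009,
    9027, 15969, 10900, 15953, 11410, 9801, 8997, 15507, 15945, 15141, 11409, 11401, 9797, 15499,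
    15139, 9100, 14105, 15129, 9098, 15125, 9609, 10633, 10889, 9094, 9753, 8973, 15411, 8971,
    8967, 9584, 15809, 15073, 9576, 15777, 15057, 9060, 10596, 10852, 8905, 15049, 15753, 15045,
    9560, 15713, 15697, 9545, 15689, 15665, 15657, 8851, 14925, 9030, 8843, 14893, 8839, 14877,
    15585, 15569, 9417, 15561, 8803, 13511, 14733, 9516, 15537, 14937, 15529, 10531, 10515, 10517,
    10521, 9357, 8775, 13455, 14621, 14919, 8988, 13881, 8986, 9491, 14817, 14801, 10020, 10018,
    8649, 14793, 8930, 9442, 9826, 9890, 8645, 13765, 14769, 14761, 9874, 14745, 14705, 13673,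
    8882, 8870, 14649, 14569, 8419, 13529, 14553, 13497, 14521, 8794, 8335, 12575, 14479, 8508,
    8676, 8674, 8658, 8534, 8626, 8526, 8550, 8554, 8562, 12413, 15032, 15028, 13161, 15020,
    13033, 13017, 13560, 12785, 13556, 14164, 12777, 14226, 13996, 12761, 14154, 13660, 12729,
    13974, 12665, 13614, 13470, 14225, 15177, 14129, 15145, 15017, 13937, 14953, 13733, 8553,
    13011, 14577, 8425, 12755, 13221, 8409, 12723, 13157, 8377, 12659, 13029, 12861, 12773, 14457,
    14517, 8477, 8475],
  .combo [([([], -2)], .out 13619), ([([], 2)], .out 14949), ([([], 3)], .out 9513), ([([], -3)],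
    .out 9385), ([([], -3)], .out 9381), ([([], 1)], .out 13717), ([([], 1)], .out 13621)],
  .combo [([([], -2)], .out 8857), ([([], -2)], .out 14949), ([([], 1)], .out 8549), ([([], 1)],
    .out 8525)],
  .kills [9385],
  .combo [([([], 2)], .out 13907), ([([], -1)], .out 13651), ([([], -1)], .out 13643), ([([],
    -4)], .out 13619), ([([], 2)], .out 9513), ([([], 2)], .out 13611)],
  .kills [13619, 14515, 13717, 13621, 8359, 8793, 13491, 14693, 8787, 9513, 8853, 13611, 8789,
    13483, 8873, 13651, 8869, 13643],
  .combo [([([], 2)], .out 13989), ([([], -2)], .out 14933), ([([], -2)], .out 13669), ([([],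
    -1)], .out 13653), ([([], -2)], .out 13613)],
  .kills [14509, 13669, 8537, 8523, 12951, 8505, 13541, 8491, 12887, 8487, 13205, 13989, 14931,
    14933, 13973, 14757, 13925, 14675, 13909, 14549, 14541, 14443, 13107]]

theorem lead200_vanishing : (mkSys 2 0 0 1 stdParams []).eliminates [] lead200_vanishing_steps
    [(false, 9, 8), (true, 9, 7), (false, 9, 7), (true, 9, 6), (false, 8, 7), (true, 8, 6),
    (false, 8, 6), (true, 8, 5), (false, 7, 6), (true, 7, 5), (false, 6, 5), (true, 6, 4), (false,
    9, 5), (true, 9, 4)] = true := by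
  decide +kernel

def lead200_relations_e1_steps : List LinSys.Step :=
  [.kills [9152, 15877, 16129, 9120, 10912, 15621, 16001, 11408, 11400, 11396, 11394, 9793, 15491,
    9096, 9608, 10632, 10888, 8965, 15881, 8963, 9568, 15745, 15041, 9552, 15681, 10824, 10820,
    10818, 9028, 10564, 13957, 8835, 14861, 15553, 9512, 9377, 14659, 15521, 10532, 10530, 9361,
    14627, 10514, 9353, 8773, 13451, 14613, 10529, 10513, 10505, 9349, 8771, 13447, 14605, 8984,
    8753, 15457, 14897, 8980, 13865, 8978, 9490, 15433, 14475, 8972, 13849, 8970, 14785, 14753,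
    9800, 9796, 9794, 8900, 9412, 8585, 13075, 14729, 13701, 14689, 8866, 9378, 8497, 13509,
    14641, 9362, 8483, 12871, 14617, 8459, 12823, 8804, 13465, 8327, 12559, 14471, 8504, 8648,
    8644, 8642, 8500, 8612, 8610, 12685, 8492, 8524, 8548, 8546, 8486, 12381, 12349, 15024, 15016,
    15012, 15506, 14642, 14634, 13552, 13544, 13992, 14116, 14114, 13538, 13666, 13922, 13986,
    13656, 13652, 13970, 12657, 12649, 13714, 13466, 13462, 13454, 13390, 13398, 13414, 13418,
    13426, 12920, 12529, 12916, 13140, 12521, 12505, 8993, 13891, 15493, 14113, 14917, 13969,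
    8841, 13587, 14985, 13905, 14929, 9508, 8777, 13459, 13897, 15505, 14921, 14483, 13713, 13649,
    8521, 14665, 13617, 13609, 14633, 13453, 8467, 12839, 13389, 14561, 14545, 8393, 14537, 14513,
    14505, 8345, 12595, 12901, 8333, 12571, 12853, 12845, 12741, 12709, 14441, 8530, 12645, 14425,
    12573, 8476, 12517, 13369, 14393, 14477, 8361, 12627, 12965, 8469],
  .combo [([([], -1)], .out 8489), ([([], 1)], .sum 0)],
  .kills [13387, 14485, 8489, 12883, 13477, 8485]]

def lead200_relations_e1_rows : List (List (Poly × Row)) :=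
  [[([([], -1)], .out 906), ([([], -1)], .out 850), ([([5], -2)], .out 2130), ([([5], -2)], .out
    3730), ([([5], -1)], .out 3626), ([([5], 1)], .out 3474), ([([6], 1)], .out 2130), ([([6],
    1)], .out 3730)],
  [([([], 1)], .out 5268), ([([], 1)], .out 4682)],
  [([([], -1)], .out 5268)]]

theorem lead200_relations_e1 : (mkSys 2 0 0 1 stdParams [(false, 9, 8), (true, 9, 7), (false, 9, 7),
    (true, 9, 6), (false, 8, 7), (true, 8, 6), (false, 8, 6), (true, 8, 5), (false, 7, 6), (true,
    7, 5), (false, 6, 5), (true, 6, 4), (false, 9, 5), (true, 9, 4)]).relations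
    [] lead200_relations_e1_steps lead200_relations_e1_rows =
      [some [([5, 5], -6), ([5, 6], 5), ([6, 6], -1), ([9], 1)], some [([0], 1)], some [([1], 1)]]
    := by
  decide +kernel

def lead200_relation_x_steps : List LinSys.Step :=
  [.kills [9152, 15877, 16129, 9120, 10912, 15621, 16001, 11408, 11400, 11396, 11394, 9793, 15491,
    9096, 9608, 10632, 10888, 8965, 15881, 8963, 9568, 15745, 15041, 9552, 15681, 10824, 10820,
    10818, 9028, 10564, 13957, 8835, 14861, 15553, 9512, 9377, 14659, 15521, 10532, 10530, 9361,
    14627, 10514, 9353, 8773, 13451, 14613, 10529, 10513, 10505, 9349, 8771, 13447, 14605, 8984,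
    8753, 15457, 14897, 8980, 13865, 8978, 9490, 15433, 14475, 8972, 13849, 8970, 14785, 14753,
    9800, 9796, 9794, 8900, 9412, 8585, 13075, 14729, 13701, 14689, 8866, 9378, 8497, 13509,
    14641, 9362, 8483, 12871, 14617, 8459, 12823, 8804, 13465, 8327, 12559, 14471, 8504, 8648,
    8644, 8642, 8500, 8612, 8610, 12685, 8492, 8524, 8548, 8546, 8486, 12381, 12349, 15024, 15016,
    15012, 15506, 14642, 14634, 13552, 13544, 13992, 14116, 14114, 13538, 13666, 13922, 13986,
    13656, 13652, 13970, 12657, 12649, 13714, 13466, 13462, 13454, 13390, 13398, 13414, 13418,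
    13426, 12920, 12529, 12916, 13140, 12521, 12505, 8993, 13891, 15493, 14113, 14917, 13969,
    8841, 13587, 14985, 13905, 14929, 9508, 8777, 13459, 13897, 15505, 14921, 14483, 13713, 13649,
    8521, 14665, 13617, 13609, 14633, 13453, 8467, 12839, 13389, 14561, 14545, 8393, 14537, 14513,
    14505, 8345, 12595, 12901, 8333, 12571, 12853, 12845, 12741, 12709, 14441, 8530, 12645, 14425,
    12573, 8476, 12517, 13369, 14393, 14477, 8361, 12627, 12965, 8469],
  .combo [([([], -1)], .out 8489), ([([], 1)], .sum 0)],
  .kills [13387, 14485, 8489, 12883, 13477, 8485]]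

def lead200_relation_x_rows : List (List (Poly × Row)) :=
  [[([([], -1)], .out 2634)]]

theorem lead200_relation_x : (mkSys 2 0 0 1 ⟨[], [], [([2], 1)], [([3], 1)], [([4], 1)], [([5], 1)],
    [([6], 1)], [([7], 1)], [([8], 1)], [([9], 1)]⟩ [(false, 9, 8), (true, 9, 7), (false, 9, 7),
    (true, 9, 6), (false, 8, 7), (true, 8, 6), (false, 8, 6), (true, 8, 5), (false, 7, 6), (true,
    7, 5), (false, 6, 5), (true, 6, 4), (false, 9, 5), (true, 9, 4)]).relations
    [] lead200_relation_x_steps lead200_relation_x_rows =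
      [some [([2], 1), ([3], -1)]] := by
  decide +kernel

def lead031_vanishing_steps : List LinSys.Step :=
  [.kills [10720, 10114, 10176, 14273, 10704, 11600, 10050, 10144, 14241, 11848, 11844, 10692,
    10948, 11460, 11588, 16146, 15300, 10690, 16137, 15298, 9990, 10928, 9922, 10080, 14177,
    10920, 10064, 11556, 9874, 16018, 15268, 10658, 10914, 16009, 15266, 9862, 10032, 10642,
    15945, 11409, 11401, 11402, 9105, 11404, 14115, 15942, 10636, 10892, 9609, 10630, 11306, 9750,
    9742, 9952, 14049, 9936, 14033, 11044, 15762, 15204, 9570, 15753, 15202, 9569, 9904, 9553,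
    9545, 10566, 10794, 9030, 9541, 9539, 9840, 10534, 10538, 8998, 9366, 10531, 10515, 10517,
    10521, 10522, 8995, 10524, 13895, 15502, 10410, 9497, 8982, 10510, 10346, 8974, 9270, 9262,
    9246, 8944, 8936, 8920, 9365, 14631, 14926, 9293, 9301, 14619, 14902, 14615, 14894, 9287,
    14607, 14878, 8793, 8550, 13005, 13491, 14694, 8787, 8526, 8781, 8502, 12909, 14646, 12725,
    8613, 8406, 12717, 13419, 12661, 8749, 8374, 8523, 8366, 8487, 8350, 8436, 12533, 8733, 8310,
    8428, 8412, 8380, 8316, 15588, 15555, 8688, 14226, 13257, 14154, 13209, 13974, 13113, 13614,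
    13470, 12915, 13107, 9160, 15941, 14225, 15241, 10660, 10916, 11428, 14153, 10644, 10900,
    10024, 9106, 15250, 9798, 15501, 15139, 10596, 10852, 14025, 10580, 10836, 9896, 15689, 10572,
    9880, 14901, 9832, 15561, 9816, 14919, 9500, 9330, 9318, 9456, 13769, 15076, 8930, 9432, 9400,
    8857, 14643, 13469, 8809, 8614, 8805, 8598, 8789, 8534, 8506, 12917, 14650, 14622, 8508, 9124,
    9892, 15186, 9828, 15154, 14621, 8873, 14675, 8869, 8806, 13517, 14950, 8853, 9528, 9010,
    13925, 9444, 14761, 8790, 13485, 14934, 8618, 9560],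
  .combo [([([], -1)], .out 15145), ([([], -1)], .out 14953), ([([], -1)], .out 9418)],
  .kills [15177, 9810, 9546, 9514, 9034, 9426, 14757, 9386, 9002, 14677, 8870, 8854, 8794, 13493,
    14938, 9636, 9556, 9554, 15013, 15017, 14949]]

theorem lead031_vanishing : (mkSys 0 3 (-1) 1 stdParams []).eliminates [] lead031_vanishing_steps
    [(false, 9, 5), (true, 9, 4)] = true := by
  decide +kernel

def lead031_relation_C_steps : List LinSys.Step :=
  [.kills [10688, 9986, 10112, 14209, 10656, 10912, 9858, 10048, 14145, 11408, 11400, 11396,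
    10632, 10888, 15890, 15236, 10626, 15881, 15234, 9734, 9920, 14017, 9888, 10824, 10820, 10564,
    15634, 15172, 10562, 15625, 15170, 9537, 9824, 9808, 10532, 15506, 15140, 10530, 10514, 10516,
    15498, 10529, 10513, 10505, 10506, 8993, 10508, 13891, 15494, 10520, 9314, 9776, 13873, 15433,
    9489, 10502, 10282, 8966, 9238, 9230, 8928, 8912, 9361, 9353, 8774, 8849, 13603, 14611, 9285,
    14603, 14870, 9283, 14599, 14862, 8390, 8485, 8342, 12589, 13387, 8483, 8467, 8469, 8473,
    8334, 12573, 13383, 8294, 8372, 12469, 8278, 8270, 8308, 12405, 8717, 8246, 8300, 8284, 8252,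
    15560, 15940, 15524, 8672, 8656, 14116, 14114, 13538, 13666, 13922, 13986, 13193, 8624, 13137,
    13970, 13129, 13105, 13097, 8560, 13714, 13001, 12977, 12969, 12953, 12913, 13466, 13462,
    13390, 13426, 12857, 8432, 12883, 9794, 9104, 15493, 14113, 15113, 9506, 9032, 13969, 14885,
    14985, 14869, 9800, 13897, 15505, 8994, 9796, 13893, 15138, 14915, 9492, 9298, 9286, 9440,
    9424, 8904, 13713, 15048, 14729, 8898, 9392, 8866, 8872, 8802, 8856, 8594, 14738, 8741, 14614,
    14606, 8504, 9328, 14449, 8612, 8402, 9320, 12709, 8492, 14613, 14605, 13513, 8804, 9368],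
  .combo [([([], 3)], .out 9508), ([([], 1)], .out 8850)],
  .kills [9544, 13641, 8868, 13481],
  .combo [([([], 1)], .out 9380), ([([], -1)], .out 14665)],
  .kills [9512],
  .combo [([([], -1)], .out 9362), ([([], 1)], .out 14629)],
  .combo [([([], 1)], .out 12877), ([([], -1)], .out 13459)],
  .kills [14413, 9292, 9300, 8844, 8746, 13389, 8530, 14505, 12901, 8532],
  .combo [([([], -1)], .out 8786), ([([], -3)], .out 14633), ([([], -1)], .out 8778), ([([], 3)],
    .out 9364), ([([], -2)], .sum 0)],
  .kills [9508, 9362, 8778, 8788, 8780],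
  .combo [([([], 1)], .sum 0)],
  .kills [14501, 9380]]

def lead031_relation_C_rows : List (List (Poly × Row)) :=
  [[([([], -3)], .out 4681), ([([], -1)], .out 4425)]]

theorem lead031_relation_C : (mkSys 0 3 (-1) 1 stdParams [(false, 9, 5), (true, 9, 4)]).relations
    [] lead031_relation_C_steps lead031_relation_C_rows =
      [some [([0], 1), ([1], -3)]] := by
  decide +kernel

def lead031_relation_p_steps : List LinSys.Step :=
  [.kills [10688, 9986, 10112, 14209, 10656, 10912, 9858, 10048, 14145, 11408, 11400, 11396,
    10632, 10888, 15890, 15236, 10626, 15881, 15234, 9734, 9920, 14017, 9888, 10824, 10820, 10564,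
    15634, 15172, 10562, 15625, 15170, 9537, 9824, 9808, 10532, 15506, 15140, 10530, 10514, 10516,
    15498, 10529, 10513, 10505, 10506, 8993, 10508, 13891, 15494, 10520, 9314, 9776, 13873, 15433,
    9489, 10502, 10282, 8966, 9238, 9230, 8928, 8912, 9361, 9353, 8774, 8849, 13603, 14611, 9285,
    14603, 14870, 9283, 14599, 14862, 8390, 8485, 8342, 12589, 13387, 8483, 8467, 8469, 8473,
    8334, 12573, 13383, 8294, 8372, 12469, 8278, 8270, 8308, 12405, 8717, 8246, 8300, 8284, 8252,
    15560, 15940, 15524, 8672, 8656, 14116, 14114, 13538, 13666, 13922, 13986, 13193, 8624, 13137,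
    13970, 13129, 13105, 13097, 8560, 13714, 13001, 12977, 12969, 12953, 12913, 13466, 13462,
    13390, 13426, 12857, 8432, 12883, 9794, 9104, 15493, 14113, 15113, 9506, 9032, 13969, 14885,
    14985, 14869, 9800, 13897, 15505, 8994, 9796, 13893, 15138, 14915, 9492, 9298, 9286, 9440,
    9424, 8904, 13713, 15048, 14729, 8898, 9392, 8866, 8872, 8802, 8856, 8594, 14738, 8741, 14614,
    14606, 8504, 9328, 14449, 8612, 8402, 9320, 12709, 8492, 14613, 14605, 13513, 8804, 9368],
  .combo [([([], 3)], .out 9508), ([([], 1)], .out 8850)],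
  .kills [9544, 13641, 8868, 13481],
  .combo [([([], 1)], .out 9380), ([([], -1)], .out 14665)],
  .kills [9512],
  .combo [([([], -1)], .out 9362), ([([], 1)], .out 14629)],
  .combo [([([], 1)], .out 12877), ([([], -1)], .out 13459)],
  .kills [14413, 9292, 9300, 8844, 8746, 13389, 8530, 14505, 12901, 8532],
  .combo [([([], -1)], .out 8786), ([([], -3)], .out 14633), ([([], -1)], .out 8778), ([([], 3)],
    .out 9364), ([([], -2)], .sum 0)],
  .kills [9508, 9362, 8778, 8788, 8780],
  .combo [([([], 1)], .sum 0)],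
  .kills [14501, 9380]]

def lead031_relation_p_rows : List (List (Poly × Row)) :=
  [[([([], 1)], .out 2852), ([([], 2)], .out 2634), ([([], 1)], .out 2450), ([([], -1)], .out
    2249), ([([1], 2)], .out 4498), ([([1], -2)], .out 4389)]]

theorem lead031_relation_p :
    (mkSys 0 3 (-1) 1 ⟨[([1], 3)], [([1], 1)], [([2], 1)], [([3], 1)], [([4],
    1)], [([5], 1)], [([6], 1)], [([7], 1)], [([8], 1)], [([9], 1)]⟩ [(false, 9, 5), (true, 9,
    4)]).relations
    [] lead031_relation_p_steps lead031_relation_p_rows =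
      [some [([1, 1], -6), ([3], 2)]] := by
  decide +kernel

def lead020_vanishing_steps : List LinSys.Step :=
  [.kills [9472, 8960, 13825, 9344, 8706, 8832, 13569, 8449, 8198, 14624, 14608, 14600, 14596,
    14594, 14480, 14472, 14468, 14466, 14408, 14404, 14402, 14372, 14370, 14354, 13057, 12929,
    12865, 12833, 12817, 12809, 12673, 12609, 12481, 12449, 12385, 12369, 12337, 14593, 13441,
    14465, 8464, 8456, 8452, 8322, 12549, 9600, 9088, 15365, 14081, 10560, 9474, 9024, 14853,
    13953, 10528, 10512, 10504, 10500, 9346, 9488, 14857, 15369, 9408, 8896, 13697, 9360, 9352,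
    9348, 8710, 8769, 13443, 8481, 8465, 8457, 13379, 13347, 13331, 8453, 8214, 8451, 8206, 15504,
    15496, 15492, 15490, 14984, 14920, 14916, 14914, 14672, 14664, 14628, 14626, 14610, 14616,
    14488, 14504, 14536, 14532, 14530, 14612, 14484, 14500, 14498, 14482, 14604, 14476, 14412,
    14420, 14436, 14434, 14602, 14474, 14410, 14418, 14598, 14470, 14406, 14374, 14378, 14386,
    13185, 13121, 13089, 12993, 12945, 12873, 12849, 12841, 12825, 12737, 12705, 12641, 12513,
    12497, 12465, 12401, 8992, 14597, 13889, 14657, 13601, 14529, 14497, 8776, 8772, 13457, 13449,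
    8454, 12813, 14433, 14417, 8484, 8338, 12581, 14409, 14385, 8274, 12453, 14625, 14609, 8722,
    13349, 8482, 12869, 4736, 4480, 6913, 4672, 4354, 4416, 6785, 4225, 4102, 7312, 7304, 7300,
    7298, 7240, 7236, 7234, 7204, 7202, 7186, 6529, 6465, 6433, 6417, 6409, 6337, 6305, 6241,
    6225, 6193, 7297, 6721, 7233, 4232, 4228, 4162, 6277, 4800, 4544, 7685, 7041, 5280, 4738,
    4512, 7429, 6977, 5264, 5256, 5252, 4674, 4744, 7433, 7689, 4704, 4448, 6849, 4680, 4676,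
    4358, 4385, 6723, 4241, 4233, 6691, 6675, 4229, 4118, 4227, 4110, 7752, 7748, 7746, 7492,
    7460, 7458, 7336, 7332, 7314, 7308, 7244, 7252, 7268, 7266, 7306, 7242, 7250, 7302, 7238,
    7206, 7210, 7218, 6593, 6561, 6545, 6497, 6473, 6425, 6369, 6353, 6321, 6257, 4496, 7301,
    6945, 7329, 6801, 7265, 7249, 4388, 6729, 4230, 6413, 7217, 4178, 6309, 7313, 4242, 6437,
    7241, 4386, 6725, 2368, 2240, 3457, 2336, 2178, 2208, 3393, 2113, 2054, 3656, 3652, 3650,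
    3620, 3618, 3602, 3265, 3233, 3217, 3209, 3169, 3153, 3121, 3649, 3361, 3617, 2116, 2082,
    3141, 1184, 1120, 1729, 1168, 1090, 1104, 1697, 1057, 1030, 1828, 1826, 1810, 1633, 1617,
    1609, 1585, 1825, 1681, 1809, 1042, 1573, 9696, 9184, 16133, 14273, 9680, 11600, 9168, 16005,
    14241, 11848, 11844, 10018, 9668, 10692, 10948, 11460, 11588, 15241, 10690, 9994, 16137,
    15237, 15885, 9136, 15749, 14177, 10920, 16033, 11556, 15653, 9634, 10914, 9866, 16009, 15629,
    15969, 10642, 9802, 15945, 15141, 11409, 11401, 11402, 9798, 9105, 14115, 15139, 9612, 9100,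
    9610, 10634, 10890, 9770, 9098, 9606, 11306, 9754, 9094, 15405, 15389, 9584, 9072, 14049,
    15073, 9576, 9064, 14033, 10596, 10852, 15753, 9560, 15713, 10836, 15697, 9542, 15011, 15665,
    9510, 14925, 14995, 10794, 9494, 14893, 14987, 9486, 14877, 14983, 15585, 14733, 9516, 15537,
    10538, 10531, 10515, 10517, 10521, 10522, 9358, 13895, 14919, 9500, 8988, 9322, 8986, 9497,
    10346, 8944, 13793, 8936, 13777, 10020, 8920, 13745, 9876, 8888, 9396, 14697, 9388, 8782,
    8758, 8750, 8734, 8824, 8674, 13553, 8775, 13455, 8508, 8540, 8604, 8620, 8652, 8660, 8676,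
    8613, 13419, 8493, 8374, 8523, 13399, 8487, 13391, 8477, 8405, 8310, 8363, 8302, 8286, 8463,
    8254, 15076, 16162, 16018, 15690, 15538, 15530, 15002, 14998, 15250, 15178, 14934, 14682,
    14762, 14678, 14622, 13281, 13265, 13257, 13233, 13169, 13041, 12785, 12915, 13107, 10660,
    11428, 9124, 14153, 9060, 14025, 9548, 14621, 14517, 8932, 13769, 8908, 8658, 13221, 8626,
    13157, 8562, 13029, 8478, 12861, 8505, 8601],
  .combo [([([], -3)], .out 9810), ([([], -2)], .out 9522), ([([], -2)], .out 14949), ([([], -3)],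
    .out 9426), ([([], 1)], .out 9418), ([([], 1)], .out 8906), ([([], 1)], .out 8858), ([([],
    -2)], .out 8857)],
  .kills [15177, 9810, 9426],
  .combo [([([], -4)], .out 9381), ([([], 2)], .out 8869), ([([], 2)], .out 8853), ([([], -4)],
    .out 8805), ([([], 2)], .out 8789), ([([], -3)], .out 8534), ([([], -4)], .out 8787)],
  .kills [8534],
  .combo [([([], -4)], .out 9513), ([([], 4)], .out 9001), ([([], 2)], .out 9385), ([([], 1)],
    .out 8873), ([([], -4)], .out 9381), ([([], -5)], .out 8869), ([([], -2)], .out 8857), ([([],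
    1)], .out 8853), ([([], -6)], .out 8809), ([([], 6)], .out 8805)],
  .kills [9381, 8869, 13643, 14667, 8853, 13611, 8805, 13515, 8789, 13483, 14645, 8809, 8614,
    8793, 8550, 9001, 8873, 14675, 8857, 9418, 15561],
  .combo [([([], -1)], .out 15001), ([([], -1)], .out 14937), ([([], -1)], .out 9382)],
  .kills [15049, 9522, 9394, 14693, 8906, 8858],
  .combo [([([], -1)], .out 15017), ([([], -1)], .out 9386), ([([], -2)], .out 15529)],
  .kills [15017, 15689, 15657, 9386],
  .combo [([([], 2)], .out 15013), ([([], -2)], .out 9034), ([([], -4)], .out 14761), ([([], -2)],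
    .out 14681), ([([], -1)], .out 8874)],
  .kills [14793, 14761, 14745, 8882, 8874, 8870, 8854, 13613, 8818, 13485, 8650, 8618, 8602,
    15013, 14997, 4848, 4592, 8069, 7137, 4840, 5800, 4584, 8005, 7121, 5924, 7973, 5346, 5002,
    8073, 7621, 7949, 4568, 7877, 7089, 5780, 8017, 7821, 7757, 4806, 5674, 4890, 4550, 7725,
    7709, 4792, 4536, 7025, 5300, 4532, 5420, 7857, 4750, 7453, 7495, 5226, 4472, 6897, 4724,
    4948, 4468, 7401, 4460, 7385, 4700, 7353, 4382, 4397, 4278, 4253, 4309, 4214, 4267, 4206,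
    4190, 4239, 4158, 7858, 7986, 7530, 7786, 7342, 6641, 5348, 5732, 4580, 7113, 7285, 7277,
    7261, 4457, 7379, 4453, 4406, 4338, 6629],
  .combo [([([], -1)], .out 5286), ([([], -1)], .out 7833), ([([], -1)], .out 7769)],
  .kills [4530, 7833, 7769, 4518, 4502],
  .combo [([([], 2)], .out 4693), ([([], -1)], .out 4437), ([([], -2)], .out 4427), ([([], 2)],
    .out 4405), ([([], -2)], .out 4395)],
  .kills [4427, 6749, 6807, 4395, 6743, 4698, 4697, 4441, 6835, 4693, 4437, 6827, 4691, 4435,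
    6823, 4818, 5330, 5458, 5714, 4938, 4562, 7589, 5322, 5450, 4906, 7573, 4778, 5290, 5418,
    4522, 7507, 7477, 7469, 4714, 4506, 7381, 4946, 7845, 7593, 9712, 9200, 16261, 14305, 9704,
    11944, 9192, 16197, 14289, 12068, 16165, 10722, 10122, 16265, 15301, 16141, 11608, 9176,
    16069, 14257, 11924, 16209, 16013, 15949, 10694, 11818, 10010, 9158, 15245, 15917, 15901,
    9144, 14193, 9652, 10932, 9938, 9140, 15757, 11564, 16049, 15645, 15517, 9614, 11370, 9786,
    9102, 15469, 15453, 15421, 9592, 9080, 14065, 9588, 11092, 9076, 9580, 9068, 10844, 15729,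
    9502, 14909, 14991, 10474, 8952, 13809, 8948, 14825, 9900, 8940, 14809, 8924, 14777, 9404,
    14713, 8766, 8813, 8630, 8797, 8566, 8795, 8558, 8509, 8661, 8438, 8619, 8430, 8535, 8414,
    8382, 8479, 8318, 15730, 15986, 16178, 15082, 15594, 14686, 13297, 10724, 11492, 11876, 9188,
    14281, 9065, 9061, 9037, 9005, 14701, 14939, 14581, 14573, 14557, 14525, 8937, 14803, 8933,
    8922, 8921, 14771, 8917, 8915, 8909, 8907, 8886, 9389, 8814, 8690, 13285, 15781, 9650, 10674,
    11442, 11570, 9138, 15765, 9126, 15669, 10902, 9110, 15541, 11082, 15785, 9062, 10582, 10838,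
    9046, 15003, 10930],
  .combo [([([], -2)], .out 10066), ([([], 2)], .out 10962), ([([], -2)], .out 10058), ([([], 2)],
    .out 9586), ([([], -1)], .out 9578)],
  .kills [10066, 15273, 10058, 9170, 15269, 10034, 10026, 15253, 9906, 9898, 15189, 9894, 9878,
    9125, 14155, 9842, 9834, 15157, 9830, 9814, 9109, 14123, 15081, 9586, 9578, 9574, 9562, 10842,
    15029, 9561, 9558, 9557, 9045, 13995, 10835, 10571, 9458, 9450, 14805, 9446, 14963, 9430,
    9013, 13931, 9422, 9402, 14709, 9515, 14685, 14653, 8910, 8890, 13685, 8889, 13683, 13557,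
    16021, 9162, 15957, 15717, 15589, 2424, 2296, 4037, 3569, 2420, 2900, 2514, 2292, 3981, 2732,
    2482, 2284, 2470, 2281, 3539, 3795, 2454, 3869, 2396, 2268, 2770, 2710, 3929, 3897, 2358,
    3693, 2251, 3479, 3735, 2236, 3705, 2230, 2469, 2229, 3435, 3691, 2227, 2219, 2206, 3389,
    2170, 3317, 3915, 4005, 2674, 2866, 2898, 2506, 3989, 3813, 2410, 2730, 3925, 2729, 3917,
    3893]]

theorem lead020_vanishing : (mkSys 0 2 0 1 stdParams []).eliminates [] lead020_vanishing_steps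
    [(false, 9, 8), (true, 9, 7), (false, 9, 7), (true, 9, 6), (false, 8, 7), (true, 8, 6),
    (false, 8, 6), (true, 8, 5), (false, 7, 6), (true, 7, 5), (false, 6, 5), (true, 6, 4), (false,
    9, 5), (true, 9, 4), (false, 8, 4), (true, 8, 3), (false, 9, 4), (true, 9, 3), (false, 7, 3),
    (true, 7, 2)] = true := by
  decide +kernel

def lead020_relations_e1_steps : List LinSys.Step :=
  [.kills [9664, 9152, 15877, 14209, 9632, 10912, 9120, 15621, 14145, 11408, 11400, 11396, 9794,
    9608, 10632, 10888, 15113, 9602, 9738, 15881, 15373, 9568, 9056, 14017, 15041, 9552, 9538,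
    15681, 10824, 10820, 10564, 9026, 9478, 14861, 14979, 14725, 15553, 9512, 9378, 14661, 15521,
    10532, 9362, 14921, 10530, 10514, 10529, 10513, 10505, 10506, 9350, 13891, 14915, 9496, 8984,
    13873, 9492, 9298, 8980, 9290, 15433, 9489, 9484, 8972, 9258, 8970, 10282, 8928, 13761, 8912,
    13729, 9800, 9796, 9412, 8880, 8850, 8842, 13589, 9361, 14627, 9356, 8844, 14611, 8726, 8718,
    8816, 8642, 13537, 8777, 13459, 8773, 13451, 8771, 13447, 8504, 8536, 8600, 8616, 8648, 8644,
    8418, 8497, 8390, 8485, 13387, 8483, 8467, 8469, 8473, 13383, 13363, 13355, 13351, 8461, 8277,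
    8246, 8238, 8455, 8222, 15048, 15940, 15938, 15524, 15650, 14996, 15506, 15140, 15138, 14946,
    14740, 14738, 14642, 14668, 14666, 14620, 14618, 14490, 14538, 14546, 14614, 14486, 14502,
    14514, 14606, 14478, 14414, 14422, 14438, 14442, 14450, 13249, 13217, 13153, 13650, 13129,
    13025, 13009, 13001, 12857, 12769, 12753, 12721, 12657, 12883, 12529, 9032, 13969, 14985,
    8996, 14629, 13897, 15505, 8994, 14613, 13893, 14605, 8904, 13713, 14737, 14673, 9380, 8868,
    13641, 14641, 8852, 8774, 13453, 8754, 14545, 13513, 14537, 14513, 8530, 8498, 12877, 8474,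
    12853, 8470, 12845, 8462, 12829, 14449, 8394, 8362, 8489],
  .combo [([([], -1)], .out 14665), ([([], 1)], .out 14633), ([([], 1)], .sum 0)],
  .kills [14485, 14633],
  .combo [([([], 1)], .sum 0)],
  .combo [([([], 1)], .sum 1)]]

def lead020_relations_e1_rows : List (List (Poly × Row)) :=
  [[([([], -6)], .out 916), ([([], 6)], .out 850), ([([], -6)], .out 842), ([([5], -8)], .out
    2596), ([([5], -12)], .out 2244), ([([5], -10)], .out 3858), ([([5], -3)], .out 3746), ([([5],
    -6)], .out 3682), ([([5], 6)], .out 3666), ([([5], -12)], .out 3665), ([([5], -12)], .out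
    3474), ([([5], -6)], .out 3410), ([([5], 6)], .out 3409), ([([5], 12)], .out 3377), ([([6],
    6)], .out 2340), ([([6], 6)], .out 2212), ([([6], 6)], .out 3730)],
  [([([], -1)], .out 5268)]]

theorem lead020_relations_e1 : (mkSys 0 2 0 1 stdParams [(false, 9, 8), (true, 9, 7), (false, 9, 7),
    (true, 9, 6), (false, 8, 7), (true, 8, 6), (false, 8, 6), (true, 8, 5), (false, 7, 6), (true,
    7, 5), (false, 6, 5), (true, 6, 4)]).relations
    [] lead020_relations_e1_steps lead020_relations_e1_rows =
      [some [([5, 5], -12), ([5, 6], 18), ([6, 6], -6), ([9], 6)], some [([1], 1)]] := by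
  decide +kernel

def lead020_relations_x_steps : List LinSys.Step :=
  [.kills [9664, 9152, 15877, 14209, 9632, 10912, 9120, 15621, 14145, 11408, 11400, 11396, 9794,
    9608, 10632, 10888, 15113, 9602, 9738, 15881, 15373, 9568, 9056, 14017, 15041, 9552, 9538,
    15681, 10824, 10820, 10564, 9026, 9478, 14861, 14979, 14725, 15553, 9512, 9378, 14661, 15521,
    10532, 9362, 14921, 10530, 10514, 10529, 10513, 10505, 10506, 9350, 13891, 14915, 9496, 8984,
    13873, 9492, 9298, 8980, 9290, 15433, 9489, 9484, 8972, 9258, 8970, 10282, 8928, 13761, 8912,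
    13729, 9800, 9796, 9412, 8880, 8850, 8842, 13589, 9361, 14627, 9356, 8844, 14611, 8726, 8718,
    8816, 8642, 13537, 8777, 13459, 8773, 13451, 8771, 13447, 8504, 8536, 8600, 8616, 8648, 8644,
    8418, 8497, 8390, 8485, 13387, 8483, 8467, 8469, 8473, 13383, 13363, 13355, 13351, 8461, 8277,
    8246, 8238, 8455, 8222, 15048, 15940, 15938, 15524, 15650, 14996, 15506, 15140, 15138, 14946,
    14740, 14738, 14642, 14668, 14666, 14620, 14618, 14490, 14538, 14546, 14614, 14486, 14502,
    14514, 14606, 14478, 14414, 14422, 14438, 14442, 14450, 13249, 13217, 13153, 13650, 13129,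
    13025, 13009, 13001, 12857, 12769, 12753, 12721, 12657, 12883, 12529, 9032, 13969, 14985,
    8996, 14629, 13897, 15505, 8994, 14613, 13893, 14605, 8904, 13713, 14737, 14673, 9380, 8868,
    13641, 14641, 8852, 8774, 13453, 8754, 14545, 13513, 14537, 14513, 8530, 8498, 12877, 8474,
    12853, 8470, 12845, 8462, 12829, 14449, 8394, 8362, 8489],
  .combo [([([], -1)], .out 14665), ([([], 1)], .out 14633), ([([], 1)], .sum 0)],
  .kills [14485, 14633],
  .combo [([([], 1)], .sum 0)],
  .combo [([([], 1)], .sum 1)],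
  .kills [4832, 4576, 7941, 7105, 4816, 5456, 4560, 7813, 7073, 5704, 5700, 4898, 4804, 5316,
    5444, 7561, 4802, 4874, 7945, 7693, 4784, 4528, 7009, 7521, 4776, 4770, 7841, 5412, 4754,
    7461, 4514, 4742, 7437, 7491, 7365, 7777, 7753, 5265, 5257, 5258, 4678, 6947, 7459, 4748,
    4492, 4650, 4490, 4745, 5162, 4464, 6881, 4456, 6865, 4900, 4440, 4390, 6733, 4374, 4366,
    4408, 4322, 6769, 6731, 4387, 6727, 4252, 4268, 4300, 4308, 4324, 4261, 6699, 4243, 6695,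
    4237, 4181, 4150, 4142, 4231, 4126, 7524, 7970, 7826, 7570, 7370, 7334, 7310, 6625, 6609,
    6601, 6577, 6513, 6385, 6451, 4772, 5284, 4516, 6985, 4500, 7317, 7309, 4708, 4452, 6857,
    4436, 4428, 7321, 4394, 6741, 4306, 6565, 4274, 6501, 4393, 4262, 4238, 6429, 4249, 4690,
    7465, 7369, 6821, 4426, 2416, 2288, 3973, 3553, 2408, 2728, 2280, 3909, 3537, 2852, 3877,
    2402, 2442, 3977, 3853, 2392, 2264, 3505, 2708, 3921, 2374, 3725, 3747, 2602, 2232, 3441,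
    2356, 2228, 3689, 2348, 3673, 2190, 2125, 2133, 2102, 2094, 2119, 2078, 3922, 3754, 3882,
    3670, 3313, 2660, 2276, 3529, 3637, 3629, 2162, 3301],
  .combo [([([], -4)], .out 2345), ([([], -1)], .out 2217), ([([], 2)], .out 2213), ([([], 2)],
    .out 2201), ([([], -1)], .out 2197)],
  .kills [2345, 3667, 2213, 3403, 2197, 3371, 2217, 3411],
  .combo [([([], 2)], .out 2642), ([([], -1)], .out 2378)],
  .kills [2218],
  .combo [([([], -2)], .out 2378), ([([], -2)], .out 3733), ([([], 1)], .out 2346), ([([], -1)],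
    .out 2214)],
  .kills [2214, 2202, 2354, 3737, 2346, 2250, 3881],
  .combo [([([], 1)], .sum 4)]]

def lead020_relations_x_rows : List (List (Poly × Row)) :=
  [[([([], -2)], .out 1364), ([([], -4)], .out 1362), ([([], 2)], .out 1354), ([([], -3)], .out
    1226), ([([], 6)], .out 1204), ([([], -2)], .out 1189), ([([], -3)], .out 1178), ([([], 6)],
    .out 1173), ([([], 1)], .out 1130), ([([], 2)], .out 1126), ([([], -1)], .out 1125), ([([],
    2)], .out 1114), ([([], -2)], .out 1110), ([([], -4)], .out 1107), ([([], -1)], .out 1101),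
    ([([], 4)], .out 1957), ([([], -6)], .out 1941), ([([], -2)], .out 1893), ([([], 4)], .out
    1875), ([([], -2)], .out 1869)],
  [([([], 12)], .out 1364), ([([], 4)], .out 1362), ([([], -8)], .out 1322), ([([], 4)], .out
    1321), ([([], 4)], .out 1234), ([([], -12)], .out 1202), ([([], 3)], .out 1194), ([([], 4)],
    .out 1193), ([([], 2)], .out 1190), ([([], -20)], .out 1189), ([([], -2)], .out 1178), ([([],
    4)], .out 1174), ([([], -4)], .out 1130), ([([], 8)], .out 1126), ([([], 18)], .out 1125),
    ([([], -12)], .out 1113), ([([], 5)], .out 1109), ([([], 2)], .out 1107), ([([], -20)], .out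
    1101), ([([], 16)], .out 1957), ([([], -8)], .out 1941)]]

theorem lead020_relations_x : (mkSys 0 2 0 2 ⟨[([0], 1)], [], [([2], 1)], [([3], 1)], [([4], 1)],
    [([5], 1)], [([6], 1)], [([7], 1)], [([8], 1)], [([9], 1)]⟩ [(false, 9, 5), (true, 9, 4),
    (false, 8, 4), (true, 8, 3)]).relations
    [(917, [([10], 2)]), (845, [([11], 2)]), (843, [([12], 2)])] lead020_relations_x_steps
    lead020_relations_x_rows =
      [some [([3, 10], 28)], some [([0, 0, 0], -18), ([0, 0, 10], 18), ([0, 2], 54), ([0, 3], 18),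
    ([4], 72)]] := by
  decide +kernel

def lead020_relation_p_steps : List LinSys.Step :=
  [.kills [9664, 9152, 15877, 14209, 9632, 10912, 9120, 15621, 14145, 11408, 11400, 11396, 9794,
    9608, 10632, 10888, 15113, 9602, 9738, 15881, 15373, 9568, 9056, 14017, 15041, 9552, 9538,
    15681, 10824, 10820, 10564, 9026, 9478, 14861, 14979, 14725, 15553, 9512, 9378, 14661, 15521,
    10532, 9362, 14921, 10530, 10514, 10529, 10513, 10505, 10506, 9350, 13891, 14915, 9496, 8984,
    13873, 9492, 9298, 8980, 9290, 15433, 9489, 9484, 8972, 9258, 8970, 10282, 8928, 13761, 8912,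
    13729, 9800, 9796, 9412, 8880, 8850, 8842, 13589, 9361, 14627, 9356, 8844, 14611, 8726, 8718,
    8816, 8642, 13537, 8777, 13459, 8773, 13451, 8771, 13447, 8504, 8536, 8600, 8616, 8648, 8644,
    8418, 8497, 8390, 8485, 13387, 8483, 8467, 8469, 8473, 13383, 13363, 13355, 13351, 8461, 8277,
    8246, 8238, 8455, 8222, 15048, 15940, 15938, 15524, 15650, 14996, 15506, 15140, 15138, 14946,
    14740, 14738, 14642, 14668, 14666, 14620, 14618, 14490, 14538, 14546, 14614, 14486, 14502,
    14514, 14606, 14478, 14414, 14422, 14438, 14442, 14450, 13249, 13217, 13153, 13650, 13129,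
    13025, 13009, 13001, 12857, 12769, 12753, 12721, 12657, 12883, 12529, 9032, 13969, 14985,
    8996, 14629, 13897, 15505, 8994, 14613, 13893, 14605, 8904, 13713, 14737, 14673, 9380, 8868,
    13641, 14641, 8852, 8774, 13453, 8754, 14545, 13513, 14537, 14513, 8530, 8498, 12877, 8474,
    12853, 8470, 12845, 8462, 12829, 14449, 8394, 8362, 8489],
  .combo [([([], -1)], .out 14665), ([([], 1)], .out 14633), ([([], 1)], .sum 0)],
  .kills [14485, 14633],
  .combo [([([], 1)], .sum 0)],
  .combo [([([], 1)], .sum 1)],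
  .kills [2416, 2288, 3973, 3553, 2408, 2728, 2280, 3909, 3537, 2852, 3877, 2402, 2442, 3977,
    3853, 2392, 2264, 3505, 2708, 3921, 2374, 3725, 3747, 2602, 2232, 3441, 2356, 2228, 3689,
    2348, 3673, 2190, 2125, 2133, 2102, 2094, 2119, 2078, 3922, 3754, 3882, 3670, 3313, 2660,
    2276, 3529, 3637, 3629, 2162, 3301],
  .combo [([([], -4)], .out 2345), ([([], -1)], .out 2217), ([([], 2)], .out 2213), ([([], 2)],
    .out 2201), ([([], -1)], .out 2197)],
  .kills [2345, 3667, 2213, 3403, 2197, 3371, 2217, 3411],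
  .combo [([([], 2)], .out 2642), ([([], -1)], .out 2378)],
  .kills [2218],
  .combo [([([], -2)], .out 2378), ([([], -2)], .out 3733), ([([], 1)], .out 2346), ([([], -1)],
    .out 2214)],
  .kills [2214, 2202, 2354, 3737, 2346, 2250, 3881],
  .combo [([([], 1)], .sum 4)]]

def lead020_relation_p_rows : List (List (Poly × Row)) :=
  [[([([], 1)], .out 681), ([([], -1)], .out 661), ([([], 2)], .out 947), ([([], -2)], .out 935)]]

theorem lead020_relation_p :
    (mkSys 0 2 0 2 ⟨[], [], [], [([3], 1)], [], [([5], 1)], [([6], 1)], [([7],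
    1)], [([8], 1)], [([9], 1)]⟩ [(false, 9, 5), (true, 9, 4), (false, 8, 4), (true, 8, 3),
    (false, 9, 4), (true, 9, 3), (false, 7, 3), (true, 7, 2)]).relations
    [] lead020_relation_p_steps lead020_relation_p_rows =
      [some [([3, 3], 6)]] := by
  decide +kernel

def lead110_vanishing_steps : List LinSys.Step :=
  [.kills [9600, 9730, 13827, 9536, 10528, 10512, 10504, 10500, 10498, 9345, 14595, 14597, 9488,
    9234, 13829, 8896, 8577, 13697, 8864, 13573, 9360, 9352, 9348, 8714, 12811, 8451, 12807, 8800,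
    8323, 8203, 8214, 8206, 14784, 8640, 13185, 14752, 8608, 13121, 14736, 15496, 15492, 15490,
    12993, 14920, 14916, 14914, 14660, 14628, 14626, 14625, 14610, 14609, 14601, 14488, 14484,
    14476, 14474, 14470, 12737, 12705, 13896, 13892, 13890, 13508, 13636, 12641, 13604, 13602,
    13474, 13458, 13452, 13396, 13410, 13412, 13450, 13394, 13446, 13350, 13354, 13362, 12513,
    12497, 12489, 12900, 12882, 12870, 13889, 8513, 13601, 8722, 8385, 8353, 8776, 8772, 13457,
    13449, 8454, 12813, 12677, 12613, 8484, 13385, 8472, 12485, 8468, 8274, 12371, 12453, 8460,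
    8481, 12867, 13445, 8465, 12835, 8457, 12819, 8482, 12869, 8466, 12837, 4800, 4866, 6915,
    4768, 5264, 5256, 5252, 5250, 4673, 7299, 7301, 4744, 4626, 6917, 4448, 4289, 6849, 4432,
    6789, 4680, 4676, 4362, 6411, 4227, 6407, 4400, 4163, 4107, 4118, 4110, 7392, 4320, 6593,
    7376, 4304, 6561, 7368, 7748, 7746, 6497, 7460, 7458, 7330, 7314, 7313, 7305, 7244, 7242,
    7238, 6369, 6353, 6948, 6946, 6754, 6818, 6802, 6730, 6726, 6698, 6706, 6450, 6945, 4257,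
    6801, 4370, 4193, 4177, 4388, 6729, 4230, 6413, 6341, 4178, 6227, 6309, 4236, 4121, 4241,
    6435, 6725, 4233, 6419, 4169, 6437, 9696, 10114, 14211, 9680, 11600, 10050, 14147, 11848,
    11844, 11842, 10017, 15939, 15941, 9668, 10692, 10948, 11460, 11588, 10002, 9666, 9093, 14213,
    9091, 9136, 9922, 14019, 14177, 10920, 9890, 11556, 11554, 9873, 9874, 15651, 13971, 9634,
    10658, 11426, 9029, 14149, 9027, 9826, 10900, 11410, 9801, 8997, 15507, 11409, 11401, 9797,
    11402, 9798, 15499, 15501, 9612, 14105, 9098, 10634, 10890, 14101, 9094, 9753, 8973, 15411,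
    8971, 8967, 9072, 14049, 9064, 14033, 11044, 11042, 8905, 15139, 9570, 10594, 10850, 8901,
    14021, 9554, 10578, 9542, 8851, 9510, 14899, 8843, 9494, 8839, 9486, 8817, 8803, 13511, 14643,
    10531, 10515, 10517, 10521, 9357, 8775, 10522, 9358, 14619, 13455, 14621, 9500, 13881, 14515,
    9491, 14451, 8944, 8673, 13793, 8936, 8657, 13777, 9444, 13765, 8920, 8625, 13745, 8914,
    13733, 8888, 8561, 8884, 13673, 8876, 8860, 13625, 8487, 12879, 8477, 12859, 8475, 12855,
    8471, 12847, 8463, 12831, 8824, 8425, 8658, 8820, 13221, 8812, 13529, 8377, 8562, 8796, 13029,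
    8310, 8302, 8286, 8254, 14832, 8688, 13281, 14824, 8680, 13265, 14820, 15588, 15716, 15972,
    16036, 16162, 15570, 15954, 15697, 15945, 14770, 15538, 15666, 15018, 15657, 15014, 14937,
    14494, 14226, 14154, 13974, 13614, 13470, 14225, 14129, 9106, 13937, 9010, 8818, 8433, 8409,
    13157, 8478, 12861, 8313],
  .combo [([([], 2)], .out 15525), ([([], -1)], .out 15013), ([([], -1)], .out 14997), ([([], 2)],
    .out 14949), ([([], 2)], .out 14931), ([([], -1)], .out 14933)],
  .combo [([([], 2)], .out 8857), ([([], 2)], .out 14949), ([([], -4)], .out 9418), ([([], -4)],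
    .out 8906), ([([], -2)], .out 13003), ([([], 2)], .out 8858), ([([], 4)], .out 12955), ([([],
    -1)], .out 13013)],
  .combo [([([], 2)], .out 13619), ([([], -2)], .out 14949), ([([], -2)], .out 9418), ([([], -1)],
    .out 13717), ([([], -1)], .out 13621)],
  .kills [9418],
  .combo [([([], 6)], .out 15525), ([([], -5)], .out 14997), ([([], -2)], .out 10570), ([([],
    -4)], .out 14931), ([([], 1)], .out 14933), ([([], -6)], .out 14757), ([([], 4)], .out 14741),
    ([([], -4)], .out 14675), ([([], 1)], .out 14677), ([([], 2)], .out 14667), ([([], -2)], .out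
    14669)],
  .kills [14997, 15525, 15013, 14949, 14757, 14741, 14693, 14669, 13717, 8499, 12903, 8371, 8906,
    8553, 13011],
  .combo [([([], -1)], .out 9001), ([([], 1)], .out 8613), ([([], -1)], .out 8597)],
  .kills [9001, 8809, 13467, 8613, 13131, 8403, 8395],
  .combo [([([], -1)], .out 8873), ([([], -1)], .out 8869), ([([], 1)], .out 9546), ([([], -2)],
    .out 8853), ([([], 2)], .out 9385), ([([], -2)], .out 8789), ([([], 4)], .out 9381), ([([],
    4)], .out 8787)],
  .kills [8363],
  .combo [([([], 4)], .out 8873), ([([], -8)], .out 9546), ([([], -2)], .out 13989), ([([], -8)],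
    .out 13973), ([([], 2)], .out 13669), ([([], -1)], .out 13653)],
  .kills [13989, 13973, 13925, 13909, 13669, 13653, 13541, 13525, 13517, 13469, 8421, 13205, 8873,
    8869, 9514, 14931, 9385, 8789, 9386, 14675, 13483, 8787, 13479, 8874, 8533, 12971, 4848, 5058,
    7107, 4840, 5800, 5026, 7075, 5924, 5922, 5009, 5010, 7971, 7059, 5346, 5474, 5730, 5794,
    4549, 7109, 4833, 4547, 4568, 4962, 7011, 7089, 4820, 5460, 4818, 5458, 4515, 4499, 4550,
    4889, 4493, 7731, 4491, 4487, 4536, 7025, 4532, 7589, 4530, 7573, 7013, 4423, 4750, 7283,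
    4472, 4337, 6897, 4468, 4466, 6885, 4460, 4444, 6841, 4239, 6431, 4217, 4338, 4412, 6629,
    4218, 4158, 7416, 4344, 7412, 7794, 7858, 7986, 8018, 7401, 7077],
  .combo [([([], -2)], .out 4938), ([([], 2)], .out 6867), ([([], -1)], .out 6869)],
  .kills [4938],
  .combo [([([], 1)], .out 4713), ([([], -1)], .out 4714)],
  .combo [([([], 2)], .out 4698), ([([], 2)], .out 6747), ([([], 1)], .out 6869)],
  .kills [4457, 6867, 4458, 4281, 6515, 4275, 4810, 4905, 4906, 4710, 5322, 4713],
  .combo [([([], -1)], .out 6837), ([([], -2)], .out 4269), ([([], -1)], .out 6493)],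
  .kills [6715, 4329],
  .combo [([([], -2)], .out 7845), ([([], -2)], .out 7829), ([([], 2)], .out 7525), ([([], 2)],
    .out 7507), ([([], -1)], .out 7509)],
  .kills [7845, 7829, 7781, 4554, 7763, 7061, 7525, 7501, 6989, 7469, 4409, 6771, 7397, 4506,
    4405, 7379, 6763, 6965, 6957, 7341, 4309, 6571, 4406, 5450, 4777, 4437, 7507, 6827, 4435,
    4774, 7475, 4427, 7347, 9712, 10178, 14275, 9704, 11944, 10146, 14243, 12068, 12066, 10129,
    10130, 16163, 14227, 10722, 10978, 11490, 11618, 11874, 11938, 9157, 14277, 9697, 9155, 9176,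
    11608, 10082, 14179, 14257, 9684, 11604, 10706, 11602, 9681, 9123, 9673, 9107, 9158, 9670,
    10009, 9101, 15923, 9099, 9095, 9144, 9073, 14193, 9140, 15781, 9138, 9650, 15765, 14181,
    9059, 9031, 8999, 9102, 9785, 8989, 15475, 8987, 8983, 8975, 9080, 14065, 9076, 15269, 9074,
    15253, 14053, 9068, 15205, 15181, 15149, 14957, 8847, 9502, 14701, 14579, 8952, 8689, 13809,
    8948, 8946, 13797, 8940, 8924, 8892, 13689, 8479, 12863, 8441, 8690, 8828, 13285, 8442, 8318,
    14840, 8696, 14836, 15602, 15730, 15986, 16050, 16178, 16210, 14825, 14245, 11082, 15187,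
    15147, 14955, 8795, 9398, 14699, 13495, 8922, 14935, 9065, 14035, 9061, 9638, 10662, 11430,
    9881, 15667, 10902, 9817, 15539, 9066, 10602, 10858, 11050, 8859, 14771, 8633, 13171],
  .combo [([([], 2)], .out 15717), ([([], -2)], .out 15077), ([([], -2)], .out 10837), ([([],
    -1)], .out 15021), ([([], -2)], .out 14941)],
  .kills [15077, 14941, 14821, 14685, 16037, 16021, 15973, 15717, 15693, 14157, 15661, 15589,
    15565, 15533, 10842, 15059, 10841, 15051, 10837, 15019, 10835, 15003, 9547, 9517, 9518, 14797,
    13933, 14765, 14749, 9515, 9389, 9390, 14683, 8659, 13223, 8651, 8619, 8886, 8878, 9387, 8535,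
    12975, 9125, 10058, 14155, 10954, 11466, 11594, 9109, 10026, 14123, 14229, 9130, 10666, 9045,
    9898, 13995, 9637, 9013, 9834, 13931, 9621, 8917, 13739, 9562, 8885, 13675, 9561, 8821, 13547,
    8681, 13267, 8677, 2424, 2530, 3555, 2420, 2900, 4005, 3561, 2674, 3989, 2417, 2275, 2284,
    3941, 3917, 3885, 2247, 2268, 3813, 3789, 2710, 3763, 3757, 3741, 3693, 3677, 2236, 3708,
    2172, 3705, 3751, 3671, 3557, 2890, 3923, 2469, 2259, 2470, 3495, 2726, 3533, 2405, 2453,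
    2266, 2229, 3795, 3435, 2393, 2262, 2390, 2646, 2221, 3419, 2215, 2362, 2169, 3315]]

theorem lead110_vanishing : (mkSys 1 1 0 1 stdParams []).eliminates [] lead110_vanishing_steps
    [(false, 9, 7), (true, 9, 6), (false, 8, 6), (true, 8, 5), (false, 9, 5), (true, 9, 4),
    (false, 8, 4), (true, 8, 3), (false, 9, 4), (true, 9, 3), (false, 7, 3), (true, 7, 2)] = true
    := by
  decide +kernel

def lead110_relations_e1_steps : List LinSys.Step :=
  [.kills [9664, 9986, 14083, 9632, 10912, 9858, 13955, 11408, 11400, 11396, 11394, 9793, 15491,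
    15493, 9608, 10632, 10888, 9746, 8965, 14085, 8963, 9056, 14017, 10824, 10820, 10818, 14915,
    14917, 10564, 13957, 8835, 9478, 9410, 9512, 9377, 10532, 10530, 9361, 9362, 14627, 14629,
    10514, 9353, 8773, 9354, 14611, 13451, 14613, 10529, 10513, 10505, 9349, 8771, 10506, 9350,
    14603, 13447, 14605, 9496, 8753, 9492, 13865, 9484, 13849, 8970, 13845, 14387, 8928, 8641,
    13761, 8912, 8609, 13729, 9416, 9796, 13701, 8880, 8545, 8872, 8856, 8778, 12875, 8483, 8774,
    12871, 13453, 8844, 8754, 12851, 8469, 12843, 8467, 12839, 8461, 12827, 8459, 12823, 8455,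
    12815, 8816, 8808, 8792, 8339, 8267, 8243, 8246, 8238, 8222, 14816, 8672, 13249, 14800, 8656,
    13217, 14792, 15560, 15688, 15940, 15938, 13153, 14756, 15012, 15524, 15650, 15010, 15506,
    15505, 15497, 14732, 8588, 14729, 14985, 13025, 13009, 14673, 14929, 14921, 14630, 14492,
    14490, 14506, 14478, 12769, 12753, 14116, 14114, 13538, 13666, 13922, 13986, 13970, 13714,
    13466, 13462, 13454, 13398, 13414, 13418, 13426, 12914, 14113, 13969, 9490, 13587, 9378,
    13475, 13905, 8996, 9508, 13897, 8994, 13893, 8593, 13091, 13713, 8529, 13649, 8868, 8521,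
    13641, 8497, 13617, 8786, 8417, 8401, 8393, 8804, 13513, 8369, 8361, 8345, 12877, 8474, 12853,
    8470, 12845, 8462, 12829, 12741, 8297, 8293, 8281, 8277, 8476, 8249],
  .combo [([([], 1)], .out 8489), ([([], 1)], .sum 0)],
  .kills [13395, 8489, 13461, 8357]]

def lead110_relations_e1_rows : List (List (Poly × Row)) :=
  [[([([], -1)], .out 3658)],
  [([([], -1)], .out 5268)]]

theorem lead110_relations_e1 : (mkSys 1 1 0 1 stdParams [(false, 9, 7), (true, 9, 6), (false, 8, 6),
    (true, 8, 5)]).relations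
    [] lead110_relations_e1_steps lead110_relations_e1_rows =
      [some [([5], 2), ([6], -1)], some [([1], 1)]] := by
  decide +kernel

def lead110_relations_x_steps : List LinSys.Step :=
  [.kills [9664, 9986, 14083, 9632, 10912, 9858, 13955, 11408, 11400, 11396, 11394, 9793, 15491,
    15493, 9608, 10632, 10888, 9746, 8965, 14085, 8963, 9056, 14017, 10824, 10820, 10818, 14915,
    14917, 10564, 13957, 8835, 9478, 9410, 9512, 9377, 10532, 10530, 9361, 9362, 14627, 14629,
    10514, 9353, 8773, 9354, 14611, 13451, 14613, 10529, 10513, 10505, 9349, 8771, 10506, 9350,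
    14603, 13447, 14605, 9496, 8753, 9492, 13865, 9484, 13849, 8970, 13845, 14387, 8928, 8641,
    13761, 8912, 8609, 13729, 9416, 9796, 13701, 8880, 8545, 8872, 8856, 8778, 12875, 8483, 8774,
    12871, 13453, 8844, 8754, 12851, 8469, 12843, 8467, 12839, 8461, 12827, 8459, 12823, 8455,
    12815, 8816, 8808, 8792, 8339, 8267, 8243, 8246, 8238, 8222, 14816, 8672, 13249, 14800, 8656,
    13217, 14792, 15560, 15688, 15940, 15938, 13153, 14756, 15012, 15524, 15650, 15010, 15506,
    15505, 15497, 14732, 8588, 14729, 14985, 13025, 13009, 14673, 14929, 14921, 14630, 14492,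
    14490, 14506, 14478, 12769, 12753, 14116, 14114, 13538, 13666, 13922, 13986, 13970, 13714,
    13466, 13462, 13454, 13398, 13414, 13418, 13426, 12914, 14113, 13969, 9490, 13587, 9378,
    13475, 13905, 8996, 9508, 13897, 8994, 13893, 8593, 13091, 13713, 8529, 13649, 8868, 8521,
    13641, 8497, 13617, 8786, 8417, 8401, 8393, 8804, 13513, 8369, 8361, 8345, 12877, 8474, 12853,
    8470, 12845, 8462, 12829, 12741, 8297, 8293, 8281, 8277, 8476, 8249],
  .combo [([([], 1)], .out 8489), ([([], 1)], .sum 0)],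
  .kills [13395, 8489, 13461, 8357, 4832, 4994, 7043, 4816, 5456, 4930, 6979, 5704, 5700, 5698,
    4897, 7747, 7749, 4804, 5316, 5444, 4882, 4485, 7045, 4483, 4528, 7009, 5412, 5410, 7459,
    5282, 6981, 4419, 4742, 4706, 4756, 4689, 4690, 5266, 4681, 7315, 6731, 5265, 5257, 4677,
    4387, 5258, 4678, 7307, 6727, 7309, 4748, 6707, 6937, 4490, 6699, 6933, 7219, 4464, 4321,
    6881, 4456, 4305, 6865, 4708, 6853, 4440, 4273, 4436, 4428, 6809, 4243, 6439, 4237, 6427,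
    4235, 6423, 4231, 6415, 4408, 4404, 6761, 4185, 4274, 4396, 6501, 4150, 4142, 4126, 7408,
    4336, 6625, 7400, 4328, 6609, 7396, 7780, 7844, 7970, 7378, 7762, 7753, 7465, 7246, 7058,
    6986, 6806, 6734, 7057, 6961, 4498, 4265, 4402, 6451, 6733, 4209, 4201, 6565, 4197, 4181,
    4238, 6429, 4153],
  .combo [([([], 1)], .out 7333), ([([], 1)], .sum 3)],
  .kills [4179],
  .combo [([([], 1)], .sum 2)],
  .kills [4261, 4245, 2416, 2498, 3523, 2408, 2728, 2466, 3491, 2852, 2850, 2449, 2450, 3875,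
    3475, 2402, 2658, 2722, 2245, 3525, 2243, 2264, 3505, 2386, 2258, 3493, 2211, 2374, 3635,
    2232, 2161, 3441, 2228, 2226, 3429, 2220, 3417, 2119, 3215, 2105, 2162, 2204, 3301, 2106,
    2078, 3704, 2168, 3700, 3890, 3922],
  .combo [([([], 1)], .out 3749), ([([], -2)], .out 3733), ([([], -2)], .out 3685), ([([], -2)],
    .out 3667), ([([], 1)], .out 3669)],
  .kills [3733, 3749, 3685],
  .combo [([([], 2)], .out 3411), ([([], -2)], .out 2378), ([([], -2)], .out 3477), ([([], -1)],
    .out 3413)],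
  .kills [2131, 3239, 3405, 2093],
  .combo [([([], -1)], .out 2217), ([([], -2)], .out 3275), ([([], -1)], .out 3243)],
  .kills [3355, 2153, 2149, 2125, 3381, 2099, 2250, 2345, 2197, 2346, 3667, 3371]]

def lead110_relations_x_rows : List (List (Poly × Row)) :=
  [[([([], -1)], .out 1362), ([([], 1)], .out 1354), ([([], 1)], .out 1204), ([([], -1)], .out
    1189), ([([], 1)], .out 1173), ([([], -1)], .out 1107), ([([], 1)], .out 1099), ([([], 1)],
    .out 1957), ([([], -1)], .out 1941), ([([], 1)], .out 1875), ([([], -1)], .out 1867)],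
  [([([], -9)], .out 1364), ([([], 18)], .out 1354), ([([], -4)], .out 1322), ([([], -32)], .out
    1321), ([([], -14)], .out 1226), ([([], 12)], .out 1202), ([([], -18)], .out 1193), ([([],
    -6)], .out 1190), ([([], 30)], .out 1189), ([([], 20)], .out 1178), ([([], -4)], .out 1174),
    ([([], 4)], .out 1130), ([([], 18)], .out 1129), ([([], -10)], .out 1125), ([([], -12)], .out
    1114), ([([], 30)], .out 1113), ([([], -4)], .out 1110), ([([], -4)], .out 1109), ([([],
    -10)], .out 1107), ([([], -4)], .out 1077), ([([], 4)], .out 1067), ([([], 12)], .out 1893)],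
  [([([], 4)], .out 1362), ([([], -3)], .out 1354), ([([], -2)], .out 1322), ([([], 12)], .out
    1321), ([([], -4)], .out 1226), ([([], -2)], .out 1190), ([([], -3)], .out 1189), ([([], 6)],
    .out 1178), ([([], 4)], .out 1174), ([([], 2)], .out 1130), ([([], -4)], .out 1125), ([([],
    -1)], .out 1114), ([([], 4)], .out 1113), ([([], -2)], .out 1110), ([([], 1)], .out 1109),
    ([([], -4)], .out 1107), ([([], 2)], .out 1101), ([([], -2)], .out 1077), ([([], -1)], .out
    1069), ([([], 2)], .out 1067), ([([], 2)], .out 1893)]]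

theorem lead110_relations_x : (mkSys 1 1 0 2 ⟨[([0], 1)], [], [([2], 1)], [([3], 1)], [([4], 1)],
    [([5], 1)], [([6], 1)], [([7], 1)], [([8], 1)], [([9], 1)]⟩ [(false, 9, 5), (true, 9, 4),
    (false, 8, 4), (true, 8, 3)]).relations
    [(843, [([10], 2)]), (819, [([11], 2)]), (811, [([12], 2)])] lead110_relations_x_steps
    lead110_relations_x_rows =
      [some [([0, 3], 8), ([3, 10], 8), ([3, 11], 8), ([3, 12], 8)], some [([0, 0, 12], -24), ([0,
    2], 48), ([0, 3], -48), ([2, 12], 24), ([4], 48)], some [([0, 0, 10], 6), ([0, 0, 11], 6),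
    ([0, 0, 12], -6), ([0, 2], 6), ([2, 12], 12)]] := by
  decide +kernel

def lead110_relation_p_steps : List LinSys.Step :=
  [.kills [9664, 9986, 14083, 9632, 10912, 9858, 13955, 11408, 11400, 11396, 11394, 9793, 15491,
    15493, 9608, 10632, 10888, 9746, 8965, 14085, 8963, 9056, 14017, 10824, 10820, 10818, 14915,
    14917, 10564, 13957, 8835, 9478, 9410, 9512, 9377, 10532, 10530, 9361, 9362, 14627, 14629,
    10514, 9353, 8773, 9354, 14611, 13451, 14613, 10529, 10513, 10505, 9349, 8771, 10506, 9350,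
    14603, 13447, 14605, 9496, 8753, 9492, 13865, 9484, 13849, 8970, 13845, 14387, 8928, 8641,
    13761, 8912, 8609, 13729, 9416, 9796, 13701, 8880, 8545, 8872, 8856, 8778, 12875, 8483, 8774,
    12871, 13453, 8844, 8754, 12851, 8469, 12843, 8467, 12839, 8461, 12827, 8459, 12823, 8455,
    12815, 8816, 8808, 8792, 8339, 8267, 8243, 8246, 8238, 8222, 14816, 8672, 13249, 14800, 8656,
    13217, 14792, 15560, 15688, 15940, 15938, 13153, 14756, 15012, 15524, 15650, 15010, 15506,
    15505, 15497, 14732, 8588, 14729, 14985, 13025, 13009, 14673, 14929, 14921, 14630, 14492,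
    14490, 14506, 14478, 12769, 12753, 14116, 14114, 13538, 13666, 13922, 13986, 13970, 13714,
    13466, 13462, 13454, 13398, 13414, 13418, 13426, 12914, 14113, 13969, 9490, 13587, 9378,
    13475, 13905, 8996, 9508, 13897, 8994, 13893, 8593, 13091, 13713, 8529, 13649, 8868, 8521,
    13641, 8497, 13617, 8786, 8417, 8401, 8393, 8804, 13513, 8369, 8361, 8345, 12877, 8474, 12853,
    8470, 12845, 8462, 12829, 12741, 8297, 8293, 8281, 8277, 8476, 8249],
  .combo [([([], 1)], .out 8489), ([([], 1)], .sum 0)],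
  .kills [13395, 8489, 13461, 8357, 2416, 2498, 3523, 2408, 2728, 2466, 3491, 2852, 2850, 2449,
    2450, 3875, 3475, 2402, 2658, 2722, 2245, 3525, 2243, 2264, 3505, 2386, 2258, 3493, 2211,
    2374, 3635, 2232, 2161, 3441, 2228, 2226, 3429, 2220, 3417, 2119, 3215, 2105, 2162, 2204,
    3301, 2106, 2078, 3704, 2168, 3700, 3890, 3922],
  .combo [([([], 1)], .out 3749), ([([], -2)], .out 3733), ([([], -2)], .out 3685), ([([], -2)],
    .out 3667), ([([], 1)], .out 3669)],
  .kills [3733, 3749, 3685],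
  .combo [([([], 2)], .out 3411), ([([], -2)], .out 2378), ([([], -2)], .out 3477), ([([], -1)],
    .out 3413)],
  .kills [2131, 3239, 3405, 2093],
  .combo [([([], -1)], .out 2217), ([([], -2)], .out 3275), ([([], -1)], .out 3243)],
  .kills [3355, 2153, 2149, 2125, 3381, 2099, 2250, 2345, 2197, 2346, 3667, 3371]]

def lead110_relation_p_rows : List (List (Poly × Row)) :=
  [[([([], -1)], .out 714), ([([], 1)], .out 666), ([([], -1)], .out 971), ([([], 1)], .out 923)]]

theorem lead110_relation_p : (mkSys 1 1 0 2 ⟨[], [], [([3], 1)], [([3], 1)], [], [([5], 1)], [([6],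
    1)], [([7], 1)], [([8], 1)], [([9], 1)]⟩ [(false, 9, 5), (true, 9, 4), (false, 8, 4), (true,
    8, 3), (false, 9, 4), (true, 9, 3), (false, 7, 3), (true, 7, 2)]).relations
    [] lead110_relation_p_steps lead110_relation_p_rows =
      [some [([3, 3], 5)]] := by
  decide +kernel

def lead011_vanishing_steps : List LinSys.Step :=
  [.kills [10624, 9730, 9984, 14081, 10560, 9856, 13953, 10528, 10512, 10504, 10500, 15378, 15108,
    10370, 15369, 15106, 9222, 8896, 9345, 14595, 14854, 8769, 8737, 8721, 8713, 8454, 12813,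
    14598, 8326, 14470, 8262, 14406, 9240, 12389, 14386, 8230, 14374, 8244, 12341, 8709, 8214,
    8236, 8220, 15504, 15496, 15492, 14604, 14412, 14436, 8640, 8608, 13896, 13892, 13890, 13089,
    13512, 13636, 13073, 8544, 12961, 13604, 13602, 13476, 12937, 12881, 13458, 12873, 13452,
    12849, 13450, 12841, 13394, 13354, 8416, 8400, 8368, 8304, 9346, 8992, 14597, 13889, 14857,
    9408, 8834, 8864, 8714, 13333, 8496, 9312, 14433, 8488, 9296, 8484, 8338, 12581, 14409, 14482,
    14884, 8340, 9256, 14660, 14628, 9488, 9376, 13585, 9252, 8722, 8836, 13349, 14601, 8776,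
    13457, 14481, 14626, 14920, 14916, 13385, 9504, 9284, 13381, 5312, 4866, 4992, 7041, 5280,
    4928, 6977, 5264, 5256, 5252, 7698, 7556, 5186, 7689, 7554, 4614, 4448, 4673, 7299, 7430,
    4385, 4369, 4361, 4230, 6413, 7302, 4166, 7238, 4632, 6245, 7218, 4134, 7206, 4148, 6197,
    4357, 4118, 4140, 4124, 7752, 7748, 7308, 7268, 4320, 4304, 6820, 6946, 6545, 6756, 4272,
    6481, 6802, 4260, 6738, 4208, 4674, 4496, 7301, 6945, 7433, 4704, 4418, 4432, 4362, 6677,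
    7265, 4178, 4648, 7332, 4688, 4258],
  .combo [([([], -1)], .out 4388), ([([], -1)], .out 7314), ([([], 3)], .out 7460)],
  .kills [4752],
  .combo [([([], -1)], .out 4388), ([([], 3)], .out 6729), ([([], -1)], .out 7314)],
  .combo [([([], -1)], .out 4388), ([([], 2)], .out 7314)],
  .kills [4680, 7313, 4242, 6437, 7241, 4386, 6725, 7458, 4644]]

theorem lead011_vanishing : (mkSys 0 1 1 1 stdParams []).eliminates [] lead011_vanishing_steps
    [(false, 9, 7), (true, 9, 6), (false, 8, 6), (true, 8, 5)] = true := by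
  decide +kernel

def lead011_relation_e1_steps : List LinSys.Step :=
  [.kills [10688, 9986, 10112, 14209, 10656, 10912, 9858, 10048, 14145, 11408, 11400, 11396,
    10632, 10888, 15890, 15236, 10626, 15881, 15234, 9734, 9920, 14017, 9888, 10824, 10820, 10564,
    15634, 15172, 10562, 15625, 15170, 9537, 9824, 9808, 10532, 15506, 15140, 10530, 10514, 10516,
    15498, 10529, 10513, 10505, 10506, 8993, 10508, 13891, 15494, 10392, 9314, 9776, 13873, 15433,
    9489, 10374, 10282, 8966, 9238, 9230, 8928, 8912, 9361, 9353, 8849, 13603, 14627, 14611, 9349,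
    14603, 14870, 9347, 14599, 14862, 8777, 13459, 14630, 8773, 8741, 8745, 8470, 12845, 14614,
    8771, 8739, 8723, 8725, 8729, 8462, 12829, 14606, 8390, 9304, 12645, 14514, 8358, 14502, 8342,
    14486, 8334, 14478, 9272, 12517, 14450, 8294, 14438, 8372, 12469, 8278, 14422, 8270, 14414,
    8308, 12405, 8717, 8246, 8300, 8284, 8252, 15560, 15940, 15524, 14668, 14620, 14508, 14540,
    14564, 8672, 8656, 13988, 14114, 13201, 13540, 8624, 13137, 13970, 8612, 13522, 13097, 8560,
    13610, 8432, 9794, 9104, 15493, 14113, 15113, 9506, 9032, 14917, 13969, 14985, 14869, 9362,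
    9800, 14629, 13897, 15505, 14921, 9354, 8994, 9796, 14613, 13893, 15138, 9350, 14605, 9440,
    9424, 8904, 13713, 15048, 14729, 8898, 8866, 8872, 8850, 14994, 8802, 8856, 14641, 8778,
    13461, 8774, 9356, 13453, 14918, 9292, 9300, 14617, 14898, 13397, 13389, 8730, 13365, 14561,
    8594, 14738, 8788, 8498, 12901, 14618, 8500, 9384, 8868],
  .combo [([([], -1)], .out 9380), ([([], 1)], .out 8786), ([([], 1)], .sum 0)],
  .kills [14501, 9380, 8786, 8852]]

def lead011_relation_e1_rows : List (List (Poly × Row)) :=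
  [[([([], -1)], .out 3666), ([([], 1)], .out 3369)]]

theorem lead011_relation_e1 : (mkSys 0 1 1 1 stdParams [(false, 9, 7), (true, 9, 6), (false, 8, 6),
    (true, 8, 5)]).relations
    [] lead011_relation_e1_steps lead011_relation_e1_rows =
      [some [([5], 2), ([6], -2)]] := by
  decide +kernel

def lead011_relation_split_steps : List LinSys.Step :=
  [.kills [10720, 10114, 10176, 14273, 10704, 11600, 10050, 10144, 14241, 11848, 11844, 10692,
    10948, 11460, 11588, 16146, 15300, 10690, 16137, 15298, 9990, 10928, 9922, 10080, 14177,
    10920, 10064, 10660, 10916, 9874, 16018, 15268, 10658, 10914, 16009, 15266, 9862, 10032,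
    10642, 15945, 11409, 11401, 11402, 9105, 11404, 14115, 15942, 10636, 10892, 9609, 10630,
    11306, 9750, 9742, 9952, 14049, 9936, 14033, 15762, 15204, 9570, 15753, 15202, 9569, 9904,
    9553, 9545, 10566, 10794, 9030, 9541, 9539, 9840, 10534, 10538, 8998, 9366, 10531, 10515,
    10517, 10521, 10522, 8995, 10524, 13895, 15502, 10410, 9497, 8982, 10382, 10346, 8974, 9270,
    9262, 9246, 8944, 8936, 8920, 9363, 14631, 14926, 9357, 9301, 14619, 14902, 14615, 14894,
    9351, 14607, 14878, 8781, 8502, 8812, 12909, 8494, 8796, 12893, 8775, 8743, 8747, 8755, 8757,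
    8761, 8478, 12861, 14622, 9336, 12773, 14578, 8422, 14566, 12725, 8533, 8406, 14550, 8398,
    14542, 12661, 8374, 8366, 14510, 8350, 14494, 8436, 12533, 8733, 8310, 8428, 8412, 8380, 8316,
    15588, 15555, 14684, 14804, 8688, 9160, 15941, 14225, 15241, 9124, 9106, 15250, 9798, 15501,
    15139, 9060, 14901, 9358, 14621, 14493, 8932, 15076, 8930, 9432, 9400, 8762, 13429, 8658,
    13545],
  .combo [([([], -10)], .out 9620), ([([], -42)], .out 10644), ([([], -30)], .out 10900), ([([],
    -10)], .out 9810), ([([], 6)], .out 15525), ([([], 2)], .out 9556), ([([], 15)], .out 10580),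
    ([([], 3)], .out 10836), ([([], 6)], .out 9554), ([([], -2)], .out 15013), ([([], 12)], .out
    10578), ([([], 3)], .out 9546), ([([], -1)], .out 14997), ([([], -8)], .out 10572), ([([],
    7)], .out 9522), ([([], 5)], .out 14949), ([([], 5)], .out 10570), ([([], -13)], .out 9514),
    ([([], -2)], .out 9876), ([([], 6)], .out 9524), ([([], 9)], .out 9418), ([([], -2)], .out
    9516), ([([], -18)], .out 9394), ([([], -2)], .out 9386), ([([], -2)], .out 9002), ([([],
    -2)], .out 9812), ([([], -4)], .out 9513), ([([], 24)], .out 9382), ([([], 2)], .out 14931),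
    ([([], -4)], .out 14745), ([([], 9)], .out 8906), ([([], 2)], .out 14681), ([([], 1)], .out
    8874), ([([], -10)], .out 9385), ([([], -11)], .out 8858), ([([], 26)], .out 9381)],
  .kills [10024],
  .combo [([([], 6)], .out 9620), ([([], -6)], .out 10644), ([([], 6)], .out 10900), ([([], -6)],
    .out 15525), ([([], -3)], .out 9556), ([([], 3)], .out 10580), ([([], -3)], .out 9554), ([([],
    6)], .out 10834), ([([], -4)], .out 9546), ([([], 2)], .out 14997), ([([], 2)], .out 9548),
    ([([], -10)], .out 10572), ([([], -6)], .out 14949), ([([], 2)], .out 10570), ([([], -2)],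
    .out 9514), ([([], 6)], .out 9876), ([([], 2)], .out 14933), ([([], 2)], .out 9516), ([([],
    -1)], .out 9386), ([([], 2)], .out 9002), ([([], 2)], .out 9513), ([([], -10)], .out 9001),
    ([([], -6)], .out 14931), ([([], 4)], .out 14745), ([([], -2)], .out 14681), ([([], -1)], .out
    8874), ([([], 5)], .out 8873), ([([], 2)], .out 9385), ([([], 2)], .out 8858), ([([], 6)],
    .out 9381), ([([], -10)], .out 8857)],
  .kills [9896, 15690, 10834, 9892, 15658, 10836],
  .combo [([([], 2)], .out 10644), ([([], -1)], .out 10580), ([([], -1)], .out 10578), ([([], 2)],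
    .out 10572), ([([], -1)], .out 10570)],
  .kills [10578, 10570, 9828, 15562, 15530, 10644, 10580],
  .combo [([([], 2)], .out 9513), ([([], -2)], .out 13907), ([([], -1)], .out 9385), ([([], 1)],
    .out 13651), ([([], -1)], .out 9381), ([([], 1)], .out 13643), ([([], -2)], .out 13619),
    ([([], -2)], .out 13611)],
  .kills [8526],
  .combo [([([], -1)], .out 9524), ([([], 1)], .out 14697), ([([], 1)], .out 8858)],
  .kills [9576, 14697, 8554],
  .combo [([([], 1)], .out 9620), ([([], -1)], .out 8906)],
  .kills [8857, 13619, 14643],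
  .combo [([([], -1)], .out 9513), ([([], 1)], .out 9385), ([([], -1)], .out 9381)],
  .kills [9513, 9385, 14675, 8853, 13611, 9546, 9514, 9382, 14669, 8873, 13651, 8869, 13643, 9810,
    15145, 9554, 15017, 9426, 14757, 8906, 8858],
  .combo [([([], -2)], .out 15013), ([([], 1)], .out 14933), ([([], -4)], .out 15178), ([([],
    -1)], .out 15018), ([([], 2)], .out 14998)],
  .kills [9640, 9876, 13973, 14549, 9428, 14761, 8860, 14962, 8650, 15525, 15013, 14997, 14933,
    9516, 9002, 9812, 13909, 15146, 8882, 13669, 15026]]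

def lead011_relation_split_rows : List (List (Poly × Row)) :=
  [[([([], -1)], .out 4940), ([([], 1)], .out 4908), ([([], 1)], .out 4518), ([([], -1)], .out
    4502)]]

theorem lead011_relation_split :
    (mkSys 0 1 1 1 ⟨[([0], 1), ([1], 1)], [([0], 1), ([1], -1)], [([2], 1)],
    [([3], 1)], [([4], 1)], [([5], 1)], [([5], 1)], [([7], 1)], [([8], 1)], [([9], 1)]⟩
    []).relations
    [(1962, [([10], 1)])] lead011_relation_split_steps lead011_relation_split_rows =
      [some [([1, 10], 8)]] := by
  decide +kernel

def lead011_vanishing_of_split_steps : List LinSys.Step :=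
  [.kills [10720, 10114, 10176, 14273, 10704, 11600, 10050, 10144, 14241, 11848, 11844, 10692,
    10948, 11460, 11588, 16146, 15300, 10690, 16137, 15298, 9990, 10928, 9922, 10080, 14177,
    10920, 10064, 10660, 10916, 9874, 16018, 15268, 10658, 10914, 16009, 15266, 9862, 10032,
    10642, 15945, 11409, 11401, 11402, 9105, 11404, 14115, 15942, 10636, 10892, 9609, 10630,
    11306, 9750, 9742, 9952, 14049, 9936, 14033, 15762, 15204, 9570, 15753, 15202, 9569, 9904,
    9553, 9545, 10566, 10794, 9030, 9541, 9539, 9840, 10534, 10538, 8998, 9366, 10531, 10515,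
    10517, 10521, 10522, 8995, 10524, 13895, 15502, 10410, 9497, 8982, 10382, 10346, 8974, 9270,
    9262, 9246, 8944, 8936, 8920, 9363, 14631, 14926, 9357, 9301, 14619, 14902, 14615, 14894,
    9351, 14607, 14878, 8781, 8502, 8812, 12909, 8494, 8796, 12893, 8775, 8743, 8747, 8755, 8757,
    8761, 8478, 12861, 14622, 9336, 12773, 14578, 8422, 14566, 12725, 8533, 8406, 14550, 8398,
    14542, 12661, 8374, 8366, 14510, 8350, 14494, 8436, 12533, 8733, 8310, 8428, 8412, 8380, 8316,
    15588, 15555, 14684, 14804, 8688, 9160, 15941, 14225, 15241, 9124, 9106, 15250, 9798, 15501,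
    15139, 9060, 14901, 9358, 14621, 14493, 8932, 15076, 8930, 9432, 9400, 8762, 13429, 8658,
    13545],
  .combo [([([], -10)], .out 9620), ([([], -42)], .out 10644), ([([], -30)], .out 10900), ([([],
    -10)], .out 9810), ([([], 6)], .out 15525), ([([], 2)], .out 9556), ([([], 15)], .out 10580),
    ([([], 3)], .out 10836), ([([], 6)], .out 9554), ([([], -2)], .out 15013), ([([], 12)], .out
    10578), ([([], 3)], .out 9546), ([([], -1)], .out 14997), ([([], -8)], .out 10572), ([([],
    7)], .out 9522), ([([], 5)], .out 14949), ([([], 5)], .out 10570), ([([], -13)], .out 9514),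
    ([([], -2)], .out 9876), ([([], 6)], .out 9524), ([([], 9)], .out 9418), ([([], -2)], .out
    9516), ([([], -18)], .out 9394), ([([], -2)], .out 9386), ([([], -2)], .out 9002), ([([],
    -2)], .out 9812), ([([], -4)], .out 9513), ([([], 24)], .out 9382), ([([], 2)], .out 14931),
    ([([], -4)], .out 14745), ([([], 9)], .out 8906), ([([], 2)], .out 14681), ([([], 1)], .out
    8874), ([([], -10)], .out 9385), ([([], -11)], .out 8858), ([([], 26)], .out 9381)],
  .kills [10024],
  .combo [([([], 6)], .out 9620), ([([], -6)], .out 10644), ([([], 6)], .out 10900), ([([], -6)],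
    .out 15525), ([([], -3)], .out 9556), ([([], 3)], .out 10580), ([([], -3)], .out 9554), ([([],
    6)], .out 10834), ([([], -4)], .out 9546), ([([], 2)], .out 14997), ([([], 2)], .out 9548),
    ([([], -10)], .out 10572), ([([], -6)], .out 14949), ([([], 2)], .out 10570), ([([], -2)],
    .out 9514), ([([], 6)], .out 9876), ([([], 2)], .out 14933), ([([], 2)], .out 9516), ([([],
    -1)], .out 9386), ([([], 2)], .out 9002), ([([], 2)], .out 9513), ([([], -10)], .out 9001),
    ([([], -6)], .out 14931), ([([], 4)], .out 14745), ([([], -2)], .out 14681), ([([], -1)], .out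
    8874), ([([], 5)], .out 8873), ([([], 2)], .out 9385), ([([], 2)], .out 8858), ([([], 6)],
    .out 9381), ([([], -10)], .out 8857)],
  .kills [9896, 15690, 10834, 9892, 15658, 10836],
  .combo [([([], 2)], .out 10644), ([([], -1)], .out 10580), ([([], -1)], .out 10578), ([([], 2)],
    .out 10572), ([([], -1)], .out 10570)],
  .kills [10578, 10570, 9828, 15562, 15530, 10644, 10580],
  .combo [([([], 2)], .out 9513), ([([], -2)], .out 13907), ([([], -1)], .out 9385), ([([], 1)],
    .out 13651), ([([], -1)], .out 9381), ([([], 1)], .out 13643), ([([], -2)], .out 13619),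
    ([([], -2)], .out 13611)],
  .kills [8526],
  .combo [([([], -1)], .out 9524), ([([], 1)], .out 14697), ([([], 1)], .out 8858)],
  .kills [9576, 14697, 8554],
  .combo [([([], 1)], .out 9620), ([([], -1)], .out 8906)],
  .kills [8857, 13619, 14643],
  .combo [([([], -1)], .out 9513), ([([], 1)], .out 9385), ([([], -1)], .out 9381)],
  .kills [9513, 9385, 14675, 8853, 13611, 9546, 9514, 9382, 14669, 8873, 13651, 8869, 13643, 9810,
    15145, 9554, 15017, 9426, 14757, 8906, 8858],
  .combo [([([], -2)], .out 15013), ([([], 1)], .out 14933), ([([], -4)], .out 15178), ([([],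
    -1)], .out 15018), ([([], 2)], .out 14998)],
  .kills [9640, 9876, 13973, 14549, 9428, 14761, 8860, 14962, 8650, 15525, 15013, 14997, 14933,
    9516, 9002, 9812, 13909, 15146, 8882, 13669, 15026, 5360, 5058, 5088, 7137, 5352, 5800, 5026,
    5072, 7121, 5348, 5010, 8082, 7652, 5346, 8073, 7650, 4998, 5464, 4962, 5040, 7089, 4934,
    4902, 5318, 5674, 4886, 4878, 4976, 7025, 4785, 4771, 4686, 5198, 5226, 4494, 4662, 4654,
    4638, 4472, 4679, 7311, 7454, 4254, 4412, 6461, 6389, 4381, 4214, 4206, 4190, 4220, 7779,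
    4580, 4728],
  .combo [([([], -1)], .out 5426), ([([], -1)], .out 7882), ([([], -1)], .out 7834)],
  .kills [4968, 7882, 7834, 7770, 4964],
  .combo [([([], -1)], .out 4905), ([([], -1)], .out 4713), ([([], 1)], .out 4709)],
  .kills [4905, 4457, 4713, 6867, 7379],
  .combo [([([], -1)], .out 7590), ([([], -1)], .out 7574), ([([], -1)], .out 7763)],
  .kills [4824, 4530, 7013, 4518, 4502],
  .combo [([([], 1)], .out 4820), ([([], -1)], .out 5460), ([([], -1)], .out 4780), ([([], -2)],
    .out 5420), ([([], 1)], .out 5418), ([([], -1)], .out 4458), ([([], 1)], .out 4438)],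
  .kills [5420, 4952, 5418, 7849, 7850, 5417, 7846, 4773, 5285, 4517, 6987, 7785, 7786, 7782,
    4757, 4501, 6955, 4437, 4693, 6827, 7339, 5460, 5780, 4818, 5714, 4938, 7829, 7589, 5452,
    4810, 4906, 7765, 7573, 5292, 4778, 4522, 4948, 6997, 7594, 4521, 7501, 6995, 7507, 7477,
    4714, 7381, 4458, 6869, 7530, 4444, 4946, 7845, 7593]]

theorem lead011_vanishing_of_split :
    (mkSys 0 1 1 1 ⟨[([0], 1), ([1], 1)], [([0], 1), ([1], -1)], [([2], 1)],
    [([3], 1)], [([4], 1)], [([5], 1)], [([5], 1)], [([7], 1)], [([8], 1)], [([9], 1)]⟩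
    []).eliminates [(1962, [])] lead011_vanishing_of_split_steps
    [(false, 9, 5), (true, 9, 4), (false, 8, 4), (true, 8, 3)] = true := by
  decide +kernel

def lead011_relations_of_eq_steps : List LinSys.Step :=
  [.kills [10720, 10114, 10176, 14273, 10704, 11600, 10050, 10144, 14241, 11848, 11844, 10692,
    10948, 11460, 11588, 16146, 15300, 10690, 16137, 15298, 9990, 10928, 9922, 10080, 14177,
    10920, 10064, 10660, 10916, 9874, 16018, 15268, 10658, 10914, 16009, 15266, 9862, 10032,
    10642, 15945, 11409, 11401, 11402, 9105, 11404, 14115, 15942, 10636, 10892, 9609, 10630,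
    11306, 9750, 9742, 9952, 14049, 9936, 14033, 15762, 15204, 9570, 15753, 15202, 9569, 9904,
    9553, 9545, 10566, 10794, 9030, 9541, 9539, 9840, 10534, 10538, 8998, 9366, 10531, 10515,
    10517, 10521, 10522, 8995, 10524, 13895, 15502, 10410, 9497, 8982, 10382, 10346, 8974, 9270,
    9262, 9246, 8944, 8936, 8920, 9363, 14631, 14926, 9357, 9301, 14619, 14902, 14615, 14894,
    9351, 14607, 14878, 8781, 8502, 8812, 12909, 8494, 8796, 12893, 8775, 8743, 8747, 8755, 8757,
    8761, 8478, 12861, 14622, 9336, 12773, 14578, 8422, 14566, 12725, 8533, 8406, 14550, 8398,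
    14542, 12661, 8374, 8366, 14510, 8350, 14494, 8436, 12533, 8733, 8310, 8428, 8412, 8380, 8316,
    15588, 15555, 14684, 14804, 8688, 9160, 15941, 14225, 15241, 9124, 9106, 15250, 9798, 15501,
    15139, 9060, 14901, 9358, 14621, 14493, 8932, 15076, 8930, 9432, 9400, 8762, 13429, 8658,
    13545],
  .combo [([([], -10)], .out 9620), ([([], -42)], .out 10644), ([([], -30)], .out 10900), ([([],
    -10)], .out 9810), ([([], 6)], .out 15525), ([([], 2)], .out 9556), ([([], 15)], .out 10580),
    ([([], 3)], .out 10836), ([([], 6)], .out 9554), ([([], -2)], .out 15013), ([([], 12)], .out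
    10578), ([([], 3)], .out 9546), ([([], -1)], .out 14997), ([([], -8)], .out 10572), ([([],
    7)], .out 9522), ([([], 5)], .out 14949), ([([], 5)], .out 10570), ([([], -13)], .out 9514),
    ([([], -2)], .out 9876), ([([], 6)], .out 9524), ([([], 9)], .out 9418), ([([], -2)], .out
    9516), ([([], -18)], .out 9394), ([([], -2)], .out 9386), ([([], -2)], .out 9002), ([([],
    -2)], .out 9812), ([([], -4)], .out 9513), ([([], 24)], .out 9382), ([([], 2)], .out 14931),
    ([([], -4)], .out 14745), ([([], 9)], .out 8906), ([([], 2)], .out 14681), ([([], 1)], .out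
    8874), ([([], -10)], .out 9385), ([([], -11)], .out 8858), ([([], 26)], .out 9381)],
  .kills [10024],
  .combo [([([], 6)], .out 9620), ([([], -6)], .out 10644), ([([], 6)], .out 10900), ([([], -6)],
    .out 15525), ([([], -3)], .out 9556), ([([], 3)], .out 10580), ([([], -3)], .out 9554), ([([],
    6)], .out 10834), ([([], -4)], .out 9546), ([([], 2)], .out 14997), ([([], 2)], .out 9548),
    ([([], -10)], .out 10572), ([([], -6)], .out 14949), ([([], 2)], .out 10570), ([([], -2)],
    .out 9514), ([([], 6)], .out 9876), ([([], 2)], .out 14933), ([([], 2)], .out 9516), ([([],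
    -1)], .out 9386), ([([], 2)], .out 9002), ([([], 2)], .out 9513), ([([], -10)], .out 9001),
    ([([], -6)], .out 14931), ([([], 4)], .out 14745), ([([], -2)], .out 14681), ([([], -1)], .out
    8874), ([([], 5)], .out 8873), ([([], 2)], .out 9385), ([([], 2)], .out 8858), ([([], 6)],
    .out 9381), ([([], -10)], .out 8857)],
  .kills [9896, 15690, 10834, 9892, 15658, 10836],
  .combo [([([], 2)], .out 10644), ([([], -1)], .out 10580), ([([], -1)], .out 10578), ([([], 2)],
    .out 10572), ([([], -1)], .out 10570)],
  .kills [10578, 10570, 9828, 15562, 15530, 10644, 10580],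
  .combo [([([], 2)], .out 9513), ([([], -2)], .out 13907), ([([], -1)], .out 9385), ([([], 1)],
    .out 13651), ([([], -1)], .out 9381), ([([], 1)], .out 13643), ([([], -2)], .out 13619),
    ([([], -2)], .out 13611)],
  .kills [8526],
  .combo [([([], -1)], .out 9524), ([([], 1)], .out 14697), ([([], 1)], .out 8858)],
  .kills [9576, 14697, 8554],
  .combo [([([], 1)], .out 9620), ([([], -1)], .out 8906)],
  .kills [8857, 13619, 14643],
  .combo [([([], -1)], .out 9513), ([([], 1)], .out 9385), ([([], -1)], .out 9381)],
  .kills [9513, 9385, 14675, 8853, 13611, 9546, 9514, 9382, 14669, 8873, 13651, 8869, 13643, 9810,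
    15145, 9554, 15017, 9426, 14757, 8906, 8858],
  .combo [([([], -2)], .out 15013), ([([], 1)], .out 14933), ([([], -4)], .out 15178), ([([],
    -1)], .out 15018), ([([], 2)], .out 14998)],
  .kills [9640, 9876, 13973, 14549, 9428, 14761, 8860, 14962, 8650, 15525, 15013, 14997, 14933,
    9516, 9002, 9812, 13909, 15146, 8882, 13669, 15026, 5360, 5058, 5088, 7137, 5352, 5800, 5026,
    5072, 7121, 5348, 5010, 8082, 7652, 5346, 8073, 7650, 4998, 5464, 4962, 5040, 7089, 4934,
    4902, 5318, 5674, 4886, 4878, 4976, 7025, 4785, 4771, 4686, 5198, 5226, 4494, 4662, 4654,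
    4638, 4472, 4679, 7311, 7454, 4254, 4412, 6461, 6389, 4381, 4214, 4206, 4190, 4220, 7779,
    4580, 4728],
  .combo [([([], -1)], .out 5426), ([([], -1)], .out 7882), ([([], -1)], .out 7834)],
  .kills [4968, 7882, 7834, 7770, 4964],
  .combo [([([], -1)], .out 4905), ([([], -1)], .out 4713), ([([], 1)], .out 4709)],
  .kills [4905, 4457, 4713, 6867, 7379],
  .combo [([([], -1)], .out 7590), ([([], -1)], .out 7574), ([([], -1)], .out 7763)],
  .kills [4824, 4530, 7013, 4518, 4502],
  .combo [([([], 1)], .out 4820), ([([], -1)], .out 5460), ([([], -1)], .out 4780), ([([], -2)],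
    .out 5420), ([([], 1)], .out 5418), ([([], -1)], .out 4458), ([([], 1)], .out 4438)],
  .kills [5420, 4952, 5418, 7849, 7850, 5417, 7846, 4773, 5285, 4517, 6987, 7785, 7786, 7782,
    4757, 4501, 6955, 4437, 4693, 6827, 7339, 5460, 5780, 4818, 5714, 4938, 7829, 7589, 5452,
    4810, 4906, 7765, 7573, 5292, 4778, 4522, 4948, 6997, 7594, 4521, 7501, 6995, 7507, 7477,
    4714, 7381, 4458, 6869, 7530, 4444, 4946, 7845, 7593, 10688, 9986, 10112, 14209, 10656, 10912,
    9858, 10048, 14145, 11408, 11400, 11396, 10632, 10888, 15890, 15236, 10626, 15881, 15234,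
    9734, 9920, 14017, 9888, 10824, 10820, 10564, 15634, 15172, 10562, 15625, 15170, 9537, 9824,
    9808, 10532, 15506, 15140, 10530, 10514, 10516, 15498, 10529, 10513, 10505, 10506, 8993,
    10508, 13891, 15494, 10392, 9314, 9776, 13873, 15433, 9489, 10374, 10282, 8966, 9238, 9230,
    8928, 8912, 9361, 9353, 8849, 13603, 14627, 14611, 9349, 14603, 14870, 9347, 14599, 14862,
    8777, 13459, 14630, 8773, 8741, 8745, 8470, 12845, 14614, 8771, 8739, 8723, 8725, 8729, 8462,
    12829, 14606, 8390, 9304, 12645, 14514, 8358, 14502, 8342, 14486, 8334, 14478, 9272, 12517,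
    14450, 8294, 14438, 8372, 12469, 8278, 14422, 8270, 14414, 8308, 12405, 8717, 8246, 8300,
    8284, 8252, 15560, 15940, 15524, 14668, 14620, 14508, 14540, 14564, 8672, 8656, 13988, 14114,
    13201, 13540, 8624, 13137, 13970, 8612, 13522, 13097, 8560, 13610, 8432, 9794, 9104, 15493,
    14113, 15113, 9506, 9032, 14917, 13969, 14985, 14869, 9362, 9800, 14629, 13897, 15505, 14921,
    9354, 8994, 9796, 14613, 13893, 15138, 9350, 14605, 9440, 9424, 8904, 13713, 15048, 14729,
    8898, 8866, 8872, 8850, 14994, 8802, 8856, 14641, 8778, 13461, 8774, 9356, 13453, 14918, 9292,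
    9300, 14617, 14898, 13397, 13389, 8730, 13365, 14561, 8594, 14738, 8788, 8498, 12901, 14618,
    8500, 9384, 8868],
  .combo [([([], -1)], .out 9380), ([([], 1)], .out 8786), ([([], 1)], .sum 0)],
  .kills [14501, 9380, 8786, 8852, 5344, 4994, 5056, 7105, 5328, 5456, 4930, 5024, 7073, 5704,
    5700, 5316, 5444, 7954, 7620, 5314, 7945, 7618, 4870, 4960, 7009, 4944, 5284, 7826, 7588,
    5282, 7817, 7586, 4769, 4912, 5266, 7753, 5265, 5257, 5258, 4497, 5260, 6947, 7750, 4745,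
    5190, 5162, 4486, 4630, 4622, 4464, 4456, 4681, 7315, 7462, 4677, 7307, 7446, 4675, 7303,
    7438, 4262, 6477, 6739, 7334, 4389, 4387, 4371, 4373, 4377, 4238, 6429, 7310, 4664, 6373,
    7282, 4198, 7270, 6325, 4182, 7254, 4174, 7246, 4212, 6261, 4365, 4150, 4204, 4188, 4156,
    7780, 7340, 7380, 4336, 4898, 4552, 7749, 7057, 7561, 4516, 7445, 4498, 7317, 7570, 4678,
    7309, 7269, 7253, 7245, 4452, 4708, 7524, 4450, 4696, 7337, 7508, 4402, 4428, 4378, 6709,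
    4306, 6761],
  .combo [([([], -1)], .out 4426), ([([], -1)], .out 7498)],
  .kills [4500, 7333, 7465, 4426]]

def lead011_relations_of_eq_rows : List (List (Poly × Row)) :=
  [[([([], 3)], .out 2708), ([([], -1)], .out 2644), ([([], 3)], .out 2452), ([([], -1)], .out
    2388), ([([], -1)], .out 2386), ([([], 1)], .out 2380), ([([], 1)], .out 2346), ([([], 1)],
    .out 2345), ([([], -1)], .out 2258), ([([], -1)], .out 2250), ([([], 1)], .out 2218), ([([],
    1)], .out 2217), ([([], -3)], .out 2214), ([([], -3)], .out 2213), ([([], 1)], .out 3881),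
    ([([], -1)], .out 3749), ([([], 1)], .out 3733), ([([], -1)], .out 3673)],
  [([([], -18)], .out 1428), ([([], 11)], .out 1380), ([([], 2)], .out 1364), ([([], -18)], .out
    1356), ([([], 10)], .out 1354), ([([], 14)], .out 1332), ([([], 26)], .out 1330), ([([], -8)],
    .out 1236), ([([], -10)], .out 1234), ([([], 25)], .out 1226), ([([], -5)], .out 1202), ([([],
    8)], .out 1196), ([([], -13)], .out 1190), ([([], -10)], .out 1189), ([([], -1)], .out 1178),
    ([([], -34)], .out 1177), ([([], -4)], .out 1130), ([([], -10)], .out 1129), ([([], 24)], .out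
    1125), ([([], -18)], .out 1113), ([([], 4)], .out 1110), ([([], -2)], .out 1109), ([([], 28)],
    .out 1107), ([([], -17)], .out 1101), ([([], -1)], .out 1961), ([([], -10)], .out 1957),
    ([([], 8)], .out 1945), ([([], 23)], .out 1941), ([([], 1)], .out 1898), ([([], -2)], .out
    1894), ([([], -3)], .out 1881), ([([], -21)], .out 1875), ([([], 6)], .out 1867), ([([], 1)],
    .out 1845), ([([], -8)], .out 1843), ([([], 3)], .out 1835), ([([], 6)], .out 1741), ([([],
    -3)], .out 1709), ([([0], -9)], .out 2644), ([([0], 12)], .out 2642), ([([0], 3)], .out 2386),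
    ([([0], 27)], .out 2380), ([([0], -3)], .out 2346), ([([0], -18)], .out 2345), ([([0], -27)],
    .out 2250), ([([0], 3)], .out 2218), ([([0], 9)], .out 2217), ([([0], -12)], .out 2213),
    ([([0], -18)], .out 3914), ([([0], -6)], .out 3786), ([([0], 3)], .out 3754), ([([0], 21)],
    .out 3749), ([([0], 6)], .out 3734), ([([0], -21)], .out 3733)]]

theorem lead011_relations_of_eq :
    (mkSys 0 1 1 2 ⟨[([0], 1)], [([0], 1)], [([2], 1)], [([3], 1)], [([4], 1)],
    [([5], 1)], [([5], 1)], [([7], 1)], [([8], 1)], [([9], 1)]⟩ []).relations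
    [(1962, [([14], 2)]), (917, [([10], 2)]), (869, [([11], 2)]), (853, [([12], 2)]), (851,
    [([13], 2)])] lead011_relations_of_eq_steps lead011_relations_of_eq_rows =
      [some [([0, 10], 24), ([0, 11], 24), ([0, 12], 24), ([0, 13], 24), ([2], 12)], some [([0,
    2], 36)]] := by
  decide +kernel

def lead011_relations_of_ne_steps : List LinSys.Step :=
  [.kills [10688, 9986, 10112, 14209, 10656, 10912, 9858, 10048, 14145, 11408, 11400, 11396,
    10632, 10888, 15890, 15236, 10626, 15881, 15234, 9734, 9920, 14017, 9888, 10824, 10820, 10564,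
    15634, 15172, 10562, 15625, 15170, 9537, 9824, 9808, 10532, 15506, 15140, 10530, 10514, 10516,
    15498, 10529, 10513, 10505, 10506, 8993, 10508, 13891, 15494, 10392, 9314, 9776, 13873, 15433,
    9489, 10374, 10282, 8966, 9238, 9230, 8928, 8912, 9361, 9353, 8849, 13603, 14627, 14611, 9349,
    14603, 14870, 9347, 14599, 14862, 8777, 13459, 14630, 8773, 8741, 8745, 8470, 12845, 14614,
    8771, 8739, 8723, 8725, 8729, 8462, 12829, 14606, 8390, 9304, 12645, 14514, 8358, 14502, 8342,
    14486, 8334, 14478, 9272, 12517, 14450, 8294, 14438, 8372, 12469, 8278, 14422, 8270, 14414,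
    8308, 12405, 8717, 8246, 8300, 8284, 8252, 15560, 15940, 15524, 14668, 14620, 14508, 14540,
    14564, 8672, 8656, 13988, 14114, 13201, 13540, 8624, 13137, 13970, 8612, 13522, 13097, 8560,
    13610, 8432, 9794, 9104, 15493, 14113, 15113, 9506, 9032, 14917, 13969, 14985, 14869, 9362,
    9800, 14629, 13897, 15505, 14921, 9354, 8994, 9796, 14613, 13893, 15138, 9350, 14605, 9440,
    9424, 8904, 13713, 15048, 14729, 8898, 8866, 8872, 8850, 14994, 8802, 8856, 14641, 8778,
    13461, 8774, 9356, 13453, 14918, 9292, 9300, 14617, 14898, 13397, 13389, 8730, 13365, 14561,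
    8594, 14738, 8788, 8498, 12901, 14618, 8500, 9384, 8868],
  .combo [([([], -1)], .out 9380), ([([], 1)], .out 8786), ([([], 1)], .sum 0)],
  .kills [14501, 9380, 8786, 8852, 5344, 4994, 5056, 7105, 5328, 5456, 4930, 5024, 7073, 5704,
    5700, 5316, 5444, 7954, 7620, 5314, 7945, 7618, 4870, 4960, 7009, 4944, 5284, 7826, 7588,
    5282, 7817, 7586, 4769, 4912, 5266, 7753, 5265, 5257, 5258, 4497, 5260, 6947, 7750, 4745,
    5190, 5162, 4486, 4630, 4622, 4464, 4456, 4681, 7315, 7462, 4677, 7307, 7446, 4675, 7303,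
    7438, 4262, 6477, 6739, 7334, 4389, 4387, 4371, 4373, 4377, 4238, 6429, 7310, 4664, 6373,
    7282, 4198, 7270, 6325, 4182, 7254, 4174, 7246, 4212, 6261, 4365, 4150, 4204, 4188, 4156,
    7780, 7340, 7380, 4336, 4898, 4552, 7749, 7057, 7561, 4516, 7445, 4498, 7317, 7570, 4678,
    7309, 7269, 7253, 7245, 4452, 4708, 7524, 4450, 4696, 7337, 7508, 4402, 4428, 4378, 6709,
    4306, 6761],
  .combo [([([], -1)], .out 4426), ([([], -1)], .out 7498)],
  .kills [4500, 7333, 7465, 4426]]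

def lead011_relations_of_ne_rows : List (List (Poly × Row)) :=
  [[([([], 3)], .out 2708), ([([], -1)], .out 2644), ([([], 3)], .out 2452), ([([], -1)], .out
    2388), ([([], -1)], .out 2386), ([([], 1)], .out 2380), ([([], 1)], .out 2346), ([([], 1)],
    .out 2345), ([([], -1)], .out 2258), ([([], -1)], .out 2250), ([([], 1)], .out 2218), ([([],
    1)], .out 2217), ([([], -3)], .out 2214), ([([], -3)], .out 2213), ([([], 1)], .out 3881),
    ([([], -1)], .out 3749), ([([], 1)], .out 3733), ([([], -1)], .out 3673)],
  [([([], -1)], .out 1444), ([([], 1)], .out 1428), ([([], -1)], .out 1362), ([([], 1)], .out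
    1354), ([([], -1)], .out 1189), ([([], 1)], .out 1173), ([([], -1)], .out 1107), ([([], 1)],
    .out 1099), ([([], 1)], .out 1957), ([([], -1)], .out 1941), ([([], 1)], .out 1875), ([([],
    -1)], .out 1867)]]

theorem lead011_relations_of_ne :
    (mkSys 0 1 1 2 ⟨[([0], 1), ([1], 1)], [([0], 1), ([1], -1)], [([2], 1)],
    [([3], 1)], [([4], 1)], [([5], 1)], [([5], 1)], [([7], 1)], [([8], 1)], [([9], 1)]⟩ [(false,
    9, 5), (true, 9, 4), (false, 8, 4), (true, 8, 3)]).relations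
    [(917, [([10], 2)]), (869, [([11], 2)]), (853, [([12], 2)]), (851, [([13], 2)])]
    lead011_relations_of_ne_steps lead011_relations_of_ne_rows =
      [some [([0, 1], 48), ([0, 10], 24), ([0, 11], 24), ([0, 12], 24), ([0, 13], 24), ([1, 1],
    48), ([1, 11], 24), ([1, 12], 24), ([1, 13], 48), ([2], 12)], some [([1, 3], 16), ([3, 10],
    8), ([3, 11], 8), ([3, 12], 8), ([3, 13], 8)]] := by
  decide +kernel

def lead011_relations_reduced_steps : List LinSys.Step :=
  [.kills [10688, 9986, 10112, 14209, 10656, 10912, 9858, 10048, 14145, 11408, 11400, 11396,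
    10632, 10888, 15890, 15236, 10626, 15881, 15234, 9734, 9920, 14017, 9888, 10824, 10820, 10564,
    15634, 15172, 10562, 15625, 15170, 9537, 9824, 9808, 10532, 15506, 15140, 10530, 10514, 10516,
    15498, 10529, 10513, 10505, 10506, 8993, 10508, 13891, 15494, 10392, 9314, 9776, 13873, 15433,
    9489, 10374, 10282, 8966, 9238, 9230, 8928, 8912, 9361, 9353, 8849, 13603, 14627, 14611, 9349,
    14603, 14870, 9347, 14599, 14862, 8777, 13459, 14630, 8773, 8741, 8745, 8470, 12845, 14614,
    8771, 8739, 8723, 8725, 8729, 8462, 12829, 14606, 8390, 9304, 12645, 14514, 8358, 14502, 8342,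
    14486, 8334, 14478, 9272, 12517, 14450, 8294, 14438, 8372, 12469, 8278, 14422, 8270, 14414,
    8308, 12405, 8717, 8246, 8300, 8284, 8252, 15560, 15940, 15524, 14668, 14620, 14508, 14540,
    14564, 8672, 8656, 13988, 14114, 13201, 13540, 8624, 13137, 13970, 8612, 13522, 13097, 8560,
    13610, 8432, 9794, 9104, 15493, 14113, 15113, 9506, 9032, 14917, 13969, 14985, 14869, 9362,
    9800, 14629, 13897, 15505, 14921, 9354, 8994, 9796, 14613, 13893, 15138, 9350, 14605, 9440,
    9424, 8904, 13713, 15048, 14729, 8898, 8866, 8872, 8850, 14994, 8802, 8856, 14641, 8778,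
    13461, 8774, 9356, 13453, 14918, 9292, 9300, 14617, 14898, 13397, 13389, 8730, 13365, 14561,
    8594, 14738, 8788, 8498, 12901, 14618, 8500, 9384, 8868],
  .combo [([([], -1)], .out 9380), ([([], 1)], .out 8786), ([([], 1)], .sum 0)],
  .kills [14501, 9380, 8786, 8852, 5344, 4994, 5056, 7105, 5328, 5456, 4930, 5024, 7073, 5704,
    5700, 5316, 5444, 7954, 7620, 5314, 7945, 7618, 4870, 4960, 7009, 4944, 5284, 7826, 7588,
    5282, 7817, 7586, 4769, 4912, 5266, 7753, 5265, 5257, 5258, 4497, 5260, 6947, 7750, 4745,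
    5190, 5162, 4486, 4630, 4622, 4464, 4456, 4681, 7315, 7462, 4677, 7307, 7446, 4675, 7303,
    7438, 4262, 6477, 6739, 7334, 4389, 4387, 4371, 4373, 4377, 4238, 6429, 7310, 4664, 6373,
    7282, 4198, 7270, 6325, 4182, 7254, 4174, 7246, 4212, 6261, 4365, 4150, 4204, 4188, 4156,
    7780, 7340, 7380, 4336, 4898, 4552, 7749, 7057, 7561, 4516, 7445, 4498, 7317, 7570, 4678,
    7309, 7269, 7253, 7245, 4452, 4708, 7524, 4450, 4696, 7337, 7508, 4402, 4428, 4378, 6709,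
    4306, 6761],
  .combo [([([], -1)], .out 4426), ([([], -1)], .out 7498)],
  .kills [4500, 7333, 7465, 4426, 2672, 2498, 2528, 3553, 2664, 2728, 2466, 2512, 3537, 2660,
    2450, 3986, 3812, 2658, 3977, 3810, 2438, 2480, 3505, 2708, 2472, 3497, 2642, 2468, 2385,
    3882, 2342, 2598, 2602, 2246, 2326, 2318, 2232, 2339, 3655, 3726, 2162, 3301, 3385, 2126,
    3189, 2189, 2102, 2094, 2108, 2644],
  .combo [([([], -1)], .out 3753), ([([], -1)], .out 2378), ([([], 1)], .out 2345)],
  .kills [2404],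
  .combo [([([], -1)], .out 2380), ([([], -1)], .out 3429), ([([], -1)], .out 3405)],
  .kills [3629, 2226, 3762],
  .combo [([([], 1)], .out 2388), ([([], 2)], .out 2250), ([([], -2)], .out 2452), ([([], -1)],
    .out 2218), ([([], -2)], .out 2217), ([([], 2)], .out 2345), ([([], -2)], .out 2213)],
  .kills [2220, 2213, 3373, 2345, 3411, 2150, 2386, 2354, 3685, 2214, 3733, 2218, 3413, 3754],
  .combo [([([], 1)], .sum 4)],
  .combo [([([], 1)], .sum 5)]]

def lead011_relations_reduced_rows : List (List (Poly × Row)) :=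
  [[([([], 12)], .out 1428), ([([], 5)], .out 1364), ([([], 102)], .out 1362), ([([], -90)], .out
    1354), ([([], -22)], .out 1332), ([([], 98)], .out 1324), ([([], -20)], .out 1322), ([([],
    -28)], .out 1236), ([([], 56)], .out 1228), ([([], -108)], .out 1202), ([([], 1)], .out 1194),
    ([([], 74)], .out 1193), ([([], 32)], .out 1190), ([([], -66)], .out 1189), ([([], -2)], .out
    1178), ([([], -40)], .out 1177), ([([], 74)], .out 1174), ([([], 16)], .out 1173), ([([],
    28)], .out 1130), ([([], -56)], .out 1126), ([([], -27)], .out 1109), ([([], -20)], .out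
    1107)],
  [([([], 64)], .out 1428), ([([], 55)], .out 1362), ([([], 54)], .out 1356), ([([], -55)], .out
    1354), ([([], -37)], .out 1332), ([([], -82)], .out 1330), ([([], 12)], .out 1324), ([([],
    -9)], .out 1236), ([([], -27)], .out 1234), ([([], 24)], .out 1228), ([([], 28)], .out 1226),
    ([([], -60)], .out 1202), ([([], -3)], .out 1196), ([([], 31)], .out 1193), ([([], 60)], .out
    1190), ([([], -31)], .out 1189), ([([], -1)], .out 1178), ([([], -58)], .out 1177), ([([],
    9)], .out 1130), ([([], -39)], .out 1129), ([([], -24)], .out 1126), ([([], 22)], .out 1125),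
    ([([], 3)], .out 1110)],
  [([([], -1)], .out 1362), ([([], 1)], .out 1322), ([([], 1)], .out 1236), ([([], -2)], .out
    1226), ([([], 2)], .out 1202), ([([], -1)], .out 1196), ([([], 1)], .out 1193), ([([], -2)],
    .out 1190), ([([], 2)], .out 1178), ([([], -1)], .out 1173), ([([], -1)], .out 1130), ([([],
    1)], .out 1110)],
  [([([], 6)], .out 1428), ([([], 26)], .out 1364), ([([], -41)], .out 1362), ([([], -10)], .out
    1356), ([([], -112)], .out 1332), ([([], 160)], .out 1330), ([([], -37)], .out 1236), ([([],
    78)], .out 1234), ([([], 74)], .out 1228), ([([], -42)], .out 1202), ([([], 13)], .out 1194),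
    ([([], -57)], .out 1193), ([([], 16)], .out 1190), ([([], -80)], .out 1178), ([([], 156)],
    .out 1177), ([([], -24)], .out 1174), ([([], -6)], .out 1173), ([([], 13)], .out 1130), ([([],
    54)], .out 1129), ([([], -74)], .out 1126), ([([], 24)], .out 1110), ([([], 24)], .out 1957),
    ([([], -24)], .out 1867)],
  [([([], 2)], .out 1428), ([([], -1)], .out 1364), ([([], 6)], .out 1362), ([([], 4)], .out
    1356), ([([], -5)], .out 1354), ([([], -4)], .out 1332), ([([], -6)], .out 1330), ([([], 2)],
    .out 1234), ([([], -4)], .out 1226), ([([], 1)], .out 1204), ([([], -2)], .out 1202), ([([],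
    4)], .out 1190), ([([], 5)], .out 1189), ([([], 2)], .out 1178), ([([], 6)], .out 1177),
    ([([], -2)], .out 1174), ([([], -6)], .out 1173), ([([], -4)], .out 1125), ([([], -1)], .out
    1114), ([([], 4)], .out 1113), ([([], 1)], .out 1109), ([([], -2)], .out 1107)]]

theorem lead011_relations_reduced :
    (mkSys 0 1 1 2 ⟨[([0], 1), ([1], 1)], [([0], 1), ([1], -1)], [([1, 14],
    2)], [([3], 1)], [([4], 1)], [([5], 1)], [([5], 1)], [([7], 1)], [([8], 1)], [([9], 1)]⟩
    [(false, 9, 5), (true, 9, 4), (false, 8, 4), (true, 8, 3)]).relations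
    [(917, [([10], 2)]), (869, [([11], 2)]), (853, [([1], -4), ([10], -4), ([11], -2), ([14],
    2)]), (851, [([10], 2), ([14], -2)]), (340, [([12], 2)])] lead011_relations_reduced_steps
    lead011_relations_reduced_rows =
      [some [([0, 1, 1], -576), ([0, 1, 10], -1440), ([0, 1, 11], -576), ([0, 1, 14], 432), ([1,
    1, 1], -288), ([1, 1, 10], -288), ([1, 1, 11], 576), ([1, 10, 14], 288), ([1, 12], 576)], some
    [([0, 1, 1], -144), ([0, 1, 10], -432), ([0, 1, 11], -576), ([0, 1, 14], -72), ([1, 1, 1],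
    -288), ([1, 1, 10], -288), ([1, 1, 11], 576), ([1, 12], 576), ([1, 14, 14], 144)], some [([0,
    1, 1], 32), ([0, 1, 10], 96), ([0, 1, 14], -48), ([1, 1, 14], 32)], some [([0, 0, 1], 576),
    ([0, 0, 10], 864), ([0, 0, 14], -432), ([0, 1, 1], -144), ([0, 1, 10], -432), ([0, 1, 11],
    -1152), ([0, 1, 14], -72), ([1, 1, 1], -576), ([1, 1, 10], -288), ([1, 1, 11], 1152), ([1,
    12], 1152), ([3, 10], -288), ([3, 14], 144)], some [([0, 1, 11], -144), ([0, 1, 14], -72),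
    ([1, 1, 1], -48), ([1, 1, 11], 144), ([1, 3], 48), ([1, 12], 144)]] := by
  decide +kernel

/-! ### Shifted systems as linear combinations of words -/

/-- The linear combination given by the shifted system. -/
def Params.combo {R M : Type*} [CommRing R] [AddCommGroup M] [Module R M] (a1 a2 a3 : ℤ)
    (V : Params R) (f : Bool → Word → M) : M :=
  (a1 : R) • f false [false, false, false, true] +
  ((a2 : R) • f false [false, false, true, false] +
  ((a3 : R) • f false [false, true, false, false] +
  (((2 - a1 - a2 - a3 : ℤ) : R) • f false [true, false, false, false] +
  (((-a1 : ℤ) : R) • f true [false, false, true, true] +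
  (((-a1 - a2 : ℤ) : R) • f true [false, true, false, true] +
  (((1 - a2 - a3 : ℤ) : R) • f true [true, false, false, true] +
  (((a1 + a2 - 2 : ℤ) : R) • f true [true, false, true, false] +
  (((a1 + a2 + a3 - 2 : ℤ) : R) • f true [true, true, false, false] +
  (V.C1 • f false [false, false, true] +
  ((- V.C1 - V.C2) • f false [false, true, false] +
  (V.C2 • f false [true, false, false] +
  ((- V.C1) • f true [false, true, true] +
  ((V.C1 + V.C2) • f true [true, false, true] +
  ((- V.C2) • f true [true, true, false] +
  ((- V.x - V.p) • f false [false, true] +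
  ((V.x - V.p) • f false [true, false] +
  (V.p • f true [true, true] +
  ((-2 * V.q) • f false [true] +
  ((- V.k1) • f false [false, false] +
  (V.e1 • f true [false, true] +
  ((2 * V.k1 - V.e1) • f true [true, false] +
  (V.th1 • f false [false] +
  ((- V.th1) • f true [true] +
  (V.th0 • f false [] + V.k3 • f true []))))))))))))))))))))))))

theorem VField.sum_map_push {R M : Type*} [CommRing R] [AddCommGroup M] [Module R M]
    (env : ℕ → R) (f : Bool → Word → M) (c : Bool) (m : Word) (q : Poly) (L : VField) :
    ((VField.push c m q L).map fun t => t.2.2.eval env • f t.1 t.2.1).sum =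
      q.eval env • f c m + (L.map fun t => t.2.2.eval env • f t.1 t.2.1).sum := by
  cases q with
  | nil => simp [VField.push, Poly.eval]
  | cons t q => simp [VField.push]

theorem sum_map_mkField {R M : Type*} [CommRing R] [AddCommGroup M] [Module R M]
    (a1 a2 a3 : ℤ) {env : ℕ → R} {P : Params Poly} {V : Params R} (hP : P.eval env = V)
    (f : Bool → Word → M) :
    ((mkField a1 a2 a3 P).map fun t => t.2.2.eval env • f t.1 t.2.1).sum =
      V.combo a1 a2 a3 f := by
  subst hP
  simp only [mkField, VField.sum_map_push, Params.combo, Params.eval, Poly.eval_add,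
    Poly.eval_smul, Poly.eval_const, List.map_nil, List.sum_nil, add_zero, Int.cast_neg,
    Int.cast_one, Int.cast_ofNat, neg_mul, one_mul, ← sub_eq_add_neg]

theorem VField.eval_eq_sum (env : ℕ → ℂ[X]) (L : VField) (i : Bool) :
    L.eval env i = (L.map fun t => t.2.2.eval env • if t.1 = i then word t.2.1 else 0).sum := by
  induction L with
  | nil => rfl
  | cons t L ih =>
    obtain ⟨c, m, q⟩ := t
    simp only [VField.eval, ih, List.map_cons, List.sum_cons, smul_ite, smul_zero]

/-- The coefficient of the term `m` in the component `c` of the system in `VField.pull`. -/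
def pullCoeff {R : Type*} [CommRing R] (g : Bool → Word → R) (i : Bool) (o : Word) (n : ℕ)
    (c : Bool) (m : Word) : R :=
  if m.length + 9 ≤ n then 0 else ((Word.subs c m o []).map (g i)).sum -
    if c = i then ((Word.holes (n + 1 - m.length) m o).map fun x => g x.1 x.2).sum else 0

theorem LForm.eval_pull {R : Type*} [CommRing R] (env : ℕ → R) (g : Bool → Word → R)
    (i : Bool) (o : Word) (n : ℕ) (L : VField) : LForm.eval env g (L.pull i o n) =
      (L.map fun t => t.2.2.eval env • pullCoeff g i o n t.1 t.2.1).sum := by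
  induction L with
  | nil => rfl
  | cons t L ih =>
    rw [VField.pull_cons, LForm.eval_append, ih, List.map_cons, List.sum_cons]
    congr 1
    obtain ⟨c, m, q⟩ := t
    have h1 : ∀ l : List Word, LForm.eval env g (l.map fun w => (q, i, w)) =
        q.eval env * (l.map (g i)).sum := by
      intro l
      induction l with
      | nil => simp [LForm.eval]
      | cons a l ih => simp [LForm.eval, ih, mul_add]
    have h2 : ∀ l : List (Bool × Word), LForm.eval env g
        (l.map fun t => (Poly.smul (-1) q, t.1, t.2)) =
          - (q.eval env * (l.map fun t => g t.1 t.2).sum) := by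
      intro l
      induction l with
      | nil => simp [LForm.eval]
      | cons a l ih =>
        simp only [List.map_cons, LForm.eval, ih, Poly.eval_smul, List.sum_cons]
        push_cast; ring
    simp only [pullCoeff, smul_eq_mul]
    split_ifs with h3 h4
    · simp [LForm.eval]
    · rw [LForm.eval_append, h1, h2]; ring
    · rw [LForm.eval_append, h1]; simp [LForm.eval]

theorem map_pullCoeff {R S : Type*} [CommRing R] [CommRing S] (φ : R →+* S)
    (g : Bool → Word → R) (i : Bool) (o : Word) (n : ℕ) (c : Bool) (m : Word) :
    φ (pullCoeff g i o n c m) = pullCoeff (fun c w => φ (g c w)) i o n c m := by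
  simp only [pullCoeff]
  split_ifs <;> simp [map_list_sum, Function.comp_def]

theorem Params.map_combo {R S : Type*} [CommRing R] [CommRing S] (φ : R →+* S) (a1 a2 a3 : ℤ)
    (V : Params R) (f : Bool → Word → R) :
    φ (V.combo a1 a2 a3 f) = (V.map φ).combo a1 a2 a3 fun c w => φ (f c w) := by
  simp [Params.combo, Params.map, map_ofNat φ]

/-- The values of the sums in `mkSums`. -/
def sumVals {R : Type*} [CommRing R] (V : Params R) : List (Bool × ℕ × ℕ × R) :=
  [(false, 9, 6, 2), (true, 9, 5, -3), (false, 8, 5, 0), (true, 8, 4, 0),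
   (false, 7, 4, -4 * V.p), (true, 7, 3, 4 * V.p),
   (false, 6, 3, -4 * V.q), (true, 6, 2, 3 * V.q),
   (false, 5, 2, 2 * V.p ^ 2), (true, 5, 1, - V.p ^ 2),
   (false, 7, 5, -3 * V.k1), (true, 7, 4, 5 * V.k1),
   (false, 5, 4, V.k1 ^ 2 - 2 * V.k3), (true, 5, 3, -2 * (V.k1 ^ 2 - 2 * V.k3))]

theorem mkSums_eval {R : Type*} [CommRing R] {env : ℕ → R} {P : Params Poly} {V : Params R}
    (hP : P.eval env = V) :
    (mkSums P).map (fun t => (t.1, t.2.1, t.2.2.1, t.2.2.2.eval env)) = sumVals V := by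
  subst hP
  simp [mkSums, sumVals, Params.eval, Poly.eval_smul, Poly.eval_addMul, Poly.eval_const,
    Poly.eval_nil, sq, sub_eq_add_neg]

theorem IsSymmetry.mk' {R : Type*} [CommRing R] {a1 a2 a3 : ℤ} {V : Params R}
    {g : Bool → Word → R}
    (pull : ∀ i o, V.combo a1 a2 a3 (pullCoeff g i o o.length) = 0)
    (long : ∀ c w, 10 ≤ w.length → g c w = 0)
    (sums : ∀ c n i r, (c, n, i, r) ∈ sumVals V → ((Word.all n i).map (g c)).sum = r) :
    IsSymmetry a1 a2 a3 V g where
  pull env P hP i o := by rw [LForm.eval_pull, sum_map_mkField a1 a2 a3 hP, pull]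
  long := long
  sums env P hP c n i p hp := by
    apply sums
    rw [← mkSums_eval hP]
    exact List.mem_map.2 ⟨_, hp, rfl⟩

theorem IsSymmetry.map {R S : Type*} [CommRing R] [CommRing S] (φ : R →+* S) {a1 a2 a3 : ℤ}
    {V : Params R} {g : Bool → Word → R} (h : IsSymmetry a1 a2 a3 V g) :
    IsSymmetry a1 a2 a3 (V.map φ) fun c w => φ (g c w) := by
  have hV := stdParams_eval V []
  refine .mk' (fun i o => ?_) (fun c w hw => by rw [h.long c w hw, map_zero]) ?_
  · have := h.pull _ _ hV i o
    rw [LForm.eval_pull, sum_map_mkField a1 a2 a3 hV] at this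
    have := congrArg φ this
    rw [Params.map_combo, map_zero] at this
    simpa only [map_pullCoeff] using this
  · have key : ∀ c n i r, (c, n, i, r) ∈ sumVals V → ((Word.all n i).map (g c)).sum = r := by
      intro c n i r hr
      rw [← mkSums_eval hV] at hr
      obtain ⟨⟨c', n', i', p⟩, ht, hh⟩ := List.mem_map.1 hr
      simp only [Prod.mk.injEq] at hh
      obtain ⟨rfl, rfl, rfl, rfl⟩ := hh
      exact h.sums _ _ hV _ _ _ _ ht
    intro c n i r hr
    have hm : sumVals (V.map φ) = (sumVals V).map fun t => (t.1, t.2.1, t.2.2.1, φ t.2.2.2) := by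
      simp [sumVals, Params.map, map_ofNat φ]
    rw [hm] at hr
    obtain ⟨⟨c', n', i', p⟩, ht, hh⟩ := List.mem_map.1 hr
    simp only [Prod.mk.injEq] at hh
    obtain ⟨rfl, rfl, rfl, rfl⟩ := hh
    rw [← key _ _ _ _ ht, map_list_sum, List.map_map]
    rfl

/-! ### The shift of `u` -/

theorem word_mem_span {n : ℕ} {w : Word} (h : w.length ≤ n) :
    word w ∈ Submodule.span ℂ[X] (word '' {w | w.length ≤ n}) :=
  Submodule.subset_span ⟨w, h, rfl⟩

theorem co_eq_zero_of_mem_span {n : ℕ} {p : NC}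
    (hp : p ∈ Submodule.span ℂ[X] (word '' {w | w.length ≤ n})) {w : Word} (hw : n < w.length) :
    co w p = 0 := by
  induction hp using Submodule.span_induction with
  | mem x hx =>
    obtain ⟨w', h', rfl⟩ := hx
    rw [co_word, if_neg]
    rintro rfl
    exact absurd h' (not_le.2 hw)
  | zero => simp
  | add x y _ _ hx hy => rw [map_add, hx, hy, add_zero]
  | smul r x _ hx => rw [map_smul, hx, smul_zero]

theorem DegreeLE.mem_span {n : ℕ} {p : NC} (h : DegreeLE n p) :
    p ∈ Submodule.span ℂ[X] (word '' {w | w.length ≤ n}) := by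
  have hs : ∀ m : FreeMonoid (Fin 2), m.length ≤ n → ∀ r : ℂ[X],
      FreeAlgebra.equivMonoidAlgebraFreeMonoid.symm (MonoidAlgebra.single m r) ∈
        Submodule.span ℂ[X] (word '' {w | w.length ≤ n}) := by
    intro m hm r
    obtain ⟨w, hw⟩ := exists_word_eq m
    have : MonoidAlgebra.single m r =
        r • FreeAlgebra.equivMonoidAlgebraFreeMonoid (PainleveSix.word w) := by
      rw [equiv_word, hw]; simp
    rw [this, ← map_smul, AlgEquiv.symm_apply_apply]
    refine Submodule.smul_mem _ _ (word_mem_span ?_)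
    rw [hw] at hm
    simpa [FreeMonoid.length] using hm
  rw [← FreeAlgebra.equivMonoidAlgebraFreeMonoid.symm_apply_apply p]
  rw [← MonoidAlgebra.sum_coeff_single (FreeAlgebra.equivMonoidAlgebraFreeMonoid p), Finsupp.sum,
    map_sum]
  exact Submodule.sum_mem _ fun m hm => hs m (h m hm) _

/-- The substitution `u ↦ u + r`. -/
def shift (r : ℂ[X]) : NC →ₐ[ℂ[X]] NC :=
  FreeAlgebra.lift ℂ[X] ![u + algebraMap ℂ[X] NC r, v]

theorem shift_letter_false (r : ℂ[X]) : shift r (letter false) = letter false + r • 1 := by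
  simp [shift, letter, fin, u, Algebra.algebraMap_eq_smul_one]

theorem shift_letter_true (r : ℂ[X]) : shift r (letter true) = letter true := by
  simp [shift, letter, fin, v]

theorem letter_mul_mem_span {n : ℕ} {p : NC} (c : Bool)
    (hp : p ∈ Submodule.span ℂ[X] (word '' {w | w.length ≤ n})) :
    letter c * p ∈ Submodule.span ℂ[X] (word '' {w | w.length ≤ n + 1}) := by
  induction hp using Submodule.span_induction with
  | mem x hx =>
    obtain ⟨w', h', rfl⟩ := hx
    rw [← word_cons]
    exact word_mem_span (Nat.succ_le_succ h')
  | zero => simp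
  | add x y _ _ hx hy => rw [mul_add]; exact Submodule.add_mem _ hx hy
  | smul r x _ hx => rw [mul_smul_comm]; exact Submodule.smul_mem _ _ hx

theorem shift_word_mem_span (r : ℂ[X]) (w : Word) :
    shift r (word w) ∈ Submodule.span ℂ[X] (word '' {w' | w'.length ≤ w.length}) := by
  induction w with
  | nil => rw [word_nil, map_one]; exact word_mem_span (w := []) le_rfl
  | cons c w ih =>
    rw [word_cons, map_mul]
    cases c
    · rw [shift_letter_false, add_mul, smul_mul_assoc, one_mul]
      refine Submodule.add_mem _ (letter_mul_mem_span _ ih) (Submodule.smul_mem _ _ ?_)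
      exact Submodule.span_mono (Set.image_mono fun _ hx => le_trans hx (Nat.le_succ _)) ih
    · rw [shift_letter_true]
      exact letter_mul_mem_span _ ih

theorem DegreeLE.shift_mem_span {n : ℕ} {p : NC} (h : DegreeLE n p) (r : ℂ[X]) :
    shift r p ∈ Submodule.span ℂ[X] (word '' {w | w.length ≤ n}) := by
  have hp := h.mem_span
  clear h
  induction hp using Submodule.span_induction with
  | mem x hx =>
    obtain ⟨w, hw, rfl⟩ := hx
    have hw : w.length ≤ n := hw
    have hsub : {w' : Word | w'.length ≤ w.length} ⊆ {w' | w'.length ≤ n} :=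
      Set.ofPred_subset_ofPred.2 fun _ hx => hx.trans hw
    exact Submodule.span_mono (Set.image_mono hsub) (shift_word_mem_span r w)
  | zero => rw [map_zero]; exact Submodule.zero_mem _
  | add x y _ _ hx hy => rw [map_add]; exact Submodule.add_mem _ hx hy
  | smul s x _ hx => rw [map_smul]; exact Submodule.smul_mem _ _ hx

theorem shift_flow (r : ℂ[X]) (F : NCSystem) (p : NC) :
    shift r (flow F p) = flow (fun i => shift r (F i)) (shift r p) := by
  induction p using FreeAlgebra.induction with
  | grade0 s => simp [flow_algebraMap]
  | grade1 i =>
    rw [flow_var]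
    fin_cases i
    · change _ = flow _ (shift r (letter false))
      rw [shift_letter_false, flow_add, flow_smul, flow_one, smul_zero, add_zero, letter, flow_var]
      rfl
    · change _ = flow _ (shift r (letter true))
      rw [shift_letter_true, letter, flow_var]
      rfl
  | mul a b ha hb => rw [flow_mul, map_add, map_mul, map_mul, ha, hb, map_mul, flow_mul]
  | add a b ha hb => rw [flow_add, map_add, ha, hb, map_add, flow_add]

/-! ### Sums of coefficients over blocks -/

theorem comm_word (w : Word) : comm (word w) =
    MvPolynomial.monomial (Finsupp.single 0 (Word.numU w) + Finsupp.single 1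
      (w.length - Word.numU w)) 1 := by
  induction w with
  | nil => simp [Word.numU]
  | cons c w ih =>
    have := Word.numU_le_length w
    rw [word_cons, map_mul, ih]
    cases c
    · have h : comm (letter false) = MvPolynomial.monomial (Finsupp.single 0 1) 1 := by
        simp [comm, letter, fin, MvPolynomial.X]
      rw [h, MvPolynomial.monomial_mul, one_mul, Word.numU, List.length_cons,
        Nat.add_sub_add_right, Finsupp.single_add, ← add_assoc, add_comm (Finsupp.single 0 1)]
    · have h : comm (letter true) = MvPolynomial.monomial (Finsupp.single 1 1) 1 := by
        simp [comm, letter, fin, MvPolynomial.X]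
      rw [h, MvPolynomial.monomial_mul, one_mul, Word.numU, List.length_cons,
        Nat.sub_add_comm this, Finsupp.single_add, add_comm (Finsupp.single 1 1), add_assoc]

/-- The sum of the coefficients in a block depends only on the commutative reduction. -/
theorem sum_co_all (n i : ℕ) (p : NC) (hi : i ≤ n) : ((Word.all n i).map fun w => co w p).sum =
    MvPolynomial.coeff (Finsupp.single 0 i + Finsupp.single 1 (n - i)) (comm p) := by
  induction p using nc_induction with
  | zero => simp
  | add p q hp hq => simp only [map_add, List.sum_map_add, hp, hq, MvPolynomial.coeff_add]
  | word r w =>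
    simp only [map_smul, smul_eq_mul, List.sum_map_mul_left, MvPolynomial.coeff_smul, co_word,
      comm_word, MvPolynomial.coeff_monomial]
    congr 1
    have h := Word.numU_le_length w
    have h1 : (Finsupp.single (0 : Fin 2) (Word.numU w) + Finsupp.single 1
        (w.length - Word.numU w) = Finsupp.single 0 i + Finsupp.single 1 (n - i)) ↔
        w ∈ Word.all n i := by
      rw [Word.mem_all]
      constructor
      · intro h'
        have e0 := DFunLike.congr_fun h' 0
        have e1 := DFunLike.congr_fun h' 1
        simp at e0 e1
        omega
      · rintro ⟨rfl, rfl⟩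
        rfl
    simp only [h1]
    have h2 : ∀ l : List Word, l.Nodup →
        (l.map fun w' => if w' = w then (1 : ℂ[X]) else 0).sum = if w ∈ l then 1 else 0 := by
      intro l hl
      induction l with
      | nil => simp
      | cons a l ih =>
        rw [List.nodup_cons] at hl
        rw [List.map_cons, List.sum_cons, ih hl.2]
        by_cases ha : a = w
        · subst ha; simp [hl.1]
        · simp [ha, Ne.symm ha]
    exact h2 _ (Word.nodup_all n i)

/-! ### Computing in the commutative reduction -/

/-- Polynomials in the commuting variables `u`, `v`: lists of two exponents and a coefficient. -/
abbrev CommPoly : Type := List (ℕ × ℕ × Poly)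

namespace CommPoly

def eval {R : Type*} [CommRing R] (env : ℕ → R) (L : CommPoly) : MvPolynomial (Fin 2) R :=
  (L.map fun t => MvPolynomial.monomial (Finsupp.single 0 t.1 + Finsupp.single 1 t.2.1)
    (t.2.2.eval env)).sum

def mul (L M : CommPoly) : CommPoly :=
  L.flatMap fun t => M.map fun s => (t.1 + s.1, t.2.1 + s.2.1, Poly.addMul t.2.2 s.2.2 [])

def coeff (i j : ℕ) : CommPoly → Poly
  | [] => []
  | t :: L => bif t.1 == i && t.2.1 == j then Poly.add t.2.2 (coeff i j L) else coeff i j L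

theorem eval_mul {R : Type*} [CommRing R] (env : ℕ → R) (L M : CommPoly) :
    (L.mul M).eval env = L.eval env * M.eval env := by
  induction L with
  | nil => simp [mul, eval]
  | cons t L ih =>
    have h : (mul (t :: L) M).eval env = (M.map fun s => MvPolynomial.monomial
        (Finsupp.single 0 (t.1 + s.1) + Finsupp.single 1 (t.2.1 + s.2.1))
        ((Poly.addMul t.2.2 s.2.2 []).eval env)).sum + (mul L M).eval env := by
      simp [mul, eval, Function.comp_def]
    have h' : eval env (t :: L) = MvPolynomial.monomial (Finsupp.single 0 t.1 +
        Finsupp.single 1 t.2.1) (t.2.2.eval env) + eval env L := by simp [eval]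
    rw [h, ih, h', add_mul]
    congr 1
    rw [eval, ← List.sum_map_mul_left]
    congr 2
    funext s
    rw [MvPolynomial.monomial_mul, Poly.eval_addMul, Poly.eval_nil, add_zero, Finsupp.single_add,
      Finsupp.single_add]
    congr 2
    rw [add_add_add_comm]

theorem coeff_eval {R : Type*} [CommRing R] (env : ℕ → R) (i j : ℕ) (L : CommPoly) :
    (L.eval env).coeff (Finsupp.single 0 i + Finsupp.single 1 j) = (L.coeff i j).eval env := by
  induction L with
  | nil => simp [eval, coeff, Poly.eval_nil]
  | cons t L ih =>
    have h' : eval env (t :: L) = MvPolynomial.monomial (Finsupp.single 0 t.1 +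
        Finsupp.single 1 t.2.1) (t.2.2.eval env) + eval env L := by simp [eval]
    rw [h', MvPolynomial.coeff_add, ih, MvPolynomial.coeff_monomial, coeff]
    have h1 : (Finsupp.single (0 : Fin 2) t.1 + Finsupp.single 1 t.2.1 =
        Finsupp.single 0 i + Finsupp.single 1 j) ↔ t.1 = i ∧ t.2.1 = j := by
      constructor
      · intro h'
        have e0 := DFunLike.congr_fun h' 0
        have e1 := DFunLike.congr_fun h' 1
        simp at e0 e1
        exact ⟨e0, e1⟩
      · rintro ⟨rfl, rfl⟩
        rfl
    simp only [h1]
    by_cases h : t.1 = i ∧ t.2.1 = j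
    · simp [h, Poly.eval_add]
    · rw [if_neg h, zero_add]
      have : (t.1 == i && t.2.1 == j) = false := by
        rw [← Bool.not_eq_true]; simpa using h
      rw [this, cond_false]

end CommPoly

/-- The shifted scalar Hamiltonian, its constant term being the variable `10`. -/
def depressedH : CommPoly :=
  [(3, 2, .const 1), (1, 2, [([3], -1)]), (0, 2, [([4], -1)]), (2, 1, [([5], -1)]),
    (1, 1, [([7], 1)]), (0, 1, [([8], 1)]), (1, 0, [([9], -1)]), (0, 0, [([10], 1)])]

/-- The shifted scalar system. -/
def depressedRhs (c : Bool) : CommPoly :=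
  bif c then [(2, 2, .const (-3)), (0, 2, [([3], 1)]), (1, 1, [([5], 2)]), (0, 1, [([7], -1)]),
    (0, 0, [([9], 1)])]
  else [(3, 1, .const 2), (1, 1, [([3], -2)]), (0, 1, [([4], -2)]), (2, 0, [([5], -1)]),
    (1, 0, [([7], 1)]), (0, 0, [([8], 1)])]

theorem coeff_depressed : ∀ t ∈ mkSums stdParams, t.2.2.1 ≤ t.2.1 ∧
    ((depressedRhs t.1).mul depressedH).coeff t.2.2.1 (t.2.1 - t.2.2.1) = t.2.2.2 := by
  decide +kernel

/-! ### The shifted system -/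

/-- The shift of `u` that removes the quadratic term of `u (u - 1) (u - z)`. -/
def center : ℂ[X] := Polynomial.C (1 / 3) * (1 + Polynomial.X)

theorem X_eq_center : (Polynomial.X : ℂ[X]) = 3 * center - 1 := by
  have : (3 : ℂ[X]) = Polynomial.C 3 := rfl
  rw [center, ← mul_assoc, this, ← Polynomial.C_mul]
  norm_num

/-- The parameters of the shifted system. -/
def params (κ : Kappa) (s : Coeffs) : Params ℂ[X] :=
  let C : ℂ[X] := .C s.c1 + .C s.f1 * .X
  let D : ℂ[X] := .C s.c2 + .C s.f2 * .X
  let p : ℂ[X] := 3 * center ^ 2 - .X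
  let th : ℂ[X] := .C κ.k2 + .C κ.k4 * .X
  { C1 := C + center * (3 * .C s.a1 + .C s.a2)
    C2 := D + center * (.C s.a3 + 3 * .C (2 - s.a1 - s.a2 - s.a3))
    x := - p - (.X * .C s.h1 + center * (C - D) - 6 * center ^ 2 +
      center ^ 2 * (3 * .C s.a1 + 2 * .C s.a2 + .C s.a3))
    p := p
    q := 2 * center ^ 3 - .X * center
    k1 := .C κ.k1
    e1 := .C s.e1
    th1 := th - 2 * .C κ.k1 * center
    th0 := - .C κ.k1 * center ^ 2 + th * center + .X * .C (κ.k1 - κ.k2 - κ.k4)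
    k3 := .C κ.k3 }

theorem smul_eq_C_smul (c : ℂ) (p : NC) : c • p = (Polynomial.C c : ℂ[X]) • p := by
  rw [← Polynomial.algebraMap_eq, algebraMap_smul]

theorem cst_eq_C_smul (c : ℂ) : cst c = (Polynomial.C c : ℂ[X]) • (1 : NC) := by
  rw [← smul_eq_C_smul, cst, Algebra.algebraMap_eq_smul_one]

theorem z_mul (p : NC) : z * p = (Polynomial.X : ℂ[X]) • p := by
  rw [z, Algebra.algebraMap_eq_smul_one, smul_mul_assoc, one_mul]

theorem u_eq_letter : u = letter false := rfl

theorem v_eq_letter : v = letter true := rfl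

set_option maxHeartbeats 1000000 in
theorem shift_system (κ : Kappa) (s : Coeffs) (a1 a2 a3 : ℤ) (h1 : s.a1 = a1) (h2 : s.a2 = a2)
    (h3 : s.a3 = a3) (i : Bool) : shift center (system κ s (fin i)) =
      (params κ s).combo a1 a2 a3 fun c w => if c = i then word w else 0 := by
  obtain ⟨_, _, _, c1, c2, e1, f1, f2, hh⟩ := s
  obtain ⟨k1, k2, k3, k4⟩ := κ
  dsimp only at h1 h2 h3
  subst h1 h2 h3
  cases i
  · simp only [fin, cond_false, system, Matrix.cons_val_zero, params, Params.combo,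
      Bool.true_eq_false, if_false, if_true, smul_zero, zero_add, add_zero, z_mul, cst_eq_C_smul,
      smul_eq_C_smul, u_eq_letter, v_eq_letter, map_add, map_sub, map_mul, map_smul, map_one,
      shift_letter_false, shift_letter_true, word, X_eq_center, mul_one, map_neg, map_ofNat]
    generalize letter false = a
    generalize letter true = b
    generalize center = l
    simp only [mul_add, add_mul, smul_mul_assoc, mul_smul_comm, one_mul, mul_one, mul_assoc,
      Int.cast_sub, Int.cast_ofNat, map_intCast]
    module
  · simp only [fin, cond_true, system, Matrix.cons_val_one, Matrix.cons_val_fin_one, params,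
      Params.combo, Bool.false_eq_true, if_false, if_true, smul_zero, zero_add, z_mul,
      cst_eq_C_smul, smul_eq_C_smul, u_eq_letter, v_eq_letter, map_add, map_sub, map_mul, map_smul,
      map_one, shift_letter_false, shift_letter_true, word, X_eq_center, mul_one, map_neg,
      map_ofNat]
    generalize letter false = a
    generalize letter true = b
    generalize center = l
    simp only [mul_add, add_mul, smul_mul_assoc, mul_smul_comm, one_mul, mul_one, mul_assoc,
      Int.cast_sub, Int.cast_ofNat, Int.cast_neg, Int.cast_add, Int.cast_one, map_intCast]
    simp only [smul_add, smul_sub, smul_smul, neg_smul, smul_neg]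
    module

/-- The substitution `u ↦ u + r` in commuting variables. -/
def commShift (r : ℂ[X]) : MvPolynomial (Fin 2) ℂ[X] →ₐ[ℂ[X]] MvPolynomial (Fin 2) ℂ[X] :=
  MvPolynomial.aeval ![MvPolynomial.X 0 + MvPolynomial.C r, MvPolynomial.X 1]

theorem comm_shift (r : ℂ[X]) (p : NC) : comm (shift r p) = commShift r (comm p) := by
  suffices h : comm.comp (shift r) = (commShift r).comp comm from DFunLike.congr_fun h p
  ext i
  fin_cases i <;> simp [comm, shift, commShift, u, v]

theorem commShift_X_zero (r : ℂ[X]) :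
    commShift r (MvPolynomial.X 0) = MvPolynomial.X 0 + MvPolynomial.C r := by
  simp [commShift]

theorem commShift_X_one (r : ℂ[X]) : commShift r (MvPolynomial.X 1) = MvPolynomial.X 1 := by
  simp [commShift]

theorem commShift_C (r c : ℂ[X]) : commShift r (MvPolynomial.C c) = MvPolynomial.C c := by
  simp [commShift]

theorem smul_eq_C_mul_of_complex (c : ℂ) (p : MvPolynomial (Fin 2) ℂ[X]) :
    c • p = MvPolynomial.C (Polynomial.C c) * p := by
  rw [← MvPolynomial.smul_eq_C_mul, ← Polynomial.algebraMap_eq, algebraMap_smul]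

theorem monomial_eq_C_mul {R : Type*} [CommRing R] (i j : ℕ) (r : R) :
    MvPolynomial.monomial (Finsupp.single (0 : Fin 2) i + Finsupp.single 1 j) r =
      MvPolynomial.C r * MvPolynomial.X 0 ^ i * MvPolynomial.X 1 ^ j := by
  rw [mul_assoc, MvPolynomial.X_pow_eq_monomial, MvPolynomial.X_pow_eq_monomial,
    MvPolynomial.monomial_mul, MvPolynomial.C_mul_monomial]
  simp

theorem commShift_scalarH (κ : Kappa) (s : Coeffs) : commShift center (scalarH κ) =
    depressedH.eval ((params κ s).env [- .C κ.k3 * center]) := by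
  simp only [scalarH, depressedH, CommPoly.eval, List.map_cons, List.map_nil, List.sum_cons,
    List.sum_nil, monomial_eq_C_mul, Poly.eval_const, Poly.eval, Poly.evalMono,
    smul_eq_C_mul_of_complex, params, Params.env, X_eq_center, map_add, map_sub, map_mul, map_pow,
    map_neg, commShift_X_zero, commShift_X_one, commShift_C, map_one,
    map_ofNat (MvPolynomial.C : ℂ[X] →+* MvPolynomial (Fin 2) ℂ[X]), map_ofNat (commShift center),
    List.getD_cons_succ,
    List.getD_cons_zero, List.cons_append, List.nil_append, Int.cast_one, Int.cast_neg, map_zero]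
  ring

theorem commShift_scalarRhs (κ : Kappa) (s : Coeffs) (c : Bool) :
    commShift center (scalarRhs κ (fin c)) =
      (depressedRhs c).eval ((params κ s).env [- .C κ.k3 * center]) := by
  have hC (n : ℕ) [n.AtLeastTwo] := map_ofNat
    (MvPolynomial.C : ℂ[X] →+* MvPolynomial (Fin 2) ℂ[X]) n
  have hC' (n : ℕ) [n.AtLeastTwo] := map_ofNat (Polynomial.C : ℂ →+* ℂ[X]) n
  have hS (n : ℕ) [n.AtLeastTwo] := map_ofNat (commShift center) n
  cases c <;>
  simp only [scalarRhs, depressedRhs, CommPoly.eval, List.map_cons, List.map_nil, List.sum_cons,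
      List.sum_nil, monomial_eq_C_mul, Poly.eval_const, Poly.eval, Poly.evalMono, mul_one,
      smul_eq_C_mul_of_complex, params, Params.env, X_eq_center, map_add, map_sub, map_mul, map_pow,
      map_neg, commShift_X_zero, commShift_X_one, commShift_C, map_one, hC, hC', hS,
      List.getD_cons_succ, List.getD_cons_zero, List.cons_append, List.nil_append, Int.cast_one,
      Int.cast_neg, Int.cast_ofNat, map_zero, cond_true, cond_false, fin, Matrix.cons_val_zero,
      Matrix.cons_val_one, Matrix.cons_val_fin_one] <;>
  ring

theorem AdmitsSymmetryNine.exists_isSymmetry {κ : Kappa} {s : Coeffs}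
    (h : AdmitsSymmetryNine κ (system κ s)) (a1 a2 a3 : ℤ) (h1 : s.a1 = a1) (h2 : s.a2 = a2)
    (h3 : s.a3 = a3) : ∃ g, IsSymmetry a1 a2 a3 (params κ s) g := by
  obtain ⟨G, hd, hc, hf⟩ := h
  have long : ∀ c w, 10 ≤ w.length → co w (shift center (G (fin c))) = 0 := fun c w hw =>
    co_eq_zero_of_mem_span ((hd (fin c)).shift_mem_span center) hw
  refine ⟨fun c w => co w (shift center (G (fin c))), .mk' (fun i o => ?_) long ?_⟩
  · have hV := stdParams_eval (params κ s) []
    have := eval_pull_eq_zero (env := (params κ s).env []) (L := mkField a1 a2 a3 stdParams)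
      (F := fun i => shift center (system κ s i)) (G := fun i => shift center (G i))
      (fun i => by
        rw [VField.eval_eq_sum, sum_map_mkField a1 a2 a3 hV fun c w => if c = i then word w else 0,
          shift_system κ s a1 a2 a3 h1 h2 h3])
      (fun i => by rw [← shift_flow, hf, shift_flow]) long i o
    rwa [LForm.eval_pull, sum_map_mkField a1 a2 a3 hV] at this
  · intro c n i r hr
    rw [← mkSums_eval (stdParams_eval (params κ s) [- .C κ.k3 * center])] at hr
    obtain ⟨⟨c', n', i', p⟩, ht, hh⟩ := List.mem_map.1 hr
    simp only [Prod.mk.injEq] at hh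
    obtain ⟨rfl, rfl, rfl, rfl⟩ := hh
    obtain ⟨hi, e⟩ := coeff_depressed _ ht
    rw [sum_co_all _ _ _ hi, comm_shift, hc, map_mul, commShift_scalarRhs κ s,
      commShift_scalarH κ s, ← CommPoly.eval_mul, CommPoly.coeff_eval, e]

/-! ### Consequences for the parameters -/

theorem LinSys.key_mul {R : Type*} [CommRing R] (N : R) (g : Bool → Word → R) (w : Word) :
    LinSys.key (fun c w => N * g c w) w = N * LinSys.key g w := by
  cases w <;> simp [LinSys.key]

theorem VanishOn.mono {R : Type*} [CommRing R] {g : Bool → Word → R} {Z Z' : List (Bool × ℕ × ℕ)}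
    (h : VanishOn g Z) (hZ : Z' ⊆ Z) : VanishOn g Z' := fun c n i hm => h c n i (hZ hm)

theorem VanishOn.nil {R : Type*} [CommRing R] {g : Bool → Word → R} : VanishOn g [] := by
  simp [VanishOn]

section

variable {R : Type*} [CommRing R] [NoZeroDivisors R] [CharZero R] {V : Params R}
  {g : Bool → Word → R}

theorem IsSymmetry.lead130 (h : IsSymmetry (-1) 3 0 V g) :
    V.C1 = 0 ∧ V.C2 = 0 ∧ V.x = 0 ∧ V.e1 ^ 2 - 2 * V.k1 * V.e1 - 4 * V.k3 = 0 := by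
  have hV := stdParams_eval V []
  have hZ := h.vanishOn hV .nil (free := []) (by simp) lead130_vanishing
  have r1 := h.relation 1 hV hZ (free := []) (by simp) lead130_relations_e1
    (p := [([5, 6], 6), ([6, 6], -3), ([9], 12)]) (by simp)
  have r2 := h.relation 1 hV hZ (free := []) (by simp) lead130_relations_e1
    (p := [([0], 2)]) (by simp)
  have r3 := h.relation 1 hV hZ (free := []) (by simp) lead130_relations_e1
    (p := [([1], 1)]) (by simp)
  simp [Poly.eval, Poly.evalMono, Params.env] at r1 r2 r3
  have hV' : Params.eval (V.env []) ⟨[], [], [([2], 1)], [([3], 1)], [([4], 1)], [([5],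
    1)], [([6], 1)], [([7], 1)], [([8], 1)], [([9], 1)]⟩ = V := by
    obtain ⟨_, _, _, _, _, _, _, _, _, _⟩ := V
    simp_all [Poly.eval, Poly.evalMono, Params.env, Params.eval]
  have r4 := h.relation 1 hV' hZ (free := []) (by simp) lead130_relation_x
    (p := [([2], 3)]) (by simp)
  simp [Poly.eval, Poly.evalMono, Params.env] at r4
  refine ⟨r2, r3, r4, ?_⟩
  have : (3 : R) * (V.e1 ^ 2 - 2 * V.k1 * V.e1 - 4 * V.k3) = 0 := by linear_combination -r1
  simpa using this

theorem IsSymmetry.lead200 (h : IsSymmetry 2 0 0 V g) :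
    V.C1 = 0 ∧ V.C2 = 0 ∧ V.x = V.p ∧ 6 * V.k1 ^ 2 - 5 * V.k1 * V.e1 + V.e1 ^ 2 - V.k3 = 0 := by
  have hV := stdParams_eval V []
  have hZ := h.vanishOn hV .nil (free := []) (by simp) lead200_vanishing
  have r1 := h.relation 1 hV hZ (free := []) (by simp) lead200_relations_e1
    (p := [([5, 5], -6), ([5, 6], 5), ([6, 6], -1), ([9], 1)]) (by simp)
  have r2 := h.relation 1 hV hZ (free := []) (by simp) lead200_relations_e1
    (p := [([0], 1)]) (by simp)
  have r3 := h.relation 1 hV hZ (free := []) (by simp) lead200_relations_e1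
    (p := [([1], 1)]) (by simp)
  simp [Poly.eval, Poly.evalMono, Params.env] at r1 r2 r3
  have hV' : Params.eval (V.env []) ⟨[], [], [([2], 1)], [([3], 1)], [([4], 1)], [([5],
    1)], [([6], 1)], [([7], 1)], [([8], 1)], [([9], 1)]⟩ = V := by
    obtain ⟨_, _, _, _, _, _, _, _, _, _⟩ := V
    simp_all [Poly.eval, Poly.evalMono, Params.env, Params.eval]
  have r4 := h.relation 1 hV' hZ (free := []) (by simp) lead200_relation_x
    (p := [([2], 1), ([3], -1)]) (by simp)
  simp [Poly.eval, Poly.evalMono, Params.env] at r4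
  exact ⟨r2, r3, by linear_combination r4, by linear_combination -r1⟩

theorem IsSymmetry.lead031 (h : IsSymmetry 0 3 (-1) V g) :
    V.C1 = 3 * V.C2 ∧ V.p = 3 * V.C2 ^ 2 := by
  have hV := stdParams_eval V []
  have hZ := h.vanishOn hV .nil (free := []) (by simp) lead031_vanishing
  have r1 := h.relation 1 hV hZ (free := []) (by simp) lead031_relation_C
    (p := [([0], 1), ([1], -3)]) (by simp)
  simp [Poly.eval, Poly.evalMono, Params.env] at r1
  have e1 : V.C1 = 3 * V.C2 := by linear_combination r1
  have hV' : Params.eval (V.env []) ⟨[([1], 3)], [([1], 1)], [([2], 1)], [([3], 1)], [([4],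
    1)], [([5], 1)], [([6], 1)], [([7], 1)], [([8], 1)], [([9], 1)]⟩ = V := by
    obtain ⟨_, _, _, _, _, _, _, _, _, _⟩ := V
    simp_all [Poly.eval, Poly.evalMono, Params.env, Params.eval]
  have r2 := h.relation 1 hV' hZ (free := []) (by simp) lead031_relation_p
    (p := [([1, 1], -6), ([3], 2)]) (by simp)
  simp [Poly.eval, Poly.evalMono, Params.env] at r2
  have : (2 : R) * (V.p - 3 * V.C2 ^ 2) = 0 := by linear_combination r2
  exact ⟨e1, by simpa [sub_eq_zero] using this⟩

theorem IsSymmetry.lead020 (h : IsSymmetry 0 2 0 V g) (hp : V.p ≠ 0) :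
    V.C2 = 0 ∧ 2 * V.k1 ^ 2 - 3 * V.k1 * V.e1 + V.e1 ^ 2 - V.k3 = 0 ∧
      - V.C1 ^ 3 + 3 * V.C1 * V.x + V.C1 * V.p + 4 * V.q = 0 ∧
      (V.C1 = 0 → V.x = 0 → V.q = 0 → False) := by
  have hV := stdParams_eval V []
  have hZ := h.vanishOn hV .nil (free := []) (by simp) lead020_vanishing
  have hZ1 := hZ.mono (Z' := [(false, 9, 8), (true, 9, 7), (false, 9, 7),
    (true, 9, 6), (false, 8, 7), (true, 8, 6), (false, 8, 6), (true, 8, 5), (false, 7, 6), (true,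
    7, 5), (false, 6, 5), (true, 6, 4)]) (by decide)
  have hZ2 := hZ.mono (Z' := [(false, 9, 5), (true, 9, 4), (false, 8, 4), (true, 8, 3)]) (by decide)
  have hZ3 := hZ.mono (Z' := [(false, 9, 5), (true, 9, 4), (false, 8, 4), (true, 8, 3),
    (false, 9, 4), (true, 9, 3), (false, 7, 3), (true, 7, 2)]) (by decide)
  have r1 := h.relation 1 hV hZ1 (free := []) (by simp) lead020_relations_e1
    (p := [([5, 5], -12), ([5, 6], 18), ([6, 6], -6), ([9], 6)]) (by simp)
  have r2 := h.relation 1 hV hZ1 (free := []) (by simp) lead020_relations_e1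
    (p := [([1], 1)]) (by simp)
  simp [Poly.eval, Poly.evalMono, Params.env] at r1 r2
  have hV' : ∀ l, Params.eval (V.env l) ⟨[([0], 1)], [], [([2], 1)], [([3], 1)], [([4], 1)],
    [([5], 1)], [([6], 1)], [([7], 1)], [([8], 1)], [([9], 1)]⟩ = V := by
    obtain ⟨_, _, _, _, _, _, _, _, _, _⟩ := V
    simp_all [Poly.eval, Poly.evalMono, Params.env, Params.eval]
  have hf : ∀ x ∈ ([(917, [([10], 2)]), (845, [([11], 2)]), (843, [([12], 2)])] :
      List (ℕ × Poly)), LinSys.key (fun c w => ((2 : ℤ) : R) * g c w) (Word.decode 15 x.1 []) =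
      x.2.eval (V.env [LinSys.key g (Word.decode 15 917 []),
        LinSys.key g (Word.decode 15 845 []), LinSys.key g (Word.decode 15 843 [])]) := by
    simp [LinSys.key_mul, Poly.eval, Poly.evalMono, Params.env]
  have r3 := h.relation 2 (hV' _) hZ2 hf lead020_relations_x (p := [([3, 10], 28)]) (by simp)
  have r4 := h.relation 2 (hV' _) hZ2 hf lead020_relations_x
    (p := [([0, 0, 0], -18), ([0, 0, 10], 18),
    ([0, 2], 54), ([0, 3], 18), ([4], 72)]) (by simp)
  simp [Poly.eval, Poly.evalMono, Params.env, hp] at r3 r4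
  rw [r3] at r4
  refine ⟨r2, ?_, ?_, fun h1 h2 h3 => ?_⟩
  · have : (6 : R) * (2 * V.k1 ^ 2 - 3 * V.k1 * V.e1 + V.e1 ^ 2 - V.k3) = 0 := by
      linear_combination -r1
    simpa using this
  · have : (18 : R) * (- V.C1 ^ 3 + 3 * V.C1 * V.x + V.C1 * V.p + 4 * V.q) = 0 := by
      linear_combination r4
    simpa using this
  · have hV3 : Params.eval (V.env []) ⟨[], [], [], [([3], 1)], [], [([5], 1)], [([6], 1)], [([7],
      1)], [([8], 1)], [([9], 1)]⟩ = V := by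
      obtain ⟨_, _, _, _, _, _, _, _, _, _⟩ := V
      simp_all [Poly.eval, Poly.evalMono, Params.env, Params.eval]
    have r5 := h.relation 2 hV3 hZ3 (free := []) (by simp) lead020_relation_p
      (p := [([3, 3], 6)]) (by simp)
    simp [Poly.eval, Poly.evalMono, Params.env, hp] at r5

theorem IsSymmetry.lead110 (h : IsSymmetry 1 1 0 V g) (hp : V.p ≠ 0) :
    V.C2 = 0 ∧ V.e1 = 2 * V.k1 ∧ V.C1 ^ 3 - 4 * V.p * V.C1 + 3 * V.C1 * V.x + 4 * V.q = 0 ∧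
      (V.C1 = 0 → V.x = V.p → V.q = 0 → False) := by
  have hV := stdParams_eval V []
  have hZ := h.vanishOn hV .nil (free := []) (by simp) lead110_vanishing
  have hZ1 := hZ.mono (Z' := [(false, 9, 7), (true, 9, 6), (false, 8, 6), (true, 8, 5)])
    (by decide)
  have hZ2 := hZ.mono (Z' := [(false, 9, 5), (true, 9, 4), (false, 8, 4), (true, 8, 3)]) (by decide)
  have hZ3 := hZ.mono (Z' := [(false, 9, 5), (true, 9, 4), (false, 8, 4), (true, 8, 3),
    (false, 9, 4), (true, 9, 3), (false, 7, 3), (true, 7, 2)]) (by decide)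
  have r1 := h.relation 1 hV hZ1 (free := []) (by simp) lead110_relations_e1
    (p := [([5], 2), ([6], -1)]) (by simp)
  have r2 := h.relation 1 hV hZ1 (free := []) (by simp) lead110_relations_e1
    (p := [([1], 1)]) (by simp)
  simp [Poly.eval, Poly.evalMono, Params.env] at r1 r2
  have hV' : ∀ l, Params.eval (V.env l) ⟨[([0], 1)], [], [([2], 1)], [([3], 1)], [([4], 1)],
    [([5], 1)], [([6], 1)], [([7], 1)], [([8], 1)], [([9], 1)]⟩ = V := by
    obtain ⟨_, _, _, _, _, _, _, _, _, _⟩ := V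
    simp_all [Poly.eval, Poly.evalMono, Params.env, Params.eval]
  set t0 := LinSys.key g (Word.decode 15 843 []) with ht0
  set t1 := LinSys.key g (Word.decode 15 819 []) with ht1
  set t2 := LinSys.key g (Word.decode 15 811 []) with ht2
  have hf : ∀ x ∈ ([(843, [([10], 2)]), (819, [([11], 2)]), (811, [([12], 2)])] :
      List (ℕ × Poly)), LinSys.key (fun c w => ((2 : ℤ) : R) * g c w) (Word.decode 15 x.1 []) =
      x.2.eval (V.env [t0, t1, t2]) := by
    simp [LinSys.key_mul, Poly.eval, Poly.evalMono, Params.env, ht0, ht1, ht2]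
  have r3 := h.relation 2 (hV' _) hZ2 hf lead110_relations_x
    (p := [([0, 3], 8), ([3, 10], 8), ([3, 11], 8), ([3, 12], 8)]) (by simp)
  have r4 := h.relation 2 (hV' _) hZ2 hf lead110_relations_x (p := [([0, 0, 12], -24), ([0,
    2], 48), ([0, 3], -48), ([2, 12], 24), ([4], 48)]) (by simp)
  have r5 := h.relation 2 (hV' _) hZ2 hf lead110_relations_x
    (p := [([0, 0, 10], 6), ([0, 0, 11], 6),
    ([0, 0, 12], -6), ([0, 2], 6), ([2, 12], 12)]) (by simp)
  simp [Poly.eval, Poly.evalMono, Params.env] at r3 r4 r5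
  refine ⟨r2, by linear_combination -r1, ?_, fun h1 h2 h3 => ?_⟩
  · have r6 : (8 : R) * V.p * (V.C1 + t0 + t1 + t2) = 0 := by linear_combination r3
    have r7 : V.C1 + t0 + t1 + t2 = 0 := by simpa [hp] using r6
    have : (12 : R) * (V.C1 ^ 3 - 4 * V.p * V.C1 + 3 * V.C1 * V.x + 4 * V.q) = 0 := by
      linear_combination r4 - 2 * r5 + 12 * V.C1 ^ 2 * r7
    simpa using this
  · have hV3 : Params.eval (V.env []) ⟨[], [], [([3], 1)], [([3], 1)], [], [([5], 1)], [([6],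
      1)], [([7], 1)], [([8], 1)], [([9], 1)]⟩ = V := by
      obtain ⟨_, _, _, _, _, _, _, _, _, _⟩ := V
      simp_all [Poly.eval, Poly.evalMono, Params.env, Params.eval]
    have r5 := h.relation 2 hV3 hZ3 (free := []) (by simp) lead110_relation_p
      (p := [([3, 3], 5)]) (by simp)
    simp [Poly.eval, Poly.evalMono, Params.env, hp] at r5

end

/-- The variables `0` and `1` stand for half the sum and half the difference of `C1` and `C2`. -/
theorem eval_splitParams {R : Type*} [CommRing R] {V : Params R} {m d : R}
    (h1 : V.C1 = m + d) (h2 : V.C2 = m - d) (he : V.e1 = V.k1)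
    (l : List R) : Params.eval (Params.env { V with C1 := m, C2 := d } l)
      ⟨[([0], 1), ([1], 1)], [([0], 1), ([1], -1)], [([2], 1)],
        [([3], 1)], [([4], 1)], [([5], 1)], [([5], 1)], [([7], 1)], [([8], 1)],
        [([9], 1)]⟩ = V := by
  obtain ⟨_, _, _, _, _, _, _, _, _, _⟩ := V
  simp_all [Poly.eval, Poly.evalMono, Params.env, Params.eval, sub_eq_add_neg]

section

variable {R : Type*} [CommRing R] [NoZeroDivisors R] [CharZero R] {V : Params R}
  {g : Bool → Word → R}

theorem eq_of_lead011_relations {m d y p t0 t1 s : R} (hd : d ≠ 0)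
    (h3 : ∀ f, p ≠ 3 * f ^ 2) (h2 : ∀ f, 2 * p ≠ - f ^ 2)
    (r1 : d * (2 * t0 * y + 4 * s - 4 * m * t1 - 10 * m * t0 + 3 * m * y + 4 * d * t1
      - 2 * d * t0 - 4 * m * d - 2 * d ^ 2) = 0)
    (r2 : d * (2 * y ^ 2 + 8 * s - 8 * m * t1 - 6 * m * t0 - m * y + 8 * d * t1 - 4 * d * t0
      - 2 * m * d - 4 * d ^ 2) = 0)
    (r3 : d * (2 * d * y + 6 * m * t0 - 3 * m * y + 2 * m * d) = 0)
    (r4 : 8 * m ^ 2 * d + 12 * m ^ 2 * t0 - 6 * m ^ 2 * y - 2 * m * d ^ 2 - 6 * m * d * t0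
      - 16 * m * d * t1 - m * d * y - 8 * d ^ 3 - 4 * d ^ 2 * t0 + 16 * d ^ 2 * t1 + 16 * d * s
      - 4 * p * t0 + 2 * p * y = 0)
    (r5 : d * (2 * p + 6 * s - 6 * m * t1 - 3 * m * y + 6 * d * t1 - 2 * d ^ 2) = 0) :
    p = 3 * m ^ 2 + d ^ 2 ∧ y = 2 * m := by
  have A := (mul_eq_zero.1 r1).resolve_left hd
  have B := (mul_eq_zero.1 r2).resolve_left hd
  have C := (mul_eq_zero.1 r3).resolve_left hd
  have D := (mul_eq_zero.1 r5).resolve_left hd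
  have G : 4 * p - 3 * y ^ 2 - 3 * d * y + 6 * d * t0 + 2 * d ^ 2 = 0 := by
    have : (2 : R) * (4 * p - 3 * y ^ 2 - 3 * d * y + 6 * d * t0 + 2 * d ^ 2) = 0 := by
      linear_combination 4 * D - 3 * B - 3 * C
    simpa using this
  have H : 4 * p * m - 3 * m * y ^ 2 - 2 * d ^ 2 * y = 0 := by linear_combination m * G - d * C
  have E : 2 * m ^ 2 * d - d ^ 2 * y + 2 * d ^ 2 * t0 - 2 * d * y ^ 2 - 2 * p * t0 + p * y = 0 := by
    have : (2 : R) * (2 * m ^ 2 * d - d ^ 2 * y + 2 * d ^ 2 * t0 - 2 * d * y ^ 2 - 2 * p * t0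
        + p * y) = 0 := by
      linear_combination r4 - 2 * m * C - 2 * d * B - 2 * d * C + d * C
    simpa using this
  have K : 3 * m ^ 3 - m * d ^ 2 - d ^ 2 * y - 3 * m * y ^ 2 + p * m + p * y = 0 := by
    have : (2 : R) * d * (3 * m ^ 3 - m * d ^ 2 - d ^ 2 * y - 3 * m * y ^ 2 + p * m + p * y)
        = 0 := by
      linear_combination 3 * m * E - (d ^ 2 - p) * C
    simpa [hd] using this
  have M : (2 * y - m) * (y - 2 * m) = 0 := by
    have : (2 : R) * d * ((2 * y - m) * (y - 2 * m)) = 0 := by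
      linear_combination -6 * m * A + 3 * m * B + 3 * m * C + 2 * (y - 5 * m) * C
    simpa [hd] using this
  rcases mul_eq_zero.1 M with hM | hM
  · have hm : m = 2 * y := by linear_combination -hM
    by_cases hy : y = 0
    · have hm0 : m = 0 := by rw [hm, hy, mul_zero]
      subst hy hm0
      have : 2 * t0 * (d ^ 2 - p) = 0 := by linear_combination E
      rcases mul_eq_zero.1 this with h | h
      · have ht : t0 = 0 := by simpa using h
        subst ht
        refine absurd ?_ (h2 d)
        have : (2 : R) * (2 * p + d ^ 2) = 0 := by linear_combination G
        have : 2 * p + d ^ 2 = 0 := by simpa using this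
        linear_combination this
      · exact ⟨by linear_combination -h, by ring⟩
    · subst hm
      have e1 : y * (4 * p - 3 * y ^ 2 - d ^ 2) = 0 := by
        have : 2 * (y * (4 * p - 3 * y ^ 2 - d ^ 2)) = 0 := by linear_combination H
        simpa using this
      have e2 : y * (6 * y ^ 2 - d ^ 2 + p) = 0 := by
        have : 3 * (y * (6 * y ^ 2 - d ^ 2 + p)) = 0 := by linear_combination K
        simpa using this
      have e1 := (mul_eq_zero.1 e1).resolve_left hy
      have e2 := (mul_eq_zero.1 e2).resolve_left hy
      refine absurd ?_ (h3 y)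
      have : (3 : R) * (p - 3 * y ^ 2) = 0 := by linear_combination e1 - e2
      have : p - 3 * y ^ 2 = 0 := by simpa using this
      linear_combination this
  · have hy : y = 2 * m := by linear_combination hM
    subst hy
    refine ⟨?_, rfl⟩
    by_cases hm : m = 0
    · subst hm
      have : 2 * t0 * (d ^ 2 - p) = 0 := by linear_combination E
      rcases mul_eq_zero.1 this with h | h
      · have ht : t0 = 0 := by simpa using h
        subst ht
        refine absurd ?_ (h2 d)
        have : (2 : R) * (2 * p + d ^ 2) = 0 := by linear_combination G
        have : 2 * p + d ^ 2 = 0 := by simpa using this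
        linear_combination this
      · linear_combination -h
    · have : 4 * m * (p - 3 * m ^ 2 - d ^ 2) = 0 := by linear_combination H
      have : p - 3 * m ^ 2 - d ^ 2 = 0 := by simpa [hm] using this
      linear_combination this

theorem IsSymmetry.lead011_e1 (h : IsSymmetry 0 1 1 V g) : V.e1 = V.k1 := by
  have hV := stdParams_eval V []
  have hZ := h.vanishOn hV .nil (free := []) (by simp) lead011_vanishing
  have r1 := h.relation 1 hV hZ (free := []) (by simp) lead011_relation_e1
    (p := [([5], 2), ([6], -2)]) (by simp)
  simp [Poly.eval, Poly.evalMono, Params.env] at r1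
  have : (2 : R) * (V.k1 - V.e1) = 0 := by linear_combination r1
  have : V.k1 - V.e1 = 0 := by simpa using this
  linear_combination -this

theorem IsSymmetry.lead011_of_eq (h : IsSymmetry 0 1 1 V g) {m : R} (h1 : V.C1 = m)
    (h2 : V.C2 = m) : V.x = 0 := by
  have he := h.lead011_e1
  have hV : ∀ l, Params.eval (V.env l) ⟨[([0], 1)], [([0], 1)], [([2], 1)], [([3], 1)], [([4], 1)],
    [([5], 1)], [([5], 1)], [([7], 1)], [([8], 1)],
        [([9], 1)]⟩ = V := by
    obtain ⟨_, _, _, _, _, _, _, _, _, _⟩ := V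
    simp_all [Poly.eval, Poly.evalMono, Params.env, Params.eval]
  set t0 := LinSys.key g (Word.decode 15 917 []) with ht0
  set t1 := LinSys.key g (Word.decode 15 869 []) with ht1
  set t2 := LinSys.key g (Word.decode 15 853 []) with ht2
  set t3 := LinSys.key g (Word.decode 15 851 []) with ht3
  set y := LinSys.key g (Word.decode 15 1962 []) with hy
  have hf : ∀ x ∈ ([(1962, [([14], 2)]), (917, [([10], 2)]), (869, [([11], 2)]),
      (853, [([12], 2)]), (851, [([13], 2)])] : List (ℕ × Poly)),
      LinSys.key (fun c w => ((2 : ℤ) : R) * g c w) (Word.decode 15 x.1 []) =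
      x.2.eval (V.env [t0, t1, t2, t3, y]) := by
    simp [LinSys.key_mul, Poly.eval, Poly.evalMono, Params.env, ht0, ht1, ht2, ht3, hy]
  have r1 := h.relation 2 (hV _) .nil hf lead011_relations_of_eq
    (p := [([0, 10], 24), ([0, 11], 24),
    ([0, 12], 24), ([0, 13], 24), ([2], 12)]) (by simp)
  have r2 := h.relation 2 (hV _) .nil hf lead011_relations_of_eq (p := [([0, 2], 36)]) (by simp)
  simp [Poly.eval, Poly.evalMono, Params.env] at r1 r2
  have : 12 * V.x ^ 2 = 0 := by
    rcases r2 with r2 | r2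
    · rw [r2] at r1
      linear_combination V.x * r1
    · simp [r2]
  simpa using this

theorem IsSymmetry.lead011_of_ne (h : IsSymmetry 0 1 1 V g) {m d : R} (h1 : V.C1 = m + d)
    (h2 : V.C2 = m - d) (hd : d ≠ 0) (hp : V.p ≠ 0) (hp3 : ∀ f, V.p ≠ 3 * f ^ 2)
    (hp2 : ∀ f, 2 * V.p ≠ - f ^ 2) : V.p = 3 * m ^ 2 + d ^ 2 ∧ V.x = 4 * m * d := by
  have he := h.lead011_e1
  have hV := eval_splitParams h1 h2 he
  have hf : ∀ x ∈ ([(1962, [([10], 1)])] : List (ℕ × Poly)),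
      LinSys.key (fun c w => ((1 : ℤ) : R) * g c w) (Word.decode 15 x.1 []) =
      x.2.eval (Params.env { V with C1 := m, C2 := d }
        [LinSys.key g (Word.decode 15 1962 [])]) := by
    simp [Poly.eval, Poly.evalMono, Params.env]
  have r0 := h.relation 1 (hV _) .nil hf lead011_relation_split (p := [([1, 10], 8)]) (by simp)
  simp [Poly.eval, Poly.evalMono, Params.env, hd] at r0
  have hf : ∀ x ∈ ([(1962, [])] : List (ℕ × Poly)),
      LinSys.key (fun c w => ((1 : ℤ) : R) * g c w) (Word.decode 15 x.1 []) =
      x.2.eval (Params.env { V with C1 := m, C2 := d } []) := by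
    simp [Poly.eval, r0]
  have hZ := h.vanishOn (hV []) .nil hf lead011_vanishing_of_split
  set t0 := LinSys.key g (Word.decode 15 917 []) with ht0
  set t1 := LinSys.key g (Word.decode 15 869 []) with ht1
  set t2 := LinSys.key g (Word.decode 15 853 []) with ht2
  set t3 := LinSys.key g (Word.decode 15 851 []) with ht3
  set s := LinSys.key g (Word.decode 15 340 []) with hs
  have hf : ∀ x ∈ ([(917, [([10], 2)]), (869, [([11], 2)]), (853, [([12], 2)]),
      (851, [([13], 2)])] : List (ℕ × Poly)),
      LinSys.key (fun c w => ((2 : ℤ) : R) * g c w) (Word.decode 15 x.1 []) =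
      x.2.eval (Params.env { V with C1 := m, C2 := d } [t0, t1, t2, t3]) := by
    simp [LinSys.key_mul, Poly.eval, Poly.evalMono, Params.env, ht0, ht1, ht2, ht3]
  have r1 := h.relation 2 (hV _) hZ hf lead011_relations_of_ne (p := [([0, 1], 48), ([0, 10], 24),
    ([0, 11], 24), ([0, 12], 24), ([0, 13], 24), ([1, 1], 48), ([1, 11], 24), ([1, 12], 24),
    ([1, 13], 48), ([2], 12)]) (by simp)
  have r2 := h.relation 2 (hV _) hZ hf lead011_relations_of_ne (p := [([1, 3], 16), ([3, 10],
    8), ([3, 11], 8), ([3, 12], 8), ([3, 13], 8)]) (by simp)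
  simp [Poly.eval, Poly.evalMono, Params.env] at r1 r2
  have r3 : 2 * d + t0 + t1 + t2 + t3 = 0 := by
    have : (8 : R) * V.p * (2 * d + t0 + t1 + t2 + t3) = 0 := by linear_combination r2
    simpa [hp] using this
  set y := 2 * t0 + t1 + t2 + 2 * d with hy
  have hx : V.x = 2 * d * y := by
    have : (12 : R) * (V.x - 2 * d * y) = 0 := by
      rw [hy]; linear_combination r1 - (24 * m + 48 * d) * r3
    have : V.x - 2 * d * y = 0 := by simpa using this
    linear_combination this
  have hV' : Params.eval (Params.env { V with C1 := m, C2 := d } [t0, t1, s, 0, y])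
      ⟨[([0], 1), ([1], 1)], [([0], 1), ([1], -1)], [([1, 14], 2)], [([3], 1)], [([4], 1)],
        [([5], 1)], [([5], 1)], [([7], 1)], [([8], 1)],
        [([9], 1)]⟩ = V := by
    conv_rhs => rw [← hV [t0, t1, s, 0, y]]
    simp [Poly.eval, Poly.evalMono, Params.env, Params.eval, hx, mul_assoc]
  have hf : ∀ x ∈ ([(917, [([10], 2)]), (869, [([11], 2)]), (853, [([1], -4), ([10], -4),
      ([11], -2), ([14], 2)]), (851, [([10], 2), ([14], -2)]), (340, [([12], 2)])] :
        List (ℕ × Poly)),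
      LinSys.key (fun c w => ((2 : ℤ) : R) * g c w) (Word.decode 15 x.1 []) =
      x.2.eval (Params.env { V with C1 := m, C2 := d } [t0, t1, s, 0, y]) := by
    simp only [LinSys.key_mul, Poly.eval, Poly.evalMono, Params.env, List.forall_mem_cons]
    simp [← ht0, ← ht1, ← ht2, ← ht3, ← hs]
    refine ⟨?_, ?_⟩
    · rw [hy]; ring
    · rw [hy]; linear_combination 2 * r3
  have q1 := h.relation 2 hV' hZ hf lead011_relations_reduced
    (p := [([0, 1, 1], -576), ([0, 1, 10], -1440),
    ([0, 1, 11], -576), ([0, 1, 14], 432), ([1, 1, 1], -288), ([1, 1, 10], -288), ([1, 1, 11], 576),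
    ([1, 10, 14], 288), ([1, 12], 576)]) (by simp)
  have q2 := h.relation 2 hV' hZ hf lead011_relations_reduced
    (p := [([0, 1, 1], -144), ([0, 1, 10], -432),
    ([0, 1, 11], -576), ([0, 1, 14], -72), ([1, 1, 1], -288), ([1, 1, 10], -288), ([1, 1, 11], 576),
    ([1, 12], 576), ([1, 14, 14], 144)]) (by simp)
  have q3 := h.relation 2 hV' hZ hf lead011_relations_reduced
    (p := [([0, 1, 1], 32), ([0, 1, 10], 96),
    ([0, 1, 14], -48), ([1, 1, 14], 32)]) (by simp)
  have q4 := h.relation 2 hV' hZ hf lead011_relations_reduced (p := [([0, 0, 1], 576),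
    ([0, 0, 10], 864), ([0, 0, 14], -432), ([0, 1, 1], -144), ([0, 1, 10], -432), ([0, 1, 11],
    -1152), ([0, 1, 14], -72), ([1, 1, 1], -576), ([1, 1, 10], -288), ([1, 1, 11], 1152), ([1,
    12], 1152), ([3, 10], -288), ([3, 14], 144)]) (by simp)
  have q5 := h.relation 2 hV' hZ hf lead011_relations_reduced
    (p := [([0, 1, 11], -144), ([0, 1, 14], -72),
    ([1, 1, 1], -48), ([1, 1, 11], 144), ([1, 3], 48), ([1, 12], 144)]) (by simp)
  simp [Poly.eval, Poly.evalMono, Params.env] at q1 q2 q3 q4 q5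
  clear_value y
  have cancel : ∀ {n : ℕ} {a : R}, (n : R) * a = 0 → n ≠ 0 → a = 0 := fun h hn => by
    simpa [hn] using h
  obtain ⟨e1, e2⟩ := eq_of_lead011_relations (m := m) (y := y) (t0 := t0) (t1 := t1) (s := s)
    hd hp3 hp2
    (cancel (n := 144) (by push_cast; linear_combination q1) (by norm_num))
    (cancel (n := 72) (by push_cast; linear_combination q2) (by norm_num))
    (cancel (n := 16) (by push_cast; linear_combination q3) (by norm_num))
    (cancel (n := 72) (by push_cast; linear_combination q4) (by norm_num))
    (cancel (n := 24) (by push_cast; linear_combination q5) (by norm_num))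
  exact ⟨e1, by rw [hx, e2]; ring⟩

end

/-! ### Transposition -/

theorem star_smul_poly (r : ℂ[X]) (p : NC) : star (r • p) = r • star p := by
  rw [Algebra.smul_def, star_mul, FreeAlgebra.star_algebraMap, ← Algebra.commutes,
    ← Algebra.smul_def]

theorem star_letter (c : Bool) : star (letter c) = letter c := FreeAlgebra.star_ι _

theorem flow_transpose (F : NCSystem) (p : NC) : flow (transpose F) (star p) = star (flow F p) := by
  induction p using FreeAlgebra.induction with
  | grade0 s => rw [FreeAlgebra.star_algebraMap, flow_algebraMap, flow_algebraMap, star_zero]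
  | grade1 i => rw [FreeAlgebra.star_ι, flow_var, flow_var, transpose]
  | mul a b ha hb =>
    rw [star_mul, flow_mul, flow_mul, ha, hb, star_add, star_mul, star_mul, add_comm]
  | add a b ha hb => rw [star_add, flow_add, ha, hb, flow_add, star_add]

theorem comm_star (p : NC) : comm (star p) = comm p := by
  induction p using FreeAlgebra.induction with
  | grade0 s => rw [FreeAlgebra.star_algebraMap]
  | grade1 i => rw [FreeAlgebra.star_ι]
  | mul a b ha hb => rw [star_mul, map_mul, map_mul, ha, hb, mul_comm]
  | add a b ha hb => rw [star_add, map_add, ha, hb, map_add]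

theorem star_word (w : Word) : star (word w) = word w.reverse := by
  induction w with
  | nil => simp
  | cons c w ih =>
    rw [word_cons, star_mul, ih, star_letter, List.reverse_cons, word_append, word_cons, word_nil,
      mul_one]

theorem degreeLE_of_mem_span {n : ℕ} {p : NC}
    (hp : p ∈ Submodule.span ℂ[X] (word '' {w | w.length ≤ n})) : DegreeLE n p := by
  intro m hm
  obtain ⟨w, rfl⟩ := exists_word_eq m
  by_contra hlt
  rw [Finsupp.mem_support_iff] at hm
  refine hm (co_eq_zero_of_mem_span hp (w := w) ?_)
  simpa [FreeMonoid.length] using hlt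

theorem DegreeLE.star {n : ℕ} {p : NC} (h : DegreeLE n p) : DegreeLE n (star p) := by
  apply degreeLE_of_mem_span
  have hp := h.mem_span
  clear h
  induction hp using Submodule.span_induction with
  | mem x hx =>
    obtain ⟨w, hw, rfl⟩ := hx
    rw [star_word]
    exact word_mem_span (by rw [List.length_reverse]; exact hw)
  | zero => rw [star_zero]; exact Submodule.zero_mem _
  | add x y _ _ hx hy => rw [star_add]; exact Submodule.add_mem _ hx hy
  | smul s x _ hx => rw [star_smul_poly]; exact Submodule.smul_mem _ _ hx

theorem transpose_transpose (F : NCSystem) : transpose (transpose F) = F := by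
  funext i; simp [transpose]

theorem AdmitsSymmetryNine.transpose {κ : Kappa} {F : NCSystem} (h : AdmitsSymmetryNine κ F) :
    AdmitsSymmetryNine κ (transpose F) := by
  obtain ⟨G, hd, hc, hf⟩ := h
  refine ⟨PainleveSix.transpose G, fun i => (hd i).star, fun i => ?_, fun i => ?_⟩
  · rw [PainleveSix.transpose, comm_star, hc]
  · change flow _ (star (G i)) = flow _ (star (F i))
    rw [flow_transpose, flow_transpose, hf]

/-- The coefficients of the transposed system. -/
def Coeffs.transpose (κ : Kappa) (s : Coeffs) : Coeffs :=
  ⟨2 - s.a1 - s.a2 - s.a3, s.a3, s.a2, s.c2, s.c1, 2 * κ.k1 - s.e1, s.f2, s.f1, 2 - s.h1⟩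

theorem NCSystem.ext' {F G : NCSystem} (h0 : F 0 = G 0) (h1 : F 1 = G 1) : F = G := by
  funext i; fin_cases i
  · exact h0
  · exact h1

theorem transpose_system (κ : Kappa) (s : Coeffs) :
    transpose (system κ s) = system κ (s.transpose κ) := by
  have hC (n : ℕ) [n.AtLeastTwo] := map_ofNat (Polynomial.C : ℂ →+* ℂ[X]) n
  apply NCSystem.ext' <;>
  simp only [transpose, system, Matrix.cons_val_zero, Matrix.cons_val_one, Matrix.cons_val_fin_one,
    z_mul, smul_eq_C_smul, cst_eq_C_smul, star_add, star_sub, star_mul, star_one,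
    star_smul_poly, u_eq_letter, v_eq_letter, star_letter, Coeffs.transpose, mul_assoc, map_sub,
    map_add, map_neg, map_mul, hC, smul_add, smul_sub, smul_smul, map_one] <;>
  module

/-! ### The listed systems in terms of the coefficients -/

theorem two_mul_eq_smul (p : NC) : 2 * p = (2 : ℂ) • p := by rw [two_mul, two_smul]

theorem three_mul_eq_smul (p : NC) : 3 * p = (3 : ℂ) • p := by
  rw [← two_add_one_eq_three, add_mul, two_mul, one_mul, ← two_add_one_eq_three, add_smul,
    two_smul, one_smul]

theorem neg_eq_smul (p : NC) : - p = (-1 : ℂ) • p := by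
  apply neg_eq_of_add_eq_zero_right
  nth_rewrite 1 [← one_smul ℂ p]
  rw [← add_smul, add_neg_cancel, zero_smul]

theorem sub_eq_add_smul (p q : NC) : p - q = p + (-1 : ℂ) • q := by
  rw [← neg_eq_smul, sub_eq_add_neg]

theorem cst_eq_smul (c : ℂ) : cst c = c • (1 : NC) := by
  rw [cst, Algebra.algebraMap_eq_smul_one]

set_option linter.unusedSimpArgs false

theorem hamiltonian_eq (κ : Kappa) (β γ : ℂ) :
    hamiltonian κ β γ = system κ ⟨0, 1, 1, β, β, κ.k1, γ, γ, 1⟩ := by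
  apply NCSystem.ext' <;>
  simp only [system, hamiltonian, Matrix.cons_val_zero, Matrix.cons_val_one,
    Matrix.cons_val_fin_one, two_mul_eq_smul, three_mul_eq_smul, cst_eq_smul, mul_add,
    mul_smul_comm, smul_mul_assoc, neg_eq_smul, sub_eq_add_smul] <;>
  module

theorem okamoto1_eq (κ : Kappa) (kh : ℂ) :
    okamoto1 κ kh = system κ ⟨0, 2, 0, 0, 0, (3 * κ.k1 - kh) / 2, -1, 0, 1⟩ := by
  apply NCSystem.ext' <;>
  simp only [system, okamoto1, Matrix.cons_val_zero, Matrix.cons_val_one,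
    Matrix.cons_val_fin_one, two_mul_eq_smul, three_mul_eq_smul, cst_eq_smul, mul_add,
    mul_smul_comm, smul_mul_assoc, neg_eq_smul, sub_eq_add_smul] <;>
  module

theorem okamoto2_eq (κ : Kappa) (kh : ℂ) :
    okamoto2 κ kh = system κ ⟨0, 2, 0, -1, 0, (3 * κ.k1 - kh) / 2, 0, 0, 1⟩ := by
  apply NCSystem.ext' <;>
  simp only [system, okamoto2, Matrix.cons_val_zero, Matrix.cons_val_one,
    Matrix.cons_val_fin_one, two_mul_eq_smul, three_mul_eq_smul, cst_eq_smul, mul_add,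
    mul_smul_comm, smul_mul_assoc, neg_eq_smul, sub_eq_add_smul] <;>
  module

theorem okamoto3_eq (κ : Kappa) (kh : ℂ) :
    okamoto3 κ kh = system κ ⟨0, 2, 0, -1, 0, (3 * κ.k1 - kh) / 2, -1, 0, 2⟩ := by
  apply NCSystem.ext' <;>
  simp only [system, okamoto3, Matrix.cons_val_zero, Matrix.cons_val_one,
    Matrix.cons_val_fin_one, two_mul_eq_smul, three_mul_eq_smul, cst_eq_smul, mul_add,
    mul_smul_comm, smul_mul_assoc, neg_eq_smul, sub_eq_add_smul] <;>
  module

theorem okamoto4_eq (κ : Kappa) :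
    okamoto4 κ = system κ ⟨1, 1, 0, -1, 0, 2 * κ.k1, -2, 0, 2⟩ := by
  apply NCSystem.ext' <;>
  simp only [system, okamoto4, Matrix.cons_val_zero, Matrix.cons_val_one,
    Matrix.cons_val_fin_one, two_mul_eq_smul, three_mul_eq_smul, cst_eq_smul, mul_add,
    mul_smul_comm, smul_mul_assoc, neg_eq_smul, sub_eq_add_smul] <;>
  module

theorem okamoto5_eq (κ : Kappa) :
    okamoto5 κ = system κ ⟨1, 1, 0, -2, 0, 2 * κ.k1, -1, 0, 2⟩ := by
  apply NCSystem.ext' <;>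
  simp only [system, okamoto5, Matrix.cons_val_zero, Matrix.cons_val_one,
    Matrix.cons_val_fin_one, two_mul_eq_smul, three_mul_eq_smul, cst_eq_smul, mul_add,
    mul_smul_comm, smul_mul_assoc, neg_eq_smul, sub_eq_add_smul] <;>
  module

theorem okamoto6_eq (κ : Kappa) :
    okamoto6 κ = system κ ⟨1, 1, 0, -1, 0, 2 * κ.k1, -1, 0, 1⟩ := by
  apply NCSystem.ext' <;>
  simp only [system, okamoto6, Matrix.cons_val_zero, Matrix.cons_val_one,
    Matrix.cons_val_fin_one, two_mul_eq_smul, three_mul_eq_smul, cst_eq_smul, mul_add,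
    mul_smul_comm, smul_mul_assoc, neg_eq_smul, sub_eq_add_smul] <;>
  module

theorem okamoto7_eq (κ : Kappa) :
    okamoto7 κ = system κ ⟨0, 1, 1, -1, 0, κ.k1, 0, 0, 2⟩ := by
  apply NCSystem.ext' <;>
  simp only [system, okamoto7, Matrix.cons_val_zero, Matrix.cons_val_one,
    Matrix.cons_val_fin_one, two_mul_eq_smul, three_mul_eq_smul, cst_eq_smul, mul_add,
    mul_smul_comm, smul_mul_assoc, neg_eq_smul, sub_eq_add_smul] <;>
  module

theorem okamoto8_eq (κ : Kappa) :
    okamoto8 κ = system κ ⟨0, 1, 1, 0, 0, κ.k1, -1, 0, 2⟩ := by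
  apply NCSystem.ext' <;>
  simp only [system, okamoto8, Matrix.cons_val_zero, Matrix.cons_val_one,
    Matrix.cons_val_fin_one, two_mul_eq_smul, three_mul_eq_smul, cst_eq_smul, mul_add,
    mul_smul_comm, smul_mul_assoc, neg_eq_smul, sub_eq_add_smul] <;>
  module

theorem okamoto9_eq (κ : Kappa) :
    okamoto9 κ = system κ ⟨0, 1, 1, -1, 0, κ.k1, 0, -1, 1⟩ := by
  apply NCSystem.ext' <;>
  simp only [system, okamoto9, Matrix.cons_val_zero, Matrix.cons_val_one,
    Matrix.cons_val_fin_one, two_mul_eq_smul, three_mul_eq_smul, cst_eq_smul, mul_add,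
    mul_smul_comm, smul_mul_assoc, neg_eq_smul, sub_eq_add_smul] <;>
  module

theorem new1_eq (κ : Kappa) {kh : ℂ} (h : κ.k3 = (kh ^ 2 - κ.k1 ^ 2) / 4) :
    new1 κ kh = system κ ⟨-1, 3, 0, 0, 0, κ.k1 - kh, 0, 0, 1⟩ := by
  apply NCSystem.ext' <;>
  simp only [system, new1, Matrix.cons_val_zero, Matrix.cons_val_one,
    Matrix.cons_val_fin_one, two_mul_eq_smul, three_mul_eq_smul, cst_eq_smul, mul_add,
    mul_smul_comm, smul_mul_assoc, neg_eq_smul, sub_eq_add_smul, h] <;>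
  module

theorem new2_eq (κ : Kappa) :
    new2 κ = system κ ⟨1, 1, 0, -2, 0, 2 * κ.k1, -2, 0, 3⟩ := by
  apply NCSystem.ext' <;>
  simp only [system, new2, Matrix.cons_val_zero, Matrix.cons_val_one,
    Matrix.cons_val_fin_one, two_mul_eq_smul, three_mul_eq_smul, cst_eq_smul, mul_add,
    mul_smul_comm, smul_mul_assoc, neg_eq_smul, sub_eq_add_smul] <;>
  module

theorem new3_eq (κ : Kappa) :
    new3 κ = system κ ⟨1, 1, 0, -2, 0, 2 * κ.k1, 0, 0, 1⟩ := by
  apply NCSystem.ext' <;>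
  simp only [system, new3, Matrix.cons_val_zero, Matrix.cons_val_one,
    Matrix.cons_val_fin_one, two_mul_eq_smul, three_mul_eq_smul, cst_eq_smul, mul_add,
    mul_smul_comm, smul_mul_assoc, neg_eq_smul, sub_eq_add_smul] <;>
  module

theorem new4_eq (κ : Kappa) :
    new4 κ = system κ ⟨1, 1, 0, 0, 0, 2 * κ.k1, -2, 0, 1⟩ := by
  apply NCSystem.ext' <;>
  simp only [system, new4, Matrix.cons_val_zero, Matrix.cons_val_one,
    Matrix.cons_val_fin_one, two_mul_eq_smul, three_mul_eq_smul, cst_eq_smul, mul_add,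
    mul_smul_comm, smul_mul_assoc, neg_eq_smul, sub_eq_add_smul] <;>
  module

theorem new5_eq (κ : Kappa) {kh : ℂ} (h : κ.k3 = (kh ^ 2 - κ.k1 ^ 2) / 4) :
    new5 κ kh = system κ ⟨2, 0, 0, -2, 0, (5 * κ.k1 - kh) / 2, -2, 0, 2⟩ := by
  apply NCSystem.ext' <;>
  simp only [system, new5, Matrix.cons_val_zero, Matrix.cons_val_one,
    Matrix.cons_val_fin_one, two_mul_eq_smul, three_mul_eq_smul, cst_eq_smul, mul_add,
    mul_smul_comm, smul_mul_assoc, neg_eq_smul, sub_eq_add_smul, h] <;>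
  module

theorem new6_eq (κ : Kappa) {kh : ℂ} (h : κ.k3 = (kh ^ 2 - κ.k1 ^ 2) / 4) :
    new6 κ kh = system κ ⟨0, 2, 0, -2, 0, (3 * κ.k1 - kh) / 2, 0, 0, 2⟩ := by
  apply NCSystem.ext' <;>
  simp only [system, new6, Matrix.cons_val_zero, Matrix.cons_val_one,
    Matrix.cons_val_fin_one, two_mul_eq_smul, three_mul_eq_smul, cst_eq_smul, mul_add,
    mul_smul_comm, smul_mul_assoc, neg_eq_smul, sub_eq_add_smul, h] <;>
  module

theorem new7_eq (κ : Kappa) {kh : ℂ} (h : κ.k3 = (kh ^ 2 - κ.k1 ^ 2) / 4) :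
    new7 κ kh = system κ ⟨0, 2, 0, 0, 0, (3 * κ.k1 - kh) / 2, -2, 0, 2⟩ := by
  apply NCSystem.ext' <;>
  simp only [system, new7, Matrix.cons_val_zero, Matrix.cons_val_one,
    Matrix.cons_val_fin_one, two_mul_eq_smul, three_mul_eq_smul, cst_eq_smul, mul_add,
    mul_smul_comm, smul_mul_assoc, neg_eq_smul, sub_eq_add_smul, h] <;>
  module

theorem new8_eq (κ : Kappa) {kh : ℂ} (h : κ.k3 = (kh ^ 2 - κ.k1 ^ 2) / 4) :
    new8 κ kh = system κ ⟨0, 2, 0, 0, 0, (3 * κ.k1 - kh) / 2, 0, 0, 0⟩ := by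
  apply NCSystem.ext' <;>
  simp only [system, new8, Matrix.cons_val_zero, Matrix.cons_val_one,
    Matrix.cons_val_fin_one, two_mul_eq_smul, three_mul_eq_smul, cst_eq_smul, mul_add,
    mul_smul_comm, smul_mul_assoc, neg_eq_smul, sub_eq_add_smul, h] <;>
  module

/-! ### Systems with a symmetry are in the lists -/

theorem center_eval (t : ℂ) : center.eval t = (1 + t) / 3 := by
  simp [center]; ring

/-- The parameters of the shifted system at a value of `z`. -/
def paramsAt (κ : Kappa) (s : Coeffs) (t : ℂ) : Params ℂ :=
  let l := (1 + t) / 3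
  let C := s.c1 + s.f1 * t
  let D := s.c2 + s.f2 * t
  let p := 3 * l ^ 2 - t
  let th := κ.k2 + κ.k4 * t
  { C1 := C + l * (3 * s.a1 + s.a2)
    C2 := D + l * (s.a3 + 3 * (2 - s.a1 - s.a2 - s.a3))
    x := - p - (t * s.h1 + l * (C - D) - 6 * l ^ 2 + l ^ 2 * (3 * s.a1 + 2 * s.a2 + s.a3))
    p := p
    q := 2 * l ^ 3 - t * l
    k1 := κ.k1
    e1 := s.e1
    th1 := th - 2 * κ.k1 * l
    th0 := - κ.k1 * l ^ 2 + th * l + t * (κ.k1 - κ.k2 - κ.k4)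
    k3 := κ.k3 }

theorem params_map_eval (κ : Kappa) (s : Coeffs) (t : ℂ) :
    (params κ s).map (Polynomial.evalRingHom t) = paramsAt κ s t := by
  simp [params, Params.map, paramsAt, center_eval]
  exact mul_comm _ _

theorem AdmitsSymmetryNine.exists_isSymmetry_at {κ : Kappa} {s : Coeffs}
    (h : AdmitsSymmetryNine κ (system κ s)) (a1 a2 a3 : ℤ) (h1 : s.a1 = a1) (h2 : s.a2 = a2)
    (h3 : s.a3 = a3) (t : ℂ) : ∃ g, IsSymmetry a1 a2 a3 (paramsAt κ s t) g := by
  obtain ⟨g, hg⟩ := h.exists_isSymmetry a1 a2 a3 h1 h2 h3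
  exact ⟨_, params_map_eval κ s t ▸ hg.map (Polynomial.evalRingHom t)⟩

theorem params_p_ne_C_mul_sq (κ : Kappa) (s : Coeffs) (b : ℂ) (f : ℂ[X]) :
    (params κ s).p ≠ Polynomial.C b * f ^ 2 := by
  intro h
  obtain ⟨r, hr⟩ := IsAlgClosed.exists_pow_nat_eq (-3 : ℂ) (n := 2) (by norm_num)
  have hr0 : r ≠ 0 := by rintro rfl; norm_num at hr
  have e1 := congrArg (Polynomial.eval ((1 + r) / 2)) h
  have e2 := congrArg (fun q => Polynomial.eval ((1 + r) / 2) (Polynomial.derivative q)) h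
  have hd : Polynomial.derivative center = Polynomial.C (1 / 3) := by simp [center]
  simp [params, center_eval, hd, sq] at e1 e2
  have e3 : b * (f.eval ((1 + r) / 2)) ^ 2 = 0 := by linear_combination -e1 + hr / 12
  rcases mul_eq_zero.1 e3 with hb | hf
  · subst hb
    apply hr0
    linear_combination 3 * e2
  · have hf : f.eval ((1 + r) / 2) = 0 := by simpa using hf
    rw [hf] at e2
    apply hr0
    linear_combination 3 * e2

theorem inLists_of_lead130 {κ : Kappa} {s : Coeffs} (h : AdmitsSymmetryNine κ (system κ s))
    (h1 : s.a1 = -1) (h2 : s.a2 = 3) (h3 : s.a3 = 0) : InLists κ (system κ s) := by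
  obtain ⟨g, hg⟩ := h.exists_isSymmetry_at (-1) 3 0 (by simp [h1]) (by simp [h2]) (by simp [h3]) 0
  obtain ⟨p1, p2, p3, p4⟩ := hg.lead130
  obtain ⟨g, hg⟩ := h.exists_isSymmetry_at (-1) 3 0 (by simp [h1]) (by simp [h2]) (by simp [h3]) 1
  obtain ⟨q1, q2, q3, q4⟩ := hg.lead130
  obtain ⟨a1, a2, a3, c1, c2, e1, f1, f2, hh⟩ := s
  simp only [paramsAt] at *
  subst h1 h2 h3
  have hc1 : c1 = 0 := by linear_combination p1
  have hc2 : c2 = 0 := by linear_combination p2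
  subst hc1 hc2
  have hf1 : f1 = 0 := by linear_combination q1
  have hf2 : f2 = 0 := by linear_combination q2
  subst hf1 hf2
  have hh1 : hh = 1 := by linear_combination -q3
  subst hh1
  have hk : κ.k3 = ((κ.k1 - e1) ^ 2 - κ.k1 ^ 2) / 4 := by linear_combination -p4 / 4
  refine .inr (.inr (.inl ⟨κ.k1 - e1, hk, .inl ?_⟩))
  rw [new1_eq κ hk, sub_sub_cancel]

theorem inLists_of_lead200 {κ : Kappa} {s : Coeffs} (h : AdmitsSymmetryNine κ (system κ s))
    (h1 : s.a1 = 2) (h2 : s.a2 = 0) (h3 : s.a3 = 0) : InLists κ (system κ s) := by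
  obtain ⟨g, hg⟩ := h.exists_isSymmetry_at 2 0 0 (by simp [h1]) (by simp [h2]) (by simp [h3]) 0
  obtain ⟨p1, p2, p3, p4⟩ := hg.lead200
  obtain ⟨g, hg⟩ := h.exists_isSymmetry_at 2 0 0 (by simp [h1]) (by simp [h2]) (by simp [h3]) 1
  obtain ⟨q1, q2, q3, q4⟩ := hg.lead200
  obtain ⟨a1, a2, a3, c1, c2, e1, f1, f2, hh⟩ := s
  simp only [paramsAt] at *
  subst h1 h2 h3
  have hc1 : c1 = -2 := by linear_combination p1
  have hc2 : c2 = 0 := by linear_combination p2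
  subst hc1 hc2
  have hf1 : f1 = -2 := by linear_combination q1
  have hf2 : f2 = 0 := by linear_combination q2
  subst hf1 hf2
  have hh1 : hh = 2 := by linear_combination -q3
  subst hh1
  have hk : κ.k3 = ((5 * κ.k1 - 2 * e1) ^ 2 - κ.k1 ^ 2) / 4 := by linear_combination -p4
  refine .inr (.inr (.inl ⟨5 * κ.k1 - 2 * e1, hk, .inr (.inl ?_)⟩))
  rw [new5_eq κ hk]
  congr 2
  ring

theorem not_admits_of_lead031 {κ : Kappa} {s : Coeffs} (h : AdmitsSymmetryNine κ (system κ s))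
    (h1 : s.a1 = 0) (h2 : s.a2 = 3) (h3 : s.a3 = -1) : False := by
  obtain ⟨g, hg⟩ := h.exists_isSymmetry 0 3 (-1) (by simp [h1]) (by simp [h2]) (by simp [h3])
  exact params_p_ne_C_mul_sq κ s 3 _ hg.lead031.2

theorem inLists_of_lead020 {κ : Kappa} {s : Coeffs} (h : AdmitsSymmetryNine κ (system κ s))
    (h1 : s.a1 = 0) (h2 : s.a2 = 2) (h3 : s.a3 = 0) : InLists κ (system κ s) := by
  have key := fun t => h.exists_isSymmetry_at 0 2 0 (by simp [h1]) (by simp [h2]) (by simp [h3]) t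
  obtain ⟨g, hg⟩ := key 0
  obtain ⟨A1, A2, A3, A4⟩ := hg.lead020 (by norm_num [paramsAt])
  obtain ⟨g, hg⟩ := key 1
  obtain ⟨B1, B2, B3, B4⟩ := hg.lead020 (by norm_num [paramsAt])
  obtain ⟨g, hg⟩ := key (-1)
  obtain ⟨D1, D2, D3, D4⟩ := hg.lead020 (by norm_num [paramsAt])
  obtain ⟨g, hg⟩ := key 2
  obtain ⟨E1, E2, E3, E4⟩ := hg.lead020 (by norm_num [paramsAt])
  clear key hg g h B2 D2 E2 E4 A4 B4
  obtain ⟨a1, a2, a3, c, c2, e1, f, f2, hh⟩ := s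
  simp only [paramsAt] at *
  subst h1 h2 h3
  have hc2 : c2 = 0 := by linear_combination A1
  subst hc2
  have hf2 : f2 = 0 := by linear_combination B1
  subst hf2
  have hk : κ.k3 = ((3 * κ.k1 - 2 * e1) ^ 2 - κ.k1 ^ 2) / 4 := by linear_combination -A2
  have he : e1 = (3 * κ.k1 - (3 * κ.k1 - 2 * e1)) / 2 := by ring
  generalize 3 * κ.k1 - 2 * e1 = kh at hk he
  subst he
  have F0 : c * ((c + 1) * (c + 2)) = 0 := by linear_combination -A3
  have F3 : f * ((f + 1) * (f + 2)) = 0 := by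
    linear_combination (-E3 + 3 * B3 - 3 * A3 + D3) / 6
  have F1 : (c + f) * (c + f + 2) * (c + f + 4) + (3 * hh - 2) * (c + f) + 4 * hh = 0 := by
    linear_combination -B3
  have F2 : (c - f) ^ 3 - (3 * hh - 2) * (c - f) = 0 := by linear_combination -D3
  have hc : c = 0 ∨ c = -1 ∨ c = -2 := by
    simpa only [mul_eq_zero, add_eq_zero_iff_eq_neg] using F0
  have hf : f = 0 ∨ f = -1 ∨ f = -2 := by
    simpa only [mul_eq_zero, add_eq_zero_iff_eq_neg] using F3
  rcases hc with rfl | rfl | rfl <;> rcases hf with rfl | rfl | rfl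
  · have : hh = 0 := by linear_combination F1 / 4
    subst this
    exact .inr (.inr (.inl ⟨kh, hk, by simp [new8_eq κ hk]⟩))
  · have : hh = 1 := by linear_combination F1
    subst this
    exact .inr (.inl (.inl ⟨kh, hk, by simp [okamoto1_eq]⟩))
  · have : hh = 2 := by linear_combination -F1 / 2
    subst this
    exact .inr (.inr (.inl ⟨kh, hk, by simp [new7_eq κ hk]⟩))
  · have : hh = 1 := by linear_combination F1
    subst this
    exact .inr (.inl (.inl ⟨kh, hk, by simp [okamoto2_eq]⟩))
  · have : hh = 2 := by linear_combination -F1 / 2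
    subst this
    exact .inr (.inl (.inl ⟨kh, hk, by simp [okamoto3_eq]⟩))
  · exfalso
    have : (1 : ℂ) = 0 := by linear_combination (5 * F2 - 3 * F1) / (-12)
    norm_num at this
  · have : hh = 2 := by linear_combination -F1 / 2
    subst this
    exact .inr (.inr (.inl ⟨kh, hk, by simp [new6_eq κ hk]⟩))
  · exfalso
    have : (1 : ℂ) = 0 := by linear_combination (-5 * F2 - 3 * F1) / (-12)
    norm_num at this
  · have : hh = 1 := by linear_combination -F1 / 8
    subst this
    exact (D4 (by ring) (by ring) (by ring)).elim

theorem inLists_of_lead110 {κ : Kappa} {s : Coeffs} (h : AdmitsSymmetryNine κ (system κ s))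
    (h1 : s.a1 = 1) (h2 : s.a2 = 1) (h3 : s.a3 = 0) : InLists κ (system κ s) := by
  have key := fun t => h.exists_isSymmetry_at 1 1 0 (by simp [h1]) (by simp [h2]) (by simp [h3]) t
  obtain ⟨g, hg⟩ := key 0
  obtain ⟨A1, A2, A3, A4⟩ := hg.lead110 (by norm_num [paramsAt])
  obtain ⟨g, hg⟩ := key 1
  obtain ⟨B1, B2, B3, B4⟩ := hg.lead110 (by norm_num [paramsAt])
  obtain ⟨g, hg⟩ := key (-1)
  obtain ⟨D1, D2, D3, D4⟩ := hg.lead110 (by norm_num [paramsAt])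
  obtain ⟨g, hg⟩ := key 2
  obtain ⟨E1, E2, E3, E4⟩ := hg.lead110 (by norm_num [paramsAt])
  clear key hg g h B2 D2 E2 E4 A4 B4
  obtain ⟨a1, a2, a3, c, c2, e1, f, f2, hh⟩ := s
  simp only [paramsAt] at *
  subst h1 h2 h3 A2
  have hc2 : c2 = 0 := by linear_combination A1
  subst hc2
  have hf2 : f2 = 0 := by linear_combination B1
  subst hf2
  have F0 : c * ((c + 1) * (c + 2)) = 0 := by linear_combination A3
  have F3 : f * ((f + 1) * (f + 2)) = 0 := by
    linear_combination (E3 - 3 * B3 + 3 * A3 - D3) / 6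
  have F1 : (c + f) * (c + f + 2) * (c + f + 4) + (7 - 3 * hh) * (c + f) + 2 * (8 - 4 * hh) = 0 := by
    linear_combination B3
  have F2 : (c - f) ^ 3 - (7 - 3 * hh) * (c - f) = 0 := by linear_combination D3
  have hc : c = 0 ∨ c = -1 ∨ c = -2 := by
    simpa only [mul_eq_zero, add_eq_zero_iff_eq_neg] using F0
  have hf : f = 0 ∨ f = -1 ∨ f = -2 := by
    simpa only [mul_eq_zero, add_eq_zero_iff_eq_neg] using F3
  rcases hc with rfl | rfl | rfl <;> rcases hf with rfl | rfl | rfl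
  · have : hh = 2 := by linear_combination -F1 / 8
    subst this
    exact (D4 (by ring) (by ring) (by ring)).elim
  · exfalso
    have : (1 : ℂ) = 0 := by linear_combination (5 * F2 + 3 * F1) / (-12)
    norm_num at this
  · have : hh = 1 := by linear_combination -F1 / 2
    subst this
    exact .inr (.inr (.inr (.inr (.inr (new4_eq κ).symm))))
  · exfalso
    have : (1 : ℂ) = 0 := by linear_combination (-5 * F2 + 3 * F1) / (-12)
    norm_num at this
  · have : hh = 1 := by linear_combination -F1 / 2
    subst this
    exact .inr (.inl (.inr (.inr (.inr (.inl (okamoto6_eq κ).symm)))))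
  · have : hh = 2 := by linear_combination F1
    subst this
    exact .inr (.inl (.inr (.inl (okamoto4_eq κ).symm)))
  · have : hh = 1 := by linear_combination -F1 / 2
    subst this
    exact .inr (.inr (.inr (.inr (.inl (new3_eq κ).symm))))
  · have : hh = 2 := by linear_combination F1
    subst this
    exact .inr (.inl (.inr (.inr (.inl (okamoto5_eq κ).symm))))
  · have : hh = 3 := by linear_combination F1 / 4
    subst this
    exact .inr (.inr (.inr (.inl (new2_eq κ).symm)))

theorem inLists_of_lead011 {κ : Kappa} {s : Coeffs} (h : AdmitsSymmetryNine κ (system κ s))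
    (h1 : s.a1 = 0) (h2 : s.a2 = 1) (h3 : s.a3 = 1) :
    InLists κ (system κ s) ∨ InLists κ (transpose (system κ s)) := by
  obtain ⟨g, hg⟩ := h.exists_isSymmetry 0 1 1 (by simp [h1]) (by simp [h2]) (by simp [h3])
  have he := hg.lead011_e1
  obtain ⟨a1, a2, a3, c1, c2, e1, f1, f2, hh⟩ := s
  dsimp only at h1 h2 h3
  subst h1 h2 h3
  have he : e1 = κ.k1 := by simpa [params] using he
  subst he
  set d : ℂ[X] := .C ((c1 - c2) / 2) + .C ((f1 - f2) / 2) * .X with hd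
  set m : ℂ[X] := .C ((c1 + c2) / 2) + .C ((f1 + f2) / 2) * .X + center with hm
  have e1 : (params κ ⟨0, 1, 1, c1, c2, κ.k1, f1, f2, hh⟩).C1 = m + d := by
    apply Polynomial.funext
    intro t
    simp [params, hm, hd]
    ring
  have e2 : (params κ ⟨0, 1, 1, c1, c2, κ.k1, f1, f2, hh⟩).C2 = m - d := by
    apply Polynomial.funext
    intro t
    simp [params, hm, hd]
    ring
  by_cases hd0 : d = 0
  · left; left
    rw [hd0, add_zero] at e1
    rw [hd0, sub_zero] at e2
    have hx := hg.lead011_of_eq e1 e2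
    have d0 := congrArg (Polynomial.eval 0) hd0
    have d1 := congrArg (Polynomial.eval 1) hd0
    have x1 := congrArg (Polynomial.eval 1) hx
    simp [hd, params, center_eval] at d0 d1 x1
    have hc : c2 = c1 := by linear_combination -d0
    have hf : f2 = f1 := by linear_combination -2 * d1 + d0
    subst hc hf
    have : hh = 1 := by linear_combination -x1
    subst this
    exact ⟨c2, f2, (hamiltonian_eq κ c2 f2).symm⟩
  · obtain ⟨hp, hx⟩ := hg.lead011_of_ne e1 e2 hd0
      (fun h0 => params_p_ne_C_mul_sq κ _ 0 0 (by simpa using h0))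
      (fun f => params_p_ne_C_mul_sq κ _ 3 f)
      (fun f hf => params_p_ne_C_mul_sq κ ⟨0, 1, 1, c1, c2, κ.k1, f1, f2, hh⟩ (-1 / 2) f (by
        have : (2 : ℂ[X]) * ((params κ ⟨0, 1, 1, c1, c2, κ.k1, f1, f2, hh⟩).p -
            Polynomial.C (-1 / 2) * f ^ 2) = 0 := by
          have hC : (2 : ℂ[X]) * Polynomial.C (-1 / 2) = -1 := by
            have : (2 : ℂ[X]) = Polynomial.C 2 := rfl
            rw [this, ← Polynomial.C_mul]
            norm_num
          linear_combination hf - f ^ 2 * hC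
        have := (mul_eq_zero.1 this).resolve_left (by simp)
        linear_combination this))
    have P := fun t => congrArg (Polynomial.eval t) hp
    have Q := fun t => congrArg (Polynomial.eval t) hx
    simp only [params, hm, hd] at P Q
    simp [center_eval] at P Q
    have A0 : c1 ^ 2 + c1 * c2 + c2 ^ 2 + c1 + c2 = 0 := by linear_combination -P 0
    have A2 : f1 ^ 2 + f1 * f2 + f2 ^ 2 + f1 + f2 = 0 := by
      linear_combination -(P 1 + P (-1) - 2 * P 0) / 2
    have A1 : 2 * c1 * f1 + c1 * f2 + c2 * f1 + 2 * c2 * f2 + c1 + c2 + f1 + f2 + 1 = 0 := by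
      linear_combination -(P 1 - P (-1)) / 2
    have B0 : (c1 - c2) * (c1 + c2 + 1) = 0 := by linear_combination -Q 0
    have B2 : (f1 - f2) * (f1 + f2 + 1) = 0 := by
      linear_combination -(Q 1 + Q (-1) - 2 * Q 0) / 2
    have B1 : 1 - hh = (c1 - c2) * (f1 + f2 + 1) + (f1 - f2) * (c1 + c2 + 1) := by
      linear_combination (Q 1 - Q (-1)) / 2
    have roots : ∀ a b : ℂ, a ^ 2 + a * b + b ^ 2 + a + b = 0 → (a - b) * (a + b + 1) = 0 →
        (a = 0 ∧ b = 0) ∨ (a = -2 / 3 ∧ b = -2 / 3) ∨ (a = 0 ∧ b = -1) ∨ (a = -1 ∧ b = 0) := by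
      intro a b h1 h2
      rcases mul_eq_zero.1 h2 with h | h
      · have hb : b = a := by linear_combination -h
        subst hb
        have : b * (b + 2 / 3) = 0 := by linear_combination h1 / 3
        rcases mul_eq_zero.1 this with h | h
        · exact .inl ⟨h, h⟩
        · have : b = -2 / 3 := by linear_combination h
          exact .inr (.inl ⟨this, this⟩)
      · have hb : b = -1 - a := by linear_combination h
        subst hb
        have : a * (a + 1) = 0 := by linear_combination h1
        rcases mul_eq_zero.1 this with h | h
        · exact .inr (.inr (.inl ⟨h, by rw [h]; ring⟩))
        · have : a = -1 := by linear_combination h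
          exact .inr (.inr (.inr ⟨this, by rw [this]; ring⟩))
    have tr : ∀ (s : Coeffs) (F : NCSystem), F = system κ (s.transpose κ) →
        transpose (system κ s) = F := fun s F hF => by rw [transpose_system, hF]
    clear P Q hp hx hd0 e1 e2 hg h
    rcases roots c1 c2 A0 B0 with ⟨rfl, rfl⟩ | ⟨rfl, rfl⟩ | ⟨rfl, rfl⟩ | ⟨rfl, rfl⟩ <;>
    rcases roots f1 f2 A2 B2 with ⟨rfl, rfl⟩ | ⟨rfl, rfl⟩ | ⟨rfl, rfl⟩ | ⟨rfl, rfl⟩ <;>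
    first
    | (exfalso; norm_num at A1; done)
    | skip
    · have : hh = 0 := by linear_combination -B1
      subst this
      right
      refine .inr (.inl (.inr (.inr (.inr (.inr (.inr (.inl (tr _ _ ?_))))))))
      rw [okamoto8_eq]; congr 1; simp only [Coeffs.transpose, Coeffs.mk.injEq]; norm_num; ring
    · have : hh = 2 := by linear_combination -B1
      subst this
      left
      exact .inr (.inl (.inr (.inr (.inr (.inr (.inr (.inl (okamoto8_eq κ).symm)))))))
    · have : hh = 0 := by linear_combination -B1
      subst this
      right
      refine .inr (.inl (.inr (.inr (.inr (.inr (.inl (tr _ _ ?_)))))))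
      rw [okamoto7_eq]; congr 1; simp only [Coeffs.transpose, Coeffs.mk.injEq]; norm_num; ring
    · have : hh = 1 := by linear_combination -B1
      subst this
      right
      refine .inr (.inl (.inr (.inr (.inr (.inr (.inr (.inr (tr _ _ ?_))))))))
      rw [okamoto9_eq]; congr 1; simp only [Coeffs.transpose, Coeffs.mk.injEq]; norm_num; ring
    · have : hh = 2 := by linear_combination -B1
      subst this
      left
      exact .inr (.inl (.inr (.inr (.inr (.inr (.inl (okamoto7_eq κ).symm))))))
    · have : hh = 1 := by linear_combination -B1
      subst this
      left
      exact .inr (.inl (.inr (.inr (.inr (.inr (.inr (.inr (okamoto9_eq κ).symm)))))))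

theorem inLists_of_isLeadingCase {κ : Kappa} {s : Coeffs}
    (h : AdmitsSymmetryNine κ (system κ s)) (hs : IsLeadingCase s.a1 s.a2 s.a3) :
    InLists κ (system κ s) ∨ InLists κ (transpose (system κ s)) := by
  have ht : AdmitsSymmetryNine κ (system κ (s.transpose κ)) := by
    rw [← transpose_system]; exact h.transpose
  rcases hs with ⟨a, rfl | rfl | rfl | rfl, h1, h2, h3⟩ |
    ⟨a, rfl | rfl | rfl | rfl | rfl, h1, h2, h3⟩
  · exact .inl (inLists_of_lead130 h h1 (by rw [h2]; norm_num) h3)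
  · exact .inl (inLists_of_lead020 h h1 (by rw [h2]; norm_num) h3)
  · exact .inl (inLists_of_lead110 h h1 (by rw [h2]; norm_num) h3)
  · exact .inl (inLists_of_lead200 h h1 (by rw [h2]; norm_num) h3)
  · refine (not_admits_of_lead031 ht ?_ ?_ ?_).elim <;>
    simp only [Coeffs.transpose, h1, h2, h3] <;> norm_num
  · right
    rw [transpose_system]
    refine inLists_of_lead020 ht ?_ ?_ ?_ <;>
    simp only [Coeffs.transpose, h1, h2, h3] <;> norm_num
  · exact inLists_of_lead011 h h1 h2 (by rw [h3]; norm_num)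
  · exact .inl (inLists_of_lead020 h h1 h2 (by rw [h3]; norm_num))
  · exact (not_admits_of_lead031 h h1 h2 (by rw [h3]; norm_num)).elim

theorem inLists_of_admits {κ : Kappa} {s : Coeffs} (hs : HasLeadingCase s)
    (h : AdmitsSymmetryNine κ (system κ s)) :
    InLists κ (system κ s) ∨ InLists κ (transpose (system κ s)) := by
  rcases hs with hs | hs
  · exact inLists_of_isLeadingCase h hs
  · have ht : AdmitsSymmetryNine κ (system κ (s.transpose κ)) := by
      rw [← transpose_system]; exact h.transpose
    have := inLists_of_isLeadingCase ht hs
    rw [← transpose_system, transpose_transpose] at this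
    exact this.symm

/-! ### Adding an inner derivation to a system -/

/-- The system `F` plus the inner derivation of `A`. -/
def addInner (F : NCSystem) (A : NC) : NCSystem := fun i =>
  F i + (A * FreeAlgebra.ι ℂ[X] i - FreeAlgebra.ι ℂ[X] i * A)

theorem flow_sub (F : NCSystem) (p q : NC) : flow F (p - q) = flow F p - flow F q :=
  (flowL F).map_sub p q

theorem flow_addInner (F : NCSystem) (A p : NC) :
    flow (addInner F A) p = flow F p + (A * p - p * A) := by
  induction p using FreeAlgebra.induction with
  | grade0 r => rw [flow_algebraMap, flow_algebraMap, Algebra.commutes r A, sub_self, add_zero]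
  | grade1 i => rw [flow_var, flow_var, addInner]
  | mul a b ha hb =>
    rw [flow_mul, flow_mul, ha, hb]
    simp only [mul_add, mul_sub, add_mul, sub_mul, mul_assoc]
    abel
  | add a b ha hb => rw [flow_add, flow_add, ha, hb, mul_add, add_mul]; abel

theorem comm_addInner (F : NCSystem) (A : NC) (i : Fin 2) : comm (addInner F A i) = comm (F i) := by
  rw [addInner, map_add, map_sub, map_mul, map_mul, mul_comm, sub_self, add_zero]

/-- Two commuting flows stay so if inner derivations subject to the zero curvature condition
are added to them. -/
theorem flow_addInner_comm {F G : NCSystem} {A B : NC} (h : ∀ i, flow F (G i) = flow G (F i))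
    (hAB : flow F B + (A * B - B * A) = flow G A) (i : Fin 2) :
    flow (addInner F A) (addInner G B i) = flow (addInner G B) (addInner F A i) := by
  rw [flow_addInner, flow_addInner, addInner, addInner, flow_add, flow_add, flow_sub, flow_sub,
    flow_mul, flow_mul, flow_mul, flow_mul, flow_var, flow_var, h, ← hAB]
  simp only [mul_add, mul_sub, add_mul, sub_mul, mul_assoc]
  abel

theorem mul_letter_mem_span {n : ℕ} {p : NC} (c : Bool)
    (hp : p ∈ Submodule.span ℂ[X] (word '' {w | w.length ≤ n})) :
    p * letter c ∈ Submodule.span ℂ[X] (word '' {w | w.length ≤ n + 1}) := by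
  induction hp using Submodule.span_induction with
  | mem x hx =>
    obtain ⟨w', h', rfl⟩ := hx
    have : word w' * letter c = word (w' ++ [c]) := by
      rw [word_append, word_cons, word_nil, mul_one]
    rw [this]
    refine word_mem_span ?_
    rw [List.length_append]
    exact Nat.succ_le_succ h'
  | zero => simp
  | add x y _ _ hx hy => rw [add_mul]; exact Submodule.add_mem _ hx hy
  | smul r x _ hx => rw [smul_mul_assoc]; exact Submodule.smul_mem _ _ hx

theorem DegreeLE.addInner {n : ℕ} {G : NCSystem} {B : NC} {i : Fin 2}
    (hG : DegreeLE (n + 1) (G i))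
    (hB : B ∈ Submodule.span ℂ[X] (word '' {w | w.length ≤ n})) :
    DegreeLE (n + 1) (addInner G B i) := by
  have hi : ∃ c, FreeAlgebra.ι ℂ[X] i = letter c := by
    fin_cases i
    · exact ⟨false, rfl⟩
    · exact ⟨true, rfl⟩
  obtain ⟨c, hc⟩ := hi
  apply degreeLE_of_mem_span
  rw [PainleveSix.addInner, hc]
  exact Submodule.add_mem _ hG.mem_span
    (Submodule.sub_mem _ (mul_letter_mem_span c hB) (letter_mul_mem_span c hB))

/-- The element whose inner derivation takes the Hamiltonian system with `β = γ = 0` to the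
system with the coefficients `s`. -/
def gauge (κ : Kappa) (s : Coeffs) : NC :=
  (- s.a1) • (u * u * v) + (1 - s.a1 - s.a2) • (u * v * u)
    + (2 - s.a1 - s.a2 - s.a3) • (v * u * u)
    + (- s.c1) • (u * v) + s.c2 • (v * u) + (s.e1 - κ.k1) • u
    + z * ((- s.f1) • (u * v) + s.f2 • (v * u) + (1 - s.h1) • v)

theorem system_eq_addInner (κ : Kappa) (s : Coeffs) :
    system κ s = addInner (hamiltonian κ 0 0) (gauge κ s) := by
  have hC (n : ℕ) [n.AtLeastTwo] := map_ofNat (Polynomial.C : ℂ →+* ℂ[X]) n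
  have h0 : FreeAlgebra.ι ℂ[X] (0 : Fin 2) = letter false := rfl
  have h1 : FreeAlgebra.ι ℂ[X] (1 : Fin 2) = letter true := rfl
  rw [hamiltonian_eq]
  apply NCSystem.ext' <;>
  simp only [addInner, gauge, h0, h1, system, Matrix.cons_val_zero, Matrix.cons_val_one,
    Matrix.cons_val_fin_one, z_mul, smul_eq_C_smul, cst_eq_C_smul, u_eq_letter, v_eq_letter,
    mul_assoc, map_sub, map_add, map_neg, map_mul, hC, smul_add, smul_sub, smul_smul, map_one,
    add_mul, mul_add, smul_mul_assoc, mul_smul_comm, map_zero] <;>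
  module

/-! ### Computing with non-commutative polynomials -/

/-- Non-commutative polynomials in Horner form: `node p l r` is `p + u * l + v * r`. -/
inductive Horner : Type
  | zero : Horner
  | node (p : Poly) (l r : Horner) : Horner

namespace Horner

section Ops

def add (p : Horner) : Horner → Horner :=
  Horner.rec (motive := fun _ => Horner → Horner) (fun q => q)
    (fun p l r ihl ihr q => Horner.rec (motive := fun _ => Horner) (node p l r)
      (fun p' l' r' _ _ => List.rec (motive := fun _ => Horner) (node p' (ihl l') (ihr r'))
        (fun _ _ _ => List.rec (motive := fun _ => Horner) (node p (ihl l') (ihr r'))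
          (fun _ _ _ => forcePoly (Poly.add p p') fun s => node s (ihl l') (ihr r')) p') p) q) p

def scale (c : Poly) (p : Horner) : Horner :=
  Horner.rec (motive := fun _ => Horner) zero
    (fun p _ _ ihl ihr => List.rec (motive := fun _ => Horner) (node [] ihl ihr)
      (fun _ _ _ => forcePoly (Poly.addMul c p []) fun s => node s ihl ihr) p) p

def mul (p q : Horner) : Horner :=
  Horner.rec (motive := fun _ => Horner) zero
    (fun _ _ _ _ _ => Horner.rec (motive := fun _ => Horner) zero
      (fun p _ _ ihl ihr => List.rec (motive := fun _ => Horner) (node [] ihl ihr)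
        (fun _ _ _ => add (scale p q) (node [] ihl ihr)) p) p) q

def sub (p q : Horner) : Horner := add p (scale [([], -1)] q)

/-- The derivation along the system `F`. -/
def deriv (F : Bool → Horner) (p : Horner) : Horner :=
  Horner.rec (motive := fun _ => Horner) zero
    (fun _ l r ihl ihr => add (add (mul (F false) l) (mul (F true) r)) (node [] ihl ihr)) p

def isZero : Horner → Bool
  | zero => true
  | node p l r => p.isEmpty && (isZero l && isZero r)

/-- The product with `v`, written with the letters in order, of a polynomial in which all letters
are in order. -/
def sortedVMul : Horner → Horner
  | zero => zero
  | node p l r => node [] (sortedVMul l) (node p zero r)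

/-- Sorting the letters of every word. -/
def sort : Horner → Horner
  | zero => zero
  | node p l r => add (node p (sort l) zero) (sortedVMul (sort r))

/-- One more than the degree. -/
def height : Horner → ℕ
  | zero => 0
  | node _ l r => Nat.succ (Nat.max (height l) (height r))

end Ops

section Eval

variable (env : ℕ → ℂ[X])

def eval : Horner → NC
  | zero => 0
  | node p l r => p.eval env • 1 + letter false * eval l + letter true * eval r

def evalSystem (F : Bool → Horner) : NCSystem := ![(F false).eval env, (F true).eval env]

theorem evalSystem_zero (F : Bool → Horner) : evalSystem env F 0 = (F false).eval env := rfl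

theorem evalSystem_one (F : Bool → Horner) : evalSystem env F 1 = (F true).eval env := rfl

theorem eval_add (p q : Horner) : (add p q).eval env = p.eval env + q.eval env := by
  induction p generalizing q with
  | zero => exact (zero_add _).symm
  | node p l r hl hr =>
    cases q with
    | zero => exact (add_zero _).symm
    | node p' l' r' =>
      have h : (add (node p l r) (node p' l' r')).eval env =
          (node (Poly.add p p') (add l l') (add r r')).eval env := by
        cases p with
        | nil => rfl
        | cons t p =>
          cases p' with
          | nil =>
            have h : (Poly.add (t :: p) []).eval env = Poly.eval env (t :: p) := by
              rw [Poly.eval_add, Poly.eval_nil, add_zero]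
            rw [eval.eq_2, h]
            rfl
          | cons t' p' => exact congrArg (eval env) (forcePoly_eq _ _)
      rw [h]
      simp only [eval, Poly.eval_add, hl, hr, add_smul, mul_add]
      abel

theorem eval_scale (c : Poly) (p : Horner) : (scale c p).eval env = c.eval env • p.eval env := by
  induction p with
  | zero => exact (smul_zero _).symm
  | node p l r hl hr =>
    have h : (scale c (node p l r)).eval env =
        (node (Poly.addMul c p []) (scale c l) (scale c r)).eval env := by
      cases p with
      | nil =>
        have h : (Poly.addMul c [] []).eval env = Poly.eval env [] := by
          rw [Poly.eval_addMul, Poly.eval_nil, mul_zero, add_zero]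
        rw [eval.eq_2, h]
        rfl
      | cons t p => exact congrArg (eval env) (forcePoly_eq _ _)
    rw [h]
    simp only [eval, Poly.eval_addMul, Poly.eval_nil, add_zero, hl, hr, smul_add, mul_smul,
      mul_smul_comm]

theorem eval_mul (p q : Horner) : (mul p q).eval env = p.eval env * q.eval env := by
  cases q with
  | zero => exact (mul_zero _).symm
  | node q l' r' =>
    induction p with
    | zero => exact (zero_mul _).symm
    | node p l r hl hr =>
      rw [eval.eq_2 _ p, add_mul, add_mul, mul_assoc, mul_assoc, ← hl, ← hr, smul_mul_assoc,
        one_mul]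
      cases p with
      | nil =>
        have h : mul (node [] l r) (node q l' r') =
          node [] (mul l (node q l' r')) (mul r (node q l' r')) := rfl
        rw [h, eval.eq_2 _ [], Poly.eval_nil, zero_smul, zero_smul]
      | cons t p =>
        have h : mul (node (t :: p) l r) (node q l' r') = add (scale (t :: p) (node q l' r'))
          (node [] (mul l (node q l' r')) (mul r (node q l' r'))) := rfl
        rw [h, eval_add, eval_scale, eval.eq_2 _ [], Poly.eval_nil, zero_smul, zero_add, add_assoc]

theorem eval_sub (p q : Horner) : (sub p q).eval env = p.eval env - q.eval env := by
  have h : Poly.eval env [([], -1)] = -1 := by simp [Poly.eval, Poly.evalMono]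
  rw [sub, eval_add, eval_scale, h, eq_sub_iff_add_eq, add_assoc]
  nth_rewrite 2 [← one_smul ℂ[X] (q.eval env)]
  rw [← add_smul, neg_add_cancel, zero_smul, add_zero]

theorem eval_deriv (F : Bool → Horner) (p : Horner) :
    (deriv F p).eval env = flow (evalSystem env F) (p.eval env) := by
  have h0 : evalSystem env F (fin false) = (F false).eval env := evalSystem_zero env F
  have h1 : evalSystem env F (fin true) = (F true).eval env := evalSystem_one env F
  induction p with
  | zero => exact (flow_zero _).symm
  | node p l r hl hr =>
    have h : deriv F (node p l r) = add (add (mul (F false) l) (mul (F true) r))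
      (node [] (deriv F l) (deriv F r)) := rfl
    simp only [h, eval, eval_add, eval_mul, hl, hr, flow_add, flow_smul, flow_one, smul_zero,
      flow_letter_mul, h0, h1, Poly.eval_nil, zero_smul, zero_add]
    abel

theorem eval_of_isZero {p : Horner} (h : p.isZero = true) : p.eval env = 0 := by
  induction p with
  | zero => rfl
  | node p l r hl hr =>
    rw [isZero, Bool.and_eq_true, Bool.and_eq_true, List.isEmpty_iff] at h
    rw [eval, hl h.2.1, hr h.2.2, h.1, Poly.eval_nil, zero_smul, mul_zero, mul_zero, add_zero,
      add_zero]

theorem eval_eq_of_isZero_sub {p q : Horner} (h : (sub p q).isZero = true) :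
    p.eval env = q.eval env := by
  rw [← sub_eq_zero, ← eval_sub, eval_of_isZero env h]

theorem comm_eval_sortedVMul (p : Horner) :
    comm ((sortedVMul p).eval env) = comm (letter true) * comm (p.eval env) := by
  induction p with
  | zero => rw [sortedVMul, eval, map_zero, mul_zero]
  | node p l r hl _ =>
    simp only [sortedVMul, eval, map_add, map_mul, map_smul, hl, Poly.eval_nil, zero_smul, map_zero,
      mul_zero, map_one]
    ring

theorem comm_eval_sort (p : Horner) : comm ((sort p).eval env) = comm (p.eval env) := by
  induction p with
  | zero => rfl
  | node p l r hl hr =>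
    simp only [sort, eval, eval_add, map_add, map_mul, comm_eval_sortedVMul, hl, hr, mul_zero,
      add_zero]

theorem eval_mem_span {n : ℕ} {p : Horner} (h : p.height ≤ n + 1) :
    p.eval env ∈ Submodule.span ℂ[X] (word '' {w | w.length ≤ n}) := by
  induction p generalizing n with
  | zero => exact Submodule.zero_mem _
  | node p l r hl hr =>
    have h' : max l.height r.height ≤ n := Nat.le_of_succ_le_succ h
    rw [max_le_iff] at h'
    have key : ∀ (c : Bool) (q : Horner), q.height ≤ n → (∀ {m}, q.height ≤ m + 1 →
        q.eval env ∈ Submodule.span ℂ[X] (word '' {w | w.length ≤ m})) →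
        letter c * q.eval env ∈ Submodule.span ℂ[X] (word '' {w | w.length ≤ n}) := by
      intro c q hq ih
      cases n with
      | zero =>
        cases q with
        | zero => rw [eval, mul_zero]; exact Submodule.zero_mem _
        | node _ _ _ => exact absurd hq (Nat.not_succ_le_zero _)
      | succ n => exact letter_mul_mem_span c (ih hq)
    refine Submodule.add_mem _ (Submodule.add_mem _ (Submodule.smul_mem _ _ ?_) ?_) ?_
    · exact word_mem_span (w := []) (Nat.zero_le _)
    · exact key _ _ h'.1 hl
    · exact key _ _ h'.2 hr

end Eval

end Horner

/-! ### The certificates -/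

namespace Certificate

/-- The decimal digits of a number with at most nine digits, preceding the list `l`. -/
def digits : ℕ → ℕ → List ℕ → List ℕ
  | 0, _, l => l
  | k + 1, n, l => bif Nat.beq n 0 then l else digits k (n / 10) (n % 10 :: l)

/-- The variables are `z` (`1`), `κ₁` (`2`), `ρ` (`3`), `κ₂` (`4`), `κ₄` (`5`), where
`κ₃ = ρ ^ 2 - κ₁ ρ`; the digits `6, …, 9` stand for the abbreviations `1 + z`, `κ₂ + z κ₄`,
`z (κ₁ - κ₂ - κ₄)` and `κ₃`. -/
def factor : ℕ → Poly
  | 6 => [([], 1), ([1], 1)]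
  | 7 => [([1, 5], 1), ([4], 1)]
  | 8 => [([1, 2], 1), ([1, 4], -1), ([1, 5], -1)]
  | 9 => [([2, 3], -1), ([3, 3], 1)]
  | i => [([i], 1)]

def coefficient (c : List (ℕ × ℤ)) : Poly :=
  c.foldr (fun t p => Poly.add
    ((digits 9 t.1 []).foldr (fun i q => Poly.addMul (factor i) q []) [([], t.2)]) p) []

/-- Adding the monomial given by a list of letters, `1` for `u` and `2` for `v`. -/
def insert (p : Poly) : List ℕ → Horner → Horner
  | [], .zero => .node p .zero .zero
  | [], .node q l r => .node (Poly.add p q) l r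
  | i :: w, .zero => bif Nat.beq i 1 then .node [] (insert p w .zero) .zero
      else .node [] .zero (insert p w .zero)
  | i :: w, .node q l r => bif Nat.beq i 1 then .node q (insert p w l) r
      else .node q l (insert p w r)

/-- The polynomial with the given terms; the digits of the first number of a term are the letters
of a word. -/
def polynomial (L : List (ℕ × List (ℕ × ℤ))) : Horner :=
  L.foldr (fun t p => forcePoly (coefficient t.2) fun c => insert c (digits 9 t.1 []) p) .zero

/-- The Hamiltonian system with `β = γ = 0`. -/
def base (c : Bool) : Horner :=
  bif c then
    .node (factor 9)
      (.node [] .zero (.node (factor 2)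
        (.node [] .zero (.node (.const (-1)) .zero .zero)) .zero))
      (.node (Poly.smul (-1) (factor 7))
        (.node (factor 2) (.node [] .zero (.node (.const (-1)) .zero .zero))
          (.node (Poly.smul 2 (factor 6)) (.node (.const (-1)) .zero .zero) .zero))
        (.node [([1], -1)] .zero .zero))
  else
    .node (factor 8)
      (.node (factor 7)
        (.node [([2], -1)] .zero (.node [] (.node (.const 1) .zero .zero) .zero))
        (.node (factor 1) (.node (Poly.smul (-2) (factor 6)) (.node (.const 1) .zero .zero) .zero)
          .zero))
      (.node [] (.node (factor 1) .zero .zero) .zero)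

/-- A non-commutative polynomial that reduces to the scalar Hamiltonian. -/
def energy : Horner :=
  .node []
    (.node (Poly.smul (-1) (factor 9))
      (.node [] (.node [] .zero (.node [] .zero (.node (.const 1) .zero .zero)))
        (.node [([2], -1)] .zero (.node (Poly.smul (-1) (factor 6)) .zero .zero)))
      (.node (factor 7) .zero (.node (factor 1) .zero .zero)))
    (.node (factor 8) .zero .zero)

def symmetryU : List (ℕ × List (ℕ × ℤ)) :=
  [(112121121, [(0, 1)]), (121121211, [(0, 1)]), (11212121, [(6, -1)]), (12112121, [(6, -1)]),
    (12121121, [(6, -1)]), (12121211, [(6, -1)]), (1121121, [(2, -1)]), (1121211, [(2, -1)]),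
    (1121221, [(1, 1)]), (1211211, [(2, -1)]), (1211212, [(1, 1)]), (1212121, [(66, 2)]),
    (1221211, [(1, 1)]), (2121121, [(1, 1)]), (112121, [(7, 1), (2, 1), (12, 1)]), (121121, [(7,
    1), (2, 1), (12, 1)]), (121211, [(7, 1), (2, 1), (12, 1)]), (121212, [(16, -1)]), (121221,
    [(16, -1)]), (122121, [(16, -1)]), (212121, [(16, -1)]), (11121, [(9, -1)]), (11211, [(22,
    1)]), (11221, [(8, 1), (12, -1)]), (12111, [(9, -1)]), (12112, [(8, 1), (12, -1)]), (12121,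
    [(67, -3)]), (12212, [(11, 1)]), (21211, [(8, 1), (12, -1)]), (21221, [(11, 1)]), (1121,
    [(9, 1), (27, -1), (19, 1)]), (1211, [(9, 1), (27, -1), (19, 1)]), (1212, [(8, -1), (18,
    -1), (17, 1)]), (1221, [(8, -1), (18, -1), (17, 1)]), (2121, [(8, -1), (18, -1), (17, 1)]),
    (111, [(29, 1)]), (121, [(77, 1), (28, -2), (19, -2)]), (122, [(18, 1)]), (212, [(18, 1)]),
    (221, [(18, 1)]), (11, [(79, -1)]), (12, [(78, 1)]), (21, [(78, 1)]), (1, [(89, -1)]), (2,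
    [(88, 1)])]

def symmetryV : List (ℕ × List (ℕ × ℤ)) :=
  [(121211212, [(0, -1)]), (211212112, [(0, -1)]), (212112121, [(0, -1)]), (12121212, [(6, 1)]),
    (21121212, [(6, 1)]), (21211212, [(6, 1)]), (21212112, [(6, 1)]), (21212121, [(6, 1)]),
    (1211212, [(2, 1)]), (1212112, [(2, 1)]), (1212212, [(1, -1)]), (2112112, [(2, 1)]),
    (2112121, [(2, 1)]), (2112122, [(1, -1)]), (2121121, [(2, 1)]), (2121212, [(66, -2)]),
    (2122121, [(1, -1)]), (2212112, [(1, -1)]), (121212, [(7, -1), (2, -1), (12, -1)]), (211212,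
    [(7, -1), (2, -1), (12, -1)]), (212112, [(7, -1), (2, -1), (12, -1)]), (212121, [(7, -1),
    (2, -1), (12, -1)]), (212122, [(16, 1)]), (212212, [(16, 1)]), (221212, [(16, 1)]), (11212,
    [(9, 1)]), (12112, [(22, -1)]), (12121, [(9, 1)]), (12212, [(8, -1), (12, 1)]), (21112, [(9,
    1)]), (21121, [(22, -1)]), (21122, [(8, -1), (12, 1)]), (21211, [(9, 1)]), (21212, [(67,
    3)]), (22121, [(8, -1), (12, 1)]), (22122, [(11, -1)]), (1212, [(9, -1), (27, 1), (19,
    -1)]), (2112, [(9, -1), (27, 1), (19, -1)]), (2121, [(9, -1), (27, 1), (19, -1)]), (2122,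
    [(8, 1), (18, 1), (17, -1)]), (2212, [(8, 1), (18, 1), (17, -1)]), (112, [(29, -1)]), (121,
    [(29, -1)]), (211, [(29, -1)]), (212, [(77, -1), (28, 2), (19, 2)]), (222, [(18, -1)]), (12,
    [(79, 1)]), (21, [(79, 1)]), (22, [(78, -1)]), (1, [(99, -1)]), (2, [(89, 1)])]

/-- The symmetry of degree 9 of the Hamiltonian system with `β = γ = 0`. -/
def symmetry (c : Bool) : Horner := polynomial (bif c then symmetryV else symmetryU)

/-- Integers describing the coefficients of a system; those of `e₁ - κ₁` are with respect to
`κ₁` and `ρ`. -/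
structure Data where
  a1 : ℤ
  a2 : ℤ
  a3 : ℤ
  c1 : ℤ
  c2 : ℤ
  ek : ℤ
  er : ℤ
  f1 : ℤ
  f2 : ℤ
  h1 : ℤ

def Data.coeffs (d : Data) (κ : Kappa) (ρ : ℂ) : Coeffs :=
  ⟨d.a1, d.a2, d.a3, d.c1, d.c2, κ.k1 + d.ek * κ.k1 + d.er * ρ, d.f1, d.f2, d.h1⟩

def Data.gauge (d : Data) : Horner :=
  .node []
    (.node (Poly.addMul (.const d.ek) (factor 2) (Poly.addMul (.const d.er) (factor 3) []))
      (.node [] .zero (.node (.const (-d.a1)) .zero .zero))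
      (.node (Poly.addMul (.const (-d.f1)) (factor 1) (.const (-d.c1)))
        (.node (.const (1 - d.a1 - d.a2)) .zero .zero) .zero))
    (.node (Poly.addMul (.const (1 - d.h1)) (factor 1) [])
      (.node (Poly.addMul (.const d.f2) (factor 1) (.const d.c2))
        (.node (.const (2 - d.a1 - d.a2 - d.a3)) .zero .zero) .zero)
      .zero)

/-- The inner derivation of `B` completes the symmetry to one of the system with the data `d`. -/
def check (d : Data) (B : Horner) : Bool :=
  Nat.ble B.height 9 && Horner.isZero (Horner.sub
    (.add (.deriv base B) (.sub (.mul d.gauge B) (.mul B d.gauge))) (.deriv symmetry d.gauge))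

def okamoto1 : List (ℕ × List (ℕ × ℤ)) :=
  [(12112121, [(0, -1)]), (1211212, [(1, 1)]), (1212121, [(6, 1)]), (112121, [(3, 1)]), (121121,
    [(2, 1)]), (121212, [(16, -1)]), (122121, [(1, -1)]), (11212, [(13, -1)]), (12112, [(13, 1),
    (12, -1)]), (12121, [(3, -1), (7, -1), (13, -1)]), (12212, [(11, 1)]), (1121, [(23, -1)]),
    (1211, [(33, 1), (23, -1)]), (1212, [(8, -1), (13, 1), (17, 1)]), (2112, [(8, 1), (13,
    -1)]), (2121, [(8, -1), (13, 1)]), (112, [(133, -1), (123, 1)]), (121, [(37, 1)]), (122,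
    [(18, 1)]), (11, [(333, -1), (233, 1)]), (12, [(28, 1), (133, 1), (123, -1)]), (21, [(38,
    1), (28, -1), (133, -1), (123, 1)])]

def okamoto2 : List (ℕ × List (ℕ × ℤ)) :=
  [(12112121, [(0, -1)]), (1211212, [(0, 1)]), (1212121, [(6, 1)]), (112121, [(3, 1)]), (121121,
    [(2, 1)]), (121212, [(6, -1)]), (122121, [(1, -1)]), (11212, [(3, -1)]), (12112, [(3, 1),
    (2, -1)]), (12121, [(3, -1), (7, -1), (13, -1)]), (12212, [(1, 1)]), (1121, [(23, -1)]),
    (1211, [(33, 1), (23, -1)]), (1212, [(8, -1), (7, 1), (13, 1)]), (2112, [(8, 1), (13, -1)]),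
    (2121, [(8, -1), (13, 1)]), (112, [(33, -1), (23, 1)]), (121, [(37, 1)]), (122, [(8, 1)]),
    (11, [(333, -1), (233, 1)]), (12, [(28, 1), (133, 1), (123, -1)]), (21, [(38, 1), (28, -1),
    (133, -1), (123, 1)])]

def okamoto3 : List (ℕ × List (ℕ × ℤ)) :=
  [(12112121, [(0, -1)]), (1211212, [(6, 1)]), (1212121, [(6, 1)]), (112121, [(3, 1)]), (121121,
    [(2, 1)]), (121122, [(1, -1)]), (121212, [(66, -1)]), (122112, [(1, 1)]), (122121, [(1,
    -1)]), (212112, [(1, -1)]), (11212, [(36, -1)]), (12112, [(36, 1), (26, -1)]), (12121, [(3,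
    -1), (7, -1), (13, -1)]), (12122, [(16, 1)]), (21212, [(16, 1)]), (1121, [(23, -1)]), (1122,
    [(13, 1)]), (1211, [(33, 1), (23, -1)]), (1212, [(8, -1), (7, 1), (13, -1), (17, 1), (12,
    1)]), (1221, [(13, 1), (12, -1)]), (2112, [(8, 1)]), (2121, [(8, -1), (12, 1)]), (2122,
    [(11, -1)]), (112, [(336, -1), (236, 1)]), (121, [(37, 1)]), (122, [(68, 1)]), (212, [(17,
    -1)]), (11, [(333, -1), (233, 1)]), (12, [(28, 1), (133, 1), (123, -1)]), (21, [(38, 1),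
    (28, -1)]), (22, [(18, -1)])]

def okamoto4 : List (ℕ × List (ℕ × ℤ)) :=
  [(11212112, [(0, -1)]), (12112121, [(0, -1)]), (1121212, [(6, 1)]), (1211212, [(1, 1)]),
    (1212112, [(6, 1)]), (1212121, [(6, 1)]), (112112, [(2, 1)]), (112121, [(2, 1)]), (112122,
    [(1, -1)]), (121121, [(2, 1)]), (121212, [(6, -1), (16, -2)]), (122121, [(1, -1)]), (212112,
    [(1, -1)]), (11212, [(26, -1)]), (12112, [(7, -1), (12, -1)]), (12121, [(7, -1), (2, -1),
    (12, -1)]), (12122, [(16, 1)]), (12212, [(11, 1)]), (21212, [(16, 1)]), (1112, [(9, 1)]),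
    (1121, [(22, -1)]), (1122, [(8, -1), (17, -1), (12, 1)]), (1211, [(9, 1)]), (1212, [(7, 1),
    (17, 3)]), (2121, [(8, -1), (12, 1)]), (2122, [(11, -1)]), (112, [(69, -1)]), (121, [(27,
    1), (19, -1)]), (122, [(68, 1)]), (212, [(18, 1), (17, -1)]), (11, [(29, -1)]), (12, [(28,
    1), (19, 1)]), (22, [(18, -1)])]

def okamoto5 : List (ℕ × List (ℕ × ℤ)) :=
  [(11212112, [(0, -1)]), (12112121, [(0, -1)]), (1121212, [(6, 1)]), (1211212, [(0, 1)]),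
    (1212112, [(6, 1)]), (1212121, [(6, 1)]), (112112, [(2, 1)]), (112121, [(2, 1)]), (112122,
    [(1, -1)]), (121121, [(2, 1)]), (121212, [(6, -2), (16, -1)]), (122121, [(1, -1)]), (212112,
    [(1, -1)]), (11212, [(26, -1)]), (12112, [(7, -1), (2, -1)]), (12121, [(7, -1), (2, -1),
    (12, -1)]), (12122, [(16, 1)]), (12212, [(1, 1)]), (21212, [(16, 1)]), (1112, [(9, 1)]),
    (1121, [(22, -1)]), (1122, [(8, -1), (7, -1), (12, 1)]), (1211, [(9, 1)]), (1212, [(7, 3),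
    (17, 1)]), (2121, [(8, -1), (12, 1)]), (2122, [(11, -1)]), (112, [(69, -1)]), (121, [(9,
    -1), (27, 1)]), (122, [(68, 1)]), (212, [(8, 1), (17, -1)]), (11, [(29, -1)]), (12, [(28,
    1), (19, 1)]), (22, [(18, -1)])]

def okamoto6 : List (ℕ × List (ℕ × ℤ)) :=
  [(11212112, [(0, -1)]), (12112121, [(0, -1)]), (1121212, [(6, 1)]), (1212112, [(6, 1)]),
    (1212121, [(6, 1)]), (112112, [(2, 1)]), (112121, [(2, 1)]), (112212, [(1, -1)]), (121121,
    [(2, 1)]), (121212, [(66, -1)]), (122121, [(1, -1)]), (211212, [(1, 1)]), (212112, [(1,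
    -1)]), (11212, [(26, -1)]), (12112, [(7, -1)]), (12121, [(7, -1), (2, -1), (12, -1)]),
    (12212, [(16, 1)]), (1112, [(9, 1)]), (1121, [(22, -1)]), (1122, [(8, -1)]), (1211, [(9,
    1)]), (1212, [(7, 1), (17, 1), (12, 1)]), (2112, [(12, -1)]), (2121, [(8, -1), (12, 1)]),
    (112, [(69, -1)]), (121, [(27, 1)]), (122, [(68, 1)]), (11, [(29, -1)]), (12, [(28, 1), (19,
    1)]), (21, [(19, -1)])]

def okamoto7 : List (ℕ × List (ℕ × ℤ)) :=
  [(1212112, [(0, 1)]), (121212, [(6, -1)]), (212112, [(1, -1)]), (12112, [(2, -1)]), (12122,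
    [(1, 1)]), (21212, [(16, 1)]), (1212, [(7, 1), (12, 1)]), (1221, [(12, -1)]), (2121, [(12,
    1)]), (2122, [(11, -1)]), (112, [(9, -1)]), (122, [(8, 1)]), (212, [(17, -1)]), (12, [(28,
    1), (19, 1)]), (21, [(28, -1)]), (22, [(18, -1)])]

def okamoto8 : List (ℕ × List (ℕ × ℤ)) :=
  [(1212112, [(1, 1)]), (121212, [(16, -1)]), (212112, [(1, -1)]), (12112, [(12, -1)]), (12122,
    [(11, 1)]), (21212, [(16, 1)]), (1212, [(17, 1), (12, 1)]), (1221, [(12, -1)]), (2121, [(12,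
    1)]), (2122, [(11, -1)]), (112, [(19, -1)]), (122, [(18, 1)]), (212, [(17, -1)]), (12, [(28,
    1), (19, 1)]), (21, [(28, -1)]), (22, [(18, -1)])]

def okamoto9 : List (ℕ × List (ℕ × ℤ)) :=
  [(1212112, [(0, 1)]), (2112121, [(1, -1)]), (121212, [(6, -1)]), (121221, [(1, 1)]), (122121,
    [(1, -1)]), (211212, [(1, 1)]), (212112, [(1, -1)]), (212121, [(16, 1)]), (12112, [(2,
    -1)]), (12212, [(1, 1)]), (21121, [(12, 1)]), (21221, [(11, -1)]), (1212, [(4, 1), (15, 1),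
    (14, 1)]), (1221, [(14, -1)]), (2112, [(14, -1)]), (2121, [(115, -1)]), (112, [(9, -1)]),
    (122, [(15, -1), (14, -1), (12, 1)]), (211, [(19, 1)]), (221, [(115, 1), (114, 1), (112,
    -1)]), (12, [(19, 1), (125, -1), (124, -1), (122, 1)]), (21, [(19, -1), (125, 1), (124, 1),
    (122, -1)])]

def new1 : List (ℕ × List (ℕ × ℤ)) :=
  [(12112112, [(0, 1)]), (12112121, [(0, -1)]), (1212112, [(6, -1)]), (1212121, [(6, 1)]),
    (112112, [(3, -1)]), (112121, [(3, 1)]), (121112, [(3, 1), (2, -1)]), (121121, [(3, 1)]),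
    (122112, [(1, 1)]), (122121, [(1, -1)]), (12112, [(7, 1)]), (12121, [(3, -2), (7, -1), (2,
    1), (13, -2), (12, 1)]), (1112, [(33, -1), (23, 1)]), (1121, [(33, -1)]), (1211, [(33, 2),
    (23, -3), (22, 1)]), (1212, [(13, 1)]), (1221, [(13, 1), (12, -1)]), (2112, [(8, 1), (13,
    -1)]), (2121, [(8, -1), (13, 1)]), (121, [(37, 2), (27, -1)]), (11, [(333, -2), (233, 3),
    (223, -1)]), (12, [(38, 1), (133, 1), (123, -1)]), (21, [(38, 1), (28, -1), (133, -1), (123,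
    1)])]

def new2 : List (ℕ × List (ℕ × ℤ)) :=
  [(11212112, [(0, -1)]), (12112121, [(0, -1)]), (1121212, [(6, 1)]), (1211212, [(6, 1)]),
    (1212112, [(6, 1)]), (1212121, [(6, 1)]), (112112, [(2, 1)]), (112121, [(2, 1)]), (112122,
    [(1, -1)]), (121121, [(2, 1)]), (121122, [(1, -1)]), (121212, [(66, -2)]), (122121, [(1,
    -1)]), (212112, [(1, -1)]), (11212, [(7, -1), (2, -1), (12, -1)]), (12112, [(7, -1), (2,
    -1), (12, -1)]), (12121, [(7, -1), (2, -1), (12, -1)]), (12122, [(16, 2)]), (12212, [(16,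
    1)]), (21212, [(16, 1)]), (1112, [(9, 1)]), (1121, [(22, -1)]), (1122, [(8, -1), (12, 1)]),
    (1211, [(9, 1)]), (1212, [(7, 3), (17, 3), (12, 1)]), (1222, [(11, -1)]), (2121, [(8, -1),
    (12, 1)]), (2122, [(11, -1)]), (112, [(9, -1), (27, 1), (19, -1)]), (121, [(9, -1), (27, 1),
    (19, -1)]), (122, [(8, 1), (18, 1), (17, -2)]), (212, [(8, 1), (18, 1), (17, -1)]), (11,
    [(29, -1)]), (12, [(77, -1), (28, 1), (19, 2)]), (22, [(18, -2)]), (1, [(79, 1)]), (2, [(78,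
    -1)])]

def new3 : List (ℕ × List (ℕ × ℤ)) :=
  [(11212112, [(0, -1)]), (12112121, [(0, -1)]), (1121212, [(0, 1)]), (1211212, [(0, 1)]),
    (1212112, [(6, 1)]), (1212121, [(6, 1)]), (112112, [(2, 1)]), (112121, [(2, 1)]), (121121,
    [(2, 1)]), (121212, [(6, -2)]), (122121, [(1, -1)]), (212112, [(1, -1)]), (11212, [(4, -1),
    (2, -1)]), (12112, [(4, -1), (2, -1), (15, -1)]), (12121, [(4, -1), (2, -1), (15, -1), (12,
    -1)]), (12212, [(1, 1)]), (21212, [(1, 1)]), (1112, [(9, 1)]), (1121, [(22, -1)]), (1211,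
    [(9, 1)]), (1212, [(4, 3), (15, 3), (14, 2), (12, -1)]), (2121, [(15, 1), (14, 1)]), (112,
    [(9, -1), (24, 1)]), (121, [(9, -1), (24, 1), (125, 1)]), (122, [(15, -1), (14, -1), (12,
    1)]), (212, [(15, -1), (14, -2), (12, 1)]), (11, [(29, -1)]), (12, [(44, -1), (145, -1),
    (125, -1), (124, -1), (122, 1)]), (1, [(49, 1)]), (2, [(145, 1), (144, 1), (124, -1)])]

def new4 : List (ℕ × List (ℕ × ℤ)) :=
  [(11212112, [(0, -1)]), (12112121, [(0, -1)]), (1121212, [(1, 1)]), (1211212, [(1, 1)]),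
    (1212112, [(6, 1)]), (1212121, [(6, 1)]), (112112, [(2, 1)]), (112121, [(2, 1)]), (121121,
    [(2, 1)]), (121212, [(16, -2)]), (122121, [(1, -1)]), (212112, [(1, -1)]), (11212, [(15,
    -1), (12, -1)]), (12112, [(4, -1), (15, -1), (12, -1)]), (12121, [(4, -1), (2, -1), (15,
    -1), (12, -1)]), (12212, [(11, 1)]), (21212, [(11, 1)]), (1112, [(9, 1)]), (1121, [(22,
    -1)]), (1211, [(9, 1)]), (1212, [(15, 2), (14, 3), (12, -1), (115, 3)]), (2121, [(15, 1),
    (14, 1)]), (112, [(19, -1), (125, 1)]), (121, [(24, 1), (19, -1), (125, 1)]), (122, [(115,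
    -1), (114, -1), (112, 1)]), (212, [(115, -2), (114, -1), (112, 1)]), (11, [(29, -1)]), (12,
    [(145, -1), (125, -1), (124, -1), (122, 1), (1155, -1)]), (1, [(159, 1)]), (2, [(1155, 1),
    (1145, 1), (1125, -1)])]

def new5 : List (ℕ × List (ℕ × ℤ)) :=
  [(11211212, [(0, -1)]), (11212112, [(0, -1)]), (12112121, [(0, -1)]), (1121212, [(6, 2)]),
    (1211212, [(6, 1)]), (1212112, [(6, 1)]), (1212121, [(6, 1)]), (111212, [(3, 1)]), (112112,
    [(2, 2)]), (112121, [(2, 1)]), (112122, [(1, -1)]), (112212, [(1, -1)]), (121121, [(2, 1)]),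
    (121212, [(66, -2)]), (122121, [(1, -1)]), (212112, [(1, -1)]), (11212, [(3, -1), (7, -2),
    (2, -1), (13, -1), (12, -1)]), (12112, [(7, -1), (2, -1), (12, -1)]), (12121, [(7, -1), (2,
    -1), (12, -1)]), (12122, [(16, 1)]), (12212, [(16, 1)]), (21212, [(16, 1)]), (1112, [(33,
    1), (23, -2)]), (1121, [(33, 1), (23, -1), (22, -1)]), (1122, [(8, -1), (12, 1)]), (1211,
    [(33, 1), (23, -1)]), (1212, [(8, -1), (7, 3), (13, 1), (17, 3)]), (2121, [(8, -1), (12,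
    1)]), (2122, [(11, -1)]), (112, [(33, -1), (37, 1), (23, 1), (27, 1), (133, -1), (123, 1)]),
    (121, [(33, -1), (23, 1), (27, 1), (133, -1), (123, 1)]), (122, [(8, 1), (18, 1), (17,
    -1)]), (212, [(8, 1), (18, 1), (17, -1)]), (11, [(333, -1), (223, 1)]), (12, [(38, 1), (77,
    -1), (28, 1), (133, 1), (123, -1)]), (22, [(18, -1)]), (1, [(337, 1), (237, -1)]), (2, [(78,
    -1)])]

def new6 : List (ℕ × List (ℕ × ℤ)) :=
  [(12112121, [(0, -1)]), (1211212, [(0, 1)]), (1212112, [(0, 1)]), (1212121, [(6, 1)]),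
    (112121, [(3, 1)]), (121121, [(2, 1)]), (121212, [(6, -2)]), (122121, [(1, -1)]), (212112,
    [(1, -1)]), (11212, [(3, -1)]), (12112, [(4, -1), (2, -1)]), (12121, [(4, -1), (2, -1), (13,
    -1), (15, -1)]), (12122, [(1, 1)]), (12212, [(1, 1)]), (21212, [(16, 1)]), (1121, [(23,
    -1)]), (1211, [(33, 1), (23, -1)]), (1212, [(4, 3), (13, 1), (15, 2), (14, 1)]), (2121,
    [(15, 1), (14, 1)]), (2122, [(11, -1)]), (112, [(33, -1), (34, 1), (23, 1)]), (121, [(33,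
    -1), (23, 1), (24, 1), (135, 1)]), (122, [(15, -1), (14, -2), (12, 1)]), (212, [(15, -1),
    (14, -2), (12, 1), (115, -1)]), (11, [(333, -1), (233, 1)]), (12, [(44, -1), (133, 1), (135,
    -1), (134, -1), (145, -1)]), (22, [(115, 1), (114, 1), (112, -1)]), (1, [(334, 1), (234,
    -1)]), (2, [(145, 1), (144, 1), (124, -1)])]

def new7 : List (ℕ × List (ℕ × ℤ)) :=
  [(12112121, [(0, -1)]), (1211212, [(1, 1)]), (1212112, [(1, 1)]), (1212121, [(6, 1)]),
    (112121, [(3, 1)]), (121121, [(2, 1)]), (121212, [(16, -2)]), (122121, [(1, -1)]), (212112,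
    [(1, -1)]), (11212, [(13, -1)]), (12112, [(15, -1), (12, -1)]), (12121, [(3, -1), (4, -1),
    (15, -1), (12, -1)]), (12122, [(11, 1)]), (12212, [(11, 1)]), (21212, [(16, 1)]), (1121,
    [(23, -1)]), (1211, [(33, 1), (23, -1)]), (1212, [(13, 1), (15, 1), (14, 2), (115, 3)]),
    (2121, [(15, 1), (14, 1)]), (2122, [(11, -1)]), (112, [(133, -1), (135, 1), (123, 1)]),
    (121, [(34, 1), (133, -1), (123, 1), (125, 1)]), (122, [(115, -2), (114, -1), (112, 1)]),
    (212, [(14, -1), (115, -2), (114, -1), (112, 1)]), (11, [(333, -1), (233, 1)]), (12, [(133,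
    1), (135, -1), (134, -1), (145, -1), (1155, -1)]), (22, [(115, 1), (114, 1), (112, -1)]),
    (1, [(1335, 1), (1235, -1)]), (2, [(1155, 1), (1145, 1), (1125, -1)])]

def new8 : List (ℕ × List (ℕ × ℤ)) :=
  [(12112121, [(0, -1)]), (1212121, [(6, 1)]), (112121, [(3, 1)]), (121121, [(2, 1)]), (122121,
    [(1, -1)]), (211212, [(1, 1)]), (12121, [(3, -1), (7, -1), (13, -1)]), (21212, [(16, -1)]),
    (1121, [(23, -1)]), (1211, [(33, 1), (23, -1)]), (1212, [(8, -1)]), (2112, [(8, 1), (12,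
    -1)]), (2121, [(8, -1), (13, 1)]), (2212, [(11, 1)]), (121, [(37, 1)]), (212, [(17, 1)]),
    (11, [(333, -1), (233, 1)]), (12, [(28, 1)]), (21, [(38, 1), (28, -1), (133, -1), (123,
    1)]), (22, [(18, 1)])]

theorem symmetry_comm_base (c : Bool) : Horner.isZero (Horner.sub
    (.deriv base (symmetry c)) (.deriv symmetry (base c))) = true := by
  revert c; decide +kernel

theorem symmetry_reduction (c : Bool) : Horner.isZero (Horner.sub
    (.sort (symmetry c)) (.sort (.mul (base c) energy))) = true := by
  revert c; decide +kernel

theorem height_symmetry (c : Bool) : (symmetry c).height ≤ 10 := by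
  revert c; decide +kernel

theorem deriv_symmetry_commutator : Horner.isZero (.deriv symmetry
    (.node [] (.node [] .zero (.node (.const (-1)) .zero .zero))
      (.node [] (.node (.const 1) .zero .zero) .zero))) = true := by
  decide +kernel

theorem check_okamoto1 : check ⟨0, 2, 0, 0, 0, 0, 1, -1, 0, 1⟩ (polynomial okamoto1) = true := by
  decide +kernel

theorem check_okamoto2 : check ⟨0, 2, 0, -1, 0, 0, 1, 0, 0, 1⟩ (polynomial okamoto2) = true := by
  decide +kernel

theorem check_okamoto3 : check ⟨0, 2, 0, -1, 0, 0, 1, -1, 0, 2⟩ (polynomial okamoto3) = true := by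
  decide +kernel

theorem check_okamoto4 : check ⟨1, 1, 0, -1, 0, 1, 0, -2, 0, 2⟩ (polynomial okamoto4) = true := by
  decide +kernel

theorem check_okamoto5 : check ⟨1, 1, 0, -2, 0, 1, 0, -1, 0, 2⟩ (polynomial okamoto5) = true := by
  decide +kernel

theorem check_okamoto6 : check ⟨1, 1, 0, -1, 0, 1, 0, -1, 0, 1⟩ (polynomial okamoto6) = true := by
  decide +kernel

theorem check_okamoto7 : check ⟨0, 1, 1, -1, 0, 0, 0, 0, 0, 2⟩ (polynomial okamoto7) = true := by
  decide +kernel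

theorem check_okamoto8 : check ⟨0, 1, 1, 0, 0, 0, 0, -1, 0, 2⟩ (polynomial okamoto8) = true := by
  decide +kernel

theorem check_okamoto9 : check ⟨0, 1, 1, -1, 0, 0, 0, 0, -1, 1⟩ (polynomial okamoto9) = true := by
  decide +kernel

theorem check_new1 : check ⟨-1, 3, 0, 0, 0, -1, 2, 0, 0, 1⟩ (polynomial new1) = true := by
  decide +kernel

theorem check_new2 : check ⟨1, 1, 0, -2, 0, 1, 0, -2, 0, 3⟩ (polynomial new2) = true := by
  decide +kernel

theorem check_new3 : check ⟨1, 1, 0, -2, 0, 1, 0, 0, 0, 1⟩ (polynomial new3) = true := by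
  decide +kernel

theorem check_new4 : check ⟨1, 1, 0, 0, 0, 1, 0, -2, 0, 1⟩ (polynomial new4) = true := by
  decide +kernel

theorem check_new5 : check ⟨2, 0, 0, -2, 0, 1, 1, -2, 0, 2⟩ (polynomial new5) = true := by
  decide +kernel

theorem check_new6 : check ⟨0, 2, 0, -2, 0, 0, 1, 0, 0, 2⟩ (polynomial new6) = true := by
  decide +kernel

theorem check_new7 : check ⟨0, 2, 0, 0, 0, 0, 1, -2, 0, 2⟩ (polynomial new7) = true := by
  decide +kernel

theorem check_new8 : check ⟨0, 2, 0, 0, 0, 0, 1, 0, 0, 0⟩ (polynomial new8) = true := by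
  decide +kernel

def env (κ : Kappa) (ρ : ℂ) : ℕ → ℂ[X]
  | 1 => .X
  | 2 => .C κ.k1
  | 3 => .C ρ
  | 4 => .C κ.k2
  | 5 => .C κ.k4
  | _ => 0

variable {κ : Kappa} {ρ : ℂ}

theorem eval_factor_one : (factor 1).eval (env κ ρ) = .X := by
  simp [factor, Poly.eval, Poly.evalMono, env]

theorem eval_factor_two : (factor 2).eval (env κ ρ) = .C κ.k1 := by
  simp [factor, Poly.eval, Poly.evalMono, env]

theorem eval_factor_three : (factor 3).eval (env κ ρ) = .C ρ := by
  simp [factor, Poly.eval, Poly.evalMono, env]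

theorem eval_factor_six : (factor 6).eval (env κ ρ) = 1 + .X := by
  simp [factor, Poly.eval, Poly.evalMono, env]

theorem eval_factor_seven : (factor 7).eval (env κ ρ) = .C κ.k2 + .X * .C κ.k4 := by
  simp [factor, Poly.eval, Poly.evalMono, env, add_comm]

theorem eval_factor_eight :
    (factor 8).eval (env κ ρ) = .X * (.C κ.k1 - .C κ.k2 - .C κ.k4) := by
  simp [factor, Poly.eval, Poly.evalMono, env]; ring

theorem eval_factor_nine (h : κ.k3 = ρ ^ 2 - κ.k1 * ρ) : (factor 9).eval (env κ ρ) = .C κ.k3 := by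
  simp [factor, Poly.eval, Poly.evalMono, env, h]; ring

theorem eval_variable_one (n : ℤ) : Poly.eval (env κ ρ) [([1], n)] = n * .X := by
  simp [Poly.eval, Poly.evalMono, env]

theorem eval_variable_two (n : ℤ) : Poly.eval (env κ ρ) [([2], n)] = n * .C κ.k1 := by
  simp [Poly.eval, Poly.evalMono, env]

theorem eval_base (h : κ.k3 = ρ ^ 2 - κ.k1 * ρ) :
    Horner.evalSystem (env κ ρ) base = hamiltonian κ 0 0 := by
  have hC (n : ℕ) [n.AtLeastTwo] := map_ofNat (Polynomial.C : ℂ →+* ℂ[X]) n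
  have hz : z = (Polynomial.X : ℂ[X]) • (1 : NC) := by rw [← z_mul, mul_one]
  rw [hamiltonian_eq]
  apply NCSystem.ext' <;>
  simp only [hz, Horner.evalSystem, base, cond_true, cond_false, Horner.eval, eval_factor_one,
    eval_factor_two, eval_factor_six, eval_factor_seven, eval_factor_eight, eval_factor_nine h,
    eval_variable_one, eval_variable_two, Poly.eval_const, Poly.eval_smul, Poly.eval_nil,
    system, Matrix.cons_val_zero, Matrix.cons_val_one,
    Matrix.cons_val_fin_one, z_mul, smul_eq_C_smul, cst_eq_C_smul, u_eq_letter, v_eq_letter,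
    mul_assoc, map_sub, map_add, map_neg, map_mul, hC, smul_add, smul_sub, smul_smul, map_one,
    add_mul, mul_add, smul_mul_assoc, mul_smul_comm, map_zero, mul_zero, add_zero, mul_one, one_mul,
    Int.cast_neg, Int.cast_one, Int.cast_ofNat] <;>
  module

theorem eval_gauge (d : Data) :
    d.gauge.eval (env κ ρ) = gauge κ (d.coeffs κ ρ) := by
  have hC (n : ℕ) [n.AtLeastTwo] := map_ofNat (Polynomial.C : ℂ →+* ℂ[X]) n
  have hZ (n : ℤ) := map_intCast (Polynomial.C : ℂ →+* ℂ[X]) n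
  simp only [Data.gauge, Data.coeffs, gauge, Horner.eval, eval_factor_one,
    eval_factor_two, eval_factor_three, Poly.eval_const, Poly.eval_addMul, Poly.eval_nil,
    z_mul, smul_eq_C_smul, cst_eq_C_smul, u_eq_letter, v_eq_letter,
    mul_assoc, map_sub, map_add, map_neg, map_mul, hC, hZ, smul_add, smul_sub, smul_smul, map_one,
    add_mul, mul_add, smul_mul_assoc, mul_smul_comm, map_zero, mul_zero, add_zero, mul_one,
    Int.cast_neg, Int.cast_one, Int.cast_ofNat, Int.cast_sub]
  module

theorem comm_letter (c : Bool) : comm (letter c) = MvPolynomial.X (fin c) := by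
  simp [comm, letter]

theorem comm_hamiltonian (i : Fin 2) : comm (hamiltonian κ 0 0 i) = scalarRhs κ i := by
  have h0 : comm u = MvPolynomial.X 0 := comm_letter false
  have h1 : comm v = MvPolynomial.X 1 := comm_letter true
  have hZ : comm z = MvPolynomial.C Polynomial.X := by
    rw [z, AlgHom.commutes, MvPolynomial.algebraMap_eq]
  have hC (c : ℂ) : comm (cst c) = MvPolynomial.C (Polynomial.C c) := by
    rw [cst_eq_C_smul, map_smul, map_one, MvPolynomial.smul_eq_C_mul, mul_one]
  have hs (c : ℂ) (p : NC) : comm (c • p) = MvPolynomial.C (Polynomial.C c) * comm p := by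
    rw [smul_eq_C_smul, map_smul, MvPolynomial.smul_eq_C_mul]
  fin_cases i <;>
  simp only [hamiltonian, scalarRhs, Fin.zero_eta, Fin.mk_one, Matrix.cons_val_zero,
    Matrix.cons_val_one, Matrix.cons_val_fin_one, map_add, map_sub, map_neg, map_mul, hs, hZ, hC,
    h0, h1, map_ofNat, smul_eq_C_mul_of_complex, map_zero] <;>
  ring

theorem comm_energy (h : κ.k3 = ρ ^ 2 - κ.k1 * ρ) :
    comm (energy.eval (env κ ρ)) = scalarH κ := by
  simp only [energy, Horner.eval, eval_factor_one, eval_factor_six, eval_factor_seven,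
    eval_factor_eight, eval_factor_nine h, eval_variable_two, Poly.eval_const, Poly.eval_smul,
    Poly.eval_nil, scalarH, map_add, map_mul, map_smul, MvPolynomial.smul_eq_C_mul, comm_letter,
    smul_eq_C_mul_of_complex, map_one, map_zero, map_sub, Int.cast_neg, Int.cast_one, map_neg, fin,
    cond_true, cond_false]
  ring

/-- The symmetry of the Hamiltonian system with `β = γ = 0`, together with an inner derivation. -/
theorem admits_of_zeroCurvature (h : κ.k3 = ρ ^ 2 - κ.k1 * ρ) {A B : NC}
    (hB : B ∈ Submodule.span ℂ[X] (word '' {w | w.length ≤ 8}))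
    (hAB : flow (hamiltonian κ 0 0) B + (A * B - B * A) =
      flow (Horner.evalSystem (env κ ρ) symmetry) A) :
    AdmitsSymmetryNine κ (addInner (hamiltonian κ 0 0) A) := by
  have hcomm (i : Fin 2) : flow (hamiltonian κ 0 0) (Horner.evalSystem (env κ ρ) symmetry i) =
      flow (Horner.evalSystem (env κ ρ) symmetry) (hamiltonian κ 0 0 i) := by
    rw [← eval_base h]
    have key (c : Bool) := Horner.eval_eq_of_isZero_sub (env κ ρ) (symmetry_comm_base c)
    simp only [Horner.eval_deriv] at key
    revert i
    rw [Fin.forall_fin_two]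
    simp only [Horner.evalSystem_zero, Horner.evalSystem_one]
    exact ⟨key false, key true⟩
  refine ⟨addInner (Horner.evalSystem (env κ ρ) symmetry) B, fun i => ?_, fun i => ?_,
    flow_addInner_comm hcomm hAB⟩
  · refine DegreeLE.addInner (degreeLE_of_mem_span ?_) hB
    revert i
    rw [Fin.forall_fin_two, Horner.evalSystem_zero, Horner.evalSystem_one]
    exact ⟨Horner.eval_mem_span _ (height_symmetry false),
      Horner.eval_mem_span _ (height_symmetry true)⟩
  · rw [comm_addInner, ← comm_hamiltonian, ← comm_energy h, ← map_mul, ← eval_base h]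
    have key (c : Bool) := congrArg comm
      (Horner.eval_eq_of_isZero_sub (env κ ρ) (symmetry_reduction c))
    simp only [Horner.comm_eval_sort, Horner.eval_mul] at key
    revert i
    rw [Fin.forall_fin_two]
    simp only [Horner.evalSystem_zero, Horner.evalSystem_one]
    exact ⟨key false, key true⟩

theorem admits_of_check (h : κ.k3 = ρ ^ 2 - κ.k1 * ρ) {d : Data} {B : Horner}
    (hd : check d B = true) {s : Coeffs} (hs : d.coeffs κ ρ = s) :
    AdmitsSymmetryNine κ (system κ s) := by
  subst hs
  rw [check, Bool.and_eq_true] at hd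
  have key := Horner.eval_eq_of_isZero_sub (env κ ρ) hd.2
  simp only [Horner.eval_add, Horner.eval_sub, Horner.eval_mul, Horner.eval_deriv, eval_base h,
    eval_gauge] at key
  rw [system_eq_addInner]
  exact admits_of_zeroCurvature h (Horner.eval_mem_span _ (Nat.le_of_ble_eq_true hd.1)) key

end Certificate

open Certificate

theorem exists_rho (κ : Kappa) : ∃ ρ : ℂ, κ.k3 = ρ ^ 2 - κ.k1 * ρ := by
  obtain ⟨r, hr⟩ := IsAlgClosed.exists_pow_nat_eq (κ.k3 + κ.k1 ^ 2 / 4) (n := 2) (by norm_num)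
  exact ⟨r + κ.k1 / 2, by linear_combination -hr⟩

theorem rho_eq {κ : Kappa} {kh : ℂ} (h : κ.k3 = (kh ^ 2 - κ.k1 ^ 2) / 4) :
    κ.k3 = ((κ.k1 - kh) / 2) ^ 2 - κ.k1 * ((κ.k1 - kh) / 2) := by
  rw [h]; ring

theorem admits_hamiltonian (κ : Kappa) (β γ : ℂ) : AdmitsSymmetryNine κ (hamiltonian κ β γ) := by
  obtain ⟨ρ, h⟩ := exists_rho κ
  have hg : gauge κ ⟨0, 1, 1, β, β, κ.k1, γ, γ, 1⟩ =
      (Polynomial.C β + Polynomial.X * Polynomial.C γ) • (Horner.eval (env κ ρ)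
        (.node [] (.node [] .zero (.node (.const (-1)) .zero .zero))
          (.node [] (.node (.const 1) .zero .zero) .zero))) := by
    have hC (n : ℕ) [n.AtLeastTwo] := map_ofNat (Polynomial.C : ℂ →+* ℂ[X]) n
    simp only [gauge, Horner.eval, Poly.eval_const, Poly.eval_nil,
      z_mul, smul_eq_C_smul, u_eq_letter, v_eq_letter,
      mul_assoc, map_sub, map_neg, hC, smul_add, smul_smul, map_one,
      mul_add, mul_smul_comm, map_zero, mul_zero, add_zero, mul_one,
      Int.cast_neg, Int.cast_one]
    module
  rw [hamiltonian_eq, system_eq_addInner, hg]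
  refine admits_of_zeroCurvature h (Submodule.zero_mem _) ?_
  rw [flow_zero, mul_zero, zero_mul, sub_zero, add_zero, flow_smul, ← Horner.eval_deriv,
    Horner.eval_of_isZero _ deriv_symmetry_commutator, smul_zero]

theorem admits_okamoto1 {κ : Kappa} {kh : ℂ} (h : κ.k3 = (kh ^ 2 - κ.k1 ^ 2) / 4) :
    AdmitsSymmetryNine κ (okamoto1 κ kh) := by
  rw [okamoto1_eq κ kh]
  refine admits_of_check (rho_eq h) check_okamoto1 ?_
  simp only [Data.coeffs, Coeffs.mk.injEq]
  constructorm* _ ∧ _ <;> push_cast <;> ring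

theorem admits_okamoto2 {κ : Kappa} {kh : ℂ} (h : κ.k3 = (kh ^ 2 - κ.k1 ^ 2) / 4) :
    AdmitsSymmetryNine κ (okamoto2 κ kh) := by
  rw [okamoto2_eq κ kh]
  refine admits_of_check (rho_eq h) check_okamoto2 ?_
  simp only [Data.coeffs, Coeffs.mk.injEq]
  constructorm* _ ∧ _ <;> push_cast <;> ring

theorem admits_okamoto3 {κ : Kappa} {kh : ℂ} (h : κ.k3 = (kh ^ 2 - κ.k1 ^ 2) / 4) :
    AdmitsSymmetryNine κ (okamoto3 κ kh) := by
  rw [okamoto3_eq κ kh]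
  refine admits_of_check (rho_eq h) check_okamoto3 ?_
  simp only [Data.coeffs, Coeffs.mk.injEq]
  constructorm* _ ∧ _ <;> push_cast <;> ring

theorem admits_okamoto4 (κ : Kappa) : AdmitsSymmetryNine κ (okamoto4 κ) := by
  obtain ⟨ρ, h⟩ := exists_rho κ
  rw [okamoto4_eq]
  refine admits_of_check h check_okamoto4 ?_
  simp only [Data.coeffs, Coeffs.mk.injEq]
  constructorm* _ ∧ _ <;> push_cast <;> ring

theorem admits_okamoto5 (κ : Kappa) : AdmitsSymmetryNine κ (okamoto5 κ) := by
  obtain ⟨ρ, h⟩ := exists_rho κ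
  rw [okamoto5_eq]
  refine admits_of_check h check_okamoto5 ?_
  simp only [Data.coeffs, Coeffs.mk.injEq]
  constructorm* _ ∧ _ <;> push_cast <;> ring

theorem admits_okamoto6 (κ : Kappa) : AdmitsSymmetryNine κ (okamoto6 κ) := by
  obtain ⟨ρ, h⟩ := exists_rho κ
  rw [okamoto6_eq]
  refine admits_of_check h check_okamoto6 ?_
  simp only [Data.coeffs, Coeffs.mk.injEq]
  constructorm* _ ∧ _ <;> push_cast <;> ring

theorem admits_okamoto7 (κ : Kappa) : AdmitsSymmetryNine κ (okamoto7 κ) := by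
  obtain ⟨ρ, h⟩ := exists_rho κ
  rw [okamoto7_eq]
  refine admits_of_check h check_okamoto7 ?_
  simp only [Data.coeffs, Coeffs.mk.injEq]
  constructorm* _ ∧ _ <;> push_cast <;> ring

theorem admits_okamoto8 (κ : Kappa) : AdmitsSymmetryNine κ (okamoto8 κ) := by
  obtain ⟨ρ, h⟩ := exists_rho κ
  rw [okamoto8_eq]
  refine admits_of_check h check_okamoto8 ?_
  simp only [Data.coeffs, Coeffs.mk.injEq]
  constructorm* _ ∧ _ <;> push_cast <;> ring

theorem admits_okamoto9 (κ : Kappa) : AdmitsSymmetryNine κ (okamoto9 κ) := by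
  obtain ⟨ρ, h⟩ := exists_rho κ
  rw [okamoto9_eq]
  refine admits_of_check h check_okamoto9 ?_
  simp only [Data.coeffs, Coeffs.mk.injEq]
  constructorm* _ ∧ _ <;> push_cast <;> ring

theorem admits_new1 {κ : Kappa} {kh : ℂ} (h : κ.k3 = (kh ^ 2 - κ.k1 ^ 2) / 4) :
    AdmitsSymmetryNine κ (new1 κ kh) := by
  rw [new1_eq κ h]
  refine admits_of_check (rho_eq h) check_new1 ?_
  simp only [Data.coeffs, Coeffs.mk.injEq]
  constructorm* _ ∧ _ <;> push_cast <;> ring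

theorem admits_new2 (κ : Kappa) : AdmitsSymmetryNine κ (new2 κ) := by
  obtain ⟨ρ, h⟩ := exists_rho κ
  rw [new2_eq]
  refine admits_of_check h check_new2 ?_
  simp only [Data.coeffs, Coeffs.mk.injEq]
  constructorm* _ ∧ _ <;> push_cast <;> ring

theorem admits_new3 (κ : Kappa) : AdmitsSymmetryNine κ (new3 κ) := by
  obtain ⟨ρ, h⟩ := exists_rho κ
  rw [new3_eq]
  refine admits_of_check h check_new3 ?_
  simp only [Data.coeffs, Coeffs.mk.injEq]
  constructorm* _ ∧ _ <;> push_cast <;> ring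

theorem admits_new4 (κ : Kappa) : AdmitsSymmetryNine κ (new4 κ) := by
  obtain ⟨ρ, h⟩ := exists_rho κ
  rw [new4_eq]
  refine admits_of_check h check_new4 ?_
  simp only [Data.coeffs, Coeffs.mk.injEq]
  constructorm* _ ∧ _ <;> push_cast <;> ring

theorem admits_new5 {κ : Kappa} {kh : ℂ} (h : κ.k3 = (kh ^ 2 - κ.k1 ^ 2) / 4) :
    AdmitsSymmetryNine κ (new5 κ kh) := by
  rw [new5_eq κ h]
  refine admits_of_check (rho_eq h) check_new5 ?_
  simp only [Data.coeffs, Coeffs.mk.injEq]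
  constructorm* _ ∧ _ <;> push_cast <;> ring

theorem admits_new6 {κ : Kappa} {kh : ℂ} (h : κ.k3 = (kh ^ 2 - κ.k1 ^ 2) / 4) :
    AdmitsSymmetryNine κ (new6 κ kh) := by
  rw [new6_eq κ h]
  refine admits_of_check (rho_eq h) check_new6 ?_
  simp only [Data.coeffs, Coeffs.mk.injEq]
  constructorm* _ ∧ _ <;> push_cast <;> ring

theorem admits_new7 {κ : Kappa} {kh : ℂ} (h : κ.k3 = (kh ^ 2 - κ.k1 ^ 2) / 4) :
    AdmitsSymmetryNine κ (new7 κ kh) := by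
  rw [new7_eq κ h]
  refine admits_of_check (rho_eq h) check_new7 ?_
  simp only [Data.coeffs, Coeffs.mk.injEq]
  constructorm* _ ∧ _ <;> push_cast <;> ring

theorem admits_new8 {κ : Kappa} {kh : ℂ} (h : κ.k3 = (kh ^ 2 - κ.k1 ^ 2) / 4) :
    AdmitsSymmetryNine κ (new8 κ kh) := by
  rw [new8_eq κ h]
  refine admits_of_check (rho_eq h) check_new8 ?_
  simp only [Data.coeffs, Coeffs.mk.injEq]
  constructorm* _ ∧ _ <;> push_cast <;> ring

theorem admits_of_inLists {κ : Kappa} {F : NCSystem} (h : InLists κ F) :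
    AdmitsSymmetryNine κ F := by
  rcases h with ⟨β, γ, rfl⟩ | h | h
  · exact admits_hamiltonian κ β γ
  · rcases h with ⟨kh, h, rfl | rfl | rfl⟩ | rfl | rfl | rfl | rfl | rfl | rfl
    · exact admits_okamoto1 h
    · exact admits_okamoto2 h
    · exact admits_okamoto3 h
    · exact admits_okamoto4 κ
    · exact admits_okamoto5 κ
    · exact admits_okamoto6 κ
    · exact admits_okamoto7 κ
    · exact admits_okamoto8 κ
    · exact admits_okamoto9 κ
  · rcases h with ⟨kh, h, rfl | rfl | rfl | rfl | rfl⟩ | rfl | rfl | rfl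
    · exact admits_new1 h
    · exact admits_new5 h
    · exact admits_new6 h
    · exact admits_new7 h
    · exact admits_new8 h
    · exact admits_new2 κ
    · exact admits_new3 κ
    · exact admits_new4 κ

end PainleveSix

end

theorem theorem1 (κ : PainleveSix.Kappa) (s : PainleveSix.Coeffs)
    (hs : PainleveSix.HasLeadingCase s) :
    PainleveSix.AdmitsSymmetryNine κ (PainleveSix.system κ s) ↔
      (PainleveSix.InLists κ (PainleveSix.system κ s) ∨
        PainleveSix.InLists κ (PainleveSix.transpose (PainleveSix.system κ s))) := by
  refine ⟨PainleveSix.inLists_of_admits hs, ?_⟩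
  rintro (h | h)
  · exact PainleveSix.admits_of_inLists h
  · rw [← PainleveSix.transpose_transpose (PainleveSix.system κ s)]
    exact (PainleveSix.admits_of_inLists h).transpose
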